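/- **Setting.** Let $\Omega\subset\mathbb R^2$ be a bounded open polygonal domain with Lipschitz boundary, let $\partial\Omega_D\subset\partial\Omega$ be closed and $\partial\Omega_N:=\partial\Omega\setminus\partial\Omega_D$. Let $\xi_D\in H^{1/2}(\partial\Omega_D;\mathbb R)$, i.e. $\xi_D$ is the trace on $\partial\Omega_D$ of some function in $H^1(\Omega;\mathbb R)$; fix such a lifting $\zeta_D\in H^1(\Omega;\mathbb R)$, and let $g\in L^2(\partial\Omega_N;\mathbb R)$. Put $V:=H^1(\Omega;\mathbb C)$ with its usual norm and, in the sense of traces, $$V_D:=\{\zeta\in V:\ \Re\zeta=\xi_D,\ \Im\zeta=0\text{ on }\partial\Omega_D\},\qquad V_0:=\{\zeta\in V:\ \zeta=0\text{ on }\partial\Omega_D\}.$$ Let $\alpha\le 0\le\beta$, $\xi^-\in[-\frac\pi2,0]$, $\xi^+\in[0,\frac\pi2]$, and $$\mu_1(\xi)=\cos\xi-\alpha\sin\xi,\quad \mu_2(\xi)=\cos\xi+\beta\sin\xi,\quad \Gamma_{12}=-\frac{\mu_1'}{\mu_2},\quad \Gamma_{21}=\frac{\mu_2'}{\mu_1}.$$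 For $\Gamma\in\{\Gamma_{12},\Gamma_{21}\}$ let $\widehat\Gamma(\xi)=\Gamma(\xi^+)$ if $\xi\ge\xi^+$, $\widehat\Gamma(\xi)=\Gamma(\xi^-)$ if $\xi\le\xi^-$, and $\widehat\Gamma(\xi)=\Gamma(\xi)$ otherwise. Let $\hat B(\xi)=\operatorname{diag}(-\widehat{\Gamma_{21}}(\xi),\widehat{\Gamma_{12}}(\xi))$, and assume that $\xi^\pm$ are such that $\hat B$ is bounded on $\mathbb R$. For $\varepsilon>0$ define $$a_\varepsilon(\xi;\zeta,\tilde\zeta)=\int_\Omega(\hat B(\xi)+i\varepsilon I)\nabla\zeta\cdot\overline{\nabla\tilde\zeta},\qquad l(\tilde\zeta)=\int_{\partial\Omega_N}g\,\overline{\tilde\zeta}.$$ **Discretization.** Let $(\mathcal T_h)_h$ be a shape-regular and quasi-uniform family of conforming triangulations of $\overline\Omega$ such that $\partial\Omega_D$ is a union of edges of each $\mathcal T_h$; here $h$ is the largest diameter of a cell of $\mathcal T_h$. Let $V_h$ be the space of continuous, complex-valued, piecewise affine functions on $\mathcal T_h$. Let $\mathcal I_h:V\to V_h$ be a Scott--Zhang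 interpolator: for each vertex $a$ choose an edge $e_a$ with end point $a$, contained in $\partial\Omega$ if $a\in\partial\Omega$ and in $\partial\Omega_D$ if $a\in\partial\Omega_D$, and let $(\mathcal I_hu)(a)=\int_{e_a}\theta_a u$, where $\theta_a$ is the affine function on $e_a$ with $\int_{e_a}\theta_a p=p(a)$ for all affine $p$. Put $$V_{hD}:=\{\zeta_h\in V_h:\ \Re\zeta_h=\mathcal I_h\zeta_D,\ \Im\zeta_h=0\text{ on }\partial\Omega_D\},\qquad V_{h0}:=\{\zeta_h\in V_h:\ \zeta_h=0\text{ on }\partial\Omega_D\}.$$ **Theorem.** Fix $\varepsilon>0$ and assume that there is a unique $\xi_\varepsilon\in V_D$ with $$a_\varepsilon(\Re\xi_\varepsilon;\xi_\varepsilon,\tilde\zeta)=l(\tilde\zeta)\qquad\text{for all }\tilde\zeta\in V_0.$$ For each $h$ let $\xi_h\in V_{hD}$ be a solution of the discrete nonlinear problem $$a_\varepsilon(\Re\xi_h;\xi_h,\tilde\zeta_h)=l(\tilde\zeta_h)\qquad\text{for all }\tilde\zeta_h\in V_{h0}.$$ Then $\xi_h\to\xi_\varepsilon$ strongly in $H^1(\Omega;\mathbb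 C)$ as $h\to0$. -/

import Mathlib

open MeasureTheory Filter Topology
open scoped ContDiff NNReal ENNReal

namespace Kirigami

noncomputable section

/-- The Euclidean plane. -/
abbrev Plane : Type := EuclideanSpace ℝ (Fin 2)

/-! ### The domain -/

/-- `Ω` is a bounded open polygonal set with Lipschitz boundary: the boundary is covered by finitely
many segments and, near each of its points, in suitable orthonormal coordinates, `Ω` is the set of
points strictly above the graph of a Lipschitz function. -/
structure IsPolygonalLipschitz (Ω : Set Plane) : Prop where
  isOpen : IsOpen Ω
  isBounded : Bornology.IsBounded Ω
  polygonal : ∃ S : Finset (Plane × Plane), frontier Ω ⊆ ⋃ p ∈ S, segment ℝ p.1 p.2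
  lipschitz : ∀ x ∈ frontier Ω, ∃ (A : Plane ≃ᵃⁱ[ℝ] Plane) (L : ℝ≥0) (ψ : ℝ → ℝ),
    LipschitzWith L ψ ∧ ∀ᶠ y in 𝓝 x, (y ∈ Ω ↔ ψ (A y 0) < A y 1)

/-! ### The complex Sobolev space `H¹(Ω; ℂ)` -/

/-- The space `L²(Ω; ℂ)`. -/
abbrev L2 (Ω : Set Plane) : Type := Lp ℂ 2 (volume.restrict Ω)

/-- The space `L²(Ω; ℂ²)`. -/
abbrev L2Vec (Ω : Set Plane) : Type := Lp (EuclideanSpace ℂ (Fin 2)) 2 (volume.restrict Ω)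

/-- `φ` is a (real) test function: smooth, with compact support contained in `Ω`. -/
structure IsTestFunction (Ω : Set Plane) (φ : Plane → ℝ) : Prop where
  smooth : ContDiff ℝ ∞ φ
  compact : HasCompactSupport φ
  support : tsupport φ ⊆ Ω

/-- The partial derivative `∂φ/∂x_j`. -/
def partialDeriv (j : Fin 2) (φ : Plane → ℝ) (x : Plane) : ℝ :=
  fderiv ℝ φ x (EuclideanSpace.single j 1)

/-- `G` is the weak gradient of `u` in `Ω`. -/
def IsWeakGradient (Ω : Set Plane) (u : L2 Ω) (G : L2Vec Ω) : Prop :=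
  ∀ φ : Plane → ℝ, IsTestFunction Ω φ → ∀ j : Fin 2,
    ∫ x in Ω, partialDeriv j φ x • u x = -∫ x in Ω, φ x • G x j

theorem integrable_test_smul {F : Type*} [NormedAddCommGroup F] [NormedSpace ℝ F] {Ω : Set Plane}
    {φ : Plane → ℝ} (hc : Continuous φ) (hs : HasCompactSupport φ)
    {u : Plane → F} (hu : MemLp u 2 (volume.restrict Ω)) :
    Integrable (fun x => φ x • u x) (volume.restrict Ω) :=
  (hu.locallyIntegrable (by norm_num)).integrable_smul_left_of_hasCompactSupport hc hs

theorem IsTestFunction.continuous_partialDeriv {Ω : Set Plane} {φ : Plane → ℝ}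
    (h : IsTestFunction Ω φ) (j : Fin 2) : Continuous (partialDeriv j φ) :=
  (h.smooth.continuous_fderiv (by simp)).clm_apply continuous_const

theorem IsTestFunction.hasCompactSupport_partialDeriv {Ω : Set Plane} {φ : Plane → ℝ}
    (h : IsTestFunction Ω φ) (j : Fin 2) : HasCompactSupport (partialDeriv j φ) :=
  h.compact.fderiv_apply ℝ (EuclideanSpace.single j 1)

theorem memLp_component {Ω : Set Plane} (G : L2Vec Ω) (j : Fin 2) :
    MemLp (fun x => G x j) 2 (volume.restrict Ω) :=
  (EuclideanSpace.proj (𝕜 := ℂ) j).comp_memLp G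

/-- The space `V = H¹(Ω; ℂ)`: the pairs `(u, ∇u)` with `u` in `L²(Ω; ℂ)` and weak gradient `∇u` in
`L²(Ω; ℂ²)`. As a subspace of the `ℓ²`-product it carries the usual norm
`(‖u‖² + ‖∇u‖²)^(1/2)`. -/
def H1 (Ω : Set Plane) : Submodule ℂ (WithLp 2 (L2 Ω × L2Vec Ω)) where
  carrier := {p | IsWeakGradient Ω p.fst p.snd}
  zero_mem' := by
    intro φ _ j
    have h1 : ∫ x in Ω, partialDeriv j φ x • (0 : L2 Ω) x = 0 := by
      refine integral_eq_zero_of_ae ?_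
      filter_upwards [Lp.coeFn_zero ℂ 2 (volume.restrict Ω)] with x hx
      rw [hx, Pi.zero_apply, smul_zero]
    have h2 : ∫ x in Ω, φ x • (0 : L2Vec Ω) x j = 0 := by
      refine integral_eq_zero_of_ae ?_
      filter_upwards [Lp.coeFn_zero (EuclideanSpace ℂ (Fin 2)) 2 (volume.restrict Ω)] with x hx
      rw [hx, Pi.zero_apply, PiLp.zero_apply, smul_zero]; rfl
    rw [WithLp.zero_fst, WithLp.zero_snd, h1, h2, neg_zero]
  add_mem' := by
    intro p q hp hq φ hφ j
    have hc := hφ.continuous_partialDeriv j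
    have hs := hφ.hasCompactSupport_partialDeriv j
    have h1 : ∫ x in Ω, partialDeriv j φ x • (p.fst + q.fst) x =
        (∫ x in Ω, partialDeriv j φ x • p.fst x) + ∫ x in Ω, partialDeriv j φ x • q.fst x := by
      rw [← integral_add (integrable_test_smul hc hs (Lp.memLp p.fst))
        (integrable_test_smul hc hs (Lp.memLp q.fst))]
      refine integral_congr_ae ?_
      filter_upwards [Lp.coeFn_add p.fst q.fst] with x hx
      rw [hx, Pi.add_apply, smul_add]
    have h2 : ∫ x in Ω, φ x • (p.snd + q.snd) x j =
        (∫ x in Ω, φ x • p.snd x j) + ∫ x in Ω, φ x • q.snd x j := by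
      rw [← integral_add
        (integrable_test_smul hφ.smooth.continuous hφ.compact (memLp_component p.snd j))
        (integrable_test_smul hφ.smooth.continuous hφ.compact (memLp_component q.snd j))]
      refine integral_congr_ae ?_
      filter_upwards [Lp.coeFn_add p.snd q.snd] with x hx
      rw [hx, Pi.add_apply, PiLp.add_apply, smul_add]
    rw [WithLp.add_fst, WithLp.add_snd, h1, h2, hp φ hφ j, hq φ hφ j]
    ring
  smul_mem' := by
    intro c p hp φ hφ j
    have h1 : ∫ x in Ω, partialDeriv j φ x • (c • p.fst) x =
        c * ∫ x in Ω, partialDeriv j φ x • p.fst x := by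
      rw [← integral_const_mul]
      refine integral_congr_ae ?_
      filter_upwards [Lp.coeFn_smul c p.fst] with x hx
      rw [hx, Pi.smul_apply, smul_eq_mul, mul_smul_comm]
    have h2 : ∫ x in Ω, φ x • (c • p.snd) x j = c * ∫ x in Ω, φ x • p.snd x j := by
      rw [← integral_const_mul]
      refine integral_congr_ae ?_
      filter_upwards [Lp.coeFn_smul c p.snd] with x hx
      rw [hx, Pi.smul_apply, PiLp.smul_apply, smul_eq_mul, mul_smul_comm]
    rw [WithLp.smul_fst, WithLp.smul_snd, h1, h2, hp φ hφ j]
    ring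

/-- The values of an element of `H¹(Ω; ℂ)` (defined almost everywhere in `Ω`). -/
def value {Ω : Set Plane} (u : H1 Ω) : Plane → ℂ := u.1.fst

/-- The weak gradient of an element of `H¹(Ω; ℂ)` (defined almost everywhere in `Ω`). -/
def grad {Ω : Set Plane} (u : H1 Ω) : Plane → EuclideanSpace ℂ (Fin 2) := u.1.snd

/-- The function `v`, defined everywhere, is a representative in `Ω` of `u`. -/
def Represents {Ω : Set Plane} (u : H1 Ω) (v : Plane → ℂ) : Prop :=
  value u =ᵐ[volume.restrict Ω] v

/-! ### Traces -/

/-- Arc length on a curve `S` (one-dimensional Hausdorff measure restricted to `S`). -/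
def arcLength (S : Set Plane) : Measure Plane := (Measure.hausdorffMeasure 1).restrict S

/-- `t` is the trace of `u` on the curve `S ⊆ closure Ω`: the `L²(S)`-limit of the restrictions to
`S` of functions in `H¹(Ω) ∩ C(closure Ω)` that converge to `u` in `H¹(Ω)`.  It is used for
`S = ∂Ω` and for segments `S`. -/
def IsTraceOn (Ω S : Set Plane) (u : H1 Ω) (t : Plane → ℂ) : Prop :=
  MemLp t 2 (arcLength S) ∧ ∃ (w : ℕ → H1 Ω) (v : ℕ → Plane → ℂ),
    (∀ n, ContinuousOn (v n) (closure Ω) ∧ Represents (w n) (v n)) ∧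
    Tendsto w atTop (𝓝 u) ∧
    Tendsto (fun n => eLpNorm (fun x => v n x - t x) 2 (arcLength S)) atTop (𝓝 0)

/-- The trace of `u` on `S` (a function defined almost everywhere on `S`). -/
def traceOn (Ω S : Set Plane) (u : H1 Ω) : Plane → ℂ :=
  Classical.epsilon (IsTraceOn Ω S u)

/-- The trace of `u` on the boundary of `Ω`. -/
def trace {Ω : Set Plane} (u : H1 Ω) : Plane → ℂ := traceOn Ω (frontier Ω) u

/-! ### The coefficients (rhombi slits) -/

def mu1 (α : ℝ) (ξ : ℝ) : ℝ := Real.cos ξ - α * Real.sin ξ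

def mu2 (β : ℝ) (ξ : ℝ) : ℝ := Real.cos ξ + β * Real.sin ξ

def Gamma12 (α β : ℝ) (ξ : ℝ) : ℝ := -(deriv (mu1 α) ξ / mu2 β ξ)

def Gamma21 (α β : ℝ) (ξ : ℝ) : ℝ := deriv (mu2 β) ξ / mu1 α ξ

/-- The cut-off of a coefficient `Γ` below `ξm` and above `ξp`. -/
def cutOff (ξm ξp : ℝ) (Γ : ℝ → ℝ) (ξ : ℝ) : ℝ :=
  if ξp ≤ ξ then Γ ξp else if ξ ≤ ξm then Γ ξm else Γ ξ

/-- The parameters of the coefficient: `α ≤ 0 ≤ β`, the cut-off values `ξ⁻` and `ξ⁺`, which are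
such that the cut-off matrix `B̂ = diag(-Γ̂₂₁, Γ̂₁₂)` is bounded. -/
structure Params where
  α : ℝ
  β : ℝ
  ξm : ℝ
  ξp : ℝ
  α_nonpos : α ≤ 0
  β_nonneg : 0 ≤ β
  ξm_mem : ξm ∈ Set.Icc (-(Real.pi / 2)) 0
  ξp_mem : ξp ∈ Set.Icc 0 (Real.pi / 2)
  bounded : ∃ M : ℝ, ∀ ξ : ℝ,
    |cutOff ξm ξp (Gamma21 α β) ξ| ≤ M ∧ |cutOff ξm ξp (Gamma12 α β) ξ| ≤ M

/-- The cut-off matrix `B̂(ξ)`. -/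
def Params.Bhat (P : Params) (ξ : ℝ) : Matrix (Fin 2) (Fin 2) ℝ :=
  !![-cutOff P.ξm P.ξp (Gamma21 P.α P.β) ξ, 0; 0, cutOff P.ξm P.ξp (Gamma12 P.α P.β) ξ]

/-- The complex matrix `B̂(ξ) + i ε I`. -/
def Params.Beps (P : Params) (ε : ℝ) (ξ : ℝ) : Matrix (Fin 2) (Fin 2) ℂ :=
  (P.Bhat ξ).map Complex.ofReal + (Complex.I * (ε : ℂ)) • (1 : Matrix (Fin 2) (Fin 2) ℂ)

/-! ### The regularized nonlinear problem -/

/-- The form `a_ε(ξ; ζ, η) = ∫_Ω (B̂(ξ) + i ε I) ∇ζ · conj(∇η)`. -/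
def aForm {Ω : Set Plane} (P : Params) (ε : ℝ) (ξ : Plane → ℝ) (ζ η : H1 Ω) : ℂ :=
  ∫ x in Ω, (P.Beps ε (ξ x)).mulVec (grad ζ x).ofLp ⬝ᵥ star (grad η x).ofLp

/-- The form `l(η) = ∫_{∂Ω_N} g conj(η)`, where `∂Ω_N = ∂Ω \ ∂Ω_D`. -/
def lForm {Ω : Set Plane} (ΓD : Set Plane) (g : Plane → ℝ) (η : H1 Ω) : ℂ :=
  ∫ x, (g x : ℂ) * star (trace η x) ∂(arcLength (frontier Ω \ ΓD))

/-- `ζ ∈ V_D`: `Re ζ = ξ_D` and `Im ζ = 0` on `∂Ω_D`, in the sense of traces. -/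
def MemVD {Ω : Set Plane} (ΓD : Set Plane) (ξD : Plane → ℝ) (ζ : H1 Ω) : Prop :=
  ∀ᵐ x ∂(arcLength ΓD), (trace ζ x).re = ξD x ∧ (trace ζ x).im = 0

/-- `ζ ∈ V_0`: `ζ = 0` on `∂Ω_D`, in the sense of traces. -/
def MemV0 {Ω : Set Plane} (ΓD : Set Plane) (ζ : H1 Ω) : Prop :=
  ∀ᵐ x ∂(arcLength ΓD), trace ζ x = 0

/-- `ξ ∈ V_D` solves the regularized nonlinear problem
`a_ε(Re ξ; ξ, η) = l(η)` for all `η ∈ V_0`. -/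
def IsSolution {Ω : Set Plane} (ΓD : Set Plane) (P : Params) (ε : ℝ) (ξD g : Plane → ℝ)
    (ξ : H1 Ω) : Prop :=
  MemVD ΓD ξD ξ ∧
    ∀ η : H1 Ω, MemV0 ΓD η → aForm P ε (fun x => (value ξ x).re) ξ η = lForm ΓD g η

/-- `ζD ∈ H¹(Ω; ℝ)` is a lifting of the Dirichlet datum `ξD`.  The datum `ξD` belongs to
`H^{1/2}(∂Ω_D; ℝ)`, the space of traces on `∂Ω_D`, if and only if it has such a lifting. -/
def IsLifting {Ω : Set Plane} (ΓD : Set Plane) (ξD : Plane → ℝ) (ζD : H1 Ω) : Prop :=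
  (∀ᵐ x ∂(volume.restrict Ω), (value ζD x).im = 0) ∧
    ∀ᵐ x ∂(arcLength ΓD), trace ζD x = (ξD x : ℂ)

/-! ### Triangulations -/

/-- A conforming triangulation of `closure Ω` that also fits `ΓD`: a finite geometric simplicial
complex, all of whose maximal simplices are triangles, whose union is `closure Ω`, and such that
`ΓD` is a union of edges. -/
structure Triangulation (Ω ΓD : Set Plane) where
  complex : Geometry.SimplicialComplex ℝ Plane
  finite : complex.faces.Finite
  pure : ∀ s ∈ complex.faces, ∃ c ∈ complex.faces, s ⊆ c ∧ c.card = 3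
  fits : complex.space = closure Ω
  fits_dirichlet : ∀ x ∈ ΓD, ∃ e ∈ complex.faces, e.card = 2 ∧
    x ∈ convexHull ℝ (e : Set Plane) ∧ convexHull ℝ (e : Set Plane) ⊆ ΓD

namespace Triangulation

variable {Ω ΓD : Set Plane}

/-- The cells of the triangulation, given by their three vertices. -/
def cells (T : Triangulation Ω ΓD) : Set (Finset Plane) := {c ∈ T.complex.faces | c.card = 3}

/-- The edges of the triangulation, given by their two end points. -/
def edges (T : Triangulation Ω ΓD) : Set (Finset Plane) := {e ∈ T.complex.faces | e.card = 2}

/-- The vertices of the triangulation. -/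
def vertices (T : Triangulation Ω ΓD) : Set Plane := T.complex.vertices

/-- The mesh parameter `h`, the largest diameter of a cell. -/
def meshSize (T : Triangulation Ω ΓD) : ℝ :=
  sSup ((fun c : Finset Plane => Metric.diam (convexHull ℝ (c : Set Plane))) '' T.cells)

/-- Membership in `V_h`: the function `v` is affine on every closed cell.  Continuity on `closure Ω`
follows, because the finitely many closed cells cover `closure Ω` and `v` is single-valued. -/
def IsP1 (T : Triangulation Ω ΓD) (v : Plane → ℂ) : Prop :=
  ∀ c ∈ T.cells, ∃ A : Plane →ᵃ[ℝ] ℂ, ∀ x ∈ convexHull ℝ (c : Set Plane), v x = A x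

end Triangulation

/-- A family of triangulations is shape regular: there is `σ > 0` such that every cell `c` of every
triangulation contains a disc of diameter at least `diam c / σ`. -/
def ShapeRegular {Ω ΓD : Set Plane} {ι : Type*} (T : ι → Triangulation Ω ΓD) : Prop :=
  ∃ σ > 0, ∀ i, ∀ c ∈ (T i).cells, ∃ (z : Plane) (r : ℝ),
    Metric.closedBall z r ⊆ convexHull ℝ (c : Set Plane) ∧
      Metric.diam (convexHull ℝ (c : Set Plane)) ≤ σ * (2 * r)

/-- A family of triangulations is quasi-uniform: the diameters of all cells of one triangulation are
comparable to the mesh parameter, uniformly in the family. -/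
def QuasiUniform {Ω ΓD : Set Plane} {ι : Type*} (T : ι → Triangulation Ω ΓD) : Prop :=
  ∃ τ > 0, ∀ i, ∀ c ∈ (T i).cells,
    τ * (T i).meshSize ≤ Metric.diam (convexHull ℝ (c : Set Plane))

/-! ### The Scott–Zhang interpolator -/

/-- The choice underlying a Scott–Zhang interpolator: to each vertex `a` an edge that has `a` as an
end point, contained in `∂Ω` if `a ∈ ∂Ω`, and in `∂Ω_D` if `a ∈ ∂Ω_D`. -/
structure ScottZhangChoice {Ω ΓD : Set Plane} (T : Triangulation Ω ΓD) where
  edge : Plane → Finset Plane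
  edge_mem : ∀ a ∈ T.vertices, edge a ∈ T.edges
  mem_edge : ∀ a ∈ T.vertices, a ∈ edge a
  boundary : ∀ a ∈ T.vertices, a ∈ frontier Ω →
    convexHull ℝ (edge a : Set Plane) ⊆ frontier Ω
  dirichlet : ∀ a ∈ T.vertices, a ∈ ΓD → convexHull ℝ (edge a : Set Plane) ⊆ ΓD

/-- The `L²`-dual nodal function at the end point `a` of a segment `e`: the affine function `θ` on
`e` with `∫_e θ p = p(a)` for every affine function `p` on `e`.  With `ℓ` the length of `e` and `s`
the distance to `a`, it is `θ = (4 - 6 s / ℓ) / ℓ`. -/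
def dualNodal (e : Set Plane) (a x : Plane) : ℝ :=
  (4 - 6 * dist x a / Metric.diam e) / Metric.diam e

/-- The Scott–Zhang nodal value `∫_e θ u` at the vertex `a`, `e` being the edge chosen for `a`. -/
def ScottZhangChoice.nodalValue {Ω ΓD : Set Plane} {T : Triangulation Ω ΓD}
    (S : ScottZhangChoice T) (u : H1 Ω) (a : Plane) : ℂ :=
  ∫ x, (dualNodal (convexHull ℝ (S.edge a : Set Plane)) a x : ℂ) *
    traceOn Ω (convexHull ℝ (S.edge a : Set Plane)) u x
      ∂(arcLength (convexHull ℝ (S.edge a : Set Plane)))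

/-- `w` is the Scott–Zhang interpolant `I_h u`: the element of `V_h` whose value at each vertex is
the Scott–Zhang nodal value of `u`. -/
def ScottZhangChoice.IsInterpolant {Ω ΓD : Set Plane} {T : Triangulation Ω ΓD}
    (S : ScottZhangChoice T) (u : H1 Ω) (w : Plane → ℂ) : Prop :=
  T.IsP1 w ∧ ∀ a ∈ T.vertices, w a = S.nodalValue u a

/-! ### The discrete nonlinear problem -/

/-- `ζ ∈ V_{hD}`: `ζ ∈ V_h`, with `Re ζ = I_h ζ_D` and `Im ζ = 0` on `∂Ω_D`. -/
def MemVhD {Ω ΓD : Set Plane} {T : Triangulation Ω ΓD} (S : ScottZhangChoice T) (ζD : H1 Ω)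
    (ζ : H1 Ω) : Prop :=
  ∃ v : Plane → ℂ, T.IsP1 v ∧ Represents ζ v ∧
    ∃ w : Plane → ℂ, S.IsInterpolant ζD w ∧ ∀ x ∈ ΓD, ((v x).re : ℂ) = w x ∧ (v x).im = 0

/-- `ζ ∈ V_{h0}`: `ζ ∈ V_h`, with `ζ = 0` on `∂Ω_D`. -/
def MemVh0 {Ω ΓD : Set Plane} (T : Triangulation Ω ΓD) (ζ : H1 Ω) : Prop :=
  ∃ v : Plane → ℂ, T.IsP1 v ∧ Represents ζ v ∧ ∀ x ∈ ΓD, v x = 0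

/-- `ξ ∈ V_{hD}` solves the discrete nonlinear problem
`a_ε(Re ξ; ξ, η) = l(η)` for all `η ∈ V_{h0}`. -/
def IsDiscreteSolution {Ω ΓD : Set Plane} {T : Triangulation Ω ΓD} (S : ScottZhangChoice T)
    (P : Params) (ε : ℝ) (g : Plane → ℝ) (ζD : H1 Ω) (ξ : H1 Ω) : Prop :=
  MemVhD S ζD ξ ∧
    ∀ η : H1 Ω, MemVh0 T η → aForm P ε (fun x => (value ξ x).re) ξ η = lForm ΓD g η

end

end Kirigami

namespace Kirigami

noncomputable section

/-! ### The Sobolev space: elementary facts -/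

section Basic

variable {Ω : Set Plane}

/-! Coercivity comes from the imaginary part alone. As `B̂` is real and diagonal, the imaginary part
of `a_ε(r; ζ, ζ)` equals `ε ‖∇ζ‖²` for every real coefficient argument `r` (`Params.inner_flux_im`).
Hence an estimate of `a_ε(r; e, e)` always controls `∇e` (`norm_gradL_le_of_inner_le`). Control of
the full norm needs a Poincaré inequality on `V_0`. This is extracted from the uniqueness
hypothesis: if `η` in `V_0` is real with vanishing gradient, then `ξ_ε + iη` has the same real part
and the same gradient as `ξ_ε`, so it is another solution and `η = 0` (`eq_zero_of_grad_of_unique`).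
Compactness then gives the inequality (`exists_poincare`).

The limit is identified by a compactness argument (`exists_subseq_tendsto`). Testing with `ξ_h - I_h
ζ_D` bounds `ξ_h` in `H¹`. By Rellich's theorem a subsequence converges in `L²` and almost
everywhere to some `f`. Let `z` in `ζ_D + V_0` solve the linear problem whose coefficient is frozen
at `Re f`, and put `e = ξ_h - I_h z`, an admissible discrete test function. Since `ξ_h` and `z`
satisfy equations with the same right side for `e`, the form `a_ε(Re ξ_h; e, e)` reduces to two
errors. One is the change of the coefficient acting on the fixed field `∇z`, which vanishes by
dominated convergence because `B̂` is continuous (`Params.tendsto_fluxL`). The other is the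
interpolation error `I_h z - z`. So `ξ_h → z` strongly in `H¹`, whence `z = f`, the coefficient was
frozen at `Re z`, and `z` solves the nonlinear problem. Uniqueness gives `z = ξ_ε`; as the limit
does not depend on the subsequence, the whole family converges.

The functional analysis is derived from the triangulations themselves. The Poincaré inequality is
proved on convex sets only (`poincare`). Averages over cells with a common vertex are compared along
chains of cells that share edges; the Lipschitz boundary is what makes these chains exist
(`Triangulation.star_connected`). Nodal functionals that reproduce affine functions and stay close
to cell averages, as abstracted in `Triangulation.IsNodal`, yield interpolants that converge for
every `H¹` function (`Triangulation.tendsto_interpolant`). Averaged Taylor polynomials are a first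
instance and need no traces. They show that functions continuous up to the boundary are dense; with
the trace inequality on triangles this makes traces well defined. Only then can the Scott–Zhang
functionals be recognised as a second instance (`ScottZhangChoice.isNodal`). Rellich's theorem
follows since averaging over cells is of finite rank and within `O(h)` of the inclusion into `L²`.
-/

theorem memLp_value (u : H1 Ω) : MemLp (value u) 2 (volume.restrict Ω) := Lp.memLp u.1.fst

theorem memLp_grad (u : H1 Ω) : MemLp (grad u) 2 (volume.restrict Ω) := Lp.memLp u.1.snd

theorem stronglyMeasurable_value (u : H1 Ω) : StronglyMeasurable (value u) :=
  Lp.stronglyMeasurable u.1.fst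

theorem stronglyMeasurable_grad (u : H1 Ω) : StronglyMeasurable (grad u) :=
  Lp.stronglyMeasurable u.1.snd

theorem isWeakGradient (u : H1 Ω) {φ : Plane → ℝ} (hφ : IsTestFunction Ω φ) (j : Fin 2) :
    ∫ x in Ω, partialDeriv j φ x • value u x = -∫ x in Ω, φ x • grad u x j := u.2 φ hφ j

theorem value_add (u w : H1 Ω) :
    value (u + w) =ᵐ[volume.restrict Ω] fun x => value u x + value w x :=
  Lp.coeFn_add u.1.fst w.1.fst

theorem value_sub (u w : H1 Ω) :
    value (u - w) =ᵐ[volume.restrict Ω] fun x => value u x - value w x :=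
  Lp.coeFn_sub u.1.fst w.1.fst

theorem value_smul (c : ℂ) (u : H1 Ω) :
    value (c • u) =ᵐ[volume.restrict Ω] fun x => c * value u x :=
  Lp.coeFn_smul c u.1.fst

theorem grad_add (u w : H1 Ω) :
    grad (u + w) =ᵐ[volume.restrict Ω] fun x => grad u x + grad w x :=
  Lp.coeFn_add u.1.snd w.1.snd

theorem grad_sub (u w : H1 Ω) :
    grad (u - w) =ᵐ[volume.restrict Ω] fun x => grad u x - grad w x :=
  Lp.coeFn_sub u.1.snd w.1.snd

theorem grad_smul (c : ℂ) (u : H1 Ω) :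
    grad (c • u) =ᵐ[volume.restrict Ω] fun x => c • grad u x :=
  Lp.coeFn_smul c u.1.snd

/-- A pair of square integrable functions that satisfies the defining identity of the weak gradient
is an element of the Sobolev space. -/
theorem exists_H1 {f : Plane → ℂ} {G : Plane → EuclideanSpace ℂ (Fin 2)}
    (hf : MemLp f 2 (volume.restrict Ω)) (hG : MemLp G 2 (volume.restrict Ω))
    (hw : ∀ φ, IsTestFunction Ω φ → ∀ j : Fin 2,
      ∫ x in Ω, partialDeriv j φ x • f x = -∫ x in Ω, φ x • G x j) :
    ∃ u : H1 Ω, value u =ᵐ[volume.restrict Ω] f ∧ grad u =ᵐ[volume.restrict Ω] G := by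
  refine ⟨⟨WithLp.toLp 2 (hf.toLp f, hG.toLp G), ?_⟩, hf.coeFn_toLp, hG.coeFn_toLp⟩
  intro φ hφ j
  have h1 : ∫ x in Ω, partialDeriv j φ x • (hf.toLp f) x = ∫ x in Ω, partialDeriv j φ x • f x := by
    refine integral_congr_ae ?_
    filter_upwards [hf.coeFn_toLp] with x hx
    rw [hx]
  have h2 : ∫ x in Ω, φ x • (hG.toLp G) x j = ∫ x in Ω, φ x • G x j := by
    refine integral_congr_ae ?_
    filter_upwards [hG.coeFn_toLp] with x hx
    rw [hx]
  exact h1.trans ((hw φ hφ j).trans (congrArg Neg.neg h2.symm))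

theorem sq_norm_toLp_eq_integral {F : Type*} [NormedAddCommGroup F] {μ : Measure Plane}
    (f : Lp F 2 μ) : ‖f‖ ^ 2 = ∫ x, ‖f x‖ ^ 2 ∂μ := by
  have h := (Lp.memLp f).eLpNorm_eq_integral_rpow_norm (by norm_num) (by norm_num)
  rw [Lp.norm_def, h, ENNReal.toReal_ofReal (by positivity)]
  have : (0 : ℝ) ≤ ∫ x, ‖f x‖ ^ 2 ∂μ := integral_nonneg fun x => by positivity
  simp only [ENNReal.toReal_ofNat, Real.rpow_ofNat]
  rw [← Real.rpow_natCast, ← Real.rpow_mul this]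
  norm_num

theorem sq_norm_eq (u : H1 Ω) :
    ‖u‖ ^ 2 = (∫ x in Ω, ‖value u x‖ ^ 2) + ∫ x in Ω, ‖grad u x‖ ^ 2 := by
  have h : ‖u‖ ^ 2 = ‖u.1.fst‖ ^ 2 + ‖u.1.snd‖ ^ 2 := WithLp.prod_norm_sq_eq_of_L2 u.1
  rw [h, sq_norm_toLp_eq_integral, sq_norm_toLp_eq_integral]
  rfl

theorem integrableOn_sq_value (u : H1 Ω) : IntegrableOn (fun x => ‖value u x‖ ^ 2) Ω :=
  (memLp_value u).integrable_norm_pow (by norm_num)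

theorem integrableOn_sq_grad (u : H1 Ω) : IntegrableOn (fun x => ‖grad u x‖ ^ 2) Ω :=
  (memLp_grad u).integrable_norm_pow (by norm_num)

/-- The Dirichlet energy of `u` on the part of `Ω` in `A`. -/
def energy (u : H1 Ω) (A : Set Plane) : ℝ := ∫ x in A ∩ Ω, ‖grad u x‖ ^ 2

/-- The squared `L²`-norm of `u` on the part of `Ω` in `A`. -/
def mass (u : H1 Ω) (A : Set Plane) : ℝ := ∫ x in A ∩ Ω, ‖value u x‖ ^ 2

theorem energy_nonneg (u : H1 Ω) (A : Set Plane) : 0 ≤ energy u A :=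
  integral_nonneg fun _ => by positivity

theorem mass_nonneg (u : H1 Ω) (A : Set Plane) : 0 ≤ mass u A :=
  integral_nonneg fun _ => by positivity

theorem energy_mono (u : H1 Ω) {A B : Set Plane} (h : A ∩ Ω ⊆ B) :
    energy u A ≤ energy u B :=
  setIntegral_mono_set ((integrableOn_sq_grad u).mono_set Set.inter_subset_right)
    (ae_of_all _ fun _ => by positivity)
    (LE.le.eventuallyLE fun _ hx => ⟨h hx, hx.2⟩)

theorem mass_mono (u : H1 Ω) {A B : Set Plane} (h : A ∩ Ω ⊆ B) :
    mass u A ≤ mass u B :=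
  setIntegral_mono_set ((integrableOn_sq_value u).mono_set Set.inter_subset_right)
    (ae_of_all _ fun _ => by positivity)
    (LE.le.eventuallyLE fun _ hx => ⟨h hx, hx.2⟩)

theorem sq_norm_eq_mass_add_energy (u : H1 Ω) : ‖u‖ ^ 2 = mass u Ω + energy u Ω := by
  rw [sq_norm_eq, mass, energy, Set.inter_self]

theorem energy_le_sq_norm (u : H1 Ω) (A : Set Plane) : energy u A ≤ ‖u‖ ^ 2 := by
  rw [sq_norm_eq_mass_add_energy]
  linarith [energy_mono u (A := A) (B := Ω) Set.inter_subset_right, mass_nonneg u Ω]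

theorem mass_le_sq_norm (u : H1 Ω) (A : Set Plane) : mass u A ≤ ‖u‖ ^ 2 := by
  rw [sq_norm_eq_mass_add_energy]
  linarith [mass_mono u (A := A) (B := Ω) Set.inter_subset_right, energy_nonneg u Ω]

theorem lintegral_grad_eq (u : H1 Ω) {A : Set Plane} (hA : A ⊆ Ω) :
    ∫⁻ x in A, ‖grad u x‖ₑ ^ 2 = ENNReal.ofReal (energy u A) := by
  rw [energy, Set.inter_eq_left.2 hA,
    ofReal_integral_eq_lintegral_ofReal ((integrableOn_sq_grad u).mono_set hA)
      (ae_of_all _ fun _ => by positivity)]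
  refine lintegral_congr fun x => ?_
  rw [ENNReal.ofReal_pow (norm_nonneg _), ofReal_norm]

theorem lintegral_value_eq (u : H1 Ω) {A : Set Plane} (hA : A ⊆ Ω) :
    ∫⁻ x in A, ‖value u x‖ₑ ^ 2 = ENNReal.ofReal (mass u A) := by
  rw [mass, Set.inter_eq_left.2 hA,
    ofReal_integral_eq_lintegral_ofReal ((integrableOn_sq_value u).mono_set hA)
      (ae_of_all _ fun _ => by positivity)]
  refine lintegral_congr fun x => ?_
  rw [ENNReal.ofReal_pow (norm_nonneg _), ofReal_norm]

theorem integrableOn_value [IsFiniteMeasure (volume.restrict Ω)] (u : H1 Ω) :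
    IntegrableOn (value u) Ω :=
  (memLp_value u).integrable (by norm_num)

theorem integrableOn_grad [IsFiniteMeasure (volume.restrict Ω)] (u : H1 Ω) :
    IntegrableOn (grad u) Ω :=
  (memLp_grad u).integrable (by norm_num)

/-- The weak gradient is determined by the function. -/
theorem grad_ae_eq_zero_of_value (hΩ : IsOpen Ω) (u : H1 Ω)
    (h : value u =ᵐ[volume.restrict Ω] 0) : grad u =ᵐ[volume.restrict Ω] 0 := by
  have hj : ∀ j : Fin 2, ∀ᵐ x ∂(volume.restrict Ω), grad u x j = 0 := by
    intro j
    have hloc : LocallyIntegrableOn (fun x => grad u x j) Ω volume := by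
      refine locallyIntegrableOn_of_locallyIntegrable_restrict ?_
      exact (memLp_component u.1.snd j).locallyIntegrable (by norm_num)
    -- The fundamental lemma of the calculus of variations: for vanishing values the weak gradient
    -- identity says that `∂_j u` annihilates all test functions.
    have := hΩ.ae_eq_zero_of_integral_contDiff_smul_eq_zero hloc (fun φ h1 h2 h3 => ?_)
    · exact (ae_restrict_iff' hΩ.measurableSet).2 this
    · have hφ : IsTestFunction Ω φ := ⟨h1, h2, h3⟩
      have e := isWeakGradient u hφ j
      have e0 : ∫ x in Ω, partialDeriv j φ x • value u x = 0 := by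
        refine integral_eq_zero_of_ae ?_
        filter_upwards [h] with x hx
        rw [hx]; simp
      rw [e0] at e
      have e1 : ∫ x in Ω, φ x • grad u x j = 0 := by
        rw [← neg_eq_zero]; exact e.symm
      rw [← setIntegral_eq_integral_of_forall_compl_eq_zero (s := Ω), e1]
      intro x hx
      rw [image_eq_zero_of_notMem_tsupport (fun h => hx (h3 h)), zero_smul]
  filter_upwards [hj 0, hj 1] with x h0 h1
  ext j
  fin_cases j
  · simpa using h0
  · simpa using h1

/-- An element of `H1` carries its gradient as a second component, so equal values suffice only
because weak gradients are unique. -/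
theorem ext_value (hΩ : IsOpen Ω) {u w : H1 Ω} (h : value u =ᵐ[volume.restrict Ω] value w) :
    u = w := by
  have h0 : value (u - w) =ᵐ[volume.restrict Ω] 0 := by
    filter_upwards [value_sub u w, h] with x h1 h2
    rw [h1, h2]; simp
  have h1 := grad_ae_eq_zero_of_value hΩ _ h0
  have hn : ‖u - w‖ ^ 2 = 0 := by
    rw [sq_norm_eq]
    have a : ∫ x in Ω, ‖value (u - w) x‖ ^ 2 = 0 := by
      refine integral_eq_zero_of_ae ?_
      filter_upwards [h0] with x hx
      rw [hx]; simp
    have b : ∫ x in Ω, ‖grad (u - w) x‖ ^ 2 = 0 := by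
      refine integral_eq_zero_of_ae ?_
      filter_upwards [h1] with x hx
      rw [hx]; simp
    rw [a, b, add_zero]
  exact sub_eq_zero.1 (norm_eq_zero.1 (pow_eq_zero_iff (two_ne_zero)|>.1 hn))

theorem ext_represents (hΩ : IsOpen Ω) {u w : H1 Ω} {v : Plane → ℂ} (hu : Represents u v)
    (hw : Represents w v) : u = w :=
  ext_value hΩ (hu.trans hw.symm)

theorem Represents.add {u w : H1 Ω} {f g : Plane → ℂ} (hu : Represents u f) (hw : Represents w g) :
    Represents (u + w) (fun x => f x + g x) := by
  filter_upwards [value_add u w, hu, hw] with x h1 h2 h3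
  rw [h1, h2, h3]

theorem Represents.sub {u w : H1 Ω} {f g : Plane → ℂ} (hu : Represents u f) (hw : Represents w g) :
    Represents (u - w) (fun x => f x - g x) := by
  filter_upwards [value_sub u w, hu, hw] with x h1 h2 h3
  rw [h1, h2, h3]

theorem Represents.smul {u : H1 Ω} {f : Plane → ℂ} (c : ℂ) (hu : Represents u f) :
    Represents (c • u) (fun x => c * f x) := by
  filter_upwards [value_smul c u, hu] with x h1 h2
  rw [h1, h2]

/-- Turns both sides of the weak gradient identity into inner products with a fixed `L²` function,
which makes their continuity visible. -/
theorem integral_smul_eq_inner {φ : Plane → ℝ} {f : Plane → ℂ}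
    (hφ : MemLp (fun x => (φ x : ℂ)) 2 (volume.restrict Ω)) (u : L2 Ω)
    (hf : u =ᵐ[volume.restrict Ω] f) :
    ∫ x in Ω, φ x • f x = inner ℂ (hφ.toLp _) u := by
  rw [L2.inner_def]
  refine integral_congr_ae ?_
  filter_upwards [hφ.coeFn_toLp, hf] with x h1 h2
  rw [h1, ← h2]
  simp [mul_comm]

theorem memLp_ofReal_of_compact {φ : Plane → ℝ} (hc : Continuous φ) (hs : HasCompactSupport φ) :
    MemLp (fun x => (φ x : ℂ)) 2 (volume.restrict Ω) := by
  have : MemLp (fun x => (φ x : ℂ)) 2 (volume : Measure Plane) := by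
    refine Continuous.memLp_of_hasCompactSupport (Complex.continuous_ofReal.comp hc) ?_
    exact hs.comp_left (g := ((↑) : ℝ → ℂ)) Complex.ofReal_zero
  exact this.restrict Ω

/-- Every test function and every direction impose one equation between continuous functionals; `H1`
is the intersection of these closed sets. -/
theorem isClosed_H1 : IsClosed ((H1 Ω : Submodule ℂ _) : Set (WithLp 2 (L2 Ω × L2Vec Ω))) := by
  have hset : ((H1 Ω : Submodule ℂ _) : Set (WithLp 2 (L2 Ω × L2Vec Ω))) =
      ⋂ (φ : Plane → ℝ) (hφ : IsTestFunction Ω φ) (j : Fin 2),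
        {p | inner ℂ ((memLp_ofReal_of_compact (Ω := Ω) (hφ.continuous_partialDeriv j)
            (hφ.hasCompactSupport_partialDeriv j)).toLp _) p.fst =
          -inner ℂ ((memLp_ofReal_of_compact (Ω := Ω) hφ.smooth.continuous hφ.compact).toLp _)
            ((EuclideanSpace.proj (𝕜 := ℂ) j).compLp p.snd)} := by
    ext p
    simp only [Set.mem_iInter, Set.mem_ofPred_eq, SetLike.mem_coe]
    have key : ∀ φ (hφ : IsTestFunction Ω φ) (j : Fin 2),
        ((∫ x in Ω, partialDeriv j φ x • p.fst x = -∫ x in Ω, φ x • p.snd x j) ↔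
        inner ℂ ((memLp_ofReal_of_compact (Ω := Ω) (hφ.continuous_partialDeriv j)
            (hφ.hasCompactSupport_partialDeriv j)).toLp _) p.fst =
          -inner ℂ ((memLp_ofReal_of_compact (Ω := Ω) hφ.smooth.continuous hφ.compact).toLp _)
            ((EuclideanSpace.proj (𝕜 := ℂ) j).compLp p.snd)) := by
      intro φ hφ j
      rw [← integral_smul_eq_inner (f := p.fst) _ _ (ae_eq_refl _),
        ← integral_smul_eq_inner (f := fun x => p.snd x j) _ _
          ((EuclideanSpace.proj (𝕜 := ℂ) j).coeFn_compLp p.snd)]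
    exact ⟨fun h φ hφ j => (key φ hφ j).1 (h φ hφ j), fun h φ hφ j => (key φ hφ j).2 (h φ hφ j)⟩
  rw [hset]
  refine isClosed_iInter fun φ => isClosed_iInter fun hφ => isClosed_iInter fun j => ?_
  refine isClosed_eq ?_ ?_
  · exact continuous_const.inner (WithLp.prod_continuous_ofLp 2 _ _).fst
  · refine (continuous_const.inner ?_).neg
    exact ((EuclideanSpace.proj (𝕜 := ℂ) j).compLpL 2 (volume.restrict Ω)).continuous.comp
      (WithLp.prod_continuous_ofLp 2 _ _).snd

instance instCompleteSpaceH1 : CompleteSpace (H1 Ω) := isClosed_H1.completeSpace_coe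

end Basic

/-! ### Mollification -/

section Mollification

open scoped Convolution

variable {Ω : Set Plane}

/-- Cauchy–Schwarz in extended non-negative reals, squared so that no roots occur and no
integrability has to be tracked. -/
theorem sq_lintegral_mul_le {α : Type*} [MeasurableSpace α] (μ : Measure α) {f g : α → ℝ≥0∞}
    (hf : AEMeasurable f μ) (hg : AEMeasurable g μ) :
    (∫⁻ x, f x * g x ∂μ) ^ 2 ≤ (∫⁻ x, f x ^ 2 ∂μ) * ∫⁻ x, g x ^ 2 ∂μ := by
  have h := ENNReal.lintegral_mul_le_Lp_mul_Lq μ Real.HolderConjugate.two_two hf hg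
  simp only [Pi.mul_apply, ENNReal.rpow_ofNat] at h
  calc (∫⁻ x, f x * g x ∂μ) ^ 2
      ≤ ((∫⁻ x, f x ^ 2 ∂μ) ^ ((1 : ℝ) / 2) * (∫⁻ x, g x ^ 2 ∂μ) ^ ((1 : ℝ) / 2)) ^ 2 := by gcongr
    _ = _ := by
      rw [mul_pow, ← ENNReal.rpow_natCast, ← ENNReal.rpow_natCast, ← ENNReal.rpow_mul,
        ← ENNReal.rpow_mul]
      norm_num

/-- Jensen's inequality for a weight of total mass one. -/
theorem sq_enorm_integral_smul_le {F : Type*} [NormedAddCommGroup F] [NormedSpace ℝ F]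
    {α : Type*} [MeasurableSpace α] (μ : Measure α) {ρ : α → ℝ} (hρ : 0 ≤ ρ)
    (hρm : Measurable ρ) (h1 : ∫⁻ x, ENNReal.ofReal (ρ x) ∂μ = 1) {g : α → F}
    (hg : AEStronglyMeasurable g μ) :
    ‖∫ x, ρ x • g x ∂μ‖ₑ ^ 2 ≤ ∫⁻ x, ENNReal.ofReal (ρ x) * ‖g x‖ₑ ^ 2 ∂μ := by
  have hr : AEMeasurable (fun x => ENNReal.ofReal (√(ρ x))) μ :=
    (hρm.sqrt.ennreal_ofReal).aemeasurable
  have hsq : ∀ x, ENNReal.ofReal (√(ρ x)) ^ 2 = ENNReal.ofReal (ρ x) := fun x => by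
    rw [← ENNReal.ofReal_pow (Real.sqrt_nonneg _), Real.sq_sqrt (hρ x)]
  calc ‖∫ x, ρ x • g x ∂μ‖ₑ ^ 2 ≤ (∫⁻ x, ‖ρ x • g x‖ₑ ∂μ) ^ 2 := by
        gcongr; exact enorm_integral_le_lintegral_enorm _
    -- The weight is split as `√ρ · √ρ`; after Cauchy–Schwarz one of the factors integrates to one.
    _ = (∫⁻ x, ENNReal.ofReal (√(ρ x)) * (ENNReal.ofReal (√(ρ x)) * ‖g x‖ₑ) ∂μ) ^ 2 := by
        congr 2
        ext x
        rw [← mul_assoc, ← sq, hsq, enorm_smul, Real.enorm_of_nonneg (hρ x)]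
    _ ≤ (∫⁻ x, ENNReal.ofReal (√(ρ x)) ^ 2 ∂μ) *
          ∫⁻ x, (ENNReal.ofReal (√(ρ x)) * ‖g x‖ₑ) ^ 2 ∂μ :=
        sq_lintegral_mul_le μ hr (hr.mul hg.enorm)
    _ = _ := by
        simp only [mul_pow, hsq, h1, one_mul]

theorem lintegral_ofReal_normed (φ : ContDiffBump (0 : Plane)) :
    ∫⁻ x, ENNReal.ofReal (φ.normed volume x) = 1 := by
  rw [← ofReal_integral_eq_lintegral_ofReal φ.integrable_normed
    (ae_of_all _ fun x => φ.nonneg_normed x), φ.integral_normed, ENNReal.ofReal_one]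

/-- Convolution with a mollifier does not increase the `L²`-norm. -/
theorem lintegral_sq_convolution_le {F : Type*} [NormedAddCommGroup F] [NormedSpace ℝ F]
    (φ : ContDiffBump (0 : Plane)) {g : Plane → F} (hg : StronglyMeasurable g)
    {C D : Set Plane} (hC : MeasurableSet C) (hD : MeasurableSet D)
    (hCD : ∀ x ∈ C, Metric.ball x φ.rOut ⊆ D) :
    ∫⁻ x in C, ‖(φ.normed volume ⋆[ContinuousLinearMap.lsmul ℝ ℝ, volume] g) x‖ₑ ^ 2 ≤
      ∫⁻ x in D, ‖g x‖ₑ ^ 2 := by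
  have hm : Measurable (fun p : Plane × Plane =>
      ENNReal.ofReal (φ.normed volume p.2) * ‖g (p.1 - p.2)‖ₑ ^ 2) := by
    have h1 : Measurable (fun p : Plane × Plane => ENNReal.ofReal (φ.normed volume p.2)) :=
      (φ.continuous_normed.measurable.comp measurable_snd).ennreal_ofReal
    have h2 : Measurable (fun p : Plane × Plane => ‖g (p.1 - p.2)‖ₑ ^ 2) :=
      ((hg.enorm).comp (measurable_fst.sub measurable_snd)).pow_const 2
    exact h1.mul h2
  calc ∫⁻ x in C, ‖(φ.normed volume ⋆[ContinuousLinearMap.lsmul ℝ ℝ, volume] g) x‖ₑ ^ 2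
      ≤ ∫⁻ x in C, ∫⁻ t, ENNReal.ofReal (φ.normed volume t) * ‖g (x - t)‖ₑ ^ 2 := by
        refine lintegral_mono fun x => ?_
        rw [convolution_def]
        simp only [ContinuousLinearMap.lsmul_apply]
        refine sq_enorm_integral_smul_le volume (fun x => φ.nonneg_normed x)
          φ.continuous_normed.measurable (lintegral_ofReal_normed φ) ?_
        exact (hg.comp_measurable (measurable_const.sub measurable_id)).aestronglyMeasurable
    _ = ∫⁻ t, ∫⁻ x in C, ENNReal.ofReal (φ.normed volume t) * ‖g (x - t)‖ₑ ^ 2 :=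
        lintegral_lintegral_swap hm.aemeasurable
    _ ≤ ∫⁻ t, ENNReal.ofReal (φ.normed volume t) * ∫⁻ x in D, ‖g x‖ₑ ^ 2 := by
        refine lintegral_mono fun t => ?_
        have hmt : Measurable (fun x => ‖g (x - t)‖ₑ ^ 2) :=
          ((hg.enorm).comp (measurable_id.sub_const t)).pow_const 2
        rw [lintegral_const_mul _ hmt]
        -- Only shifts shorter than the outer radius carry weight, and these move `C` into `D`.
        by_cases ht : t ∈ Metric.ball (0 : Plane) φ.rOut
        · refine mul_le_mul_right ?_ _
          rw [← lintegral_indicator hC, ← lintegral_indicator hD,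
            ← lintegral_sub_right_eq_self (fun x => D.indicator (fun a => ‖g a‖ₑ ^ 2) x) t]
          refine lintegral_mono fun x => ?_
          by_cases hx : x ∈ C
          · have : x - t ∈ D := hCD x hx (by
              simpa [Metric.mem_ball, dist_eq_norm] using ht)
            rw [Set.indicator_of_mem hx, Set.indicator_of_mem this]
          · rw [Set.indicator_of_notMem hx]; exact zero_le
        · have : φ.normed volume t = 0 := by
            have h := φ.support_normed_eq (μ := volume)
            by_contra h0
            exact ht (h ▸ h0)
          simp [this]
    _ = ∫⁻ x in D, ‖g x‖ₑ ^ 2 := by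
        rw [lintegral_mul_const _
          φ.continuous_normed.measurable.ennreal_ofReal, lintegral_ofReal_normed, one_mul]

/-- The gradient of a differentiable complex-valued function. -/
def gradC (f : Plane → ℂ) (x : Plane) : EuclideanSpace ℂ (Fin 2) :=
  WithLp.toLp 2 fun j => fderiv ℝ f x (EuclideanSpace.single j 1)

theorem norm_apply_le_norm_toLp (L : Plane →L[ℝ] ℂ) (w : Plane) :
    ‖L w‖ ≤ ‖(WithLp.toLp 2 fun j => L (EuclideanSpace.single j 1) :
      EuclideanSpace ℂ (Fin 2))‖ * ‖w‖ := by
  have hw : w = w 0 • EuclideanSpace.single 0 (1 : ℝ) + w 1 • EuclideanSpace.single 1 (1 : ℝ) := by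
    ext j; fin_cases j <;> simp
  have h1 : ‖L w‖ ≤ |w 0| * ‖L (EuclideanSpace.single 0 1)‖
      + |w 1| * ‖L (EuclideanSpace.single 1 1)‖ := by
    conv_lhs => rw [hw]
    rw [map_add, map_smul, map_smul]
    refine (norm_add_le _ _).trans ?_
    rw [norm_smul, norm_smul, Real.norm_eq_abs, Real.norm_eq_abs]
  refine h1.trans ?_
  rw [EuclideanSpace.norm_eq, EuclideanSpace.norm_eq, ← Real.sqrt_mul (by positivity)]
  refine Real.le_sqrt_of_sq_le ?_
  simp only [Fin.sum_univ_two, Real.norm_eq_abs, sq_abs]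
  nlinarith [sq_nonneg (|w 0| * ‖L (EuclideanSpace.single 1 1)‖ -
    |w 1| * ‖L (EuclideanSpace.single 0 1)‖), sq_abs (w 0), sq_abs (w 1)]

theorem norm_fderiv_apply_le (f : Plane → ℂ) (x w : Plane) :
    ‖fderiv ℝ f x w‖ ≤ ‖gradC f x‖ * ‖w‖ := norm_apply_le_norm_toLp _ _

theorem continuous_gradC {f : Plane → ℂ} (hf : ContDiff ℝ 1 f) : Continuous (gradC f) := by
  refine (PiLp.continuous_toLp 2 _).comp (continuous_pi fun j => ?_)
  exact (hf.continuous_fderiv (by simp)).clm_apply continuous_const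

theorem memLp_indicator_value (hΩ : IsOpen Ω) (u : H1 Ω) :
    MemLp (Ω.indicator (value u)) 2 volume :=
  (memLp_indicator_iff_restrict hΩ.measurableSet).2 (memLp_value u)

theorem memLp_indicator_grad (hΩ : IsOpen Ω) (u : H1 Ω) :
    MemLp (Ω.indicator (grad u)) 2 volume :=
  (memLp_indicator_iff_restrict hΩ.measurableSet).2 (memLp_grad u)

/-- The gradient of the mollified function is the mollified gradient. -/
theorem gradC_convolution (hΩ : IsOpen Ω) (u : H1 Ω) (φ : ContDiffBump (0 : Plane)) {x : Plane}
    (hx : Metric.closedBall x φ.rOut ⊆ Ω) :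
    gradC (φ.normed volume ⋆[ContinuousLinearMap.lsmul ℝ ℝ, volume] (Ω.indicator (value u))) x =
      (φ.normed volume ⋆[ContinuousLinearMap.lsmul ℝ ℝ, volume] (Ω.indicator (grad u))) x := by
  have hg : LocallyIntegrable (Ω.indicator (value u)) volume :=
    (memLp_indicator_value hΩ u).locallyIntegrable (by norm_num)
  have hG : LocallyIntegrable (Ω.indicator (grad u)) volume :=
    (memLp_indicator_grad hΩ u).locallyIntegrable (by norm_num)
  have hd := (φ.hasCompactSupport_normed (μ := volume)).hasFDerivAt_convolution_left
    (μ := (volume : Measure Plane)) (ContinuousLinearMap.lsmul ℝ ℝ) φ.contDiff_normed hg x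
  have hex : ConvolutionExistsAt (fderiv ℝ (φ.normed volume)) (Ω.indicator (value u)) x
      (ContinuousLinearMap.precompL Plane (ContinuousLinearMap.lsmul ℝ ℝ)) volume :=
    (φ.hasCompactSupport_normed.fderiv (𝕜 := ℝ)).convolutionExists_left _
      ((φ.contDiff_normed (n := 1)).continuous_fderiv (by simp)) hg x
  have hexG : ConvolutionExistsAt (φ.normed volume) (Ω.indicator (grad u)) x
      (ContinuousLinearMap.lsmul ℝ ℝ) volume :=
    φ.hasCompactSupport_normed.convolutionExists_left _ φ.continuous_normed hG x
  ext j
  -- The reflected mollifier centred at `x` is admissible in the weak gradient identity because the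
  -- closed ball about `x` lies in `Ω`. Differentiating through the reflection produces a sign,
  -- which cancels the one from integration by parts.
  have htest : IsTestFunction Ω (fun y => φ.normed volume (x - y)) := by
    refine ⟨φ.contDiff_normed.comp (contDiff_const.sub contDiff_id), ?_, ?_⟩
    · exact φ.hasCompactSupport_normed.comp_homeomorph (Homeomorph.subLeft x)
    · refine Set.Subset.trans ?_ hx
      refine closure_minimal ?_ Metric.isClosed_closedBall
      intro y hy
      have : x - y ∈ Function.support (φ.normed volume) := hy
      rw [φ.support_normed_eq, Metric.mem_ball, dist_zero_right] at this
      rw [Metric.mem_closedBall, dist_comm, dist_eq_norm]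
      exact this.le
  have hpd : ∀ y, partialDeriv j (fun y => φ.normed volume (x - y)) y =
      -fderiv ℝ (φ.normed volume) (x - y) (EuclideanSpace.single j 1) := by
    intro y
    have h1 : HasFDerivAt (fun y : Plane => x - y) (-ContinuousLinearMap.id ℝ Plane) y :=
      (hasFDerivAt_id y).const_sub x
    have h2 : HasFDerivAt (φ.normed volume) (fderiv ℝ (φ.normed volume) (x - y)) (x - y) :=
      ((φ.contDiff_normed (n := 1)).differentiable (by simp) _).hasFDerivAt
    have h3 : HasFDerivAt (fun y => φ.normed volume (x - y)) _ y := h2.comp y h1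
    rw [partialDeriv, h3.fderiv]
    simp
  have hwg := isWeakGradient u htest j
  simp only [hpd, neg_smul, integral_neg, neg_inj] at hwg
  have e1 : gradC (φ.normed volume ⋆[ContinuousLinearMap.lsmul ℝ ℝ, volume]
      (Ω.indicator (value u))) x j =
      ∫ y in Ω, fderiv ℝ (φ.normed volume) (x - y) (EuclideanSpace.single j 1) • value u y := by
    rw [gradC, hd.fderiv]
    simp only [convolution_def]
    rw [ContinuousLinearMap.integral_apply hex]
    simp only [ContinuousLinearMap.precompL_apply, ContinuousLinearMap.lsmul_apply]
    rw [← integral_indicator hΩ.measurableSet,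
      ← integral_sub_left_eq_self (fun y => Ω.indicator (fun y => fderiv ℝ (φ.normed volume) (x - y)
        (EuclideanSpace.single j 1) • value u y) y) volume x]
    refine integral_congr_ae (ae_of_all _ fun t => ?_)
    by_cases ht : x - t ∈ Ω <;> simp [ht]
  have e2 : (φ.normed volume ⋆[ContinuousLinearMap.lsmul ℝ ℝ, volume] (Ω.indicator (grad u))) x j =
      ∫ y in Ω, φ.normed volume (x - y) • grad u y j := by
    have hc := ((EuclideanSpace.proj (𝕜 := ℂ) j).restrictScalars ℝ).integral_comp_comm hexG
    have : (φ.normed volume ⋆[ContinuousLinearMap.lsmul ℝ ℝ, volume]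
        (Ω.indicator (grad u))) x j = ((EuclideanSpace.proj (𝕜 := ℂ) j).restrictScalars ℝ)
        (∫ t, (ContinuousLinearMap.lsmul ℝ ℝ) (φ.normed volume t)
          (Ω.indicator (grad u) (x - t))) := rfl
    rw [this, ← hc, ← integral_indicator hΩ.measurableSet,
      ← integral_sub_left_eq_self (fun y => Ω.indicator (fun y => φ.normed volume (x - y)
        • grad u y j) y) volume x]
    refine integral_congr_ae (ae_of_all _ fun t => ?_)
    by_cases ht : x - t ∈ Ω <;> simp [ht]
  rw [e1, e2, hwg]

/-- Approximation of a Sobolev function by smooth functions on compact subsets. -/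
theorem exists_smooth_approx (hΩ : IsOpen Ω) (u : H1 Ω) {v : Plane → ℂ} (hv : Represents u v)
    {C D : Set Plane} (hC : IsCompact C) (hD : IsOpen D) (hCD : C ⊆ D) (hDΩ : D ⊆ Ω) :
    ∃ f : ℕ → Plane → ℂ, (∀ n, ContDiff ℝ 1 (f n)) ∧
      (∀ n, ∫⁻ x in C, ‖f n x‖ₑ ^ 2 ≤ ∫⁻ x in D, ‖value u x‖ₑ ^ 2) ∧
      (∀ n, ∫⁻ x in C, ‖gradC (f n) x‖ₑ ^ 2 ≤ ∫⁻ x in D, ‖grad u x‖ₑ ^ 2) ∧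
      (∀ᵐ x, x ∈ C → Tendsto (fun n => f n x) atTop (𝓝 (v x))) ∧
      (∀ x ∈ C, ContinuousAt v x → Tendsto (fun n => f n x) atTop (𝓝 (v x))) := by
  obtain ⟨δ, hδ, hδD⟩ := hC.exists_cthickening_subset_open hD hCD
  let φ : ℕ → ContDiffBump (0 : Plane) := fun n =>
    ⟨δ / (n + 1) / 2, δ / (n + 1), by positivity, half_lt_self (by positivity)⟩
  have hφ0 : Tendsto (fun n => (φ n).rOut) atTop (𝓝 0) :=
    tendsto_const_div_atTop_nhds_zero_nat δ |>.comp (tendsto_add_atTop_nat 1) |>.congr fun n => by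
      simp [φ]
  have hφδ : ∀ n, (φ n).rOut ≤ δ := fun n => by
    refine div_le_self hδ.le ?_
    linarith [(Nat.cast_nonneg n : (0 : ℝ) ≤ n)]
  have hball : ∀ n, ∀ x ∈ C, Metric.closedBall x (φ n).rOut ⊆ D := fun n x hx =>
    ((Metric.closedBall_subset_closedBall (hφδ n)).trans
      (Metric.closedBall_subset_cthickening hx δ)).trans hδD
  have hg : LocallyIntegrable (Ω.indicator (value u)) volume :=
    (memLp_indicator_value hΩ u).locallyIntegrable (by norm_num)
  have hind : ∀ {F : Type} [NormedAddCommGroup F] (g : Plane → F),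
      ∫⁻ x in D, ‖Ω.indicator g x‖ₑ ^ 2 = ∫⁻ x in D, ‖g x‖ₑ ^ 2 := fun g =>
    setLIntegral_congr_fun hD.measurableSet fun x hx => by
      rw [Set.indicator_of_mem (hDΩ hx)]
  refine ⟨fun n => (φ n).normed volume ⋆[ContinuousLinearMap.lsmul ℝ ℝ, volume]
    (Ω.indicator (value u)), fun n => ?_, fun n => ?_, fun n => ?_, ?_, ?_⟩
  · exact (φ n).hasCompactSupport_normed.contDiff_convolution_left _ (φ n).contDiff_normed hg
  · rw [← hind]
    exact lintegral_sq_convolution_le (φ n)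
      ((stronglyMeasurable_value u).indicator hΩ.measurableSet) hC.measurableSet hD.measurableSet
      fun x hx => Metric.ball_subset_closedBall.trans (hball n x hx)
  · rw [← hind]
    refine le_trans (le_of_eq ?_) (lintegral_sq_convolution_le (φ n)
      ((stronglyMeasurable_grad u).indicator hΩ.measurableSet) hC.measurableSet hD.measurableSet
      fun x hx => Metric.ball_subset_closedBall.trans (hball n x hx))
    refine setLIntegral_congr_fun hC.measurableSet fun x hx => ?_
    simp only
    rw [gradC_convolution hΩ u (φ n) ((hball n x hx).trans hDΩ)]
  -- The constant 2 is the ratio of the outer to the inner radius of the bumps; a bounded ratio is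
  -- what convergence at Lebesgue points requires.
  · have h1 := ContDiffBump.ae_convolution_tendsto_right_of_locallyIntegrable (K := 2) hφ0
      (Eventually.of_forall fun n => le_of_eq (by simp only [φ]; ring)) hg
    have h2 := (ae_restrict_iff' hΩ.measurableSet).1 hv
    filter_upwards [h1, h2] with x hx1 hx2 hxC
    have hxΩ := hDΩ (hCD hxC)
    rw [Set.indicator_of_mem hxΩ, hx2 hxΩ] at hx1
    exact hx1
  -- At continuity points convergence holds without exceptional set. This version is the one usable
  -- on a segment, which is a null set of the plane.
  · intro x hxC hcont
    have hxΩ := hDΩ (hCD hxC)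
    have hae : Ω.indicator (value u) =ᵐ[volume] Ω.indicator v := by
      filter_upwards [(ae_restrict_iff' hΩ.measurableSet).1 hv] with y hy
      by_cases hyΩ : y ∈ Ω
      · rw [Set.indicator_of_mem hyΩ, Set.indicator_of_mem hyΩ, hy hyΩ]
      · rw [Set.indicator_of_notMem hyΩ, Set.indicator_of_notMem hyΩ]
    · have hmeas : AEStronglyMeasurable (Ω.indicator v) volume :=
        hg.aestronglyMeasurable.congr hae
      have hlim : Tendsto (Ω.indicator v) (𝓝 x) (𝓝 (v x)) := by
        refine hcont.tendsto.congr' ?_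
        filter_upwards [hΩ.mem_nhds hxΩ] with y hy
        rw [Set.indicator_of_mem hy]
      have := ContDiffBump.convolution_tendsto_right (φ := φ) (μ := (volume : Measure Plane))
        (g := fun _ => Ω.indicator v) (k := fun _ => x) hφ0 (Eventually.of_forall fun _ => hmeas)
        (hlim.comp tendsto_snd) tendsto_const_nhds
      refine this.congr fun n => ?_
      exact congrFun (convolution_congr _ (ae_eq_refl _) hae.symm) x

end Mollification

/-! ### The Poincaré inequality on convex sets -/

section Poincare

variable {Ω : Set Plane}

theorem lintegral_homothety {g : Plane → ℝ≥0∞} (hg : Measurable g) (z : Plane) {s : ℝ}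
    (hs : s ≠ 0) :
    ∫⁻ w, g (z + s • (w - z)) = ENNReal.ofReal (s ^ 2)⁻¹ * ∫⁻ w, g w := by
  have h1 : ∀ w, g (z + s • (w - z)) = (fun y => g (y + (z - s • z))) (s • w) := fun w => by
    simp only; congr 1; rw [smul_sub]; abel
  simp only [h1]
  have hm : Measurable (fun y => g (y + (z - s • z))) := hg.comp (measurable_add_const _)
  have := lintegral_map (μ := (volume : Measure Plane)) hm (measurable_const_smul s)
  rw [← this, Measure.map_addHaar_smul volume hs, lintegral_smul_measure,
    lintegral_add_right_eq_self g]
  simp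

/-- A homothety about a point of a convex set maps the set into itself. Its Jacobian `s²` is at
least `1/4`, which gives the factor 4. -/
theorem setLIntegral_homothety_le {g : Plane → ℝ≥0∞} (hg : Measurable g) {C : Set Plane}
    (hC : Convex ℝ C) (hCm : MeasurableSet C) {z : Plane} (hz : z ∈ C) {s : ℝ}
    (hs : 1 / 2 ≤ s) (hs1 : s ≤ 1) :
    ∫⁻ w in C, g (z + s • (w - z)) ≤ 4 * ∫⁻ w in C, g w := by
  have hs0 : s ≠ 0 := by linarith
  calc ∫⁻ w in C, g (z + s • (w - z)) ≤ ∫⁻ w, C.indicator g (z + s • (w - z)) := by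
        rw [← lintegral_indicator hCm]
        refine lintegral_mono fun w => ?_
        by_cases hw : w ∈ C
        · have : z + s • (w - z) ∈ C := hC.add_smul_sub_mem hz hw ⟨by linarith, hs1⟩
          rw [Set.indicator_of_mem hw, Set.indicator_of_mem this]
        · rw [Set.indicator_of_notMem hw]; exact zero_le
    _ = ENNReal.ofReal (s ^ 2)⁻¹ * ∫⁻ w in C, g w := by
        rw [lintegral_homothety (hg.indicator hCm) z hs0, lintegral_indicator hCm]
    _ ≤ 4 * ∫⁻ w in C, g w := by
        gcongr
        have : (s ^ 2)⁻¹ ≤ 4 := by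
          rw [inv_le_comm₀ (by positivity) (by norm_num)]; nlinarith
        calc ENNReal.ofReal (s ^ 2)⁻¹ ≤ ENNReal.ofReal 4 := ENNReal.ofReal_le_ofReal this
          _ = 4 := by norm_num

/-- The fundamental theorem of calculus along the segment, followed by Cauchy–Schwarz on the unit
interval. -/
theorem sq_enorm_sub_le {f : Plane → ℂ} (hf : ContDiff ℝ 1 f) {x y : Plane} {d : ℝ}
    (hd : dist x y ≤ d) :
    ‖f x - f y‖ₑ ^ 2 ≤
      ENNReal.ofReal (d ^ 2) * ∫⁻ t in Set.Ioc (0 : ℝ) 1, ‖gradC f (x + t • (y - x))‖ₑ ^ 2 := by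
  have hd0 : 0 ≤ d := dist_nonneg.trans hd
  have hline : ∀ t : ℝ, HasDerivAt (fun t : ℝ => x + t • (y - x)) (y - x) t := fun t => by
    simpa using ((hasDerivAt_id t).smul_const (y - x)).const_add x
  have hder : ∀ t : ℝ, HasDerivAt (fun t : ℝ => f (x + t • (y - x)))
      (fderiv ℝ f (x + t • (y - x)) (y - x)) t := fun t =>
    ((hf.differentiable (by simp) _).hasFDerivAt).comp_hasDerivAt t (hline t)
  have hlc : Continuous (fun t : ℝ => x + t • (y - x)) := by fun_prop
  have hcont : Continuous (fun t : ℝ => fderiv ℝ f (x + t • (y - x)) (y - x)) :=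
    ((hf.continuous_fderiv (by simp)).comp hlc).clm_apply continuous_const
  have hFTC := intervalIntegral.integral_eq_sub_of_hasDerivAt (a := 0) (b := 1)
    (fun t _ => hder t) (hcont.intervalIntegrable 0 1)
  have he : f y - f x = ∫ t in Set.Ioc (0 : ℝ) 1, fderiv ℝ f (x + t • (y - x)) (y - x) := by
    rw [← intervalIntegral.integral_of_le zero_le_one, hFTC]; simp
  have hG : Continuous (fun t : ℝ => gradC f (x + t • (y - x))) := (continuous_gradC hf).comp hlc
  rw [← enorm_neg, neg_sub, he]
  calc ‖∫ t in Set.Ioc (0 : ℝ) 1, fderiv ℝ f (x + t • (y - x)) (y - x)‖ₑ ^ 2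
      ≤ (∫⁻ t in Set.Ioc (0 : ℝ) 1,
          ENNReal.ofReal d * ‖gradC f (x + t • (y - x))‖ₑ) ^ 2 := by
        gcongr
        refine (enorm_integral_le_lintegral_enorm _).trans (lintegral_mono fun t => ?_)
        rw [← ofReal_norm, ← ofReal_norm, ← ENNReal.ofReal_mul hd0]
        refine ENNReal.ofReal_le_ofReal ((norm_fderiv_apply_le _ _ _).trans ?_)
        rw [mul_comm]
        gcongr
        rwa [← dist_eq_norm, dist_comm]
    _ ≤ (∫⁻ t in Set.Ioc (0 : ℝ) 1, ENNReal.ofReal d ^ 2) *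
          ∫⁻ t in Set.Ioc (0 : ℝ) 1, ‖gradC f (x + t • (y - x))‖ₑ ^ 2 :=
        sq_lintegral_mul_le _ aemeasurable_const hG.enorm.measurable.aemeasurable
    _ = _ := by
        rw [lintegral_const, Measure.restrict_apply_univ, Real.volume_Ioc, sub_zero,
          ENNReal.ofReal_one, mul_one, ENNReal.ofReal_pow hd0]

/-- The Poincaré inequality for a smooth function on a convex set. -/
theorem poincare_smooth {f : Plane → ℂ} (hf : ContDiff ℝ 1 f) {C : Set Plane} (hC : Convex ℝ C)
    (hCm : MeasurableSet C) {d : ℝ} (hd : ∀ x ∈ C, ∀ y ∈ C, dist x y ≤ d) :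
    ∫⁻ x in C, ∫⁻ y in C, ‖f x - f y‖ₑ ^ 2 ≤
      ENNReal.ofReal (4 * d ^ 2) * volume C * ∫⁻ x in C, ‖gradC f x‖ₑ ^ 2 := by
  obtain ⟨F, hF⟩ : ∃ F : Plane → ℝ≥0∞, F = fun x => ‖gradC f x‖ₑ ^ 2 := ⟨_, rfl⟩
  have hFm : Measurable F := hF ▸ ((continuous_gradC hf).enorm.measurable).pow_const 2
  have hmap : Continuous (fun p : (Plane × Plane) × ℝ => p.1.1 + p.2 • (p.1.2 - p.1.1)) := by
    fun_prop
  have hK : Measurable (fun p : (Plane × Plane) × ℝ => F (p.1.1 + p.2 • (p.1.2 - p.1.1))) :=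
    hFm.comp hmap.measurable
  have hinner : ∀ A : Set ℝ, Measurable (fun p : Plane × Plane =>
      ∫⁻ t in A, F (p.1 + t • (p.2 - p.1))) := fun A => hK.lintegral_prod_right'
  -- The point `x + t(y - x)` is the image of `y` under the homothety about `x` of ratio `t`, and
  -- the image of `x` under the one about `y` of ratio `1 - t`. One of the two ratios is at least
  -- `1/2`, so integrating first in the corresponding variable keeps the Jacobian away from zero.
  have hsym : ∀ t ∈ Set.Ioc (0 : ℝ) 1,
      ∫⁻ x in C, ∫⁻ y in C, F (x + t • (y - x)) ≤ 4 * (volume C * ∫⁻ x in C, F x) := by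
    intro t ht
    have hconst : ∀ a : ℝ≥0∞, ∫⁻ _ in C, 4 * a = 4 * (volume C * a) := fun a => by
      rw [lintegral_const, Measure.restrict_apply_univ]; ring
    rcases le_total (1 / 2) t with h | h
    · refine le_trans ?_ (hconst _).le
      refine setLIntegral_mono' hCm fun x hx => ?_
      exact setLIntegral_homothety_le hFm hC hCm hx h ht.2
    · rw [lintegral_lintegral_swap]
      · refine le_trans ?_ (hconst _).le
        refine setLIntegral_mono' hCm fun y hy => ?_
        refine le_trans (le_of_eq ?_)
          (setLIntegral_homothety_le hFm hC hCm hy (s := 1 - t) (by linarith) (by linarith [ht.1]))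
        refine lintegral_congr fun x => ?_
        congr 1
        rw [smul_sub, smul_sub, sub_smul, sub_smul, one_smul, one_smul]; abel
      · have : Continuous (fun p : Plane × Plane => p.1 + t • (p.2 - p.1)) := by fun_prop
        exact (hFm.comp this.measurable).aemeasurable
  calc ∫⁻ x in C, ∫⁻ y in C, ‖f x - f y‖ₑ ^ 2
      ≤ ∫⁻ x in C, ∫⁻ y in C, ENNReal.ofReal (d ^ 2) *
          ∫⁻ t in Set.Ioc (0 : ℝ) 1, F (x + t • (y - x)) :=
        setLIntegral_mono' hCm fun x hx => setLIntegral_mono' hCm fun y hy => by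
          rw [hF]
          exact sq_enorm_sub_le hf (hd x hx y hy)
    _ = ENNReal.ofReal (d ^ 2) * ∫⁻ x in C, ∫⁻ y in C,
          ∫⁻ t in Set.Ioc (0 : ℝ) 1, F (x + t • (y - x)) := by
        have h2 : ∀ x, Measurable fun y => ∫⁻ t in Set.Ioc (0 : ℝ) 1, F (x + t • (y - x)) :=
          fun x => by
            have hc : Measurable (fun y : Plane => (x, y)) := measurable_prodMk_left
            exact (hinner (Set.Ioc 0 1)).comp hc
        have h3 : Measurable fun x => ∫⁻ y in C,
            ∫⁻ t in Set.Ioc (0 : ℝ) 1, F (x + t • (y - x)) :=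
          (hinner (Set.Ioc 0 1)).lintegral_prod_right'
        rw [← lintegral_const_mul _ h3]
        exact lintegral_congr fun x => lintegral_const_mul _ (h2 x)
    _ = ENNReal.ofReal (d ^ 2) * ∫⁻ t in Set.Ioc (0 : ℝ) 1, ∫⁻ x in C, ∫⁻ y in C,
          F (x + t • (y - x)) := by
        congr 1
        have h1 : ∀ x, ∫⁻ y in C, ∫⁻ t in Set.Ioc (0 : ℝ) 1, F (x + t • (y - x)) =
            ∫⁻ t in Set.Ioc (0 : ℝ) 1, ∫⁻ y in C, F (x + t • (y - x)) := fun x => by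
          refine lintegral_lintegral_swap (Measurable.aemeasurable ?_)
          have : Continuous (fun p : Plane × ℝ => x + p.2 • (p.1 - x)) := by fun_prop
          exact hFm.comp this.measurable
        simp_rw [h1]
        refine lintegral_lintegral_swap (Measurable.aemeasurable ?_)
        have : Continuous (fun p : (Plane × ℝ) × Plane => p.1.1 + p.1.2 • (p.2 - p.1.1)) := by
          fun_prop
        exact (hFm.comp this.measurable).lintegral_prod_right'
    _ ≤ ENNReal.ofReal (d ^ 2) * ∫⁻ _ in Set.Ioc (0 : ℝ) 1, 4 * (volume C * ∫⁻ x in C, F x) := by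
        gcongr 1
        exact setLIntegral_mono' measurableSet_Ioc hsym
    _ = _ := by
        rw [lintegral_const, Measure.restrict_apply_univ, Real.volume_Ioc, sub_zero,
          ENNReal.ofReal_one, mul_one, ENNReal.ofReal_mul (by norm_num : (0 : ℝ) ≤ 4), hF,
          show ENNReal.ofReal 4 = 4 by norm_num]
        ring

/-- The image of the closure of a convex open set under a contracting homothety about a point of
the set is contained in the set. -/
theorem homothety_closure_subset {D : Set Plane} (hD : IsOpen D) (hDc : Convex ℝ D) {z : Plane}
    (hz : z ∈ D) {s : ℝ} (hs0 : 0 ≤ s) (hs1 : s < 1) {x : Plane} (hx : x ∈ closure D) :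
    z + s • (x - z) ∈ D := by
  have h := hDc.combo_interior_closure_mem_interior (x := z) (y := x) (a := 1 - s) (b := s)
    (by rwa [hD.interior_eq]) hx (by linarith) hs0 (by ring)
  rw [hD.interior_eq] at h
  convert h using 1
  rw [smul_sub, sub_smul, one_smul]; abel

/-- The Poincaré inequality on a convex open subset of the domain. -/
theorem poincare (hΩ : IsOpen Ω) (u : H1 Ω) {D : Set Plane} (hD : IsOpen D) (hDc : Convex ℝ D)
    (hDΩ : D ⊆ Ω) (hDb : Bornology.IsBounded D) {d : ℝ}
    (hd : ∀ x ∈ D, ∀ y ∈ D, dist x y ≤ d) :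
    ∫⁻ x in D, ∫⁻ y in D, ‖value u x - value u y‖ₑ ^ 2 ≤
      ENNReal.ofReal (4 * d ^ 2) * volume D * ∫⁻ x in D, ‖grad u x‖ₑ ^ 2 := by
  rcases D.eq_empty_or_nonempty with rfl | ⟨z, hz⟩
  · simp
  set R := ENNReal.ofReal (4 * d ^ 2) * volume D * ∫⁻ x in D, ‖grad u x‖ₑ ^ 2 with hR
  have hum : Measurable (fun p : Plane × Plane => ‖value u p.1 - value u p.2‖ₑ ^ 2) := by
    have h1 : StronglyMeasurable (fun p : Plane × Plane => value u p.1) :=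
      (stronglyMeasurable_value u).comp_measurable measurable_fst
    have h2 : StronglyMeasurable (fun p : Plane × Plane => value u p.2) :=
      (stronglyMeasurable_value u).comp_measurable measurable_snd
    exact (h1.sub h2).enorm.pow_const 2
  -- On compact convex subsets the smooth inequality passes to the limit by Fatou's lemma, since the
  -- energies of the mollified functions stay below the energy on `D`.
  have hcomp : ∀ C : Set Plane, IsCompact C → Convex ℝ C → C ⊆ D →
      ∫⁻ x in C, ∫⁻ y in C, ‖value u x - value u y‖ₑ ^ 2 ≤ R := by
    intro C hC hCc hCD
    obtain ⟨f, hf, -, hfg, hfa, -⟩ :=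
      exists_smooth_approx hΩ u (ae_eq_refl _ : Represents u (value u)) hC hD hCD hDΩ
    have hfa' : ∀ᵐ x ∂(volume.restrict C), Tendsto (fun n => f n x) atTop (𝓝 (value u x)) :=
      (ae_restrict_iff' hC.measurableSet).2 hfa
    have hfm : ∀ n, Measurable (fun p : Plane × Plane => ‖f n p.1 - f n p.2‖ₑ ^ 2) := fun n => by
      have := (hf n).continuous
      have h : Continuous (fun p : Plane × Plane => ‖f n p.1 - f n p.2‖ₑ ^ 2) := by fun_prop
      exact h.measurable
    have hle : ∀ n, ∫⁻ x in C, ∫⁻ y in C, ‖f n x - f n y‖ₑ ^ 2 ≤ R := fun n =>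
      (poincare_smooth (hf n) hCc hC.measurableSet
        (fun x hx y hy => hd x (hCD hx) y (hCD hy))).trans
        (by
          rw [hR]
          exact mul_le_mul' (mul_le_mul' le_rfl (measure_mono hCD)) (hfg n))
    calc ∫⁻ x in C, ∫⁻ y in C, ‖value u x - value u y‖ₑ ^ 2
        ≤ ∫⁻ x in C, ∫⁻ y in C, liminf (fun n => ‖f n x - f n y‖ₑ ^ 2) atTop := by
          refine lintegral_mono_ae ?_
          filter_upwards [hfa'] with x hx
          refine lintegral_mono_ae ?_
          filter_upwards [hfa'] with y hy
          refine le_of_eq (Tendsto.liminf_eq ?_).symm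
          exact (ENNReal.continuous_pow 2).continuousAt.tendsto.comp ((hx.sub hy).enorm)
      _ ≤ ∫⁻ x in C, liminf (fun n => ∫⁻ y in C, ‖f n x - f n y‖ₑ ^ 2) atTop :=
          lintegral_mono fun x => lintegral_liminf_le fun n =>
            (hfm n).comp measurable_prodMk_left
      _ ≤ liminf (fun n => ∫⁻ x in C, ∫⁻ y in C, ‖f n x - f n y‖ₑ ^ 2) atTop :=
          lintegral_liminf_le fun n => (hfm n).lintegral_prod_right'
      _ ≤ R := (liminf_le_liminf (Eventually.of_forall hle)).trans (by simp)
  -- Homothetic copies of `closure D` about `z` are compact, convex and contained in `D`, and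
  -- exhaust `D` as the ratio tends to one. The shift by 2 keeps the ratio positive already for `n =
  -- 0`.
  let s : ℕ → ℝ := fun n => 1 - 1 / ((n : ℝ) + 2)
  have hs0 : ∀ n, 0 < s n := fun n => by
    have : 1 / ((n : ℝ) + 2) < 1 := by rw [div_lt_one (by positivity)]; linarith [n.cast_nonneg (α := ℝ)]
    simp only [s]; linarith
  have hs1 : ∀ n, s n < 1 := fun n => by
    have : 0 < 1 / ((n : ℝ) + 2) := by positivity
    simp only [s]; linarith
  have hst : Tendsto s atTop (𝓝 1) := by
    have := (tendsto_const_div_atTop_nhds_zero_nat (1 : ℝ)).comp (tendsto_add_atTop_nat 2)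
    have h2 := this.const_sub (1 : ℝ)
    rw [sub_zero] at h2
    refine h2.congr fun n => ?_
    simp [s]
  let C : ℕ → Set Plane := fun n => (fun x => z + s n • (x - z)) '' closure D
  have hCcont : ∀ n, Continuous (fun x : Plane => z + s n • (x - z)) := fun n => by fun_prop
  have hCk : ∀ n, IsCompact (C n) := fun n => hDb.isCompact_closure.image (hCcont n)
  have hCD : ∀ n, C n ⊆ D := by
    rintro n _ ⟨x, hx, rfl⟩
    exact homothety_closure_subset hD hDc hz (hs0 n).le (hs1 n) hx
  have hCconv : ∀ n, Convex ℝ (C n) := fun n => by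
    have h := hDc.closure.affine_image (AffineMap.homothety z (s n))
    have e : C n = (AffineMap.homothety z (s n)) '' closure D := by
      refine Set.image_congr fun x _ => ?_
      simp [AffineMap.homothety_apply, add_comm]
    rw [e]; exact h
  have hin : ∀ x ∈ D, ∀ᶠ n in atTop, x ∈ C n := by
    intro x hx
    have ht : Tendsto (fun n => z + (s n)⁻¹ • (x - z)) atTop (𝓝 x) := by
      have h := ((hst.inv₀ one_ne_zero).smul_const (x - z)).const_add z
      rw [inv_one, one_smul, add_sub_cancel] at h
      exact h
    filter_upwards [ht.eventually (hD.mem_nhds hx)] with n hn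
    refine ⟨_, subset_closure hn, ?_⟩
    simp only [add_sub_cancel_left, smul_smul, mul_inv_cancel₀ (hs0 n).ne', one_smul,
      add_sub_cancel]
  have hm2 : ∀ n, Measurable (fun p : Plane × Plane =>
      (C n ×ˢ C n).indicator (fun p => ‖value u p.1 - value u p.2‖ₑ ^ 2) p) := fun n =>
    hum.indicator ((hCk n).measurableSet.prod (hCk n).measurableSet)
  have hitint : ∀ A : Set Plane, MeasurableSet A →
      ∫⁻ x in A, ∫⁻ y in A, ‖value u x - value u y‖ₑ ^ 2 =
      ∫⁻ p, (A ×ˢ A).indicator (fun p => ‖value u p.1 - value u p.2‖ₑ ^ 2) p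
        ∂((volume : Measure Plane).prod volume) := by
    intro A hA
    rw [lintegral_indicator (hA.prod hA), ← Measure.prod_restrict, lintegral_prod _ hum.aemeasurable]
  rw [hitint D hD.measurableSet]
  calc ∫⁻ p, (D ×ˢ D).indicator (fun p => ‖value u p.1 - value u p.2‖ₑ ^ 2) p
        ∂((volume : Measure Plane).prod volume)
      ≤ ∫⁻ p, liminf (fun n => (C n ×ˢ C n).indicator
          (fun p => ‖value u p.1 - value u p.2‖ₑ ^ 2) p) atTop
          ∂((volume : Measure Plane).prod volume) := by
        refine lintegral_mono fun p => ?_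
        by_cases hp : p ∈ D ×ˢ D
        · refine le_of_eq (Tendsto.liminf_eq (tendsto_const_nhds.congr' ?_)).symm
          filter_upwards [hin _ hp.1, hin _ hp.2] with n h1 h2
          rw [Set.indicator_of_mem hp, Set.indicator_of_mem (Set.mk_mem_prod h1 h2)]
        · rw [Set.indicator_of_notMem hp]; exact zero_le
    _ ≤ liminf (fun n => ∫⁻ p, (C n ×ˢ C n).indicator
          (fun p => ‖value u p.1 - value u p.2‖ₑ ^ 2) p
          ∂((volume : Measure Plane).prod volume)) atTop := lintegral_liminf_le hm2
    _ ≤ R := by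
        refine (liminf_le_liminf (Eventually.of_forall fun n => ?_)).trans
          (by simp : liminf (fun _ : ℕ => R) atTop ≤ R)
        rw [← hitint _ (hCk n).measurableSet]
        exact hcomp _ (hCk n) (hCconv n) (hCD n)

end Poincare

/-! ### Arc length on segments -/

section Segment

theorem lineMap_eq (p q : Plane) (s : ℝ) : AffineMap.lineMap p q s = p + s • (q - p) := by
  rw [AffineMap.lineMap_apply, vsub_eq_sub, vadd_eq_add, add_comm]

theorem measurableEmbedding_lineMap {p q : Plane} (h : p ≠ q) :
    MeasurableEmbedding (AffineMap.lineMap p q : ℝ → Plane) := by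
  have hne : (q - p) ≠ 0 := sub_ne_zero.2 h.symm
  have h1 : IsClosedEmbedding (fun s : ℝ => s • (q - p)) := isClosedEmbedding_smul_left hne
  have h2 := (Homeomorph.addLeft p).isClosedEmbedding.comp h1
  have h3 : (AffineMap.lineMap p q : ℝ → Plane) =
      (Homeomorph.addLeft p) ∘ (fun s : ℝ => s • (q - p)) := by
    ext1 s
    simp [lineMap_eq]
  rw [h3]
  exact h2.measurableEmbedding

/-- The parametrization by arc length is an isometry, so it transports one-dimensional Hausdorff
measure, which on the line is Lebesgue measure. Rescaling to the unit interval produces the length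
of the segment as a factor. -/
theorem arcLength_segment {p q : Plane} (h : p ≠ q) :
    arcLength (segment ℝ p q) = ENNReal.ofReal (dist p q) •
      (volume.restrict (Set.Icc (0 : ℝ) 1)).map (AffineMap.lineMap p q) := by
  have hℓ : 0 < dist p q := dist_pos.2 h
  set ℓ := dist p q with hℓd
  have hnorm : ‖q - p‖ = ℓ := by rw [hℓd, dist_comm, dist_eq_norm]
  let γ : ℝ → Plane := fun s => p + s • (ℓ⁻¹ • (q - p))
  have hγ : Isometry γ := by
    refine Isometry.of_dist_eq fun s t => ?_
    simp only [γ, dist_add_left]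
    rw [dist_eq_norm, ← sub_smul, norm_smul, norm_smul, hnorm, norm_inv, Real.norm_of_nonneg hℓ.le,
      inv_mul_cancel₀ hℓ.ne', mul_one, Real.dist_eq, Real.norm_eq_abs]
  have hγe : MeasurableEmbedding γ := hγ.isClosedEmbedding.measurableEmbedding
  have hcomp : (AffineMap.lineMap p q : ℝ → Plane) = γ ∘ (fun x => ℓ * x) := by
    ext1 s
    simp only [lineMap_eq, γ, Function.comp, smul_smul]
    congr 2
    field_simp
  have hrange : Set.range (AffineMap.lineMap p q : ℝ → Plane) = Set.range γ := by
    rw [hcomp, Set.range_comp, (mul_left_surjective₀ hℓ.ne').range_eq, Set.image_univ]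
  have hseg : segment ℝ p q = AffineMap.lineMap p q '' Set.Icc (0 : ℝ) 1 :=
    segment_eq_image_lineMap ℝ p q
  have hsub : segment ℝ p q ⊆ Set.range γ := by
    rw [← hrange, hseg]; exact Set.image_subset_range _ _
  have hmap : (Measure.hausdorffMeasure 1 : Measure Plane).restrict (Set.range γ) =
      ENNReal.ofReal ℓ • (volume : Measure ℝ).map (AffineMap.lineMap p q) := by
    rw [← hγ.map_hausdorffMeasure (d := 1) (Or.inl zero_le_one), hausdorffMeasure_real, hcomp,
      ← Measure.map_map hγe.measurable (measurable_const_mul ℓ), ← Measure.map_smul]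
    congr 1
    have := Real.smul_map_volume_mul_left hℓ.ne'
    rw [abs_of_pos hℓ] at this
    exact this.symm
  have hinj := (measurableEmbedding_lineMap h).injective
  rw [arcLength, ← Measure.restrict_restrict_of_subset hsub, hmap,
    Measure.restrict_smul, (measurableEmbedding_lineMap h).restrict_map, hseg,
    Set.preimage_image_eq _ hinj]

theorem lintegral_arcLength_segment {p q : Plane} (h : p ≠ q) (f : Plane → ℝ≥0∞) :
    ∫⁻ x, f x ∂(arcLength (segment ℝ p q)) =
      ENNReal.ofReal (dist p q) * ∫⁻ s in Set.Icc (0 : ℝ) 1, f (AffineMap.lineMap p q s) := by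
  rw [arcLength_segment h, lintegral_smul_measure, (measurableEmbedding_lineMap h).lintegral_map,
    smul_eq_mul]

theorem integral_arcLength_segment {p q : Plane} (h : p ≠ q) (f : Plane → ℂ) :
    ∫ x, f x ∂(arcLength (segment ℝ p q)) =
      (dist p q : ℂ) * ∫ s in Set.Icc (0 : ℝ) 1, f (AffineMap.lineMap p q s) := by
  rw [arcLength_segment h, integral_smul_measure, (measurableEmbedding_lineMap h).integral_map,
    ENNReal.toReal_ofReal dist_nonneg, Complex.real_smul]

instance isFiniteMeasure_arcLength_segment (p q : Plane) :
    IsFiniteMeasure (arcLength (segment ℝ p q)) := by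
  constructor
  rw [arcLength, Measure.restrict_apply_univ]
  have h := hausdorffMeasure_affineSegment p q
  rw [affineSegment_eq_segment] at h
  rw [h]
  exact edist_lt_top p q

end Segment

/-! ### The trace inequality on a triangle -/

section TraceInequality

variable {Ω : Set Plane}

/-- Coordinates for integration along rays: `s` runs along the edge opposite to `b`, and `t` leads
from `b` to that edge. -/
theorem mem_convexHull_triple {b p q x : Plane} :
    x ∈ convexHull ℝ {b, p, q} ↔ ∃ t ∈ Set.Icc (0 : ℝ) 1, ∃ s ∈ Set.Icc (0 : ℝ) 1,
      x = b + t • (AffineMap.lineMap p q s - b) := by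
  rw [convexHull_insert (Set.insert_nonempty _ _), convexHull_pair]
  simp only [convexJoin_singleton_left, Set.mem_iUnion, segment_eq_image_lineMap, exists_prop]
  constructor
  · rintro ⟨y, ⟨s, hs, rfl⟩, t, ht, rfl⟩
    exact ⟨t, ht, s, hs, by rw [lineMap_eq b]⟩
  · rintro ⟨t, ht, s, hs, rfl⟩
    exact ⟨_, ⟨s, hs, rfl⟩, t, ht, by rw [lineMap_eq b]⟩

/-- Integration over a triangle along the rays from the vertex `b`. -/
theorem lintegral_rays_le {b p q : Plane} (hK : volume (convexHull ℝ {b, p, q}) ≠ 0)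
    {F : Plane → ℝ≥0∞} (hF : Measurable F) :
    ∫⁻ s in Set.Icc (0 : ℝ) 1, ∫⁻ t in Set.Icc (0 : ℝ) 1,
        ENNReal.ofReal t * F (b + t • (AffineMap.lineMap p q s - b)) ≤
      (volume (convexHull ℝ {b, p, q}))⁻¹ * ∫⁻ x in convexHull ℝ {b, p, q}, F x := by
  set K := convexHull ℝ {b, p, q} with hKdef
  have hKc : IsCompact K := (Set.toFinite {b, p, q}).isCompact_convexHull ℝ
  -- With `σ = t s` the ray coordinates become linear in `(t, σ)`; the factor `t` in the integrand
  -- is the Jacobian of `s ↦ t s`.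
  let L₀ : (ℝ × ℝ) →ₗ[ℝ] Plane :=
    (LinearMap.toSpanSingleton ℝ Plane (p - b)).coprod (LinearMap.toSpanSingleton ℝ Plane (q - p))
  have hL₀ : ∀ z, L₀ z = z.1 • (p - b) + z.2 • (q - p) := fun z => by
    simp [L₀]
  have hray : ∀ t s : ℝ, b + t • (AffineMap.lineMap p q s - b) = b + L₀ (t, t * s) := by
    intro t s
    rw [hL₀, lineMap_eq, mul_smul, ← smul_add]
    congr 2
    abel
  -- Dependent edge vectors would confine the triangle to a translate of a proper subspace, a null
  -- set.
  have hsurj : Function.Surjective L₀ := by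
    by_contra hns
    have hr : LinearMap.range L₀ ≠ ⊤ := fun h => hns (LinearMap.range_eq_top.1 h)
    have hnull := Measure.addHaar_submodule (volume : Measure Plane) _ hr
    have hnull' : volume ((fun x => b + x) '' (LinearMap.range L₀ : Set Plane)) = 0 := by
      rw [Set.image_add_left, measure_preimage_add, hnull]
    refine hK (measure_mono_null ?_ hnull')
    intro x hx
    obtain ⟨t, -, s, -, rfl⟩ := mem_convexHull_triple.1 hx
    exact ⟨L₀ (t, t * s), ⟨_, rfl⟩, (hray t s).symm⟩
  have hinj : Function.Injective L₀ :=
    (LinearMap.injective_iff_surjective_of_finrank_eq_finrank (by simp)).2 hsurj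
  let L : (ℝ × ℝ) ≃L[ℝ] Plane := (LinearEquiv.ofBijective L₀ ⟨hinj, hsurj⟩).toContinuousLinearEquiv
  have hLL : ∀ z, L z = L₀ z := fun z => rfl
  have : (Measure.map L (volume : Measure (ℝ × ℝ))).IsAddHaarMeasure :=
    L.isAddHaarMeasure_map volume
  obtain ⟨c, hc⟩ : ∃ c : ℝ≥0, Measure.map L (volume : Measure (ℝ × ℝ)) = c • volume :=
    ⟨_, Measure.isAddLeftInvariant_eq_smul _ _⟩
  have hchange : ∀ g : Plane → ℝ≥0∞, Measurable g →
      ∫⁻ z, g (b + L z) = c * ∫⁻ x, g x := by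
    intro g hg
    have h1 : Measurable (fun x => g (b + x)) := hg.comp (measurable_const_add b)
    have h2 := lintegral_map (μ := (volume : Measure (ℝ × ℝ))) h1 L.continuous.measurable
    rw [← h2, hc, lintegral_smul_measure, lintegral_add_left_eq_self]
    rfl
  -- In the coordinates `(t, σ)` the triangle lies in the unit square, so the scaling constant is at
  -- most the inverse of its area. The sharp value has an extra factor `1/2`, which is not needed.
  have hcK : (c : ℝ≥0∞) * volume K ≤ 1 := by
    have h := hchange (K.indicator 1) (measurable_one.indicator hKc.measurableSet)
    rw [lintegral_indicator_one hKc.measurableSet] at h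
    rw [← h]
    calc ∫⁻ z, K.indicator 1 (b + L z)
        ≤ ∫⁻ z, (Set.Icc (0 : ℝ) 1 ×ˢ Set.Icc (0 : ℝ) 1).indicator 1 z := by
          refine lintegral_mono fun z => ?_
          by_cases hz : b + L z ∈ K
          · obtain ⟨t, ht, s, hs, he⟩ := mem_convexHull_triple.1 hz
            rw [hray, hLL] at he
            have : z = (t, t * s) := hinj (add_left_cancel he)
            have hz' : z ∈ Set.Icc (0 : ℝ) 1 ×ˢ Set.Icc (0 : ℝ) 1 := by
              rw [this]
              exact ⟨ht, mul_nonneg ht.1 hs.1, mul_le_one₀ ht.2 hs.1 hs.2⟩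
            rw [Set.indicator_of_mem hz, Set.indicator_of_mem hz']
            exact le_rfl
          · rw [Set.indicator_of_notMem hz]; exact zero_le
      _ = 1 := by
          rw [lintegral_indicator_one (measurableSet_Icc.prod measurableSet_Icc),
            Measure.volume_eq_prod, Measure.prod_prod]
          simp
  have hcle : (c : ℝ≥0∞) ≤ (volume K)⁻¹ := by
    rw [ENNReal.le_inv_iff_mul_le]; exact hcK
  have hFK : Measurable (K.indicator F) := hF.indicator hKc.measurableSet
  have hscale : ∀ t : ℝ, 0 < t → ∀ g : ℝ → ℝ≥0∞, Measurable g →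
      ENNReal.ofReal t * ∫⁻ s, g (t * s) = ∫⁻ σ, g σ := by
    intro t ht g hg
    have h1 := Real.smul_map_volume_mul_left ht.ne'
    rw [abs_of_pos ht] at h1
    conv_rhs => rw [← h1, lintegral_smul_measure, lintegral_map hg (measurable_const_mul t)]
    rfl
  have hcont : Continuous (fun z : ℝ × ℝ => b + z.1 • (AffineMap.lineMap p q z.2 - b)) := by
    simp only [lineMap_eq]; fun_prop
  calc ∫⁻ s in Set.Icc (0 : ℝ) 1, ∫⁻ t in Set.Icc (0 : ℝ) 1,
        ENNReal.ofReal t * F (b + t • (AffineMap.lineMap p q s - b))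
      = ∫⁻ t in Set.Icc (0 : ℝ) 1, ∫⁻ s in Set.Icc (0 : ℝ) 1,
        ENNReal.ofReal t * F (b + t • (AffineMap.lineMap p q s - b)) := by
        refine lintegral_lintegral_swap (Measurable.aemeasurable ?_)
        have h1 : Measurable (fun z : ℝ × ℝ => ENNReal.ofReal z.2) :=
          measurable_snd.ennreal_ofReal
        have h2 : Measurable (fun z : ℝ × ℝ => F (b + z.2 • (AffineMap.lineMap p q z.1 - b))) :=
          hF.comp (hcont.comp continuous_swap).measurable
        exact h1.mul h2
    _ ≤ ∫⁻ t in Set.Icc (0 : ℝ) 1, ∫⁻ σ, K.indicator F (b + L (t, σ)) := by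
        refine setLIntegral_mono' measurableSet_Icc fun t ht => ?_
        rcases ht.1.eq_or_lt with h0 | h0
        · subst h0; simp
        · have hm : Measurable (fun σ => K.indicator F (b + L (t, σ))) := by
            have : Continuous (fun σ : ℝ => b + L (t, σ)) := by fun_prop
            exact hFK.comp this.measurable
          have hm' : Measurable (fun s => K.indicator F (b + L (t, t * s))) :=
            hm.comp (measurable_const_mul t)
          rw [← hscale t h0 _ hm, ← lintegral_const_mul _ hm', ← lintegral_indicator measurableSet_Icc]
          refine lintegral_mono fun s => ?_
          by_cases hs : s ∈ Set.Icc (0 : ℝ) 1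
          · rw [Set.indicator_of_mem hs]
            have : b + L (t, t * s) ∈ K :=
              mem_convexHull_triple.2 ⟨t, ht, s, hs, by rw [hray, hLL]⟩
            rw [Set.indicator_of_mem this, hLL, hray]
          · rw [Set.indicator_of_notMem hs]; exact zero_le
    _ ≤ ∫⁻ t, ∫⁻ σ, K.indicator F (b + L (t, σ)) := setLIntegral_le_lintegral _ _
    _ = ∫⁻ z, K.indicator F (b + L z) := by
        rw [Measure.volume_eq_prod, lintegral_prod]
        have : Continuous (fun z : ℝ × ℝ => b + L z) := by fun_prop
        exact (hFK.comp this.measurable).aemeasurable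
    _ = c * ∫⁻ x in K, F x := by rw [hchange _ hFK, lintegral_indicator hKc.measurableSet]
    _ ≤ _ := by gcongr

/-- The function `t² f(b + t(y - b))` vanishes at `t = 0` and equals `f y` at `t = 1`. Its
derivative keeps a factor `t`, precisely the Jacobian of the ray coordinates. The constants come
from `(2α + dβ)² ≤ 8α² + 2d²β²`. -/
theorem sq_enorm_le_ray {f : Plane → ℂ} (hf : ContDiff ℝ 1 f) {b y : Plane} {d : ℝ}
    (hd : dist y b ≤ d) :
    ‖f y‖ₑ ^ 2 ≤ ∫⁻ t in Set.Icc (0 : ℝ) 1, ENNReal.ofReal t *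
      (8 * ‖f (b + t • (y - b))‖ₑ ^ 2 +
        ENNReal.ofReal (2 * d ^ 2) * ‖gradC f (b + t • (y - b))‖ₑ ^ 2) := by
  have hd0 : 0 ≤ d := dist_nonneg.trans hd
  have hline : ∀ t : ℝ, HasDerivAt (fun t : ℝ => b + t • (y - b)) (y - b) t := fun t => by
    simpa using ((hasDerivAt_id t).smul_const (y - b)).const_add b
  have hder : ∀ t : ℝ, HasDerivAt (fun t : ℝ => (t ^ 2) • f (b + t • (y - b)))
      (t ^ 2 • fderiv ℝ f (b + t • (y - b)) (y - b) + (2 * t) • f (b + t • (y - b))) t := fun t => by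
    have h1 := ((hf.differentiable (by simp) _).hasFDerivAt).comp_hasDerivAt t (hline t)
    have h2 : HasDerivAt (fun t : ℝ => t ^ 2) (2 * t) t := by simpa using hasDerivAt_pow 2 t
    exact h2.smul h1
  have hlc : Continuous (fun t : ℝ => b + t • (y - b)) := by fun_prop
  have hfc : Continuous (fun t : ℝ => f (b + t • (y - b))) := hf.continuous.comp hlc
  have hG : Continuous (fun t : ℝ => gradC f (b + t • (y - b))) := (continuous_gradC hf).comp hlc
  have hcont : Continuous (fun t : ℝ => t ^ 2 • fderiv ℝ f (b + t • (y - b)) (y - b) +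
      (2 * t) • f (b + t • (y - b))) := by
    have : Continuous (fun t : ℝ => fderiv ℝ f (b + t • (y - b)) (y - b)) :=
      ((hf.continuous_fderiv (by simp)).comp hlc).clm_apply continuous_const
    fun_prop
  have hFTC := intervalIntegral.integral_eq_sub_of_hasDerivAt (a := 0) (b := 1)
    (fun t _ => hder t) (hcont.intervalIntegrable 0 1)
  have he : f y = ∫ t in Set.Icc (0 : ℝ) 1, (t ^ 2 • fderiv ℝ f (b + t • (y - b)) (y - b) +
      (2 * t) • f (b + t • (y - b))) := by
    rw [integral_Icc_eq_integral_Ioc, ← intervalIntegral.integral_of_le zero_le_one, hFTC]; simp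
  set g : ℝ → ℝ≥0∞ := fun t => 2 * ‖f (b + t • (y - b))‖ₑ +
    ENNReal.ofReal d * ‖gradC f (b + t • (y - b))‖ₑ with hg
  have hgm : Measurable g := by
    have h1 : Measurable (fun t : ℝ => 2 * ‖f (b + t • (y - b))‖ₑ) :=
      hfc.enorm.measurable.const_mul 2
    have h2 : Measurable (fun t : ℝ => ENNReal.ofReal d * ‖gradC f (b + t • (y - b))‖ₑ) :=
      hG.enorm.measurable.const_mul _
    exact h1.add h2
  have hrm : Measurable (fun t : ℝ => ENNReal.ofReal (√t)) :=
    (measurable_id.sqrt).ennreal_ofReal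
  have hsq : ∀ t : ℝ, 0 ≤ t → ENNReal.ofReal (√t) ^ 2 = ENNReal.ofReal t := fun t ht => by
    rw [← ENNReal.ofReal_pow (Real.sqrt_nonneg _), Real.sq_sqrt ht]
  have hpt : ∀ t ∈ Set.Icc (0 : ℝ) 1, ‖t ^ 2 • fderiv ℝ f (b + t • (y - b)) (y - b) +
      (2 * t) • f (b + t • (y - b))‖ₑ ≤ ENNReal.ofReal (√t) * (ENNReal.ofReal (√t) * g t) := by
    intro t ht
    rw [← mul_assoc, ← sq, hsq t ht.1]
    have h1 : ‖t ^ 2 • fderiv ℝ f (b + t • (y - b)) (y - b) + (2 * t) • f (b + t • (y - b))‖ ≤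
        t * (2 * ‖f (b + t • (y - b))‖ + d * ‖gradC f (b + t • (y - b))‖) := by
      refine (norm_add_le _ _).trans ?_
      rw [norm_smul, norm_smul, Real.norm_of_nonneg (by positivity),
        Real.norm_of_nonneg (by linarith [ht.1])]
      have h2 := norm_fderiv_apply_le f (b + t • (y - b)) (y - b)
      have h3 : ‖fderiv ℝ f (b + t • (y - b)) (y - b)‖ ≤ d * ‖gradC f (b + t • (y - b))‖ := by
        refine h2.trans ?_
        rw [mul_comm]
        gcongr
        rwa [← dist_eq_norm]
      have h4 : t ^ 2 * ‖fderiv ℝ f (b + t • (y - b)) (y - b)‖ ≤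
          t * (d * ‖gradC f (b + t • (y - b))‖) := by
        have : t ^ 2 ≤ t := by nlinarith [ht.1, ht.2]
        exact mul_le_mul this h3 (norm_nonneg _) ht.1
      linarith
    rw [← ofReal_norm]
    refine (ENNReal.ofReal_le_ofReal h1).trans (le_of_eq ?_)
    rw [ENNReal.ofReal_mul ht.1, ENNReal.ofReal_add (by positivity) (by positivity),
      ENNReal.ofReal_mul (by norm_num), ENNReal.ofReal_mul hd0, ofReal_norm, ofReal_norm]
    simp [hg]
  conv_lhs => rw [he]
  calc ‖∫ t in Set.Icc (0 : ℝ) 1, (t ^ 2 • fderiv ℝ f (b + t • (y - b)) (y - b) +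
      (2 * t) • f (b + t • (y - b)))‖ₑ ^ 2
      ≤ (∫⁻ t in Set.Icc (0 : ℝ) 1, ENNReal.ofReal (√t) * (ENNReal.ofReal (√t) * g t)) ^ 2 := by
        gcongr 1
        exact (enorm_integral_le_lintegral_enorm _).trans
          (setLIntegral_mono' measurableSet_Icc hpt)
    _ ≤ (∫⁻ t in Set.Icc (0 : ℝ) 1, ENNReal.ofReal (√t) ^ 2) *
          ∫⁻ t in Set.Icc (0 : ℝ) 1, (ENNReal.ofReal (√t) * g t) ^ 2 :=
        sq_lintegral_mul_le _ hrm.aemeasurable (hrm.mul hgm).aemeasurable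
    _ ≤ 1 * ∫⁻ t in Set.Icc (0 : ℝ) 1, ENNReal.ofReal t *
      (8 * ‖f (b + t • (y - b))‖ₑ ^ 2 +
        ENNReal.ofReal (2 * d ^ 2) * ‖gradC f (b + t • (y - b))‖ₑ ^ 2) := by
        refine mul_le_mul' ?_ ?_
        · calc ∫⁻ t in Set.Icc (0 : ℝ) 1, ENNReal.ofReal (√t) ^ 2
              ≤ ∫⁻ t in Set.Icc (0 : ℝ) 1, 1 := by
                refine setLIntegral_mono' measurableSet_Icc fun t ht => ?_
                rw [hsq t ht.1]
                exact ENNReal.ofReal_le_one.2 ht.2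
            _ = 1 := by simp
        · refine setLIntegral_mono' measurableSet_Icc fun t ht => ?_
          rw [mul_pow, hsq t ht.1]
          refine mul_le_mul_right ?_ _
          have h5 : ∀ α β : ℝ≥0, (2 * α + d.toNNReal * β) ^ 2 ≤
              8 * α ^ 2 + (2 * d ^ 2).toNNReal * β ^ 2 := by
            intro α β
            rw [← NNReal.coe_le_coe]
            push_cast
            rw [Real.coe_toNNReal _ hd0, Real.coe_toNNReal _ (by positivity)]
            nlinarith [sq_nonneg (2 * (α : ℝ) - d * β)]
          have := h5 ‖f (b + t • (y - b))‖₊ ‖gradC f (b + t • (y - b))‖₊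
          simp only [hg, ← ENNReal.ofNNReal_toNNReal, enorm_eq_nnnorm]
          exact_mod_cast this
    _ = _ := one_mul _

/-- The trace inequality for a smooth function on a triangle. -/
theorem trace_smooth {f : Plane → ℂ} (hf : ContDiff ℝ 1 f) {b p q : Plane}
    (hK : volume (convexHull ℝ {b, p, q}) ≠ 0) {d : ℝ}
    (hd : ∀ x ∈ convexHull ℝ {b, p, q}, dist x b ≤ d) :
    ∫⁻ s in Set.Icc (0 : ℝ) 1, ‖f (AffineMap.lineMap p q s)‖ₑ ^ 2 ≤
      (volume (convexHull ℝ {b, p, q}))⁻¹ *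
        (8 * (∫⁻ x in convexHull ℝ {b, p, q}, ‖f x‖ₑ ^ 2) +
          ENNReal.ofReal (2 * d ^ 2) * ∫⁻ x in convexHull ℝ {b, p, q}, ‖gradC f x‖ₑ ^ 2) := by
  have hfm : Measurable (fun x => ‖f x‖ₑ ^ 2) := hf.continuous.enorm.measurable.pow_const 2
  have hgm : Measurable (fun x => ‖gradC f x‖ₑ ^ 2) :=
    (continuous_gradC hf).enorm.measurable.pow_const 2
  have hm : Measurable (fun x => 8 * ‖f x‖ₑ ^ 2 + ENNReal.ofReal (2 * d ^ 2) * ‖gradC f x‖ₑ ^ 2) :=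
    (hfm.const_mul 8).add (hgm.const_mul _)
  refine (setLIntegral_mono' measurableSet_Icc fun s hs => ?_).trans
    ((lintegral_rays_le hK hm).trans (le_of_eq ?_))
  · refine sq_enorm_le_ray hf (hd _ ?_)
    refine mem_convexHull_triple.2 ⟨1, by simp, s, hs, by simp⟩
  · rw [lintegral_add_left (hfm.const_mul 8), lintegral_const_mul _ hfm, lintegral_const_mul _ hgm]

end TraceInequality

section TraceInequality

variable {Ω : Set Plane}

/-- The trace inequality on a triangle for a continuous Sobolev function. -/
theorem trace_continuous (hΩ : IsOpen Ω) {u : H1 Ω} {v : Plane → ℂ} (hv : Represents u v)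
    {b p q : Plane} (hK : (interior (convexHull ℝ {b, p, q})).Nonempty)
    (hKΩ : interior (convexHull ℝ {b, p, q}) ⊆ Ω)
    (hvc : ContinuousOn v (convexHull ℝ {b, p, q})) {d : ℝ}
    (hd : ∀ x ∈ convexHull ℝ {b, p, q}, dist x b ≤ d) :
    ∫⁻ s in Set.Icc (0 : ℝ) 1, ‖v (AffineMap.lineMap p q s)‖ₑ ^ 2 ≤
      (volume (convexHull ℝ {b, p, q}))⁻¹ *
        (8 * (∫⁻ x in interior (convexHull ℝ {b, p, q}), ‖value u x‖ₑ ^ 2) +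
          ENNReal.ofReal (2 * d ^ 2) *
            ∫⁻ x in interior (convexHull ℝ {b, p, q}), ‖grad u x‖ₑ ^ 2) := by
  obtain ⟨K, hKdef⟩ : ∃ K, K = convexHull ℝ {b, p, q} := ⟨_, rfl⟩
  rw [← hKdef] at hK hKΩ hvc hd ⊢
  obtain ⟨R, hR⟩ : ∃ R, R = (8 * (∫⁻ x in interior K, ‖value u x‖ₑ ^ 2) +
    ENNReal.ofReal (2 * d ^ 2) * ∫⁻ x in interior K, ‖grad u x‖ₑ ^ 2) := ⟨_, rfl⟩
  rw [← hR]
  have hKc : IsCompact K := hKdef ▸ (Set.toFinite {b, p, q}).isCompact_convexHull ℝ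
  have hKconv : Convex ℝ K := hKdef ▸ convex_convexHull ℝ _
  have hb : b ∈ K := hKdef ▸ subset_convexHull ℝ _ (by simp)
  have hedge : ∀ s ∈ Set.Icc (0 : ℝ) 1, AffineMap.lineMap p q s ∈ K := fun s hs => by
    rw [hKdef]; exact mem_convexHull_triple.2 ⟨1, by simp, s, hs, by simp⟩
  have hd0 : 0 ≤ d := dist_nonneg.trans (hd b hb)
  obtain ⟨z, hz⟩ := hK
  have hcl : K ⊆ closure (interior K) := by
    rw [hKconv.closure_interior_eq_closure_of_nonempty_interior ⟨z, hz⟩]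
    exact subset_closure
  have hshrink : ∀ {r : ℝ}, 0 < r → r < 1 → ∀ x ∈ K, z + r • (x - z) ∈ interior K :=
    fun h0 h1 x hx => homothety_closure_subset isOpen_interior hKconv.interior hz h0.le h1 (hcl hx)
  have hvol : volume K ≠ 0 := by
    have := (isOpen_interior.measure_pos (μ := (volume : Measure Plane)) ⟨z, hz⟩).trans_le
      (measure_mono interior_subset)
    exact this.ne'
  -- Shrinking the triangle about an interior point moves it into the open triangle, where
  -- mollification is available. The area shrinks by `r²`, whence the factor `r⁻²`.
  have hstep : ∀ r : ℝ, 0 < r → r < 1 →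
      ∫⁻ s in Set.Icc (0 : ℝ) 1, ‖v (z + r • (AffineMap.lineMap p q s - z))‖ₑ ^ 2 ≤
        ENNReal.ofReal (r ^ 2)⁻¹ * ((volume K)⁻¹ * R) := by
    intro r hr0 hr1
    have hhom : ∀ x, AffineMap.homothety z r x = z + r • (x - z) := fun x => by
      simp [AffineMap.homothety_apply, add_comm]
    have hC : convexHull ℝ {z + r • (b - z), z + r • (p - z), z + r • (q - z)} =
        AffineMap.homothety z r '' K := by
      rw [hKdef, AffineMap.image_convexHull]
      congr 1
      simp only [Set.image_insert_eq, Set.image_singleton, hhom]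
    obtain ⟨C, hCdef⟩ : ∃ C, C = AffineMap.homothety z r '' K := ⟨_, rfl⟩
    rw [← hCdef] at hC
    have hCin : C ⊆ interior K := by
      rw [hCdef]
      rintro _ ⟨x, hx, rfl⟩
      rw [hhom]
      exact hshrink hr0 hr1 x hx
    have hCc : IsCompact C := hC ▸ (Set.toFinite _).isCompact_convexHull ℝ
    have hvolC : volume C = ENNReal.ofReal (r ^ 2) * volume K := by
      rw [hCdef, Measure.addHaar_image_homothety, abs_of_pos (by positivity)]
      simp
    have hvolC0 : volume C ≠ 0 := by
      rw [hvolC]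
      refine mul_ne_zero ?_ hvol
      simpa using hr0.ne'
    have hCd : ∀ x ∈ C, dist x (z + r • (b - z)) ≤ d := by
      rw [hCdef]
      rintro _ ⟨x, hx, rfl⟩
      rw [hhom, dist_add_left, dist_smul₀, dist_sub_right, Real.norm_of_nonneg hr0.le]
      calc r * dist x b ≤ 1 * d := mul_le_mul hr1.le (hd x hx) dist_nonneg zero_le_one
        _ = d := one_mul d
    have hline : ∀ s : ℝ, AffineMap.lineMap (z + r • (p - z)) (z + r • (q - z)) s =
        z + r • (AffineMap.lineMap p q s - z) := fun s => by
      simp only [lineMap_eq]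
      module
    obtain ⟨f, hf, hfv, hfg, -, hfc⟩ :=
      exists_smooth_approx hΩ u hv hCc isOpen_interior hCin hKΩ
    have hle : ∀ n, ∫⁻ s in Set.Icc (0 : ℝ) 1, ‖f n (z + r • (AffineMap.lineMap p q s - z))‖ₑ ^ 2 ≤
        ENNReal.ofReal (r ^ 2)⁻¹ * ((volume K)⁻¹ * R) := by
      intro n
      have h := trace_smooth (hf n) (b := z + r • (b - z)) (p := z + r • (p - z))
        (q := z + r • (q - z)) (by rw [hC]; exact hvolC0) (d := d) (by rw [hC]; exact hCd)
      simp only [hline, hC] at h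
      refine h.trans ?_
      rw [hvolC, ENNReal.mul_inv (Or.inl (by simpa using hr0.ne')) (Or.inl ENNReal.ofReal_ne_top),
        ENNReal.ofReal_inv_of_pos (by positivity), mul_assoc, hR]
      refine mul_le_mul' le_rfl (mul_le_mul' le_rfl (add_le_add ?_ ?_))
      · exact mul_le_mul' le_rfl (hfv n)
      · exact mul_le_mul' le_rfl (hfg n)
    calc ∫⁻ s in Set.Icc (0 : ℝ) 1, ‖v (z + r • (AffineMap.lineMap p q s - z))‖ₑ ^ 2
        ≤ ∫⁻ s in Set.Icc (0 : ℝ) 1,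
            liminf (fun n => ‖f n (z + r • (AffineMap.lineMap p q s - z))‖ₑ ^ 2) atTop := by
          refine setLIntegral_mono' measurableSet_Icc fun s hs => ?_
          have hmem : z + r • (AffineMap.lineMap p q s - z) ∈ C := by
            rw [hCdef]; exact ⟨_, hedge s hs, hhom _⟩
          have hca : ContinuousAt v (z + r • (AffineMap.lineMap p q s - z)) :=
            hvc.continuousAt (mem_interior_iff_mem_nhds.1 (hCin hmem))
          refine le_of_eq (Tendsto.liminf_eq ?_).symm
          exact (ENNReal.continuous_pow 2).continuousAt.tendsto.comp (hfc _ hmem hca).enorm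
      _ ≤ liminf (fun n => ∫⁻ s in Set.Icc (0 : ℝ) 1,
            ‖f n (z + r • (AffineMap.lineMap p q s - z))‖ₑ ^ 2) atTop := by
          refine lintegral_liminf_le fun n => ?_
          have h1 : Continuous (fun s : ℝ => z + r • (AffineMap.lineMap p q s - z)) := by
            simp only [lineMap_eq]; fun_prop
          exact ((hf n).continuous.comp h1).enorm.measurable.pow_const 2
      _ ≤ _ := (liminf_le_liminf (Eventually.of_forall hle)).trans (by simp)
  -- As the ratio tends to one, continuity of `v` on the closed triangle gives pointwise convergence
  -- on the edge, and Fatou's lemma concludes.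
  let r : ℕ → ℝ := fun n => 1 - 1 / ((n : ℝ) + 2)
  have hr0 : ∀ n, 0 < r n := fun n => by
    have : 1 / ((n : ℝ) + 2) < 1 := by
      rw [div_lt_one (by positivity)]; linarith [n.cast_nonneg (α := ℝ)]
    simp only [r]; linarith
  have hr1 : ∀ n, r n < 1 := fun n => by
    have : 0 < 1 / ((n : ℝ) + 2) := by positivity
    simp only [r]; linarith
  have hrt : Tendsto r atTop (𝓝 1) := by
    have := (tendsto_const_div_atTop_nhds_zero_nat (1 : ℝ)).comp (tendsto_add_atTop_nat 2)
    have h2 := this.const_sub (1 : ℝ)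
    rw [sub_zero] at h2
    refine h2.congr fun n => ?_
    simp [r]
  have hRt : Tendsto (fun n => ENNReal.ofReal ((r n) ^ 2)⁻¹ * ((volume K)⁻¹ * R)) atTop
      (𝓝 ((volume K)⁻¹ * R)) := by
    have h1 : Tendsto (fun n => ENNReal.ofReal ((r n) ^ 2)⁻¹) atTop (𝓝 1) := by
      have := (hrt.pow 2).inv₀ (by norm_num)
      have h2 := ENNReal.tendsto_ofReal this
      simpa using h2
    have := ENNReal.Tendsto.mul_const (b := (volume K)⁻¹ * R) h1 (Or.inl one_ne_zero)
    rwa [one_mul] at this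
  calc ∫⁻ s in Set.Icc (0 : ℝ) 1, ‖v (AffineMap.lineMap p q s)‖ₑ ^ 2
      ≤ ∫⁻ s in Set.Icc (0 : ℝ) 1,
          liminf (fun n => ‖v (z + r n • (AffineMap.lineMap p q s - z))‖ₑ ^ 2) atTop := by
        refine setLIntegral_mono' measurableSet_Icc fun s hs => ?_
        refine le_of_eq (Tendsto.liminf_eq ?_).symm
        have h1 : Tendsto (fun n => z + r n • (AffineMap.lineMap p q s - z)) atTop
            (𝓝[K] (AffineMap.lineMap p q s)) := by
          refine tendsto_nhdsWithin_iff.2 ⟨?_, Eventually.of_forall fun n => ?_⟩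
          · have := (hrt.smul_const (AffineMap.lineMap p q s - z)).const_add z
            rwa [one_smul, add_sub_cancel] at this
          · exact interior_subset (hshrink (hr0 n) (hr1 n) _ (hedge s hs))
        exact (ENNReal.continuous_pow 2).continuousAt.tendsto.comp
          ((hvc _ (hedge s hs)).tendsto.comp h1).enorm
    _ ≤ liminf (fun n => ∫⁻ s in Set.Icc (0 : ℝ) 1,
          ‖v (z + r n • (AffineMap.lineMap p q s - z))‖ₑ ^ 2) atTop := by
        refine lintegral_liminf_le' fun n => ?_
        have h1 : Continuous (fun s : ℝ => z + r n • (AffineMap.lineMap p q s - z)) := by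
          simp only [lineMap_eq]; fun_prop
        have h2 : ContinuousOn (fun s : ℝ => v (z + r n • (AffineMap.lineMap p q s - z)))
            (Set.Icc 0 1) :=
          hvc.comp h1.continuousOn fun s hs =>
            interior_subset (hshrink (hr0 n) (hr1 n) _ (hedge s hs))
        exact ((h2.aestronglyMeasurable measurableSet_Icc).enorm).pow_const 2
    _ ≤ liminf (fun n => ENNReal.ofReal ((r n) ^ 2)⁻¹ * ((volume K)⁻¹ * R)) atTop :=
        liminf_le_liminf (Eventually.of_forall fun n => hstep _ (hr0 n) (hr1 n))
    _ = _ := hRt.liminf_eq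

end TraceInequality

/-! ### Mean values -/

section Mean

variable {Ω : Set Plane}

/-- Jensen's inequality for the mean value, multiplied by the total mass so that the zero measure is
not an exception. -/
theorem measure_mul_sq_enorm_sub_average_le {α : Type*} [MeasurableSpace α] (μ : Measure α)
    [IsFiniteMeasure μ] {f : α → ℂ} (hf : Integrable f μ) (c : ℂ) :
    μ Set.univ * ‖c - ⨍ x, f x ∂μ‖ₑ ^ 2 ≤ ∫⁻ x, ‖c - f x‖ₑ ^ 2 ∂μ := by
  rcases eq_or_ne μ 0 with rfl | h0
  · simp
  have hu0 : μ Set.univ ≠ 0 := by simpa using h0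
  have hut : μ Set.univ ≠ ⊤ := measure_ne_top _ _
  have : NeZero μ := ⟨h0⟩
  have h1 : c - ⨍ x, f x ∂μ = ⨍ x, (c - f x) ∂μ := by
    rw [average, average, integral_sub (integrable_const c) (hf.smul_measure (by simpa using h0))]
    simp
  rw [h1, average]
  calc μ Set.univ * ‖∫ x, (c - f x) ∂((μ Set.univ)⁻¹ • μ)‖ₑ ^ 2
      ≤ μ Set.univ * (∫⁻ x, ‖c - f x‖ₑ ∂((μ Set.univ)⁻¹ • μ)) ^ 2 := by
        gcongr; exact enorm_integral_le_lintegral_enorm _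
    _ ≤ μ Set.univ * ∫⁻ x, ‖c - f x‖ₑ ^ 2 ∂((μ Set.univ)⁻¹ • μ) := by
        gcongr 1
        have hm : AEMeasurable (fun x => ‖c - f x‖ₑ) ((μ Set.univ)⁻¹ • μ) :=
          (((aestronglyMeasurable_const.sub hf.aestronglyMeasurable).enorm)).smul_measure _
        have h := sq_lintegral_mul_le ((μ Set.univ)⁻¹ • μ) hm (aemeasurable_const (b := 1))
        simpa using h
    _ = _ := by
        rw [lintegral_smul_measure, smul_eq_mul, ← mul_assoc, ENNReal.mul_inv_cancel hu0 hut,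
          one_mul]

/-- The mean value of `u` on `A`. -/
def mean (u : H1 Ω) (A : Set Plane) : ℂ := ⨍ x in A, value u x

variable [IsFiniteMeasure (volume.restrict Ω)]

/-- In the double integral form of the Poincaré inequality one variable is averaged over `A` only.
Thus `A` may be a small disc while the convex set `D` is a whole cell. -/
theorem lintegral_sq_sub_mean_le (hΩ : IsOpen Ω) (u : H1 Ω) {A D : Set Plane} (hAD : A ⊆ D)
    (hD : IsOpen D) (hDc : Convex ℝ D) (hDΩ : D ⊆ Ω) (hDb : Bornology.IsBounded D) {d : ℝ}
    (hd : ∀ x ∈ D, ∀ y ∈ D, dist x y ≤ d) :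
    volume A * ∫⁻ x in D, ‖value u x - mean u A‖ₑ ^ 2 ≤
      ENNReal.ofReal (4 * d ^ 2) * volume D * ENNReal.ofReal (energy u D) := by
  have hAΩ := hAD.trans hDΩ
  have hAfin : volume A ≠ ⊤ := ((measure_mono hAD).trans_lt hDb.measure_lt_top).ne
  have : IsFiniteMeasure (volume.restrict A) := ⟨by simpa using hAfin.lt_top⟩
  have hint : Integrable (value u) (volume.restrict A) :=
    (integrableOn_value u).mono_set hAΩ
  rw [← lintegral_grad_eq u hDΩ, ← lintegral_const_mul']
  · refine (lintegral_mono fun x => ?_).trans (poincare hΩ u hD hDc hDΩ hDb hd)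
    have h := measure_mul_sq_enorm_sub_average_le (volume.restrict A) hint (value u x)
    rw [Measure.restrict_apply_univ] at h
    exact h.trans (lintegral_mono_set hAD)
  · exact hAfin

theorem integral_sq_sub_mean_le (hΩ : IsOpen Ω) (u : H1 Ω) {A D : Set Plane} (hAD : A ⊆ D)
    (hD : IsOpen D) (hDc : Convex ℝ D) (hDΩ : D ⊆ Ω) (hDb : Bornology.IsBounded D) {d : ℝ}
    (hd : ∀ x ∈ D, ∀ y ∈ D, dist x y ≤ d) :
    volume.real A * ∫ x in D, ‖value u x - mean u A‖ ^ 2 ≤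
      4 * d ^ 2 * volume.real D * energy u D := by
  have hfin : volume D ≠ ⊤ := hDb.measure_lt_top.ne
  have h := lintegral_sq_sub_mean_le hΩ u hAD hD hDc hDΩ hDb hd
  have h1 : ∫ x in D, ‖value u x - mean u A‖ ^ 2 =
      (∫⁻ x in D, ‖value u x - mean u A‖ₑ ^ 2).toReal := by
    rw [integral_eq_lintegral_of_nonneg_ae (ae_of_all _ fun _ => by positivity)]
    · congr 1
      refine lintegral_congr fun x => ?_
      rw [ENNReal.ofReal_pow (norm_nonneg _), ofReal_norm]
    · exact ((((stronglyMeasurable_value u).sub stronglyMeasurable_const).norm.measurable.pow_const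
        2).aestronglyMeasurable)
  have h2 := ENNReal.toReal_mono (by
    exact ENNReal.mul_ne_top (ENNReal.mul_ne_top ENNReal.ofReal_ne_top hfin)
      ENNReal.ofReal_ne_top) h
  rw [ENNReal.toReal_mul, ENNReal.toReal_mul, ENNReal.toReal_mul,
    ENNReal.toReal_ofReal (by positivity), ENNReal.toReal_ofReal (energy_nonneg _ _)] at h2
  rw [h1]
  exact h2

/-- Averaging the second variable too, over `B`, compares mean values on two parts of one convex
set. -/
theorem sq_norm_mean_sub_mean_le (hΩ : IsOpen Ω) (u : H1 Ω) {A B D : Set Plane} (hAD : A ⊆ D)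
    (hBD : B ⊆ D)
    (hD : IsOpen D) (hDc : Convex ℝ D) (hDΩ : D ⊆ Ω) (hDb : Bornology.IsBounded D) {d : ℝ}
    (hd : ∀ x ∈ D, ∀ y ∈ D, dist x y ≤ d) :
    volume.real A * (volume.real B * ‖mean u A - mean u B‖ ^ 2) ≤
      4 * d ^ 2 * volume.real D * energy u D := by
  have hfin : volume D ≠ ⊤ := hDb.measure_lt_top.ne
  have h := lintegral_sq_sub_mean_le hΩ u hAD hD hDc hDΩ hDb hd
  have hBfin : volume B ≠ ⊤ := ((measure_mono hBD).trans_lt hDb.measure_lt_top).ne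
  have : IsFiniteMeasure (volume.restrict B) := ⟨by simpa using hBfin.lt_top⟩
  have hint : Integrable (value u) (volume.restrict B) :=
    (integrableOn_value u).mono_set (hBD.trans hDΩ)
  have h3 := measure_mul_sq_enorm_sub_average_le (volume.restrict B) hint (mean u A)
  rw [Measure.restrict_apply_univ] at h3
  have h4 : volume A * (volume B * ‖mean u A - mean u B‖ₑ ^ 2) ≤
      ENNReal.ofReal (4 * d ^ 2) * volume D * ENNReal.ofReal (energy u D) := by
    refine le_trans (mul_le_mul' le_rfl (h3.trans ((lintegral_mono_set hBD).trans ?_))) h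
    refine lintegral_mono fun x => ?_
    rw [← enorm_neg, neg_sub]
  have h2 := ENNReal.toReal_mono (by
    exact ENNReal.mul_ne_top (ENNReal.mul_ne_top ENNReal.ofReal_ne_top hfin)
      ENNReal.ofReal_ne_top) h4
  rw [ENNReal.toReal_mul, ENNReal.toReal_mul, ENNReal.toReal_mul, ENNReal.toReal_mul,
    ENNReal.toReal_ofReal (by positivity), ENNReal.toReal_ofReal (energy_nonneg _ _),
    ENNReal.toReal_pow, toReal_enorm] at h2
  exact h2

end Mean

/-! ### Lipschitz domains -/

section Domain

variable {Ω : Set Plane}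

theorem continuous_coord (A : Plane ≃ᵃⁱ[ℝ] Plane) (j : Fin 2) : Continuous fun y => A y j :=
  (EuclideanSpace.proj (𝕜 := ℝ) j).continuous.comp A.continuous

/-- A domain with Lipschitz boundary lies locally on one side of its boundary. -/
theorem interior_closure_eq (hΩ : IsPolygonalLipschitz Ω) : interior (closure Ω) = Ω := by
  refine Set.Subset.antisymm ?_ (interior_maximal subset_closure hΩ.isOpen)
  intro x hx
  by_contra hxΩ
  have hxf : x ∈ frontier Ω := ⟨interior_subset hx, by rwa [hΩ.isOpen.interior_eq]⟩
  obtain ⟨A, L, ψ, hψ, hev⟩ := hΩ.lipschitz x hxf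
  have hle : A x 1 ≤ ψ (A x 0) := by
    by_contra h
    exact hxΩ (hev.self_of_nhds.2 (not_le.1 h))
  obtain ⟨U, hUsub, hUo, hxU⟩ := mem_nhds_iff.1 (Filter.inter_mem hev (isOpen_interior.mem_nhds hx))
  -- Moving from `x` towards the lower side of the graph gives points strictly below it that still
  -- belong to `closure Ω`. Near such a point there is no point of `Ω`.
  let y : ℝ → Plane := fun s => A.symm (A x - s • EuclideanSpace.single 1 (1 : ℝ))
  have hy : Continuous y := A.symm.continuous.comp (by fun_prop)
  have hy0 : y 0 = x := by simp [y]
  have hyU : ∀ᶠ s in 𝓝[>] (0 : ℝ), y s ∈ U :=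
    (hy.continuousAt.tendsto.mono_left nhdsWithin_le_nhds).eventually
      (by rw [hy0]; exact hUo.mem_nhds hxU)
  obtain ⟨s, hsU, hs⟩ := (hyU.and self_mem_nhdsWithin).exists
  have hs' : (0 : ℝ) < s := hs
  have hA0 : A (y s) 0 = A x 0 := by simp [y]
  have hA1 : A (y s) 1 = A x 1 - s := by simp [y]
  have hlt : A (y s) 1 < ψ (A (y s) 0) := by rw [hA0, hA1]; linarith
  have hopen : IsOpen {w | A w 1 < ψ (A w 0)} :=
    isOpen_lt (continuous_coord A 1) (hψ.continuous.comp (continuous_coord A 0))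
  have hcl : y s ∈ closure Ω := interior_subset (hUsub hsU).2
  obtain ⟨w, ⟨hw1, hw2⟩, hwΩ⟩ := mem_closure_iff.1 hcl _ (hopen.inter hUo) ⟨hlt, hsU⟩
  have := (hUsub hw2).1.1 hwΩ
  exact lt_asymm this hw1

/-- Near a boundary point, a Lipschitz domain is connected. -/
theorem exists_preconnected_nhds (hΩ : IsPolygonalLipschitz Ω) {a : Plane} (ha : a ∈ frontier Ω)
    {ρ : ℝ} (hρ : 0 < ρ) :
    ∃ N ∈ 𝓝 a, N ∩ Ω ⊆ Metric.ball a ρ ∧ IsPreconnected (N ∩ Ω) := by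
  have haΩ : a ∉ Ω := by have := ha.2; rwa [hΩ.isOpen.interior_eq] at this
  obtain ⟨A, L, ψ, hψ, hev⟩ := hΩ.lipschitz a ha
  obtain ⟨ε, hε, hball⟩ := Metric.eventually_nhds_iff_ball.1 hev
  have hL : ∀ s t, |ψ s - ψ t| ≤ L * |s - t| := fun s t => by
    have := hψ.dist_le_mul s t
    rwa [Real.dist_eq, Real.dist_eq] at this
  have h1 : A a 1 = ψ (A a 0) := by
    refine le_antisymm ?_ ?_
    · by_contra h
      exact haΩ (hev.self_of_nhds.2 (not_le.1 h))
    · by_contra h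
      have hopen : IsOpen {w | A w 1 < ψ (A w 0)} :=
        isOpen_lt (continuous_coord A 1) (hψ.continuous.comp (continuous_coord A 0))
      obtain ⟨w, ⟨hw1, hw2⟩, hwΩ⟩ := mem_closure_iff.1 ha.1 _
        (hopen.inter Metric.isOpen_ball) ⟨not_le.1 h, Metric.mem_ball_self hε⟩
      exact lt_asymm ((hball w hw2).1 hwΩ) hw1
  set ρ' := min ρ ε with hρ'
  have hρ'0 : 0 < ρ' := lt_min hρ hε
  set η := ρ' / 2 with hη
  set δ := ρ' / (2 * (L + 1)) with hδ
  have hη0 : 0 < η := by positivity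
  have hδ0 : 0 < δ := by positivity
  have hLδ : (L : ℝ) * δ < η := by
    have : (L : ℝ) * δ = η * (L / (L + 1)) := by rw [hδ, hη]; field_simp
    rw [this]
    refine mul_lt_of_lt_one_right hη0 ?_
    rw [div_lt_one (by positivity)]; linarith
  have hδη : δ ≤ η := by
    rw [hδ, hη]
    exact div_le_div_of_nonneg_left hρ'0.le (by norm_num) (by linarith [L.coe_nonneg])
  let N : Set Plane := {y | |A y 0 - A a 0| < δ ∧ |A y 1 - A a 1| < η}
  have hNopen : IsOpen N :=
    (isOpen_lt ((continuous_coord A 0).sub continuous_const).abs continuous_const).inter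
      (isOpen_lt ((continuous_coord A 1).sub continuous_const).abs continuous_const)
  have hNa : a ∈ N := by simp [N, hη0, hδ0]
  have hNball : N ⊆ Metric.ball a ρ' := by
    intro y hy
    rw [Metric.mem_ball, ← A.dist_map, EuclideanSpace.dist_eq, Fin.sum_univ_two,
      Real.dist_eq, Real.dist_eq]
    calc √(|A y 0 - A a 0| ^ 2 + |A y 1 - A a 1| ^ 2)
        ≤ √((|A y 0 - A a 0| + |A y 1 - A a 1|) ^ 2) := by
          refine Real.sqrt_le_sqrt ?_
          nlinarith [abs_nonneg (A y 0 - A a 0), abs_nonneg (A y 1 - A a 1)]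
      _ = |A y 0 - A a 0| + |A y 1 - A a 1| := Real.sqrt_sq (by positivity)
      _ < δ + η := add_lt_add hy.1 hy.2
      _ ≤ ρ' := by linarith
  have hNΩ : ∀ y ∈ N, (y ∈ Ω ↔ ψ (A y 0) < A y 1) := fun y hy =>
    hball y (Metric.ball_subset_ball (min_le_right _ _) (hNball hy))
  refine ⟨N, hNopen.mem_nhds hNa,
    Set.inter_subset_left.trans (hNball.trans (Metric.ball_subset_ball (min_le_left _ _))), ?_⟩
  have hψb : ∀ s, |s - A a 0| < δ → |ψ s - A a 1| ≤ L * δ := fun s hs => by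
    rw [h1]
    exact (hL s _).trans (mul_le_mul_of_nonneg_left hs.le L.coe_nonneg)
  set τ := A a 1 + (L * δ + η) / 2 with hτ
  let pt : ℝ → ℝ → Plane := fun s t => A.symm (!₂[s, t])
  have hpt0 : ∀ s t, A (pt s t) 0 = s := fun s t => by simp [pt]
  have hpt1 : ∀ s t, A (pt s t) 1 = t := fun s t => by simp [pt]
  have hptA : ∀ y, pt (A y 0) (A y 1) = y := fun y => by
    simp only [pt]
    have : (!₂[A y 0, A y 1] : Plane) = A y := by ext j; fin_cases j <;> rfl
    rw [this]; simp
  have hmem : ∀ s t, |s - A a 0| < δ → ψ s < t → t < A a 1 + η → pt s t ∈ N ∩ Ω := by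
    intro s t h2 h3 h4
    have h5 := abs_le.1 (hψb s h2)
    have hN : pt s t ∈ N := by
      refine ⟨by rw [hpt0]; exact h2, ?_⟩
      rw [hpt1, abs_lt]; constructor <;> linarith
    exact ⟨hN, (hNΩ _ hN).2 (by rw [hpt0, hpt1]; exact h3)⟩
  have hptc : ∀ t, Continuous fun s => pt s t := fun t => A.symm.continuous.comp
    ((PiLp.continuous_toLp 2 _).comp (continuous_pi fun j => by fin_cases j <;> simp <;> fun_prop))
  have hptc' : ∀ s, Continuous fun t => pt s t := fun s => A.symm.continuous.comp
    ((PiLp.continuous_toLp 2 _).comp (continuous_pi fun j => by fin_cases j <;> simp <;> fun_prop))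
  have hτup : ∀ s, |s - A a 0| < δ → ψ s < τ := fun s hs => by
    have := abs_le.1 (hψb s hs)
    rw [hτ]; linarith
  have hτη : τ < A a 1 + η := by rw [hτ]; linarith
  refine isPreconnected_of_forall (pt (A a 0) τ) fun y hy => ?_
  have hyψ := (hNΩ y hy.1).1 hy.2
  have hyη : A y 1 < A a 1 + η := by linarith [(abs_lt.1 hy.1.2).2]
  -- Any point is joined to the base point by a vertical segment to height `τ` followed by a
  -- horizontal one, both above the graph.
  refine ⟨(fun t => pt (A y 0) t) '' Set.uIcc (A y 1) τ ∪
    (fun s => pt s τ) '' Set.uIcc (A y 0) (A a 0), ?_, ?_, ?_, ?_⟩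
  · rintro _ (⟨t, ht, rfl⟩ | ⟨s, hs, rfl⟩)
    · refine hmem _ _ hy.1.1 ?_ ?_
      · exact (lt_min hyψ (hτup _ hy.1.1)).trans_le ht.1
      · exact ht.2.trans_lt (max_lt hyη hτη)
    · have hs' : |s - A a 0| < δ := lt_of_le_of_lt (Set.abs_sub_right_of_mem_uIcc hs |>.trans_eq
        (abs_sub_comm _ _) |> fun h => by rw [abs_sub_comm s]; exact h) hy.1.1
      exact hmem _ _ hs' (hτup _ hs') hτη
  · exact Or.inr ⟨A a 0, Set.right_mem_uIcc, rfl⟩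
  · exact Or.inl ⟨A y 1, Set.left_mem_uIcc, hptA y⟩
  · refine IsPreconnected.union (pt (A y 0) τ) ⟨τ, Set.right_mem_uIcc, rfl⟩
      ⟨A y 0, Set.left_mem_uIcc, rfl⟩ ?_ ?_
    · exact isPreconnected_uIcc.image _ (hptc' _).continuousOn
    · exact isPreconnected_uIcc.image _ (hptc _).continuousOn

end Domain

/-! ### Geometry of triangulations -/

/-- The closed triangle with vertices `c`. -/
abbrev hull (c : Finset Plane) : Set Plane := convexHull ℝ (c : Set Plane)

theorem isCompact_hull (c : Finset Plane) : IsCompact (hull c) :=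
  c.finite_toSet.isCompact_convexHull ℝ

theorem convex_hull (c : Finset Plane) : Convex ℝ (hull c) := convex_convexHull ℝ _

theorem subset_hull {c : Finset Plane} {a : Plane} (ha : a ∈ c) : a ∈ hull c :=
  subset_convexHull ℝ _ (Finset.mem_coe.2 ha)

/-- The open triangle with vertices `c`. -/
abbrev openHull (c : Finset Plane) : Set Plane := interior (hull c)

theorem volume_openHull_ae (c : Finset Plane) : (openHull c : Set Plane) =ᵐ[volume] hull c :=
  interior_ae_eq_of_null_frontier ((convex_hull c).addHaar_frontier volume)

/-- The hull of at most two points is a null set. -/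
theorem volume_convexHull_of_card_le_two {s : Finset Plane} (hs : s.card ≤ 2) :
    volume (hull s) = 0 := by
  refine measure_mono_null (convexHull_subset_affineSpan _) ?_
  refine Measure.addHaar_affineSubspace _ _ fun htop => ?_
  rcases s.eq_empty_or_nonempty with rfl | hne
  · simp at htop
  obtain ⟨n, hn⟩ : ∃ n, s.card = n + 1 := Nat.exists_eq_succ_of_ne_zero hne.card_pos.ne'
  have h1 := finrank_vectorSpan_range_le ℝ ((↑) : s → Plane) (n := n) (by simpa using hn)
  have h2 : vectorSpan ℝ (Set.range ((↑) : s → Plane)) = ⊤ := by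
    rw [← direction_affineSpan]
    have : Set.range ((↑) : s → Plane) = (s : Set Plane) := by simp
    rw [this, htop, AffineSubspace.direction_top]
  rw [h2, finrank_top, finrank_euclideanSpace_fin] at h1
  omega

/-! ### Cells, open cells and barycentric coordinates -/

namespace Triangulation

variable {Ω ΓD : Set Plane} (T : Triangulation Ω ΓD)

theorem finite_cells : T.cells.Finite := T.finite.subset fun _ hc => hc.1

theorem hull_subset_closure {c : Finset Plane} (hc : c ∈ T.complex.faces) : hull c ⊆ closure Ω := by
  rw [← T.fits]
  exact Geometry.SimplicialComplex.convexHull_subset_space hc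

theorem exists_cell_mem {x : Plane} (hx : x ∈ closure Ω) : ∃ c ∈ T.cells, x ∈ hull c := by
  rw [← T.fits, Geometry.SimplicialComplex.mem_space_iff] at hx
  obtain ⟨s, hs, hxs⟩ := hx
  obtain ⟨c, hc, hsc, hcard⟩ := T.pure s hs
  exact ⟨c, ⟨hc, hcard⟩, convexHull_mono (Finset.coe_subset.2 hsc) hxs⟩

theorem openHull_subset (hΩ : IsPolygonalLipschitz Ω) {c : Finset Plane} (hc : c ∈ T.cells) :
    openHull c ⊆ Ω := by
  rw [← interior_closure_eq hΩ]
  exact interior_mono (T.hull_subset_closure hc.1)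

theorem diam_le {c : Finset Plane} (hc : c ∈ T.cells) : Metric.diam (hull c) ≤ T.meshSize :=
  le_csSup (T.finite_cells.image _).bddAbove ⟨c, hc, rfl⟩

theorem dist_le {c : Finset Plane} (hc : c ∈ T.cells) {x y : Plane} (hx : x ∈ hull c)
    (hy : y ∈ hull c) : dist x y ≤ T.meshSize :=
  (Metric.dist_le_diam_of_mem (isCompact_hull c).isBounded hx hy).trans (T.diam_le hc)

theorem mem_vertices {c : Finset Plane} (hc : c ∈ T.complex.faces) {a : Plane} (ha : a ∈ c) :
    a ∈ T.vertices :=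
  Geometry.SimplicialComplex.mem_vertices.2
    (T.complex.down_closed hc (Finset.singleton_subset_iff.2 ha) (Finset.singleton_nonempty a))

/-- Conformity applied to the simplex `{a}`: the two hulls meet in the hull of the common vertices,
which is therefore not empty. -/
theorem mem_of_mem_hull {c : Finset Plane} (hc : c ∈ T.complex.faces) {a : Plane}
    (ha : a ∈ T.vertices) (h : a ∈ hull c) : a ∈ c := by
  have h1 := T.complex.inter_subset_convexHull (Geometry.SimplicialComplex.mem_vertices.1 ha) hc
    ⟨subset_convexHull ℝ _ (by simp), h⟩
  obtain ⟨y, hy1, hy2⟩ := convexHull_nonempty_iff.1 ⟨a, h1⟩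
  have : y = a := by simpa using hy1
  exact this ▸ hy2

theorem exists_cell_of_vertex {a : Plane} (ha : a ∈ T.vertices) : ∃ c ∈ T.cells, a ∈ c := by
  obtain ⟨c, hc, hsc, hcard⟩ := T.pure _ (Geometry.SimplicialComplex.mem_vertices.1 ha)
  exact ⟨c, ⟨hc, hcard⟩, hsc (Finset.mem_singleton_self a)⟩

/-- Two distinct cells share at most two vertices, and by conformity they meet only in the hull of
these. -/
theorem volume_inter_eq_zero {c c' : Finset Plane} (hc : c ∈ T.cells) (hc' : c' ∈ T.cells)
    (hne : c ≠ c') : volume (hull c ∩ hull c') = 0 := by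
  classical
  refine measure_mono_null (T.complex.inter_subset_convexHull hc.1 hc'.1) ?_
  rw [← Finset.coe_inter]
  refine volume_convexHull_of_card_le_two ?_
  by_contra h
  have h1 : (c ∩ c').card = 3 :=
    le_antisymm ((Finset.card_le_card Finset.inter_subset_left).trans hc.2.le) (by omega)
  have h2 : c ∩ c' = c := Finset.eq_of_subset_of_card_le Finset.inter_subset_left (by
    rw [h1, hc.2])
  have h3 : c ∩ c' = c' := Finset.eq_of_subset_of_card_le Finset.inter_subset_right (by
    rw [h1, hc'.2])
  exact hne (h2.symm.trans h3)

theorem disjoint_openHull {c c' : Finset Plane} (hc : c ∈ T.cells) (hc' : c' ∈ T.cells)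
    (hne : c ≠ c') : Disjoint (openHull c) (openHull c') := by
  rw [Set.disjoint_iff_inter_eq_empty]
  have h0 : volume (openHull c ∩ openHull c') = 0 :=
    measure_mono_null (Set.inter_subset_inter interior_subset interior_subset)
      (T.volume_inter_eq_zero hc hc' hne)
  exact ((isOpen_interior.inter isOpen_interior).measure_eq_zero_iff volume).1 h0

/-- The affine basis formed by the vertices of a cell. -/
def cellBasis {c : Finset Plane} (hc : c ∈ T.cells) : AffineBasis c ℝ Plane where
  toFun := (↑)
  ind' := T.complex.indep hc.1
  tot' := by
    rw [(T.complex.indep hc.1).affineSpan_eq_top_iff_card_eq_finrank_add_one]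
    simp [hc.2]

theorem range_cellBasis {c : Finset Plane} (hc : c ∈ T.cells) :
    Set.range (T.cellBasis hc) = (c : Set Plane) := by
  exact Subtype.range_coe

theorem cellBasis_apply {c : Finset Plane} (hc : c ∈ T.cells) (a : c) : T.cellBasis hc a = a := rfl

theorem mem_hull_iff {c : Finset Plane} (hc : c ∈ T.cells) {x : Plane} :
    x ∈ hull c ↔ ∀ a : c, 0 ≤ (T.cellBasis hc).coord a x := by
  have := (T.cellBasis hc).convexHull_eq_nonneg_coord
  rw [T.range_cellBasis hc] at this
  exact Set.ext_iff.1 this x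

theorem mem_openHull_iff {c : Finset Plane} (hc : c ∈ T.cells) {x : Plane} :
    x ∈ openHull c ↔ ∀ a : c, 0 < (T.cellBasis hc).coord a x := by
  have := (T.cellBasis hc).interior_convexHull
  rw [T.range_cellBasis hc] at this
  exact Set.ext_iff.1 this x

theorem openHull_nonempty {c : Finset Plane} (hc : c ∈ T.cells) : (openHull c).Nonempty := by
  rw [interior_convexHull_nonempty_iff_affineSpan_eq_top, ← T.range_cellBasis hc]
  exact (T.cellBasis hc).tot

theorem coord_le_one {c : Finset Plane} (hc : c ∈ T.cells) {x : Plane} (hx : x ∈ hull c) (a : c) :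
    (T.cellBasis hc).coord a x ≤ 1 := by
  rw [← (T.cellBasis hc).sum_coord_apply_eq_one x]
  exact Finset.single_le_sum (f := fun i => (T.cellBasis hc).coord i x)
    (fun i _ => (T.mem_hull_iff hc).1 hx i) (Finset.mem_univ a)

end Triangulation

/-- An affine function whose oscillation on a ball of radius `r` is at most `M` has slope at most
`M / (2 r)`. -/
theorem norm_linear_le_of_ball {F : Type*} [NormedAddCommGroup F] [NormedSpace ℝ F]
    (A : Plane →ᵃ[ℝ] F) {z : Plane} {r M : ℝ} (hr : 0 < r)
    (hM : ∀ x ∈ Metric.closedBall z r, ∀ y ∈ Metric.closedBall z r, ‖A x - A y‖ ≤ M) (w : Plane) :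
    ‖A.linear w‖ ≤ M / (2 * r) * ‖w‖ := by
  rcases eq_or_ne w 0 with rfl | hw
  · simp
  have hw' : 0 < ‖w‖ := norm_pos_iff.2 hw
  -- The oscillation is tested at the two antipodal points of the ball in the direction of `w`.
  have hx : z + (r / ‖w‖) • w ∈ Metric.closedBall z r := by
    rw [Metric.mem_closedBall, dist_self_add_left, norm_smul, Real.norm_of_nonneg (by positivity),
      div_mul_cancel₀ _ hw'.ne']
  have hy : z - (r / ‖w‖) • w ∈ Metric.closedBall z r := by
    rw [Metric.mem_closedBall, dist_self_sub_left, norm_smul, Real.norm_of_nonneg (by positivity),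
      div_mul_cancel₀ _ hw'.ne']
  have h := hM _ hx _ hy
  have e : A (z + (r / ‖w‖) • w) - A (z - (r / ‖w‖) • w) = (2 * r / ‖w‖) • A.linear w := by
    rw [← vsub_eq_sub, ← AffineMap.linearMap_vsub, vsub_eq_sub, ← map_smul]
    congr 1
    module
  rw [e, norm_smul, Real.norm_of_nonneg (by positivity)] at h
  rw [div_mul_eq_mul_div, le_div_iff₀ (by positivity)]
  calc ‖A.linear w‖ * (2 * r) = 2 * r / ‖w‖ * ‖A.linear w‖ * ‖w‖ := by field_simp
    _ ≤ M * ‖w‖ := by gcongr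

namespace Triangulation

variable {Ω ΓD : Set Plane} (T : Triangulation Ω ΓD)

/-- A barycentric coordinate takes values in `[0, 1]` on a disc of radius `r` inside the cell, so
its slope is at most `1 / (2r)`. -/
theorem abs_coord_sub_le {c : Finset Plane} (hc : c ∈ T.cells) {z : Plane} {r : ℝ} (hr : 0 < r)
    (hz : Metric.closedBall z r ⊆ hull c) (a : c) (x y : Plane) :
    |(T.cellBasis hc).coord a x - (T.cellBasis hc).coord a y| ≤ dist x y / (2 * r) := by
  have h := norm_linear_le_of_ball ((T.cellBasis hc).coord a) (M := 1) hr (fun x hx y hy => by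
    rw [Real.norm_eq_abs, abs_le]
    have h1 := (T.mem_hull_iff hc).1 (hz hx) a
    have h2 := (T.mem_hull_iff hc).1 (hz hy) a
    have h3 := T.coord_le_one hc (hz hx) a
    have h4 := T.coord_le_one hc (hz hy) a
    constructor <;> linarith) (x - y)
  rw [← vsub_eq_sub x y, AffineMap.linearMap_vsub, vsub_eq_sub, vsub_eq_sub, ← dist_eq_norm x y,
    Real.norm_eq_abs] at h
  calc _ ≤ _ := h
    _ = _ := by ring

/-- Around the midpoint of the common edge of two cells there is a disc covered by the cells. -/
theorem ball_midpoint_subset {c c' : Finset Plane} (hc : c ∈ T.cells) (hc' : c' ∈ T.cells)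
    (hne : c ≠ c') {a b : Plane} (hab : a ≠ b) (hac : a ∈ c) (hbc : b ∈ c) (hac' : a ∈ c')
    (hbc' : b ∈ c') {z z' : Plane} {r : ℝ} (hr : 0 < r) (hz : Metric.closedBall z r ⊆ hull c)
    (hz' : Metric.closedBall z' r ⊆ hull c') :
    Metric.ball (midpoint ℝ a b) r ⊆ hull c ∪ hull c' := by
  classical
  have third : ∀ {e : Finset Plane} (he : e ∈ T.cells), a ∈ e → b ∈ e →
      ∃ o : e, (o : Plane) ≠ a ∧ (o : Plane) ≠ b ∧ ∀ i : e, (i : Plane) = a ∨ (i : Plane) = b ∨ i = o := by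
    intro e he h1 h2
    have hcard : ((e.erase a).erase b).card = 1 := by
      rw [Finset.card_erase_of_mem (Finset.mem_erase.2 ⟨hab.symm, h2⟩),
        Finset.card_erase_of_mem h1, he.2]
    obtain ⟨o, ho⟩ := Finset.card_eq_one.1 hcard
    have ho' : o ∈ (e.erase a).erase b := by rw [ho]; simp
    simp only [Finset.mem_erase] at ho'
    refine ⟨⟨o, ho'.2.2⟩, ho'.2.1, ho'.1, fun i => ?_⟩
    by_cases h3 : (i : Plane) = a
    · exact Or.inl h3
    by_cases h4 : (i : Plane) = b
    · exact Or.inr (Or.inl h4)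
    have : (i : Plane) ∈ (e.erase a).erase b := by simp [h3, h4, i.2]
    rw [ho, Finset.mem_singleton] at this
    exact Or.inr (Or.inr (Subtype.ext this))
  -- At the midpoint the coordinates of `a` and `b` are `1/2`, and within distance `r` they change
  -- by at most `1/2`. In this disc, non-negativity of the third coordinate alone ensures membership
  -- in the cell.
  have key : ∀ {e : Finset Plane} (he : e ∈ T.cells) (h1 : a ∈ e) (h2 : b ∈ e) {ζ : Plane},
      Metric.closedBall ζ r ⊆ hull e → ∃ f : Plane →ᵃ[ℝ] ℝ, f a = 0 ∧ f b = 0 ∧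
        ∀ x ∈ Metric.ball (midpoint ℝ a b) r, 0 ≤ f x → x ∈ hull e := by
    intro e he h1 h2 ζ hζ
    obtain ⟨o, hoa, hob, ho⟩ := third he h1 h2
    have cab : ∀ i j : e, (T.cellBasis he).coord i j = if i = j then 1 else 0 := fun i j =>
      (T.cellBasis he).coord_apply i j
    refine ⟨(T.cellBasis he).coord o, ?_, ?_, fun x hx hfx => (T.mem_hull_iff he).2 fun i => ?_⟩
    · have := cab o ⟨a, h1⟩
      rwa [if_neg (fun h => hoa (congrArg Subtype.val h))] at this
    · have := cab o ⟨b, h2⟩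
      rwa [if_neg (fun h => hob (congrArg Subtype.val h))] at this
    · have hmid : ∀ i : e, ((i : Plane) = a ∨ (i : Plane) = b) →
          (T.cellBasis he).coord i (midpoint ℝ a b) = 1 / 2 := by
        intro i hi
        rw [AffineMap.map_midpoint, midpoint_eq_smul_add]
        have ha := cab i ⟨a, h1⟩
        have hb := cab i ⟨b, h2⟩
        rcases hi with hi | hi
        · rw [if_pos (Subtype.ext hi)] at ha
          rw [if_neg (fun h => hab (hi.symm.trans (congrArg Subtype.val h)))] at hb
          simp only at ha hb
          rw [ha, hb]; norm_num
        · rw [if_neg (fun h => hab.symm (hi.symm.trans (congrArg Subtype.val h)))] at ha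
          rw [if_pos (Subtype.ext hi)] at hb
          simp only at ha hb
          rw [ha, hb]; norm_num
      have hpos : ((i : Plane) = a ∨ (i : Plane) = b) → 0 ≤ (T.cellBasis he).coord i x := by
        intro hi
        have h3 := T.abs_coord_sub_le he hr hζ i x (midpoint ℝ a b)
        rw [hmid i hi] at h3
        have h4 : dist x (midpoint ℝ a b) / (2 * r) ≤ 1 / 2 := by
          rw [div_le_iff₀ (by positivity)]
          linarith [Metric.mem_ball.1 hx]
        linarith [(abs_le.1 h3).1]
      rcases ho i with h | h | h
      · exact hpos (Or.inl h)
      · exact hpos (Or.inr h)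
      · rw [h]; exact hfx
  obtain ⟨f, hfa, hfb, hf⟩ := key hc hac hbc hz
  obtain ⟨f', hfa', hfb', hf'⟩ := key hc' hac' hbc' hz'
  have hcap : ((c : Set Plane) ∩ c') ⊆ {a, b} := by
    obtain ⟨o, hoa, hob, ho⟩ := third hc hac hbc
    obtain ⟨o', hoa', hob', ho'⟩ := third hc' hac' hbc'
    rintro x ⟨hx, hx'⟩
    rcases ho ⟨x, hx⟩ with h | h | h
    · exact Or.inl h
    · exact Or.inr h
    rcases ho' ⟨x, hx'⟩ with h' | h' | h'
    · exact Or.inl h'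
    · exact Or.inr h'
    exfalso
    apply hne
    have hsub : c ⊆ c' := by
      intro y hy
      rcases ho ⟨y, hy⟩ with k | k | k
      · have : y = a := k
        rw [this]; exact hac'
      · have : y = b := k
        rw [this]; exact hbc'
      · have : y = x := by rw [← h] at k; exact congrArg Subtype.val k
        rw [this]; exact hx'
    exact Finset.eq_of_subset_of_card_le hsub (by rw [hc.2, hc'.2])
  intro x hx
  by_contra hcon
  rw [Set.mem_union, not_or] at hcon
  have h1 : f x < 0 := by
    by_contra h; exact hcon.1 (hf x hx (not_lt.1 h))
  have h2 : f' x < 0 := by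
    by_contra h; exact hcon.2 (hf' x hx (not_lt.1 h))
  set m := midpoint ℝ a b with hm
  -- At a point outside both cells both third coordinates are negative. Its reflection through the
  -- midpoint then lies in both cells, hence on the common edge by conformity, where these
  -- coordinates vanish.
  have hy : AffineMap.homothety m (-1 : ℝ) x ∈ Metric.ball m r := by
    rw [AffineMap.homothety_apply, Metric.mem_ball, vadd_eq_add, dist_eq_norm, add_sub_cancel_right,
      norm_smul, norm_neg, norm_one, one_mul, vsub_eq_sub, ← dist_eq_norm]
    exact hx
  have hrefl : ∀ g : Plane →ᵃ[ℝ] ℝ, g a = 0 → g b = 0 → g (AffineMap.homothety m (-1 : ℝ) x) = - g x := by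
    intro g ha hb
    have hgm : g m = 0 := by rw [hm, AffineMap.map_midpoint, ha, hb]; simp
    rw [AffineMap.homothety_apply, AffineMap.map_vadd, map_smul, AffineMap.linearMap_vsub, hgm]
    simp
  have hin : AffineMap.homothety m (-1 : ℝ) x ∈ convexHull ℝ {a, b} :=
    convexHull_mono hcap (T.complex.inter_subset_convexHull hc.1 hc'.1
      ⟨hf _ hy (by rw [hrefl f hfa hfb]; linarith), hf' _ hy (by rw [hrefl f' hfa' hfb']; linarith)⟩)
  have hzero : ∀ y ∈ convexHull ℝ {a, b}, f y = 0 := by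
    intro y hy
    rw [convexHull_pair, segment_eq_image_lineMap] at hy
    obtain ⟨s, -, rfl⟩ := hy
    rw [AffineMap.apply_lineMap, hfa, hfb]; simp
  have := hzero _ hin
  rw [hrefl f hfa hfb] at this
  linarith

/-! ### Connectedness of the star of a vertex -/

/-- Cells sharing a vertex are linked by cells sharing an edge at this vertex. -/
theorem star_connected (hΩ : IsPolygonalLipschitz Ω) {a : Plane} {P : Set (Finset Plane)}
    (hP : ∀ c ∈ T.cells, ∀ c' ∈ T.cells, a ∈ c → a ∈ c' → c ∈ P → (∃ b ≠ a, b ∈ c ∧ b ∈ c') → c' ∈ P)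
    {c c' : Finset Plane} (hc : c ∈ T.cells) (hc' : c' ∈ T.cells) (hac : a ∈ c) (hac' : a ∈ c')
    (hcP : c ∈ P) : c' ∈ P := by
  by_contra hcP'
  let S : Set (Finset Plane) := {e ∈ T.cells | a ∈ e}
  let A : Set Plane := ⋃ e ∈ S ∩ P, hull e
  let B : Set Plane := ⋃ e ∈ S \ P, hull e
  have hSfin : S.Finite := T.finite_cells.subset fun e he => he.1
  have hA : IsClosed A := (hSfin.subset Set.inter_subset_left).isClosed_biUnion
    fun e _ => (isCompact_hull e).isClosed
  have hB : IsClosed B := (hSfin.subset Set.sdiff_subset).isClosed_biUnion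
    fun e _ => (isCompact_hull e).isClosed
  -- A cell in `P` and a cell not in `P` have no common vertex other than `a`, so by conformity the
  -- two closed unions meet at most in `a`.
  have hAB : A ∩ B ⊆ {a} := by
    rintro x ⟨hxA, hxB⟩
    simp only [A, B, Set.mem_iUnion] at hxA hxB
    obtain ⟨e, he, hxe⟩ := hxA
    obtain ⟨e', he', hxe'⟩ := hxB
    have hx := T.complex.inter_subset_convexHull he.1.1.1 he'.1.1.1 ⟨hxe, hxe'⟩
    have hsub : ((e : Set Plane) ∩ e') ⊆ {a} := by
      rintro b ⟨hb, hb'⟩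
      by_contra hba
      exact he'.2 (hP e he.1.1 e' he'.1.1 he.1.2 he'.1.2 he.2 ⟨b, hba, hb, hb'⟩)
    have := convexHull_mono hsub hx
    simpa using this
  have haV : a ∈ T.vertices := T.mem_vertices hc.1 hac
  have hloc : ∃ ρ > 0, Metric.ball a ρ ∩ closure Ω ⊆ A ∪ B := by
    let R : Set Plane := ⋃ e ∈ T.cells \ S, hull e
    have hR : IsClosed R := (T.finite_cells.subset Set.sdiff_subset).isClosed_biUnion
      fun e _ => (isCompact_hull e).isClosed
    have haR : a ∈ Rᶜ := by
      simp only [R, Set.mem_compl_iff, Set.mem_iUnion, not_exists]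
      intro e he hae
      exact he.2 ⟨he.1, T.mem_of_mem_hull he.1.1 haV hae⟩
    obtain ⟨ρ, hρ, hb⟩ := Metric.isOpen_iff.1 hR.isOpen_compl a haR
    refine ⟨ρ, hρ, ?_⟩
    rintro x ⟨hx, hxc⟩
    obtain ⟨e, he, hxe⟩ := T.exists_cell_mem hxc
    have heS : e ∈ S := by
      by_contra h
      exact hb hx (Set.mem_biUnion (show e ∈ T.cells \ S from ⟨he, h⟩) hxe)
    by_cases heP : e ∈ P
    · exact Or.inl (Set.mem_biUnion (show e ∈ S ∩ P from ⟨heS, heP⟩) hxe)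
    · exact Or.inr (Set.mem_biUnion (show e ∈ S \ P from ⟨heS, heP⟩) hxe)
  obtain ⟨ρ, hρ, hloc⟩ := hloc
  have hcA : hull c ⊆ A := Set.subset_biUnion_of_mem (u := hull) (show c ∈ S ∩ P from ⟨⟨hc, hac⟩, hcP⟩)
  have hcB : hull c' ⊆ B :=
    Set.subset_biUnion_of_mem (u := hull) (show c' ∈ S \ P from ⟨⟨hc', hac'⟩, hcP'⟩)
  -- A connected subset of `closure Ω` near `a` that avoids `a` cannot meet both closed unions,
  -- since they cover it and are disjoint away from `a`.
  suffices hC : ∃ C : Set Plane, IsPreconnected C ∧ C ⊆ Metric.ball a ρ ∩ closure Ω ∧ a ∉ C ∧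
      (C ∩ hull c).Nonempty ∧ (C ∩ hull c').Nonempty by
    obtain ⟨C, hCp, hCs, haC, h1, h2⟩ := hC
    obtain ⟨x, hxC, hxAB⟩ := isPreconnected_closed_iff.1 hCp A B hA hB (hCs.trans hloc)
      (h1.mono (Set.inter_subset_inter_right _ hcA)) (h2.mono (Set.inter_subset_inter_right _ hcB))
    exact haC (hAB hxAB ▸ hxC)
  have hacl : a ∈ closure Ω := T.hull_subset_closure hc.1 (subset_hull hac)
  -- At an interior vertex a small circle serves as the connected set. At a boundary vertex it is a
  -- connected piece of `Ω`, which avoids `a` because `Ω` is open.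
  by_cases haΩ : a ∈ Ω
  · obtain ⟨δ, hδ, hδΩ⟩ := Metric.isOpen_iff.1 hΩ.isOpen a haΩ
    have hother : ∀ e ∈ T.cells, a ∈ e → ∃ b ∈ e, b ≠ a := by
      intro e he hae
      have : 1 < e.card := by rw [he.2]; norm_num
      obtain ⟨b, hb, hba⟩ := Finset.exists_mem_ne this a
      exact ⟨b, hb, hba⟩
    obtain ⟨b, hb, hba⟩ := hother c hc hac
    obtain ⟨b', hb', hba'⟩ := hother c' hc' hac'
    set t := min (min ρ δ / 2) (min (dist a b) (dist a b')) with ht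
    have ht0 : 0 < t := lt_min (by positivity) (lt_min (dist_pos.2 hba.symm) (dist_pos.2 hba'.symm))
    have htρ : t < ρ := (min_le_left _ _).trans_lt
      ((half_lt_self (by positivity)).trans_le (min_le_left _ _))
    have htδ : t < δ := (min_le_left _ _).trans_lt
      ((half_lt_self (by positivity)).trans_le (min_le_right _ _))
    have hmeet : ∀ (e : Finset Plane) (y : Plane), a ∈ e → y ∈ e → y ≠ a → t ≤ dist a y →
        (Metric.sphere a t ∩ hull e).Nonempty := by
      intro e y hae hye hya hty
      have hd : 0 < dist a y := dist_pos.2 hya.symm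
      refine ⟨AffineMap.lineMap a y (t / dist a y), ?_, ?_⟩
      · rw [Metric.mem_sphere, dist_lineMap_left, Real.norm_of_nonneg (by positivity),
          div_mul_cancel₀ _ hd.ne']
      · exact (convex_hull e).lineMap_mem (subset_hull hae) (subset_hull hye)
          ⟨by positivity, (div_le_one hd).2 hty⟩
    refine ⟨Metric.sphere a t, isPreconnected_sphere ?_ a t, ?_, ?_, ?_, ?_⟩
    · rw [← Module.finrank_eq_rank, finrank_euclideanSpace_fin]; norm_num
    · intro x hx
      rw [Metric.mem_sphere] at hx
      exact ⟨Metric.mem_ball.2 (hx ▸ htρ), subset_closure (hδΩ (Metric.mem_ball.2 (hx ▸ htδ)))⟩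
    · rw [Metric.mem_sphere, dist_self]; exact ht0.ne
    · exact hmeet c b hac hb hba ((min_le_right _ _).trans (min_le_left _ _))
    · exact hmeet c' b' hac' hb' hba' ((min_le_right _ _).trans (min_le_right _ _))
  · have haf : a ∈ frontier Ω := ⟨hacl, by rwa [hΩ.isOpen.interior_eq]⟩
    obtain ⟨N, hN, hNb, hNc⟩ := exists_preconnected_nhds hΩ haf hρ
    have hmeet : ∀ e ∈ T.cells, a ∈ e → ((N ∩ Ω) ∩ hull e).Nonempty := by
      intro e he hae
      have hint : (openHull e).Nonempty := T.openHull_nonempty he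
      have hac : a ∈ closure (openHull e) := by
        rw [(convex_hull e).closure_interior_eq_closure_of_nonempty_interior hint]
        exact subset_closure (subset_hull hae)
      obtain ⟨U, hUN, hUo, haU⟩ := mem_nhds_iff.1 hN
      obtain ⟨y, hyU, hye⟩ := mem_closure_iff.1 hac U hUo haU
      have hycl : y ∈ closure Ω := T.hull_subset_closure he.1 (interior_subset hye)
      obtain ⟨w, ⟨hwU, hwe⟩, hwΩ⟩ := mem_closure_iff.1 hycl (U ∩ openHull e)
        (hUo.inter isOpen_interior) ⟨hyU, hye⟩
      exact ⟨w, ⟨hUN hwU, hwΩ⟩, interior_subset hwe⟩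
    exact ⟨N ∩ Ω, hNc, fun x hx => ⟨hNb hx, subset_closure hx.2⟩, fun h => haΩ h.2,
      hmeet c hc hac, hmeet c' hc' hac'⟩

end Triangulation

/-! ### Averages over neighbouring cells -/

theorem volume_real_ball (x : Plane) {r : ℝ} (hr : 0 ≤ r) :
    volume.real (Metric.ball x r) = Real.pi * r ^ 2 := by
  rw [Measure.real, EuclideanSpace.volume_ball_fin_two]
  simp [hr, Real.pi_nonneg]
  ring

theorem volume_real_closedBall (x : Plane) {r : ℝ} (hr : 0 ≤ r) :
    volume.real (Metric.closedBall x r) = Real.pi * r ^ 2 := by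
  rw [Measure.real, EuclideanSpace.volume_closedBall_fin_two]
  simp [hr, Real.pi_nonneg]
  ring

theorem IsPolygonalLipschitz.isFiniteMeasure {Ω : Set Plane} (hΩ : IsPolygonalLipschitz Ω) :
    IsFiniteMeasure (volume.restrict Ω) :=
  ⟨by rw [Measure.restrict_apply_univ]; exact hΩ.isBounded.measure_lt_top⟩

/-- Comparison of the mean values on two discs in a convex subset of the domain. -/
theorem sq_norm_mean_ball_sub_le {Ω : Set Plane} (hΩ : IsPolygonalLipschitz Ω) (u : H1 Ω)
    {D : Set Plane} (hD : IsOpen D) (hDc : Convex ℝ D) (hDΩ : D ⊆ Ω) {x y w : Plane}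
    {r r' h θ : ℝ} (hh : 0 < h) (hθ : 0 < θ) (hr : θ * h ≤ r) (hr' : θ * h ≤ r')
    (hx : Metric.ball x r ⊆ D) (hy : Metric.ball y r' ⊆ D) (hDw : D ⊆ Metric.closedBall w h) :
    ‖mean u (Metric.ball x r) - mean u (Metric.ball y r')‖ ^ 2 ≤ 16 / θ ^ 4 * energy u D := by
  have := hΩ.isFiniteMeasure
  have hDb : Bornology.IsBounded D := Metric.isBounded_closedBall.subset hDw
  have hd : ∀ x ∈ D, ∀ y ∈ D, dist x y ≤ 2 * h := fun x hx y hy => by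
    linarith [dist_triangle_right x y w, Metric.mem_closedBall.1 (hDw hx),
      Metric.mem_closedBall.1 (hDw hy)]
  have h1 := sq_norm_mean_sub_mean_le hΩ.isOpen u hx hy hD hDc hDΩ hDb hd
  have hθh : 0 < θ * h := by positivity
  rw [volume_real_ball x (hθh.le.trans hr), volume_real_ball y (hθh.le.trans hr')] at h1
  have h2 : volume.real D ≤ Real.pi * h ^ 2 := by
    rw [← volume_real_closedBall w hh.le]
    exact measureReal_mono hDw Metric.isBounded_closedBall.measure_lt_top.ne
  have hE := energy_nonneg u D
  have hpi := Real.pi_gt_three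
  set N := ‖mean u (Metric.ball x r) - mean u (Metric.ball y r')‖ ^ 2 with hN
  have hN0 : 0 ≤ N := by positivity
  have e1 : (θ * h) ^ 2 ≤ r ^ 2 := by gcongr
  have e2 : (θ * h) ^ 2 ≤ r' ^ 2 := by gcongr
  have h3 : (Real.pi * (θ * h) ^ 2) * ((Real.pi * (θ * h) ^ 2) * N) ≤
      4 * (2 * h) ^ 2 * (Real.pi * h ^ 2) * energy u D := by
    calc _ ≤ Real.pi * r ^ 2 * (Real.pi * r' ^ 2 * N) := by gcongr
      _ ≤ _ := h1
      _ ≤ _ := by gcongr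
  have h4 : Real.pi * h ^ 4 * (Real.pi * θ ^ 4 * N) ≤ Real.pi * h ^ 4 * (16 * energy u D) := by
    calc _ = (Real.pi * (θ * h) ^ 2) * ((Real.pi * (θ * h) ^ 2) * N) := by ring
      _ ≤ _ := h3
      _ = _ := by ring
  -- What remains is the bound with constant `16 / (π θ⁴)`; the factor `1 / π` is dropped.
  have h5 := le_of_mul_le_mul_left h4 (by positivity)
  rw [div_mul_eq_mul_div, le_div_iff₀ (by positivity)]
  nlinarith [mul_nonneg (by positivity : (0 : ℝ) ≤ θ ^ 4) hN0]

namespace Triangulation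

variable {Ω ΓD : Set Plane} (T : Triangulation Ω ΓD)

/-- Every cell contains a closed disc of radius `κ h`. -/
structure Regular (κ : ℝ) : Prop where
  pos : 0 < κ
  mesh_pos : 0 < T.meshSize
  exists_ball : ∀ c ∈ T.cells, ∃ z, Metric.closedBall z (κ * T.meshSize) ⊆ hull c

/-- The centre of a disc of radius `κ h` in the cell `c`. -/
def center (κ : ℝ) (c : Finset Plane) : Plane :=
  Classical.epsilon fun z => Metric.closedBall z (κ * T.meshSize) ⊆ hull c

/-- A disc of radius `κ h` in the cell `c`. -/
def disc (κ : ℝ) (c : Finset Plane) : Set Plane := Metric.ball (T.center κ c) (κ * T.meshSize)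

variable {T} {κ : ℝ}

theorem Regular.radius_pos (hT : T.Regular κ) : 0 < κ * T.meshSize := mul_pos hT.pos hT.mesh_pos

theorem Regular.closedBall_subset (hT : T.Regular κ) {c : Finset Plane} (hc : c ∈ T.cells) :
    Metric.closedBall (T.center κ c) (κ * T.meshSize) ⊆ hull c :=
  Classical.epsilon_spec (hT.exists_ball c hc)

theorem Regular.center_mem (hT : T.Regular κ) {c : Finset Plane} (hc : c ∈ T.cells) :
    T.center κ c ∈ hull c :=
  hT.closedBall_subset hc (Metric.mem_closedBall_self hT.radius_pos.le)

theorem Regular.disc_subset (hT : T.Regular κ) {c : Finset Plane} (hc : c ∈ T.cells) :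
    T.disc κ c ⊆ openHull c :=
  interior_maximal (Metric.ball_subset_closedBall.trans (hT.closedBall_subset hc))
    Metric.isOpen_ball

theorem Regular.volume_disc (hT : T.Regular κ) (c : Finset Plane) :
    volume.real (T.disc κ c) = Real.pi * (κ * T.meshSize) ^ 2 :=
  volume_real_ball _ hT.radius_pos.le

/-- The diameter `2 κ h` of the inscribed disc cannot exceed the diameter of the cell, which is at
most `h`. -/
theorem Regular.le_half (hT : T.Regular κ) {c : Finset Plane} (hc : c ∈ T.cells) : κ ≤ 1 / 2 := by
  have hr := hT.radius_pos
  have hx : T.center κ c + (κ * T.meshSize) • EuclideanSpace.single 0 (1 : ℝ) ∈ hull c :=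
    hT.closedBall_subset hc (by
      rw [Metric.mem_closedBall, dist_self_add_left, norm_smul, Real.norm_of_nonneg hr.le]; simp)
  have hy : T.center κ c - (κ * T.meshSize) • EuclideanSpace.single 0 (1 : ℝ) ∈ hull c :=
    hT.closedBall_subset hc (by
      rw [Metric.mem_closedBall, dist_self_sub_left, norm_smul, Real.norm_of_nonneg hr.le]; simp)
  have h := T.dist_le hc hx hy
  have e : T.center κ c + (κ * T.meshSize) • EuclideanSpace.single 0 (1 : ℝ) -
      (T.center κ c - (κ * T.meshSize) • EuclideanSpace.single 0 (1 : ℝ)) =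
      (2 * (κ * T.meshSize)) • EuclideanSpace.single 0 (1 : ℝ) := by module
  rw [dist_eq_norm, e, norm_smul, Real.norm_of_nonneg (by positivity)] at h
  simp only [PiLp.norm_single, norm_one, mul_one] at h
  have hm := hT.mesh_pos
  by_contra hκ
  rw [not_le] at hκ
  nlinarith

theorem hull_subset_closedBall {c : Finset Plane} (hc : c ∈ T.cells) {x : Plane} (hx : x ∈ hull c) :
    hull c ⊆ Metric.closedBall x T.meshSize := fun _ hy => T.dist_le hc hy hx

/-- The discs of the cells are disjoint, so that only boundedly many fit into a ball. -/
theorem Regular.card_mul_le (hT : T.Regular κ) {F : Finset (Finset Plane)}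
    (hF : ∀ c ∈ F, c ∈ T.cells) {x : Plane} {R : ℝ} (hR : 0 ≤ R)
    (hx : ∀ c ∈ F, T.disc κ c ⊆ Metric.closedBall x R) :
    (F.card : ℝ) * (κ * T.meshSize) ^ 2 ≤ R ^ 2 := by
  have h1 : volume.real (⋃ c ∈ F, T.disc κ c) = ∑ c ∈ F, volume.real (T.disc κ c) :=
    measureReal_biUnion_finset (fun c hc c' hc' hne =>
      (T.disjoint_openHull (hF c hc) (hF c' hc') hne).mono (hT.disc_subset (hF c hc))
        (hT.disc_subset (hF c' hc'))) (fun c _ => Metric.isOpen_ball.measurableSet)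
        (fun c _ => Metric.isBounded_ball.measure_lt_top.ne)
  have h2 : volume.real (⋃ c ∈ F, T.disc κ c) ≤ volume.real (Metric.closedBall x R) :=
    measureReal_mono (Set.iUnion₂_subset hx) Metric.isBounded_closedBall.measure_lt_top.ne
  rw [h1, volume_real_closedBall x hR] at h2
  simp only [hT.volume_disc, Finset.sum_const, nsmul_eq_mul] at h2
  have h3 : Real.pi * ((F.card : ℝ) * (κ * T.meshSize) ^ 2) ≤ Real.pi * R ^ 2 := by linarith
  exact le_of_mul_le_mul_left h3 Real.pi_pos

/-- The constant in the comparison of mean values on adjacent cells. -/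
def adjConst (κ : ℝ) : ℝ := 9 * (16 / (κ ^ 2 / 2) ^ 4)

/-- The union of two adjacent cells need not be convex. The comparison therefore passes through the
disc around the midpoint of the common edge: from the disc of `c` to a smaller one in `c`, across
the midpoint disc to a smaller one in `c'`, and on to the disc of `c'`. Each of these three
comparisons takes place in a convex set; the factor 9 comes from squaring a sum of three terms. -/
theorem sq_norm_mean_sub_adj_le (hΩ : IsPolygonalLipschitz Ω) (hT : T.Regular κ) (u : H1 Ω)
    {c c' : Finset Plane} (hc : c ∈ T.cells) (hc' : c' ∈ T.cells) (hne : c ≠ c') {a b : Plane}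
    (hab : a ≠ b) (hac : a ∈ c) (hbc : b ∈ c) (hac' : a ∈ c') (hbc' : b ∈ c') :
    ‖mean u (T.disc κ c) - mean u (T.disc κ c')‖ ^ 2 ≤
      adjConst κ * energy u (hull c ∪ hull c') := by
  set h := T.meshSize with hh
  have hh0 : 0 < h := hT.mesh_pos
  have hκ := hT.pos
  have hκ2 := hT.le_half hc
  set m := midpoint ℝ a b with hm
  set E := energy u (hull c ∪ hull c') with hE
  have hball : Metric.ball m (κ * h) ⊆ hull c ∪ hull c' :=
    T.ball_midpoint_subset hc hc' hne hab hac hbc hac' hbc' hT.radius_pos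
      (hT.closedBall_subset hc) (hT.closedBall_subset hc')
  have hballΩ : Metric.ball m (κ * h) ⊆ Ω := by
    rw [← interior_closure_eq hΩ]
    exact interior_maximal (hball.trans (Set.union_subset (T.hull_subset_closure hc.1)
      (T.hull_subset_closure hc'.1))) Metric.isOpen_ball
  have hθ : (0 : ℝ) < κ ^ 2 / 2 := by positivity
  -- The inscribed disc contracted towards `m` by the factor `κ/2`. Its centre is within `κ h / 2`
  -- of `m` and its radius is `κ² h / 2`, so it lies both in the cell and in the midpoint disc.
  let B : Finset Plane → Set Plane := fun e =>
    Metric.ball (m + (κ / 2) • (T.center κ e - m)) (κ / 2 * (κ * h))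
  have hrad : κ ^ 2 / 2 * h ≤ κ / 2 * (κ * h) := le_of_eq (by ring)
  have hrad' : κ ^ 2 / 2 * h ≤ κ * h := by
    refine mul_le_mul_of_nonneg_right ?_ hh0.le
    nlinarith
  have hmid : ∀ e ∈ T.cells, a ∈ e → b ∈ e → m ∈ hull e := fun e he hae hbe =>
    (convex_hull e).midpoint_mem (subset_hull hae) (subset_hull hbe)
  have hBm : ∀ e ∈ T.cells, a ∈ e → b ∈ e → B e ⊆ Metric.ball m (κ * h) := by
    intro e he hae hbe y hy
    have h1 : dist (m + (κ / 2) • (T.center κ e - m)) m ≤ κ / 2 * h := by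
      rw [dist_self_add_left, norm_smul, Real.norm_of_nonneg (by positivity), ← dist_eq_norm]
      gcongr
      exact T.dist_le he (hT.center_mem he) (hmid e he hae hbe)
    have h2 := Metric.mem_ball.1 hy
    rw [Metric.mem_ball]
    have h3 := dist_triangle y (m + (κ / 2) • (T.center κ e - m)) m
    nlinarith
  have hBe : ∀ e ∈ T.cells, a ∈ e → b ∈ e → B e ⊆ openHull e := by
    intro e he hae hbe
    refine interior_maximal ?_ Metric.isOpen_ball
    intro y hy
    have hs : (0 : ℝ) < κ / 2 := by positivity
    have hy' : m + (κ / 2)⁻¹ • (y - m) ∈ hull e := by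
      refine hT.closedBall_subset he ?_
      rw [Metric.mem_closedBall, dist_eq_norm]
      have e1 : m + (κ / 2)⁻¹ • (y - m) - T.center κ e =
          (κ / 2)⁻¹ • (y - (m + (κ / 2) • (T.center κ e - m))) := by
        rw [smul_sub, smul_sub, smul_add, smul_smul, inv_mul_cancel₀ hs.ne', one_smul]; abel
      rw [e1, norm_smul, norm_inv, Real.norm_of_nonneg hs.le, ← dist_eq_norm,
        inv_mul_le_iff₀ hs]
      exact (Metric.mem_ball.1 hy).le
    have := (convex_hull e).add_smul_sub_mem (hmid e he hae hbe) hy' (t := κ / 2)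
      ⟨hs.le, by linarith⟩
    rwa [add_sub_cancel_left, smul_smul, mul_inv_cancel₀ hs.ne', one_smul, add_sub_cancel] at this
  have hcell : ∀ e ∈ T.cells, a ∈ e → b ∈ e → hull e ⊆ hull c ∪ hull c' →
      ‖mean u (T.disc κ e) - mean u (B e)‖ ^ 2 ≤ 16 / (κ ^ 2 / 2) ^ 4 * E := by
    intro e he hae hbe hsub
    refine (sq_norm_mean_ball_sub_le hΩ u isOpen_interior (convex_hull e).interior
      (T.openHull_subset hΩ he) hh0 hθ hrad' hrad (hT.disc_subset he) (hBe e he hae hbe)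
      (interior_subset.trans (hull_subset_closedBall he (hT.center_mem he)))).trans ?_
    gcongr
    exact energy_mono u (Set.inter_subset_left.trans (interior_subset.trans hsub))
  have h1 := hcell c hc hac hbc Set.subset_union_left
  have h2 := hcell c' hc' hac' hbc' Set.subset_union_right
  have h3 : ‖mean u (B c) - mean u (B c')‖ ^ 2 ≤ 16 / (κ ^ 2 / 2) ^ 4 * E := by
    refine (sq_norm_mean_ball_sub_le hΩ u Metric.isOpen_ball (convex_ball m (κ * h))
      hballΩ hh0 hθ hrad hrad (hBm c hc hac hbc) (hBm c' hc' hac' hbc')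
      (Metric.ball_subset_closedBall.trans (Metric.closedBall_subset_closedBall
        (by nlinarith : κ * h ≤ h)))).trans ?_
    gcongr
    exact energy_mono u (Set.inter_subset_left.trans hball)
  set X := mean u (T.disc κ c)
  set Y := mean u (B c)
  set Z := mean u (B c')
  set W := mean u (T.disc κ c')
  have ht : ‖X - W‖ ≤ ‖X - Y‖ + ‖Y - Z‖ + ‖W - Z‖ := by
    have e : X - W = (X - Y) + (Y - Z) - (W - Z) := by ring
    rw [e]
    exact (norm_sub_le _ _).trans (add_le_add_left (norm_add_le _ _) _)
  have h4 : ‖X - W‖ ^ 2 ≤ 3 * (‖X - Y‖ ^ 2 + ‖Y - Z‖ ^ 2 + ‖W - Z‖ ^ 2) := by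
    have : ‖X - W‖ ^ 2 ≤ (‖X - Y‖ + ‖Y - Z‖ + ‖W - Z‖) ^ 2 := by gcongr
    nlinarith [sq_nonneg (‖X - Y‖ - ‖Y - Z‖), sq_nonneg (‖X - Y‖ - ‖W - Z‖),
      sq_nonneg (‖Y - Z‖ - ‖W - Z‖)]
  rw [adjConst]
  linarith

/-- Comparison of the mean values on cells with a common vertex. -/
theorem sq_norm_mean_sub_star_le (hΩ : IsPolygonalLipschitz Ω) (hT : T.Regular κ) (u : H1 Ω)
    {c c' : Finset Plane} (hc : c ∈ T.cells) (hc' : c' ∈ T.cells) {a : Plane}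
    (hac : a ∈ c) (hac' : a ∈ c') :
    ‖mean u (T.disc κ c) - mean u (T.disc κ c')‖ ^ 2 ≤
      (κ ^ 4)⁻¹ * (adjConst κ * energy u (Metric.closedBall a T.meshSize)) := by
  classical
  have hκ := hT.pos
  have hh0 := hT.mesh_pos
  set B := √(adjConst κ * energy u (Metric.closedBall a T.meshSize)) with hB
  have hadj0 : 0 ≤ adjConst κ := by rw [adjConst]; positivity
  have hE0 : 0 ≤ adjConst κ * energy u (Metric.closedBall a T.meshSize) :=
    mul_nonneg hadj0 (energy_nonneg _ _)
  let S : Finset (Finset Plane) := T.finite_cells.toFinset.filter fun e => a ∈ e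
  have hS : ∀ e, e ∈ S ↔ e ∈ T.cells ∧ a ∈ e := fun e => by simp [S]
  -- The cells at `a`, joined when they share a second vertex, form a connected graph by
  -- `star_connected`. A path has fewer steps than there are cells at `a`, and disjointness of the
  -- discs allows at most `κ⁻²` cells; the square of this count is the factor `κ⁻⁴`.
  let G : SimpleGraph S :=
    { Adj := fun e e' => e ≠ e' ∧ ∃ b ≠ a, b ∈ (e : Finset Plane) ∧ b ∈ (e' : Finset Plane)
      symm := ⟨fun e e' h => ⟨h.1.symm, h.2.imp fun b hb => ⟨hb.1, hb.2.2, hb.2.1⟩⟩⟩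
      loopless := ⟨fun e h => h.1 rfl⟩ }
  have hstep : ∀ e e' : S, G.Adj e e' →
      ‖mean u (T.disc κ e) - mean u (T.disc κ e')‖ ≤ B := by
    rintro ⟨e, he⟩ ⟨e', he'⟩ ⟨hne, b, hba, hb, hb'⟩
    rw [hS] at he he'
    refine Real.le_sqrt_of_sq_le ((sq_norm_mean_sub_adj_le hΩ hT u he.1 he'.1
      (fun h => hne (Subtype.ext h)) hba.symm he.2 hb he'.2 hb').trans ?_)
    refine mul_le_mul_of_nonneg_left (energy_mono u ?_) hadj0
    exact Set.inter_subset_left.trans (Set.union_subset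
      (hull_subset_closedBall he.1 (subset_hull he.2))
      (hull_subset_closedBall he'.1 (subset_hull he'.2)))
  have hwalk : ∀ {e e' : S} (w : G.Walk e e'),
      ‖mean u (T.disc κ e) - mean u (T.disc κ e')‖ ≤ w.length * B := by
    intro e e' w
    induction w with
    | nil => simp
    | @cons x y z hxy w ih =>
      have e1 : mean u (T.disc κ x) - mean u (T.disc κ z) =
          (mean u (T.disc κ x) - mean u (T.disc κ y)) +
            (mean u (T.disc κ y) - mean u (T.disc κ z)) := by ring
      rw [e1, SimpleGraph.Walk.length_cons]
      push_cast
      linarith [norm_add_le (mean u (T.disc κ x) - mean u (T.disc κ y))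
        (mean u (T.disc κ y) - mean u (T.disc κ z)), hstep x y hxy]
  have hcS : c ∈ S := (hS c).2 ⟨hc, hac⟩
  have hreach : c' ∈ {e | ∃ he : e ∈ S, G.Reachable ⟨c, hcS⟩ ⟨e, he⟩} := by
    refine T.star_connected hΩ (a := a) ?_ hc hc' hac hac' ⟨hcS, SimpleGraph.Reachable.refl _⟩
    rintro e he e' he' hae hae' ⟨heS, hr⟩ ⟨b, hba, hb, hb'⟩
    have he'S : e' ∈ S := (hS e').2 ⟨he', hae'⟩
    refine ⟨he'S, ?_⟩
    by_cases hee : e = e'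
    · subst hee; exact hr
    · exact hr.trans (SimpleGraph.Adj.reachable
        ⟨fun h => hee (congrArg Subtype.val h), b, hba, hb, hb'⟩)
  obtain ⟨hc'S, hr⟩ := hreach
  obtain ⟨w⟩ := hr
  have hlen : w.toPath.1.length < S.card := by
    have := w.toPath.2.length_lt
    rwa [Fintype.card_coe] at this
  have hcard : (S.card : ℝ) ≤ (κ ^ 2)⁻¹ := by
    have h1 := hT.card_mul_le (F := S) (fun e he => ((hS e).1 he).1) (x := a) hh0.le
      (fun e he => (hT.disc_subset ((hS e).1 he).1).trans (interior_subset.trans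
        (hull_subset_closedBall ((hS e).1 he).1 (subset_hull ((hS e).1 he).2))))
    rw [← one_div, le_div_iff₀ (by positivity)]
    have h2 : (S.card : ℝ) * κ ^ 2 * T.meshSize ^ 2 ≤ 1 * T.meshSize ^ 2 := by
      calc _ = (S.card : ℝ) * (κ * T.meshSize) ^ 2 := by ring
        _ ≤ _ := h1
        _ = _ := by ring
    exact le_of_mul_le_mul_right h2 (by positivity)
  have h1 : ‖mean u (T.disc κ c) - mean u (T.disc κ c')‖ ≤ (κ ^ 2)⁻¹ * B := by
    refine (hwalk w.toPath.1).trans (mul_le_mul_of_nonneg_right ?_ (Real.sqrt_nonneg _))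
    refine le_trans ?_ hcard
    exact_mod_cast hlen.le
  calc ‖mean u (T.disc κ c) - mean u (T.disc κ c')‖ ^ 2 ≤ ((κ ^ 2)⁻¹ * B) ^ 2 := by gcongr
    _ = _ := by
      rw [mul_pow, hB, Real.sq_sqrt hE0]
      congr 1
      rw [inv_pow, ← pow_mul]

end Triangulation

/-- A shape regular and quasi-uniform family is uniformly regular. -/
theorem exists_regular {Ω ΓD : Set Plane} {ι : Type*} {T : ι → Triangulation Ω ΓD}
    (hshape : ShapeRegular T) (hquasi : QuasiUniform T) :
    ∃ κ > 0, ∀ i, 0 < (T i).meshSize → (T i).Regular κ := by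
  obtain ⟨σ, hσ, hs⟩ := hshape
  obtain ⟨τ, hτ, hq⟩ := hquasi
  -- Quasi-uniformity and shape regularity give `τ h ≤ diam c ≤ 2 σ r`.
  refine ⟨τ / (2 * σ), by positivity, fun i hi => ⟨by positivity, hi, fun c hc => ?_⟩⟩
  obtain ⟨z, r, hz, hr⟩ := hs i c hc
  refine ⟨z, (Metric.closedBall_subset_closedBall ?_).trans hz⟩
  have h1 := (hq i c hc).trans hr
  rw [div_mul_eq_mul_div, div_le_iff₀ (by positivity)]
  linarith

/-! ### Piecewise affine functions -/

/-- A function that satisfies a Lipschitz estimate near every point, with the same constant, is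
Lipschitz. -/
theorem lipschitzWith_of_local {E F : Type*} [NormedAddCommGroup E] [NormedSpace ℝ E]
    [NormedAddCommGroup F] {w : E → F} {M : ℝ≥0}
    (h : ∀ x, ∀ᶠ y in 𝓝 x, ‖w y - w x‖ ≤ M * ‖y - x‖) : LipschitzWith M w := by
  refine LipschitzWith.of_dist_le_mul fun y x => ?_
  rw [dist_eq_norm, dist_eq_norm]
  let γ : ℝ → E := fun t => x + t • (y - x)
  have hγ : Continuous γ := by fun_prop
  let g : ℝ → F := fun t => w (γ t) - w x
  set N : ℝ := M * ‖y - x‖ with hN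
  have hN0 : 0 ≤ N := by positivity
  have hg : ∀ t, ∀ᶠ s in 𝓝 t, ‖g s - g t‖ ≤ N * |s - t| := by
    intro t
    filter_upwards [hγ.continuousAt.eventually (h (γ t))] with s hs
    have e : γ s - γ t = (s - t) • (y - x) := by simp only [γ]; rw [sub_smul]; abel
    simp only [g, sub_sub_sub_cancel_right]
    refine hs.trans (le_of_eq ?_)
    rw [e, norm_smul, Real.norm_eq_abs]; ring
  have hgc : Continuous g := by
    refine continuous_iff_continuousAt.2 fun t => ?_
    rw [ContinuousAt, tendsto_iff_norm_sub_tendsto_zero]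
    have hb : Tendsto (fun s => N * |s - t|) (𝓝 t) (𝓝 0) := by
      have : Continuous fun s : ℝ => N * |s - t| := by fun_prop
      simpa using this.tendsto t
    exact squeeze_zero' (Eventually.of_forall fun _ => norm_nonneg _) (hg t) hb
  have hg0 : g 0 = 0 := by simp [g, γ]
  have hg1 : g 1 = w y - w x := by simp [g, γ]
  rw [← hg1]
  -- The growth lemma compares with a function of strictly larger slope, so `ε` is added to the
  -- constant and then removed.
  refine le_of_forall_pos_le_add fun ε hε => ?_
  have := image_norm_le_of_liminf_right_slope_norm_lt_deriv_boundary (f := g) (a := 0) (b := 1)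
    (f' := fun _ => N) (B := fun t => (N + ε) * t) (B' := fun _ => N + ε) hgc.continuousOn
    (fun t _ r hr => ?_) (by simp [hg0]) (by fun_prop)
    (fun t _ => by simpa using ((hasDerivAt_id t).const_mul (N + ε)).hasDerivWithinAt)
    (fun t _ _ => by linarith) (Set.right_mem_Icc.2 zero_le_one)
  · simpa using this
  · refine Eventually.frequently ?_
    filter_upwards [(hg t).filter_mono nhdsWithin_le_nhds, self_mem_nhdsWithin] with s hs hst
    have hst' : 0 < s - t := sub_pos.2 hst
    rw [slope_def_field]
    refine lt_of_le_of_lt ?_ hr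
    rw [div_le_iff₀ hst']
    rw [abs_of_pos hst'] at hs
    exact (norm_sub_norm_le _ _).trans hs

theorem _root_.AffineMap.hasFDerivAt_toContinuousLinearMap (A : Plane →ᵃ[ℝ] ℂ) (x : Plane) :
    HasFDerivAt A A.linear.toContinuousLinearMap x := by
  have h : (A : Plane → ℂ) = fun y => A.linear.toContinuousLinearMap y + A 0 := by
    rw [AffineMap.decomp A]
    ext y
    simp
  rw [h]
  exact A.linear.toContinuousLinearMap.hasFDerivAt.add_const _

/-- The gradient of an affine function. -/
def gradA (A : Plane →ᵃ[ℝ] ℂ) : EuclideanSpace ℂ (Fin 2) :=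
  WithLp.toLp 2 fun j => A.linear (EuclideanSpace.single j 1)

namespace Triangulation

variable {Ω ΓD : Set Plane} (T : Triangulation Ω ΓD)

/-- The affine function on the cell `c` with the values `n` at the vertices. -/
def cellInterp {c : Finset Plane} (hc : c ∈ T.cells) (n : Plane → ℂ) : Plane →ᵃ[ℝ] ℂ :=
  ∑ a : c, (LinearMap.toSpanSingleton ℝ ℂ (n a)).toAffineMap.comp ((T.cellBasis hc).coord a)

theorem cellInterp_apply {c : Finset Plane} (hc : c ∈ T.cells) (n : Plane → ℂ) (x : Plane) :
    T.cellInterp hc n x = ∑ a : c, (T.cellBasis hc).coord a x • n a := by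
  rw [cellInterp]
  have : ∀ s : Finset c, (∑ a ∈ s, (LinearMap.toSpanSingleton ℝ ℂ (n a)).toAffineMap.comp
      ((T.cellBasis hc).coord a)) x = ∑ a ∈ s, (T.cellBasis hc).coord a x • n a := by
    classical
    intro s
    induction s using Finset.induction_on with
    | empty => simp
    | insert a s ha ih => rw [Finset.sum_insert ha, Finset.sum_insert ha, ← ih]; simp
  exact this _

theorem cellInterp_vertex {c : Finset Plane} (hc : c ∈ T.cells) (n : Plane → ℂ) {a : Plane}
    (ha : a ∈ c) : T.cellInterp hc n a = n a := by
  classical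
  rw [cellInterp_apply, Finset.sum_eq_single (⟨a, ha⟩ : c)]
  · have := (T.cellBasis hc).coord_apply ⟨a, ha⟩ ⟨a, ha⟩
    rw [if_pos rfl, T.cellBasis_apply] at this
    rw [this, one_smul]
  · intro b _ hb
    have := (T.cellBasis hc).coord_apply b ⟨a, ha⟩
    rw [if_neg hb, T.cellBasis_apply] at this
    rw [this, zero_smul]
  · simp

theorem _root_.AffineMap.eqOn_convexHull {E F : Type*} [AddCommGroup E] [Module ℝ E]
    [AddCommGroup F] [Module ℝ F] {A B : E →ᵃ[ℝ] F} {s : Set E} (h : Set.EqOn A B s) :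
    Set.EqOn A B (convexHull ℝ s) := by
  have hconv : Convex ℝ {x | A x = B x} := by
    intro x hx y hy a b _ _ hab
    have hx' : A x = B x := hx
    have hy' : A y = B y := hy
    have e1 := Convex.combo_affine_apply (x := x) (y := y) hab (f := A)
    have e2 := Convex.combo_affine_apply (x := x) (y := y) hab (f := B)
    change A _ = B _
    rw [e1, e2, hx', hy']
  exact convexHull_min h hconv

/-- An affine function on the plane is determined by its values at three affinely independent
points, so the equality holds beyond the cell. -/
theorem eqOn_cellInterp {c : Finset Plane} (hc : c ∈ T.cells) {v : Plane → ℂ}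
    {A : Plane →ᵃ[ℝ] ℂ} (hA : ∀ x ∈ hull c, v x = A x) : A = T.cellInterp hc v := by
  have hs : Set.EqOn A (T.cellInterp hc v) (c : Set Plane) := fun a ha => by
    rw [T.cellInterp_vertex hc v ha, hA a (subset_hull ha)]
  ext x
  have e : ∀ B : Plane →ᵃ[ℝ] ℂ, B x = ∑ a : c, (T.cellBasis hc).coord a x • B a := by
    intro B
    have h1 := (T.cellBasis hc).affineCombination_coord_eq_self x
    conv_lhs => rw [← h1]
    rw [Finset.map_affineCombination _ _ _ ((T.cellBasis hc).sum_coord_apply_eq_one x),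
      Finset.affineCombination_eq_linear_combination _ _ _
        ((T.cellBasis hc).sum_coord_apply_eq_one x)]
    rfl
  rw [e A, e (T.cellInterp hc v)]
  exact Finset.sum_congr rfl fun a _ => by rw [hs a.2]

variable {T}

theorem IsP1.eq_cellInterp {v : Plane → ℂ} (hv : T.IsP1 v) {c : Finset Plane} (hc : c ∈ T.cells)
    {x : Plane} (hx : x ∈ hull c) : v x = T.cellInterp hc v x := by
  obtain ⟨A, hA⟩ := hv c hc
  rw [← T.eqOn_cellInterp hc hA, hA x hx]

theorem IsP1.sub {v w : Plane → ℂ} (hv : T.IsP1 v) (hw : T.IsP1 w) :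
    T.IsP1 (fun x => v x - w x) := fun c hc => by
  obtain ⟨A, hA⟩ := hv c hc
  obtain ⟨B, hB⟩ := hw c hc
  exact ⟨A - B, fun x hx => by simp [hA x hx, hB x hx]⟩

theorem isP1_affine (A : Plane →ᵃ[ℝ] ℂ) : T.IsP1 A := fun _ _ => ⟨A, fun _ _ => rfl⟩

variable (T) in
/-- There is a piecewise affine function with given values at the vertices. -/
theorem exists_isP1 (n : Plane → ℂ) : ∃ v, T.IsP1 v ∧ ∀ a ∈ T.vertices, v a = n a := by
  classical
  -- By conformity two cells meet inside the hull of their common vertices, where both interpolants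
  -- are fixed by the same nodal values.
  have hcons : ∀ {c c' : Finset Plane} (hc : c ∈ T.cells) (hc' : c' ∈ T.cells) {x : Plane},
      x ∈ hull c → x ∈ hull c' → T.cellInterp hc n x = T.cellInterp hc' n x := by
    intro c c' hc hc' x hx hx'
    refine AffineMap.eqOn_convexHull ?_ (T.complex.inter_subset_convexHull hc.1 hc'.1 ⟨hx, hx'⟩)
    rintro a ⟨ha, ha'⟩
    rw [T.cellInterp_vertex hc n ha, T.cellInterp_vertex hc' n ha']
  let v : Plane → ℂ := fun x =>
    if h : ∃ c, ∃ _ : c ∈ T.cells, x ∈ hull c then T.cellInterp h.choose_spec.choose n x else 0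
  have hv : ∀ {c : Finset Plane} (hc : c ∈ T.cells) {x : Plane}, x ∈ hull c →
      v x = T.cellInterp hc n x := by
    intro c hc x hx
    have h : ∃ c, ∃ _ : c ∈ T.cells, x ∈ hull c := ⟨c, hc, hx⟩
    simp only [v, dif_pos h]
    exact hcons _ hc h.choose_spec.choose_spec hx
  refine ⟨v, fun c hc => ⟨T.cellInterp hc n, fun x hx => hv hc hx⟩, fun a ha => ?_⟩
  obtain ⟨c, hc, hac⟩ := T.exists_cell_of_vertex ha
  rw [hv hc (subset_hull hac), T.cellInterp_vertex hc n hac]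

/-- A piecewise affine function satisfies a Lipschitz estimate near every point. -/
theorem IsP1.exists_local_lipschitz {v : Plane → ℂ} (hv : T.IsP1 v) :
    ∃ L : ℝ≥0, ∀ x ∈ closure Ω, ∀ᶠ y in 𝓝 x, y ∈ closure Ω → ‖v y - v x‖ ≤ L * ‖y - x‖ := by
  classical
  have hcell : ∀ c ∈ T.cells, ∃ L : ℝ≥0, ∀ x ∈ hull c, ∀ y ∈ hull c, ‖v y - v x‖ ≤ L * ‖y - x‖ := by
    intro c hc
    obtain ⟨A, hA⟩ := hv c hc
    refine ⟨‖A.linear.toContinuousLinearMap‖₊, fun x hx y hy => ?_⟩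
    rw [hA x hx, hA y hy, ← vsub_eq_sub, ← AffineMap.linearMap_vsub]
    exact A.linear.toContinuousLinearMap.le_opNorm _
  choose! L hL using hcell
  have hfin := T.finite_cells
  refine ⟨∑ c ∈ hfin.toFinset, L c, fun x hx => ?_⟩
  -- The finitely many cells that miss `x` form a closed set, so every nearby point of `closure Ω`
  -- shares a cell with `x`.
  let R : Set Plane := ⋃ c ∈ {c ∈ T.cells | x ∉ hull c}, hull c
  have hR : IsClosed R := (hfin.subset fun c hc => hc.1).isClosed_biUnion
    fun c _ => (isCompact_hull c).isClosed
  have hxR : x ∈ Rᶜ := by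
    simp only [R, Set.mem_compl_iff, Set.mem_iUnion, not_exists]
    exact fun c hc h => hc.2 h
  filter_upwards [hR.isOpen_compl.mem_nhds hxR] with y hy hycl
  obtain ⟨c, hc, hyc⟩ := T.exists_cell_mem hycl
  have hxc : x ∈ hull c := by
    by_contra h
    exact hy (Set.mem_biUnion (show c ∈ {c ∈ T.cells | x ∉ hull c} from ⟨hc, h⟩) hyc)
  refine (hL c hc x hxc y hyc).trans (mul_le_mul_of_nonneg_right ?_ (norm_nonneg _))
  exact_mod_cast Finset.single_le_sum (f := L) (fun _ _ => zero_le)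
    ((Set.Finite.mem_toFinset hfin).2 hc)

theorem IsP1.continuousOn {v : Plane → ℂ} (hv : T.IsP1 v) : ContinuousOn v (closure Ω) := by
  obtain ⟨L, hL⟩ := hv.exists_local_lipschitz
  intro x hx
  rw [ContinuousWithinAt, tendsto_iff_norm_sub_tendsto_zero]
  have hb : Tendsto (fun y => (L : ℝ) * ‖y - x‖) (𝓝[closure Ω] x) (𝓝 0) := by
    have : Continuous fun y : Plane => (L : ℝ) * ‖y - x‖ := by fun_prop
    simpa using (this.tendsto x).mono_left nhdsWithin_le_nhds
  refine squeeze_zero' (Eventually.of_forall fun _ => norm_nonneg _) ?_ hb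
  filter_upwards [(hL x hx).filter_mono nhdsWithin_le_nhds, self_mem_nhdsWithin] with y h1 h2
  exact h1 h2

variable (T) in
theorem ae_mem_openHull (hΩ : IsOpen Ω) :
    ∀ᵐ x ∂(volume.restrict Ω), ∃ c ∈ T.cells, x ∈ openHull c := by
  have h : ∀ᵐ x : Plane, ∀ c ∈ T.cells, x ∉ frontier (hull c) := by
    refine (ae_ball_iff T.finite_cells.countable).2 fun c _ => ?_
    exact measure_eq_zero_iff_ae_notMem.1 ((convex_hull c).addHaar_frontier volume)
  have hae : ∀ᵐ x ∂(volume.restrict Ω), x ∈ closure Ω :=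
    (ae_restrict_mem hΩ.measurableSet).mono fun _ h => subset_closure h
  filter_upwards [ae_restrict_of_ae h, hae] with x hx hxΩ
  obtain ⟨c, hc, hxc⟩ := T.exists_cell_mem hxΩ
  refine ⟨c, hc, ?_⟩
  by_contra hn
  exact hx c hc ⟨subset_closure hxc, hn⟩

/-- After multiplication by a test function the product, extended by zero, is Lipschitz on the whole
plane. Integration by parts for Lipschitz functions then replaces the cancellation of boundary terms
edge by edge. -/
theorem lipschitzWith_smul_of_isP1 (hΩ : IsPolygonalLipschitz Ω) {v : Plane → ℂ} (hv : T.IsP1 v)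
    {φ : Plane → ℝ} (hφ : IsTestFunction Ω φ) :
    ∃ M : ℝ≥0, LipschitzWith M (fun x => φ x • v x) := by
  obtain ⟨L, hL⟩ := hv.exists_local_lipschitz
  obtain ⟨K, hK⟩ := (hφ.smooth.of_le (by simp) : ContDiff ℝ 1 φ).lipschitzWith_of_hasCompactSupport
    hφ.compact (by simp)
  obtain ⟨C, hC⟩ := hφ.compact.exists_bound_of_continuous hφ.smooth.continuous
  obtain ⟨V, hV⟩ := hΩ.isBounded.isCompact_closure.exists_bound_of_continuousOn hv.continuousOn
  refine ⟨⟨|C| * L + K * |V|, by positivity⟩, lipschitzWith_of_local fun x => ?_⟩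
  by_cases hx : x ∈ Ω
  · filter_upwards [hL x (subset_closure hx), hΩ.isOpen.mem_nhds hx] with y hy hyΩ
    have h1 := hy (subset_closure hyΩ)
    have h2 : ‖φ y - φ x‖ ≤ K * ‖y - x‖ := by
      have := hK.dist_le_mul y x
      rwa [dist_eq_norm, dist_eq_norm] at this
    have e : φ y • v y - φ x • v x = φ y • (v y - v x) + (φ y - φ x) • v x := by
      rw [smul_sub, sub_smul]; abel
    rw [e]
    refine (norm_add_le _ _).trans ?_
    rw [norm_smul, norm_smul]
    have h3 := (hC y).trans (le_abs_self C)
    have h4 := (hV x (subset_closure hx)).trans (le_abs_self V)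
    calc ‖φ y‖ * ‖v y - v x‖ + ‖φ y - φ x‖ * ‖v x‖
        ≤ |C| * (L * ‖y - x‖) + (K * ‖y - x‖) * |V| := by gcongr
      _ = (|C| * L + K * |V|) * ‖y - x‖ := by ring
  · have hx' : x ∈ (tsupport φ)ᶜ := fun h => hx (hφ.support h)
    filter_upwards [(isClosed_tsupport φ).isOpen_compl.mem_nhds hx'] with y hy
    rw [image_eq_zero_of_notMem_tsupport hy, image_eq_zero_of_notMem_tsupport hx', zero_smul,
      zero_smul, sub_zero, norm_zero]
    exact mul_nonneg (NNReal.coe_nonneg _) (norm_nonneg _)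

/-- Integration by parts against the constant function 1. -/
theorem integral_lineDeriv_eq_zero {w : Plane → ℝ} {M : ℝ≥0} (hw : LipschitzWith M w)
    (hs : HasCompactSupport w) (e : Plane) : ∫ x, lineDeriv ℝ w x e = 0 := by
  have h := (LipschitzWith.const (1 : ℝ) : LipschitzWith 0 fun _ : Plane => (1 : ℝ)
    ).integral_lineDeriv_mul_eq (μ := volume) hw hs (-e)
  simp only [neg_neg, mul_one] at h
  rw [← h]
  have : ∀ x : Plane, lineDeriv ℝ (fun _ : Plane => (1 : ℝ)) x (-e) = 0 := fun x => by
    simp [lineDeriv]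
  simp [this]

/-- The gradient of a piecewise affine function, defined in the open cells. -/
def gradP1 (T : Triangulation Ω ΓD) (v : Plane → ℂ) (x : Plane) : EuclideanSpace ℂ (Fin 2) :=
  ∑ c ∈ T.finite_cells.toFinset.attach,
    (openHull c.1).indicator
      (fun _ => gradA (T.cellInterp ((Set.Finite.mem_toFinset _).1 c.2) v)) x

theorem gradP1_eq (v : Plane → ℂ) {c : Finset Plane} (hc : c ∈ T.cells) {x : Plane}
    (hx : x ∈ openHull c) : T.gradP1 v x = gradA (T.cellInterp hc v) := by
  rw [gradP1, Finset.sum_eq_single (⟨c, (Set.Finite.mem_toFinset _).2 hc⟩ :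
    {c // c ∈ T.finite_cells.toFinset})]
  · rw [Set.indicator_of_mem hx]
  · rintro ⟨c', hc'⟩ _ hne
    refine Set.indicator_of_notMem (fun h => ?_) _
    have hne' : c' ≠ c := fun h => hne (Subtype.ext h)
    exact Set.disjoint_left.1
      (T.disjoint_openHull ((Set.Finite.mem_toFinset _).1 hc') hc hne') h hx
  · simp

theorem memLp_gradP1 (hΩ : IsPolygonalLipschitz Ω) (v : Plane → ℂ) :
    MemLp (T.gradP1 v) 2 (volume.restrict Ω) := by
  have := hΩ.isFiniteMeasure
  have h : T.gradP1 v = ∑ c ∈ T.finite_cells.toFinset.attach, (openHull c.1).indicator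
      (fun _ => gradA (T.cellInterp ((Set.Finite.mem_toFinset _).1 c.2) v)) := by
    ext1 x
    rw [gradP1, Finset.sum_apply]
  rw [h]
  refine memLp_finsetSum' _ fun c _ => ?_
  exact (memLp_const _).indicator isOpen_interior.measurableSet

/-- Piecewise affine functions belong to the Sobolev space. -/
theorem IsP1.exists_H1 (hΩ : IsPolygonalLipschitz Ω) {v : Plane → ℂ} (hv : T.IsP1 v) :
    ∃ w : H1 Ω, Represents w v ∧ grad w =ᵐ[volume.restrict Ω] T.gradP1 v := by
  have := hΩ.isFiniteMeasure
  obtain ⟨V, hV⟩ := hΩ.isBounded.isCompact_closure.exists_bound_of_continuousOn hv.continuousOn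
  have hvm : AEStronglyMeasurable v (volume.restrict Ω) :=
    (hv.continuousOn.mono subset_closure).aestronglyMeasurable hΩ.isOpen.measurableSet
  have hvL : MemLp v 2 (volume.restrict Ω) := MemLp.of_bound hvm V <|
    (ae_restrict_mem hΩ.isOpen.measurableSet).mono fun x hx => hV x (subset_closure hx)
  refine Kirigami.exists_H1 hvL (memLp_gradP1 hΩ v) fun φ hφ j => ?_
  obtain ⟨M, hM⟩ := lipschitzWith_smul_of_isP1 hΩ hv hφ
  have hcs : HasCompactSupport (fun x => φ x • v x) := hφ.compact.smul_right
  have hGj : MemLp (fun x => T.gradP1 v x j) 2 (volume.restrict Ω) :=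
    (EuclideanSpace.proj (𝕜 := ℂ) j).comp_memLp' (memLp_gradP1 hΩ v)
  have hi1 := integrable_test_smul (hφ.continuous_partialDeriv j)
    (hφ.hasCompactSupport_partialDeriv j) hvL
  have hi2 := integrable_test_smul hφ.smooth.continuous hφ.compact hGj
  have hi : Integrable (fun x => partialDeriv j φ x • v x + φ x • T.gradP1 v x j)
      (volume.restrict Ω) := hi1.add hi2
  rw [← add_eq_zero_iff_eq_neg, ← integral_add hi1 hi2]
  -- The vanishing of the integral of a derivative is available for real-valued functions, so real
  -- and imaginary parts are treated through a real functional `ℓ`.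
  have key : ∀ ℓ : ℂ →L[ℝ] ℝ,
      ℓ (∫ x in Ω, (partialDeriv j φ x • v x + φ x • T.gradP1 v x j)) = 0 := by
    intro ℓ
    rw [← ℓ.integral_comp_comm hi]
    have hℓ := integral_lineDeriv_eq_zero (ℓ.lipschitz.comp hM) (hcs.comp_left (map_zero ℓ))
      (EuclideanSpace.single j 1)
    rw [← hℓ, ← integral_indicator hΩ.isOpen.measurableSet]
    refine integral_congr_ae ?_
    filter_upwards [(ae_restrict_iff' hΩ.isOpen.measurableSet).1
      (T.ae_mem_openHull hΩ.isOpen)] with x hx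
    by_cases hxΩ : x ∈ Ω
    · obtain ⟨c, hc, hxc⟩ := hx hxΩ
      rw [Set.indicator_of_mem hxΩ, gradP1_eq v hc hxc]
      have hd1 : HasFDerivAt φ (fderiv ℝ φ x) x :=
        (hφ.smooth.differentiable (by simp) x).hasFDerivAt
      set A := T.cellInterp hc v with hA
      have hd2 : HasFDerivAt A A.linear.toContinuousLinearMap x :=
        A.hasFDerivAt_toContinuousLinearMap x
      have hd3 := hd1.smul hd2
      have hd4 : HasFDerivAt (fun x => φ x • v x)
          (φ x • A.linear.toContinuousLinearMap + (fderiv ℝ φ x).smulRight (A x)) x := by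
        refine hd3.congr_of_eventuallyEq ?_
        filter_upwards [isOpen_interior.mem_nhds hxc] with y hy
        rw [hv.eq_cellInterp hc (interior_subset hy)]
        rfl
      have hd5 : HasFDerivAt (ℓ ∘ fun x => φ x • v x) _ x := ℓ.hasFDerivAt.comp x hd4
      rw [(hd5.hasLineDerivAt _).lineDeriv, hv.eq_cellInterp hc (interior_subset hxc)]
      simp only [ContinuousLinearMap.coe_comp, Function.comp]
      congr 1
      rw [add_comm]
      rfl
    · rw [Set.indicator_of_notMem hxΩ]
      have hx' : x ∈ (tsupport φ)ᶜ := fun h => hxΩ (hφ.support h)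
      have hd : HasFDerivAt (ℓ ∘ fun x => φ x • v x) (0 : Plane →L[ℝ] ℝ) x := by
        refine (hasFDerivAt_const (0 : ℝ) x).congr_of_eventuallyEq ?_
        filter_upwards [(isClosed_tsupport φ).isOpen_compl.mem_nhds hx'] with y hy
        simp [image_eq_zero_of_notMem_tsupport hy]
      rw [(hd.hasLineDerivAt _).lineDeriv]; rfl
  exact Complex.ext (key Complex.reCLM) (key Complex.imCLM)

end Triangulation

/-! ### Interpolation by piecewise affine functions -/

theorem sq_norm_gradA_le (A : Plane →ᵃ[ℝ] ℂ) {K : ℝ} (hK : ∀ w, ‖A.linear w‖ ≤ K * ‖w‖) :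
    ‖gradA A‖ ^ 2 ≤ 2 * K ^ 2 := by
  have h : ∀ j : Fin 2, ‖A.linear (EuclideanSpace.single j 1)‖ ^ 2 ≤ K ^ 2 := fun j => by
    have := hK (EuclideanSpace.single j 1)
    rw [PiLp.norm_single, norm_one, mul_one] at this
    exact pow_le_pow_left₀ (norm_nonneg _) this 2
  rw [EuclideanSpace.norm_sq_eq, Fin.sum_univ_two]
  have h0 := h 0
  have h1 := h 1
  simp only [gradA]
  linarith

theorem gradA_sub (A B : Plane →ᵃ[ℝ] ℂ) : gradA (A - B) = gradA A - gradA B := by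
  ext j
  simp [gradA]

theorem exists_gradA_eq (G : EuclideanSpace ℂ (Fin 2)) : ∃ A : Plane →ᵃ[ℝ] ℂ, gradA A = G := by
  let L : Plane →ₗ[ℝ] ℂ :=
    (LinearMap.toSpanSingleton ℝ ℂ (G 0)).comp (EuclideanSpace.proj (𝕜 := ℝ) (0 : Fin 2)).toLinearMap +
      (LinearMap.toSpanSingleton ℝ ℂ (G 1)).comp (EuclideanSpace.proj (𝕜 := ℝ) (1 : Fin 2)).toLinearMap
  refine ⟨L.toAffineMap, ?_⟩
  ext j
  fin_cases j <;> simp [gradA, L]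

namespace Triangulation

variable {Ω ΓD : Set Plane} {T : Triangulation Ω ΓD} {κ : ℝ}

theorem IsP1.grad_ae_eq (hΩ : IsPolygonalLipschitz Ω) {v : Plane → ℂ} (hv : T.IsP1 v) {w : H1 Ω}
    (hw : Represents w v) {c : Finset Plane} (hc : c ∈ T.cells) :
    ∀ᵐ x ∂(volume.restrict (openHull c)), grad w x = gradA (T.cellInterp hc v) := by
  obtain ⟨w', h1, h2⟩ := hv.exists_H1 hΩ
  obtain rfl := ext_represents hΩ.isOpen hw h1
  filter_upwards [ae_restrict_of_ae_restrict_of_subset (T.openHull_subset hΩ hc) h2,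
    ae_restrict_mem isOpen_interior.measurableSet] with x hx hxc
  rw [hx, T.gradP1_eq v hc hxc]

theorem cellInterp_affine {c : Finset Plane} (hc : c ∈ T.cells) (A : Plane →ᵃ[ℝ] ℂ) :
    T.cellInterp hc A = A :=
  (T.eqOn_cellInterp hc fun _ _ => rfl).symm

theorem grad_ae_eq_of_affine (T : Triangulation Ω ΓD) (hΩ : IsPolygonalLipschitz Ω) {A : Plane →ᵃ[ℝ] ℂ} {p : H1 Ω}
    (hp : Represents p A) : ∀ᵐ x ∂(volume.restrict Ω), grad p x = gradA A := by
  obtain ⟨p', h1, h2⟩ := (isP1_affine (T := T) A).exists_H1 hΩ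
  obtain rfl := ext_represents hΩ.isOpen hp h1
  filter_upwards [h2, T.ae_mem_openHull hΩ.isOpen] with x hx ⟨c, hc, hxc⟩
  rw [hx, T.gradP1_eq _ hc hxc, cellInterp_affine]

variable (T) in
theorem setIntegral_eq_sum (hΩ : IsPolygonalLipschitz Ω) {f : Plane → ℝ}
    (hf : IntegrableOn f Ω) :
    ∫ x in Ω, f x = ∑ c ∈ T.finite_cells.toFinset, ∫ x in openHull c, f x := by
  have hae : Ω =ᵐ[volume] ⋃ c ∈ T.finite_cells.toFinset, openHull c := by
    refine EventuallyLE.antisymm ?_ (LE.le.eventuallyLE ?_)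
    · have := (ae_restrict_iff' hΩ.isOpen.measurableSet).1 (T.ae_mem_openHull hΩ.isOpen)
      filter_upwards [this] with x hx hxΩ
      obtain ⟨c, hc, hxc⟩ := hx hxΩ
      exact Set.mem_biUnion (x := c) (by simpa using hc) hxc
    · refine Set.iUnion₂_subset fun c hc => T.openHull_subset hΩ (by simpa using hc)
  rw [setIntegral_congr_set hae, integral_biUnion_finset _ (fun c _ => isOpen_interior.measurableSet)]
  · intro c hc c' hc' hne
    exact T.disjoint_openHull (by simpa using hc) (by simpa using hc') hne
  · exact fun c hc => hf.mono_set (T.openHull_subset hΩ (by simpa using hc))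

/-! ### Patches and their bounded overlap -/

/-- The patch around a cell. -/
def patch (T : Triangulation Ω ΓD) (κ : ℝ) (c : Finset Plane) : Set Plane :=
  Metric.closedBall (T.center κ c) (2 * T.meshSize)

theorem Regular.volume_openHull_le (hT : T.Regular κ) {c : Finset Plane} (hc : c ∈ T.cells) :
    volume.real (openHull c) ≤ Real.pi * T.meshSize ^ 2 := by
  rw [← volume_real_closedBall (T.center κ c) hT.mesh_pos.le]
  exact measureReal_mono (interior_subset.trans (hull_subset_closedBall hc (hT.center_mem hc)))
    measure_closedBall_lt_top.ne

theorem Regular.closedBall_subset_patch (hT : T.Regular κ) {c : Finset Plane} (hc : c ∈ T.cells)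
    {a : Plane} (ha : a ∈ c) : Metric.closedBall a T.meshSize ⊆ T.patch κ c := by
  refine Metric.closedBall_subset_closedBall' ?_
  have := T.dist_le hc (subset_hull ha) (hT.center_mem hc)
  linarith

theorem Regular.hull_subset_patch (hT : T.Regular κ) {c : Finset Plane} (hc : c ∈ T.cells) :
    hull c ⊆ T.patch κ c :=
  (hull_subset_closedBall hc (hT.center_mem hc)).trans
    (Metric.closedBall_subset_closedBall (by linarith [hT.mesh_pos]))

/-- A cell whose patch contains `x` has its disc within `3 h` of `x`. Disjoint discs of radius `κ h`
leave room for at most `9 / κ²` such cells, so the patches overlap boundedly. -/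
theorem Regular.sum_patch_le (hT : T.Regular κ) {f : Plane → ℝ} (hf : IntegrableOn f Ω)
    (hf0 : ∀ x, 0 ≤ f x) :
    ∑ c ∈ T.finite_cells.toFinset, ∫ x in T.patch κ c ∩ Ω, f x ≤ 9 / κ ^ 2 * ∫ x in Ω, f x := by
  classical
  have hm : ∀ c, MeasurableSet (T.patch κ c) := fun c => Metric.isClosed_closedBall.measurableSet
  have h1 : ∀ c, ∫ x in T.patch κ c ∩ Ω, f x = ∫ x in Ω, (T.patch κ c).indicator f x := fun c => by
    rw [integral_indicator (hm c), Measure.restrict_restrict (hm c)]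
  simp_rw [h1]
  rw [← integral_finsetSum _ fun c _ => hf.integrable.indicator (hm c), ← integral_const_mul]
  refine integral_mono (integrable_finsetSum _ fun c _ => hf.integrable.indicator (hm c))
    (hf.integrable.const_mul _) fun x => ?_
  have h2 : ∑ c ∈ T.finite_cells.toFinset, (T.patch κ c).indicator f x =
      ((T.finite_cells.toFinset.filter fun c => x ∈ T.patch κ c).card : ℝ) * f x := by
    simp_rw [Set.indicator_apply]
    rw [← Finset.sum_filter, Finset.sum_const, nsmul_eq_mul]
  have h3 : (((T.finite_cells.toFinset.filter fun c => x ∈ T.patch κ c).card : ℝ)) *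
      (κ * T.meshSize) ^ 2 ≤ (3 * T.meshSize) ^ 2 := by
    have hpos := hT.mesh_pos
    refine hT.card_mul_le (x := x) (fun c hc => ?_) (by positivity) fun c hc => ?_
    · simpa using (Finset.mem_filter.1 hc).1
    · obtain ⟨hc1, hc2⟩ := Finset.mem_filter.1 hc
      have hc1 : c ∈ T.cells := by simpa using hc1
      refine ((hT.disc_subset hc1).trans interior_subset).trans
        ((hull_subset_closedBall hc1 (hT.center_mem hc1)).trans
          (Metric.closedBall_subset_closedBall' ?_))
      have : dist x (T.center κ c) ≤ 2 * T.meshSize := hc2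
      rw [dist_comm]; linarith
  have h4 : ((T.finite_cells.toFinset.filter fun c => x ∈ T.patch κ c).card : ℝ) ≤ 9 / κ ^ 2 := by
    have hκ := hT.pos
    have hpos := hT.mesh_pos
    rw [le_div_iff₀ (by positivity)]
    have h5 : 0 < T.meshSize ^ 2 := by positivity
    nlinarith
  simp only
  rw [h2]
  exact mul_le_mul_of_nonneg_right h4 (hf0 x)

/-! ### Nodal functionals and interpolation errors -/

/-- Nodal functionals that reproduce affine functions and are close to averages. -/
structure IsNodal (T : Triangulation Ω ΓD) (κ C : ℝ) (N : Plane → H1 Ω → ℂ) : Prop where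
  nonneg : 0 ≤ C
  map_sub : ∀ a ∈ T.vertices, ∀ u w, N a (u - w) = N a u - N a w
  affine : ∀ a ∈ T.vertices, ∀ (A : Plane →ᵃ[ℝ] ℂ) (p : H1 Ω), Represents p A → N a p = A a
  bound : ∀ a ∈ T.vertices, ∃ c ∈ T.cells, a ∈ c ∧
    ∀ u, ‖N a u - mean u (T.disc κ c)‖ ^ 2 ≤ C * energy u (hull c)

/-- The constant that bounds the distance of the nodal values to the averages over the cells. -/
def nodalConst (κ C : ℝ) : ℝ := 2 * C + 2 * ((κ ^ 4)⁻¹ * adjConst κ)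

theorem nodalConst_nonneg {C : ℝ} (hC : 0 ≤ C) : 0 ≤ nodalConst κ C := by
  unfold nodalConst adjConst; positivity

/-- The cell on which the functional at `a` is controlled need not be `c`; the averages over the two
cells are compared through the star of `a`. -/
theorem IsNodal.sq_norm_sub_mean_le (hΩ : IsPolygonalLipschitz Ω) (hT : T.Regular κ) {C : ℝ}
    {N : Plane → H1 Ω → ℂ} (hN : T.IsNodal κ C N) (u : H1 Ω) {c : Finset Plane}
    (hc : c ∈ T.cells) {a : Plane} (ha : a ∈ c) :
    ‖N a u - mean u (T.disc κ c)‖ ^ 2 ≤ nodalConst κ C * energy u (T.patch κ c) := by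
  obtain ⟨c', hc', ha', hb⟩ := hN.bound a (T.mem_vertices hc.1 ha)
  have h1 := hb u
  have h2 := sq_norm_mean_sub_star_le hΩ hT u hc' hc ha' ha
  have e1 : energy u (hull c') ≤ energy u (T.patch κ c) := energy_mono u <|
    Set.inter_subset_left.trans
      ((hull_subset_closedBall hc' (subset_hull ha')).trans (hT.closedBall_subset_patch hc ha))
  have e2 : energy u (Metric.closedBall a T.meshSize) ≤ energy u (T.patch κ c) := energy_mono u <|
    Set.inter_subset_left.trans (hT.closedBall_subset_patch hc ha)
  have h3 : ‖N a u - mean u (T.disc κ c)‖ ≤ ‖N a u - mean u (T.disc κ c')‖ +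
      ‖mean u (T.disc κ c') - mean u (T.disc κ c)‖ := norm_sub_le_norm_sub_add_norm_sub _ _ _
  have h4 : ‖N a u - mean u (T.disc κ c)‖ ^ 2 ≤ 2 * ‖N a u - mean u (T.disc κ c')‖ ^ 2 +
      2 * ‖mean u (T.disc κ c') - mean u (T.disc κ c)‖ ^ 2 := by
    refine (pow_le_pow_left₀ (norm_nonneg _) h3 2).trans ?_
    nlinarith [sq_nonneg (‖N a u - mean u (T.disc κ c')‖ -
      ‖mean u (T.disc κ c') - mean u (T.disc κ c)‖)]
  have hadj : 0 ≤ adjConst κ := by unfold adjConst; positivity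
  have hκ : 0 ≤ (κ ^ 4)⁻¹ := by positivity
  have h5 : C * energy u (hull c') ≤ C * energy u (T.patch κ c) :=
    mul_le_mul_of_nonneg_left e1 hN.nonneg
  have h6 : (κ ^ 4)⁻¹ * (adjConst κ * energy u (Metric.closedBall a T.meshSize)) ≤
      (κ ^ 4)⁻¹ * (adjConst κ * energy u (T.patch κ c)) := by gcongr
  calc _ ≤ 2 * (C * energy u (T.patch κ c)) +
        2 * ((κ ^ 4)⁻¹ * (adjConst κ * energy u (T.patch κ c))) := by linarith
    _ = nodalConst κ C * energy u (T.patch κ c) := by unfold nodalConst; ring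

/-- Inside the cell the interpolant is a convex combination of its nodal values. -/
theorem sq_norm_cellInterp_sub_le {c : Finset Plane} (hc : c ∈ T.cells) {n : Plane → ℂ} {m : ℂ}
    {M : ℝ} (hM : ∀ a ∈ c, ‖n a - m‖ ≤ M) {x : Plane} (hx : x ∈ hull c) :
    ‖T.cellInterp hc n x - m‖ ≤ M := by
  have h1 := (T.cellBasis hc).sum_coord_apply_eq_one x
  have h0 := (T.mem_hull_iff hc).1 hx
  have e : T.cellInterp hc n x - m = ∑ a : c, (T.cellBasis hc).coord a x • (n a - m) := by
    simp_rw [smul_sub, Finset.sum_sub_distrib]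
    rw [cellInterp_apply, ← Finset.sum_smul, h1, one_smul]
  rw [e]
  refine (norm_sum_le _ _).trans ?_
  calc ∑ a : c, ‖(T.cellBasis hc).coord a x • (n a - m)‖
      ≤ ∑ a : c, (T.cellBasis hc).coord a x * M := Finset.sum_le_sum fun a _ => by
        rw [norm_smul, Real.norm_of_nonneg (h0 a)]
        exact mul_le_mul_of_nonneg_left (hM a a.2) (h0 a)
    _ = M := by rw [← Finset.sum_mul, h1, one_mul]

theorem IsNodal.norm_cellInterp_sub_le (hΩ : IsPolygonalLipschitz Ω) (hT : T.Regular κ) {C : ℝ}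
    {N : Plane → H1 Ω → ℂ} (hN : T.IsNodal κ C N) (u : H1 Ω) {c : Finset Plane}
    (hc : c ∈ T.cells) {n : Plane → ℂ} (hn : ∀ a ∈ c, n a = N a u) {x : Plane} (hx : x ∈ hull c) :
    ‖T.cellInterp hc n x - mean u (T.disc κ c)‖ ≤
      √(nodalConst κ C * energy u (T.patch κ c)) :=
  sq_norm_cellInterp_sub_le hc (fun a ha => Real.le_sqrt_of_sq_le
    (by rw [hn a ha]; exact hN.sq_norm_sub_mean_le hΩ hT u hc ha)) hx

/-- An inverse estimate: on a disc of radius `κ h` the interpolant oscillates by at most `2M`, so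
its slope is at most `M / (κ h)`. The area of the cell, at most `π h²`, compensates `h⁻²`, and
stability holds uniformly in `h`. -/
theorem IsNodal.sq_norm_gradA_le (hΩ : IsPolygonalLipschitz Ω) (hT : T.Regular κ) {C : ℝ}
    {N : Plane → H1 Ω → ℂ} (hN : T.IsNodal κ C N) (u : H1 Ω) {c : Finset Plane}
    (hc : c ∈ T.cells) {n : Plane → ℂ} (hn : ∀ a ∈ c, n a = N a u) :
    volume.real (openHull c) * ‖gradA (T.cellInterp hc n)‖ ^ 2 ≤
      2 * Real.pi / κ ^ 2 * nodalConst κ C * energy u (T.patch κ c) := by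
  set M := √(nodalConst κ C * energy u (T.patch κ c)) with hM
  have hM2 : M ^ 2 = nodalConst κ C * energy u (T.patch κ c) :=
    Real.sq_sqrt (mul_nonneg (nodalConst_nonneg hN.nonneg) (energy_nonneg _ _))
  have hr := hT.radius_pos
  have hκ := hT.pos
  have hh := hT.mesh_pos
  have h1 := Kirigami.sq_norm_gradA_le (T.cellInterp hc n) (K := (2 * M) / (2 * (κ * T.meshSize))) <|
    norm_linear_le_of_ball _ hr fun x hx y hy => by
      have hx' := hN.norm_cellInterp_sub_le hΩ hT u hc hn (hT.closedBall_subset hc hx)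
      have hy' := hN.norm_cellInterp_sub_le hΩ hT u hc hn (hT.closedBall_subset hc hy)
      rw [norm_sub_rev] at hy'
      have := norm_sub_le_norm_sub_add_norm_sub (T.cellInterp hc n x) (mean u (T.disc κ c))
        (T.cellInterp hc n y)
      linarith
  calc _ ≤ (Real.pi * T.meshSize ^ 2) * (2 * ((2 * M) / (2 * (κ * T.meshSize))) ^ 2) :=
        mul_le_mul (hT.volume_openHull_le hc) h1 (sq_nonneg _) (by positivity)
    _ = 2 * Real.pi / κ ^ 2 * M ^ 2 := by field_simp
    _ = _ := by rw [hM2]; ring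

theorem setIntegral_sq_norm_sub_le {E : Type*} [NormedAddCommGroup E] {s : Set Plane}
    {f g : Plane → E} (m : Plane → E)
    (hf : IntegrableOn (fun x => ‖f x - m x‖ ^ 2) s)
    (hg : IntegrableOn (fun x => ‖g x - m x‖ ^ 2) s) :
    ∫ x in s, ‖f x - g x‖ ^ 2 ≤
      2 * (∫ x in s, ‖f x - m x‖ ^ 2) + 2 * ∫ x in s, ‖g x - m x‖ ^ 2 := by
  rw [← integral_const_mul, ← integral_const_mul,
    ← integral_add (hf.integrable.const_mul 2) (hg.integrable.const_mul 2)]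
  refine integral_mono_of_nonneg (ae_of_all _ fun _ => by positivity)
    ((hf.integrable.const_mul 2).add (hg.integrable.const_mul 2)) (ae_of_all _ fun x => ?_)
  simp only
  have h := norm_sub_le_norm_sub_add_norm_sub (f x) (m x) (g x)
  rw [norm_sub_rev (m x)] at h
  refine (pow_le_pow_left₀ (norm_nonneg _) h 2).trans ?_
  nlinarith [sq_nonneg (‖f x - m x‖ - ‖g x - m x‖)]

theorem integrableOn_sq_norm_sub {E : Type*} [NormedAddCommGroup E] {s : Set Plane}
    {f g : Plane → E} (hf : MemLp f 2 (volume.restrict s)) (hg : MemLp g 2 (volume.restrict s)) :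
    IntegrableOn (fun x => ‖f x - g x‖ ^ 2) s :=
  (memLp_two_iff_integrable_sq_norm (hf.sub hg).1).1 (hf.sub hg)

theorem integral_norm_sq_le_of_eLpNorm {E : Type*} [NormedAddCommGroup E] {μ : Measure Plane}
    {f : Plane → E} (hf : MemLp f 2 μ) {τ : ℝ} (hτ : 0 ≤ τ)
    (h : eLpNorm f 2 μ ≤ ENNReal.ofReal τ) : ∫ x, ‖f x‖ ^ 2 ∂μ ≤ τ ^ 2 := by
  have h1 := sq_norm_toLp_eq_integral (hf.toLp f)
  have h2 : ∫ x, ‖f x‖ ^ 2 ∂μ = ‖hf.toLp f‖ ^ 2 := by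
    rw [h1]
    exact integral_congr_ae (hf.coeFn_toLp.mono fun x hx => by simp only [hx])
  rw [h2, Lp.norm_toLp]
  exact pow_le_pow_left₀ ENNReal.toReal_nonneg (ENNReal.toReal_le_of_le_ofReal hτ h) 2

/-- The Poincaré inequality on the open cell with the average taken over its disc; the ratio of the
areas is at most `κ⁻²`. -/
theorem Regular.integral_sq_sub_mean_cell_le (hΩ : IsPolygonalLipschitz Ω) (hT : T.Regular κ)
    (u : H1 Ω) {c : Finset Plane} (hc : c ∈ T.cells) :
    ∫ x in openHull c, ‖value u x - mean u (T.disc κ c)‖ ^ 2 ≤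
      4 / κ ^ 2 * T.meshSize ^ 2 * energy u (openHull c) := by
  have := hΩ.isFiniteMeasure
  have hκ := hT.pos
  have hh := hT.mesh_pos
  have h3 := integral_sq_sub_mean_le hΩ.isOpen u (hT.disc_subset hc) isOpen_interior
    (convex_hull c).interior (T.openHull_subset hΩ hc)
    ((isCompact_hull c).isBounded.subset interior_subset)
    (d := T.meshSize) fun x hx y hy => T.dist_le hc (interior_subset hx) (interior_subset hy)
  have h5 : 4 * T.meshSize ^ 2 * volume.real (openHull c) * energy u (openHull c) ≤
      4 * T.meshSize ^ 2 * (Real.pi * T.meshSize ^ 2) * energy u (openHull c) := by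
    have := hT.volume_openHull_le hc
    have := energy_nonneg u (openHull c)
    gcongr
  have h6 := h3.trans h5
  rw [hT.volume_disc] at h6
  have hp : 0 < Real.pi * (κ * T.meshSize) ^ 2 := by positivity
  rw [mul_comm, ← le_div_iff₀ hp] at h6
  refine h6.trans (le_of_eq ?_)
  field_simp

/-- The `L²`-error of interpolation on a cell. -/
theorem IsNodal.mass_sub_cell_le (hΩ : IsPolygonalLipschitz Ω) (hT : T.Regular κ) {C : ℝ}
    {N : Plane → H1 Ω → ℂ} (hN : T.IsNodal κ C N) {u w : H1 Ω} {v : Plane → ℂ} (hv : T.IsP1 v)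
    (hw : Represents w v) (hvn : ∀ a ∈ T.vertices, v a = N a u) {c : Finset Plane}
    (hc : c ∈ T.cells) :
    ∫ x in openHull c, ‖value w x - value u x‖ ^ 2 ≤
      (2 * Real.pi * nodalConst κ C + 8 / κ ^ 2) * T.meshSize ^ 2 * energy u (T.patch κ c) := by
  have := hΩ.isFiniteMeasure
  have hcΩ := T.openHull_subset hΩ hc
  have hκ := hT.pos
  have hh := hT.mesh_pos
  have hn : ∀ a ∈ c, v a = N a u := fun a ha => hvn a (T.mem_vertices hc.1 ha)
  have hmu : MemLp (value u) 2 (volume.restrict (openHull c)) :=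
    (memLp_value u).mono_measure (Measure.restrict_mono_set _ hcΩ)
  have hmw : MemLp (value w) 2 (volume.restrict (openHull c)) :=
    (memLp_value w).mono_measure (Measure.restrict_mono_set _ hcΩ)
  have hfin : IsFiniteMeasure (volume.restrict (openHull c)) :=
    ⟨by rw [Measure.restrict_apply_univ]
        exact (measure_mono interior_subset).trans_lt (isCompact_hull c).measure_lt_top⟩
  have hmc : MemLp (fun _ : Plane => mean u (T.disc κ c)) 2 (volume.restrict (openHull c)) :=
    memLp_const _
  refine (setIntegral_sq_norm_sub_le (fun _ => mean u (T.disc κ c))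
    (integrableOn_sq_norm_sub hmw hmc) (integrableOn_sq_norm_sub hmu hmc)).trans ?_
  have h1 : ∫ x in openHull c, ‖value w x - mean u (T.disc κ c)‖ ^ 2 ≤
      Real.pi * T.meshSize ^ 2 * (nodalConst κ C * energy u (T.patch κ c)) := by
    have hnn : 0 ≤ nodalConst κ C * energy u (T.patch κ c) :=
      mul_nonneg (nodalConst_nonneg hN.nonneg) (energy_nonneg _ _)
    calc _ ≤ ∫ x in openHull c, nodalConst κ C * energy u (T.patch κ c) := by
          refine integral_mono_ae (integrableOn_sq_norm_sub hmw hmc) (integrable_const _) ?_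
          filter_upwards [ae_restrict_of_ae_restrict_of_subset hcΩ hw,
            ae_restrict_mem isOpen_interior.measurableSet] with x hx hxc
          rw [hx, hv.eq_cellInterp hc (interior_subset hxc)]
          have := hN.norm_cellInterp_sub_le hΩ hT u hc hn (interior_subset hxc)
          exact (Real.le_sqrt (norm_nonneg _) hnn).1 this
      _ = volume.real (openHull c) * (nodalConst κ C * energy u (T.patch κ c)) := by
          rw [setIntegral_const, smul_eq_mul]
      _ ≤ _ := mul_le_mul_of_nonneg_right (hT.volume_openHull_le hc) hnn
  have h2 : ∫ x in openHull c, ‖value u x - mean u (T.disc κ c)‖ ^ 2 ≤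
      4 / κ ^ 2 * T.meshSize ^ 2 * energy u (T.patch κ c) :=
    (hT.integral_sq_sub_mean_cell_le hΩ u hc).trans (mul_le_mul_of_nonneg_left (energy_mono u
      (Set.inter_subset_left.trans (interior_subset.trans (hT.hull_subset_patch hc))))
      (by positivity))
  calc _ ≤ 2 * (Real.pi * T.meshSize ^ 2 * (nodalConst κ C * energy u (T.patch κ c))) +
        2 * (4 / κ ^ 2 * T.meshSize ^ 2 * energy u (T.patch κ c)) := by linarith
    _ = _ := by ring

theorem energy_eq (u : H1 Ω) : energy u Ω = ∫ x in Ω, ‖grad u x‖ ^ 2 := by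
  rw [energy, Set.inter_self]

/-- The `L²`-error of interpolation. -/
theorem IsNodal.mass_sub_le (hΩ : IsPolygonalLipschitz Ω) (hT : T.Regular κ) {C : ℝ}
    {N : Plane → H1 Ω → ℂ} (hN : T.IsNodal κ C N) {u w : H1 Ω} {v : Plane → ℂ} (hv : T.IsP1 v)
    (hw : Represents w v) (hvn : ∀ a ∈ T.vertices, v a = N a u) :
    ∫ x in Ω, ‖value w x - value u x‖ ^ 2 ≤
      (2 * Real.pi * nodalConst κ C + 8 / κ ^ 2) * T.meshSize ^ 2 * (9 / κ ^ 2 * energy u Ω) := by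
  have := hΩ.isFiniteMeasure
  rw [T.setIntegral_eq_sum hΩ (integrableOn_sq_norm_sub (memLp_value w) (memLp_value u))]
  calc _ ≤ ∑ c ∈ T.finite_cells.toFinset, (2 * Real.pi * nodalConst κ C + 8 / κ ^ 2) *
        T.meshSize ^ 2 * energy u (T.patch κ c) :=
        Finset.sum_le_sum fun c hc => hN.mass_sub_cell_le hΩ hT hv hw hvn (by simpa using hc)
    _ ≤ _ := by
      rw [← Finset.mul_sum, energy_eq]
      refine mul_le_mul_of_nonneg_left (hT.sum_patch_le (integrableOn_sq_grad u)
        fun _ => by positivity) ?_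
      have := nodalConst_nonneg (κ := κ) hN.nonneg
      positivity

/-- The error of the gradient of the interpolant on a cell. -/
theorem IsNodal.energy_sub_cell_le (hΩ : IsPolygonalLipschitz Ω) (hT : T.Regular κ) {C : ℝ}
    {N : Plane → H1 Ω → ℂ} (hN : T.IsNodal κ C N) {u w : H1 Ω} {v : Plane → ℂ} (hv : T.IsP1 v)
    (hw : Represents w v) (hvn : ∀ a ∈ T.vertices, v a = N a u) {c : Finset Plane}
    (hc : c ∈ T.cells) (G : EuclideanSpace ℂ (Fin 2)) :
    ∫ x in openHull c, ‖grad w x - grad u x‖ ^ 2 ≤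
      (4 * Real.pi / κ ^ 2 * nodalConst κ C + 2) *
        ∫ x in T.patch κ c ∩ Ω, ‖grad u x - G‖ ^ 2 := by
  have := hΩ.isFiniteMeasure
  have hcΩ := T.openHull_subset hΩ hc
  have hn : ∀ a ∈ c, v a = N a u := fun a ha => hvn a (T.mem_vertices hc.1 ha)
  -- An affine function with gradient `G` is reproduced by interpolation. Subtracting it from `u`
  -- and applying the stability bound replaces the energy of `u` by that of `u` minus this function.
  obtain ⟨A, rfl⟩ := exists_gradA_eq G
  obtain ⟨p, hp, -⟩ := (isP1_affine (T := T) A).exists_H1 hΩ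
  have hpg := T.grad_ae_eq_of_affine hΩ hp
  have hen : energy (u - p) (T.patch κ c) = ∫ x in T.patch κ c ∩ Ω, ‖grad u x - gradA A‖ ^ 2 := by
    refine integral_congr_ae ?_
    filter_upwards [ae_restrict_of_ae_restrict_of_subset Set.inter_subset_right (grad_sub u p),
      ae_restrict_of_ae_restrict_of_subset Set.inter_subset_right hpg] with x h1 h2
    rw [h1, h2]
  have hmu : MemLp (grad u) 2 (volume.restrict (openHull c)) :=
    (memLp_grad u).mono_measure (Measure.restrict_mono_set _ hcΩ)
  have hmw : MemLp (grad w) 2 (volume.restrict (openHull c)) :=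
    (memLp_grad w).mono_measure (Measure.restrict_mono_set _ hcΩ)
  have hfin : IsFiniteMeasure (volume.restrict (openHull c)) :=
    ⟨by rw [Measure.restrict_apply_univ]
        exact (measure_mono interior_subset).trans_lt (isCompact_hull c).measure_lt_top⟩
  have hmc : MemLp (fun _ : Plane => gradA A) 2 (volume.restrict (openHull c)) := memLp_const _
  refine (setIntegral_sq_norm_sub_le (fun _ => gradA A)
    (integrableOn_sq_norm_sub hmw hmc) (integrableOn_sq_norm_sub hmu hmc)).trans ?_
  have hsub : T.cellInterp hc (fun x => v x - A x) = T.cellInterp hc v - A := by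
    refine (T.eqOn_cellInterp hc fun x hx => ?_).symm
    rw [hv.eq_cellInterp hc hx]; rfl
  have h1 : ∫ x in openHull c, ‖grad w x - gradA A‖ ^ 2 =
      volume.real (openHull c) * ‖gradA (T.cellInterp hc fun x => v x - A x)‖ ^ 2 := by
    rw [hsub, gradA_sub, ← smul_eq_mul, ← setIntegral_const]
    refine integral_congr_ae ?_
    filter_upwards [hv.grad_ae_eq hΩ hw hc] with x hx
    rw [hx]
  have h2 := hN.sq_norm_gradA_le hΩ hT (u - p) hc (n := fun x => v x - A x) fun a ha => by
    rw [hN.map_sub a (T.mem_vertices hc.1 ha), hn a ha,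
      hN.affine a (T.mem_vertices hc.1 ha) A p hp]
  have h3 : ∫ x in openHull c, ‖grad u x - gradA A‖ ^ 2 ≤
      ∫ x in T.patch κ c ∩ Ω, ‖grad u x - gradA A‖ ^ 2 := by
    refine setIntegral_mono_set ?_ (ae_of_all _ fun _ => by positivity)
      (LE.le.eventuallyLE (Set.subset_inter
        (interior_subset.trans (hT.hull_subset_patch hc)) hcΩ))
    exact (integrableOn_sq_norm_sub (memLp_grad u) (memLp_const (gradA A))).mono_set
      Set.inter_subset_right
  rw [hen] at h2
  rw [h1]
  calc _ ≤ 2 * (2 * Real.pi / κ ^ 2 * nodalConst κ C *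
        ∫ x in T.patch κ c ∩ Ω, ‖grad u x - gradA A‖ ^ 2) +
        2 * ∫ x in T.patch κ c ∩ Ω, ‖grad u x - gradA A‖ ^ 2 := by linarith
    _ = _ := by ring

/-- The error of the gradient of the interpolant, in terms of the oscillation of a function. -/
theorem IsNodal.energy_sub_le (hΩ : IsPolygonalLipschitz Ω) (hT : T.Regular κ) {C : ℝ}
    {N : Plane → H1 Ω → ℂ} (hN : T.IsNodal κ C N) {u w : H1 Ω} {v : Plane → ℂ} (hv : T.IsP1 v)
    (hw : Represents w v) (hvn : ∀ a ∈ T.vertices, v a = N a u)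
    {G : Plane → EuclideanSpace ℂ (Fin 2)} (hG : MemLp G 2 (volume.restrict Ω)) {δ : ℝ}
    (hδ : ∀ x y, dist x y ≤ 2 * T.meshSize → ‖G x - G y‖ ≤ δ) :
    ∫ x in Ω, ‖grad w x - grad u x‖ ^ 2 ≤
      (4 * Real.pi / κ ^ 2 * nodalConst κ C + 2) *
        (9 / κ ^ 2 * (2 * (∫ x in Ω, ‖grad u x - G x‖ ^ 2) + 2 * δ ^ 2 * volume.real Ω)) := by
  have := hΩ.isFiniteMeasure
  have hint := integrableOn_sq_norm_sub (memLp_grad u) hG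
  have hint2 : IntegrableOn (fun x => 2 * ‖grad u x - G x‖ ^ 2 + 2 * δ ^ 2) Ω :=
    (hint.const_mul 2).add (integrableOn_const (measure_ne_top_of_subset (t := Ω) subset_rfl
      (by rw [← Measure.restrict_apply_univ]; exact measure_ne_top _ _)))
  have hcon := nodalConst_nonneg (κ := κ) hN.nonneg
  rw [T.setIntegral_eq_sum hΩ (integrableOn_sq_norm_sub (memLp_grad w) (memLp_grad u))]
  calc _ ≤ ∑ c ∈ T.finite_cells.toFinset, (4 * Real.pi / κ ^ 2 * nodalConst κ C + 2) *
        ∫ x in T.patch κ c ∩ Ω, (2 * ‖grad u x - G x‖ ^ 2 + 2 * δ ^ 2) := by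
        refine Finset.sum_le_sum fun c hc => ?_
        -- On each patch the field is frozen at the centre of the cell, from which it deviates by at
        -- most `δ`.
        refine (hN.energy_sub_cell_le hΩ hT hv hw hvn (by simpa using hc)
          (G (T.center κ c))).trans (mul_le_mul_of_nonneg_left ?_ (by positivity))
        refine setIntegral_mono_on ?_ (hint2.mono_set Set.inter_subset_right)
          (Metric.isClosed_closedBall.measurableSet.inter hΩ.isOpen.measurableSet) fun x hx => ?_
        · exact (integrableOn_sq_norm_sub (memLp_grad u)
            (memLp_const (G (T.center κ c)))).mono_set Set.inter_subset_right
        · have h1 := hδ x (T.center κ c) hx.1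
          have h2 := norm_sub_le_norm_sub_add_norm_sub (grad u x) (G x) (G (T.center κ c))
          have h3 : ‖grad u x - G (T.center κ c)‖ ≤ ‖grad u x - G x‖ + δ := by linarith
          refine (pow_le_pow_left₀ (norm_nonneg _) h3 2).trans ?_
          nlinarith [sq_nonneg (‖grad u x - G x‖ - δ)]
    _ ≤ (4 * Real.pi / κ ^ 2 * nodalConst κ C + 2) *
        (9 / κ ^ 2 * ∫ x in Ω, (2 * ‖grad u x - G x‖ ^ 2 + 2 * δ ^ 2)) := by
        rw [← Finset.mul_sum]
        exact mul_le_mul_of_nonneg_left (hT.sum_patch_le hint2 fun _ => by positivity)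
          (by positivity)
    _ = _ := by
        rw [integral_add (hint.const_mul 2) (integrable_const _), integral_const_mul,
          integral_const, measureReal_restrict_apply_univ, smul_eq_mul]
        ring

/-- Interpolants converge. -/
theorem tendsto_interpolant (hΩ : IsPolygonalLipschitz Ω) {ι : Type*} {l : Filter ι}
    {T : ι → Triangulation Ω ΓD} {C : ℝ} {N : ι → Plane → H1 Ω → ℂ}
    (hT : ∀ᶠ i in l, (T i).Regular κ ∧ (T i).IsNodal κ C (N i))
    (hh : Tendsto (fun i => (T i).meshSize) l (𝓝 0)) (u : H1 Ω) {w : ι → H1 Ω}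
    (hw : ∀ᶠ i in l, ∃ v, (T i).IsP1 v ∧ Represents (w i) v ∧
      ∀ a ∈ (T i).vertices, v a = N i a u) : Tendsto w l (𝓝 u) := by
  have hfin := hΩ.isFiniteMeasure
  rcases l.eq_or_neBot with rfl | hl
  · exact tendsto_bot
  obtain ⟨i₀, hi₀⟩ := hT.exists
  have hκ := hi₀.1.pos
  have hcon := nodalConst_nonneg (κ := κ) hi₀.2.nonneg
  rw [tendsto_iff_norm_sub_tendsto_zero]
  have key : Tendsto (fun i => ‖w i - u‖ ^ 2) l (𝓝 0) := by
    refine tendsto_order.2 ⟨fun a ha => Eventually.of_forall fun i =>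
      ha.trans_le (sq_nonneg _), fun η hη => ?_⟩
    -- No regularity of `u` beyond `H¹` is available. Its gradient is approximated in `L²` by a
    -- compactly supported continuous field, which is uniformly continuous and hence nearly constant
    -- on patches of a fine mesh. The tolerances `τ` and `δ` make each gradient term at most `η/4`;
    -- the `L²` error takes the other `η/2`. Adding 1 to the area avoids division by zero.
    obtain ⟨K, hK⟩ : ∃ K, K = (4 * Real.pi / κ ^ 2 * nodalConst κ C + 2) * (9 / κ ^ 2) := ⟨_, rfl⟩
    have hK0 : 0 < K := by rw [hK]; positivity
    obtain ⟨τ, hτ⟩ : ∃ τ, τ = η / (8 * K) := ⟨_, rfl⟩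
    have hτ0 : 0 < τ := by rw [hτ]; positivity
    obtain ⟨G, hGs, hGle, hGc, hGm⟩ := (memLp_grad u).exists_hasCompactSupport_eLpNorm_sub_le
      (by norm_num) (ε := ENNReal.ofReal (√τ)) (by simpa using Real.sqrt_pos.2 hτ0)
    have hG2 : ∫ x in Ω, ‖grad u x - G x‖ ^ 2 ≤ τ := by
      have h1 := integral_norm_sq_le_of_eLpNorm ((memLp_grad u).sub hGm) (Real.sqrt_nonneg τ) hGle
      rwa [Real.sq_sqrt hτ0.le] at h1
    obtain ⟨δ, hδ⟩ : ∃ δ, δ = √(η / (8 * K * (volume.real Ω + 1))) := ⟨_, rfl⟩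
    have hv0 : 0 ≤ volume.real Ω := measureReal_nonneg
    have hδ0 : 0 < δ := by rw [hδ]; exact Real.sqrt_pos.2 (by positivity)
    have hδ2 : δ ^ 2 * volume.real Ω ≤ η / (8 * K) := by
      rw [hδ, Real.sq_sqrt (by positivity), div_mul_eq_mul_div, div_le_div_iff₀ (by positivity)
        (by positivity)]
      nlinarith [mul_pos hη hK0]
    obtain ⟨ρ, hρ, hρG⟩ := Metric.uniformContinuous_iff.1
      (hGc.uniformContinuous_of_tendsto_cocompact hGs.is_zero_at_infty) δ hδ0
    have hmass : Tendsto (fun i => (2 * Real.pi * nodalConst κ C + 8 / κ ^ 2) *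
        (T i).meshSize ^ 2 * (9 / κ ^ 2 * energy u Ω)) l (𝓝 0) := by
      have := ((hh.pow 2).const_mul (2 * Real.pi * nodalConst κ C + 8 / κ ^ 2)).mul_const
        (9 / κ ^ 2 * energy u Ω)
      simpa using this
    filter_upwards [hT, hw, hmass.eventually (gt_mem_nhds (half_pos hη)),
      hh.eventually (gt_mem_nhds (half_pos hρ))] with i ⟨hi1, hi2⟩ ⟨v, hv1, hv2, hv3⟩ hm hρi
    have h1 := hi2.mass_sub_le hΩ hi1 hv1 hv2 hv3
    have h2 := hi2.energy_sub_le hΩ hi1 hv1 hv2 hv3 hGm (δ := δ) fun x y hxy => by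
      rw [← dist_eq_norm]
      exact (hρG (by linarith)).le
    have e1 : ∫ x in Ω, ‖value (w i - u) x‖ ^ 2 = ∫ x in Ω, ‖value (w i) x - value u x‖ ^ 2 :=
      integral_congr_ae ((value_sub (w i) u).mono fun x hx => by simp only [hx])
    have e2 : ∫ x in Ω, ‖grad (w i - u) x‖ ^ 2 = ∫ x in Ω, ‖grad (w i) x - grad u x‖ ^ 2 :=
      integral_congr_ae ((grad_sub (w i) u).mono fun x hx => by simp only [hx])
    rw [sq_norm_eq, e1, e2]
    rw [← mul_assoc, ← hK] at h2
    have h3 : K * (2 * (∫ x in Ω, ‖grad u x - G x‖ ^ 2) + 2 * δ ^ 2 * volume.real Ω) ≤ η / 2 := by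
      calc _ ≤ K * (2 * (η / (8 * K)) + 2 * (η / (8 * K))) := by
            refine mul_le_mul_of_nonneg_left ?_ hK0.le
            rw [hτ] at hG2
            linarith
        _ = η / 2 := by field_simp; norm_num
    linarith
  have := (Real.continuous_sqrt.tendsto 0).comp key
  simpa [Function.comp_def, Real.sqrt_sq (norm_nonneg _)] using this

end Triangulation

/-! ### Density of continuous functions -/

/-- The pairing of a gradient with a real vector. -/
def pair (G : EuclideanSpace ℂ (Fin 2)) (y : Plane) : ℂ := ∑ j, (y j : ℂ) * G j

theorem norm_pair_le (G : EuclideanSpace ℂ (Fin 2)) (y : Plane) : ‖pair G y‖ ≤ 2 * ‖y‖ * ‖G‖ := by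
  refine (norm_sum_le _ _).trans ?_
  have h : ∀ j : Fin 2, ‖(y j : ℂ) * G j‖ ≤ ‖y‖ * ‖G‖ := fun j => by
    rw [norm_mul, Complex.norm_real]
    exact mul_le_mul (PiLp.norm_apply_le y j) (PiLp.norm_apply_le G j) (norm_nonneg _)
      (norm_nonneg _)
  rw [Fin.sum_univ_two]
  linarith [h 0, h 1]

theorem pair_sub (G H : EuclideanSpace ℂ (Fin 2)) (y : Plane) :
    pair (G - H) y = pair G y - pair H y := by
  simp only [pair, Fin.sum_univ_two, PiLp.sub_apply]
  ring

/-- An affine function is its own Taylor polynomial of degree one, which is why averaged Taylor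
polynomials reproduce it. -/
theorem pair_gradA (A : Plane →ᵃ[ℝ] ℂ) (x y : Plane) : pair (gradA A) (y - x) = A y - A x := by
  have e : y - x = ∑ j, (y - x) j • EuclideanSpace.single j (1 : ℝ) := by
    ext i
    fin_cases i <;> simp
  have h : A y - A x = A.linear (y - x) := by
    rw [← vsub_eq_sub, ← vsub_eq_sub y, AffineMap.linearMap_vsub]
  rw [h]
  conv_rhs => rw [e, map_sum]
  simp only [pair, gradA, map_smul, Complex.real_smul]

namespace Triangulation

variable {Ω ΓD : Set Plane} {T : Triangulation Ω ΓD} {κ : ℝ}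

/-- The nodal value given by the averaged Taylor polynomial of degree one. -/
def taylorNodal (T : Triangulation Ω ΓD) (κ : ℝ) (f : Plane → Finset Plane) (a : Plane)
    (u : H1 Ω) : ℂ :=
  ⨍ x in T.disc κ (f a), (value u x + pair (grad u x) (a - x))

theorem stronglyMeasurable_pair (u : H1 Ω) (a : Plane) :
    StronglyMeasurable fun x => pair (grad u x) (a - x) := by
  have h : ∀ j : Fin 2, StronglyMeasurable fun x => (((a - x) j : ℝ) : ℂ) * grad u x j := fun j => by
    have h1 : Continuous fun x : Plane => (((a - x) j : ℝ) : ℂ) := by fun_prop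
    exact h1.stronglyMeasurable.mul
      ((EuclideanSpace.proj (𝕜 := ℂ) j).continuous.comp_stronglyMeasurable
        (stronglyMeasurable_grad u))
  simp only [pair, Fin.sum_univ_two]
  exact (h 0).add (h 1)

theorem integrableOn_pair [IsFiniteMeasure (volume.restrict Ω)] {D : Set Plane} (hDm : MeasurableSet D)
    (hD : D ⊆ Ω) (u : H1 Ω) (a : Plane) {d : ℝ} (hd : ∀ x ∈ D, dist x a ≤ d) :
    IntegrableOn (fun x => pair (grad u x) (a - x)) D := by
  have hi : Integrable (grad u) (volume.restrict D) := (integrableOn_grad u).mono_set hD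
  have hb : ∀ᵐ x ∂(volume.restrict D), ‖pair (grad u x) (a - x)‖ ≤ 2 * d * ‖grad u x‖ := by
    filter_upwards [ae_restrict_mem hDm] with x hx
    refine (norm_pair_le _ _).trans (mul_le_mul_of_nonneg_right ?_ (norm_nonneg _))
    have := hd x hx
    rw [dist_comm, dist_eq_norm] at this
    linarith
  exact Integrable.mono' (hi.norm.const_mul (2 * d))
    (stronglyMeasurable_pair u a).aestronglyMeasurable hb

theorem Regular.volume_disc_ne_zero (hT : T.Regular κ) (c : Finset Plane) :
    volume (T.disc κ c) ≠ 0 := (Metric.measure_ball_pos volume _ hT.radius_pos).ne'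

theorem volume_disc_ne_top (c : Finset Plane) : volume (T.disc κ c) ≠ ⊤ := measure_ball_lt_top.ne

/-- Averaged Taylor polynomials give nodal functionals. -/
theorem Regular.exists_isNodal (hΩ : IsPolygonalLipschitz Ω) (hT : T.Regular κ) :
    ∃ N, T.IsNodal κ (4 / (Real.pi * κ ^ 2)) N := by
  have hfin := hΩ.isFiniteMeasure
  have hκ := hT.pos
  have hh := hT.mesh_pos
  -- Traces are not yet at hand, so each nodal value is formed from the interior of one arbitrary
  -- cell at the vertex.
  choose! f hfc hfa using fun a ha => T.exists_cell_of_vertex (a := a) ha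
  have hsub : ∀ a ∈ T.vertices, T.disc κ (f a) ⊆ Ω := fun a ha =>
    (hT.disc_subset (hfc a ha)).trans (T.openHull_subset hΩ (hfc a ha))
  have hdist : ∀ a ∈ T.vertices, ∀ x ∈ T.disc κ (f a), dist x a ≤ T.meshSize := fun a ha x hx =>
    T.dist_le (hfc a ha) (interior_subset (hT.disc_subset (hfc a ha) hx)) (subset_hull (hfa a ha))
  have hmeas : ∀ a, MeasurableSet (T.disc κ (f a)) := fun a => Metric.isOpen_ball.measurableSet
  have hpair : ∀ a ∈ T.vertices, ∀ u : H1 Ω,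
      IntegrableOn (fun x => pair (grad u x) (a - x)) (T.disc κ (f a)) := fun a ha u =>
    integrableOn_pair (hmeas a) (hsub a ha) u a (hdist a ha)
  have hval : ∀ a ∈ T.vertices, ∀ u : H1 Ω, IntegrableOn (value u) (T.disc κ (f a)) :=
    fun a ha u => (integrableOn_value u).mono_set (hsub a ha)
  have hint : ∀ a ∈ T.vertices, ∀ u : H1 Ω,
      IntegrableOn (fun x => value u x + pair (grad u x) (a - x)) (T.disc κ (f a)) :=
    fun a ha u => (hval a ha u).add (hpair a ha u)
  refine ⟨T.taylorNodal κ f, by positivity, fun a ha u w => ?_, fun a ha A p hp => ?_,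
    fun a ha => ⟨f a, hfc a ha, hfa a ha, fun u => ?_⟩⟩
  · simp only [taylorNodal, setAverage_eq]
    rw [← smul_sub, ← integral_sub (hint a ha u) (hint a ha w)]
    congr 1
    refine integral_congr_ae ?_
    filter_upwards [ae_restrict_of_ae_restrict_of_subset (hsub a ha) (value_sub u w),
      ae_restrict_of_ae_restrict_of_subset (hsub a ha) (grad_sub u w)] with x h1 h2
    rw [h1, h2, pair_sub]
    ring
  · have : ∀ᵐ x ∂(volume.restrict (T.disc κ (f a))),
        value p x + pair (grad p x) (a - x) = A a := by
      filter_upwards [ae_restrict_of_ae_restrict_of_subset (hsub a ha) hp,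
        ae_restrict_of_ae_restrict_of_subset (hsub a ha)
          (T.grad_ae_eq_of_affine hΩ hp)] with x h1 h2
      rw [h1, h2, pair_gradA]
      ring
    rw [taylorNodal, average_congr this]
    exact setAverage_const (hT.volume_disc_ne_zero _) (volume_disc_ne_top _) _
  · have e : T.taylorNodal κ f a u - mean u (T.disc κ (f a)) =
        ⨍ x in T.disc κ (f a), pair (grad u x) (a - x) := by
      rw [taylorNodal, mean]
      simp only [setAverage_eq]
      rw [← smul_sub, ← integral_sub (hint a ha u) (hval a ha u)]
      simp
    have hfd : IsFiniteMeasure (volume.restrict (T.disc κ (f a))) :=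
      ⟨by rw [Measure.restrict_apply_univ]; exact measure_ball_lt_top⟩
    -- The linear term is at most `2 h |∇u|` and the disc has area `π κ² h²`, so the constant is `4
    -- / (π κ²)`.
    have h1 := measure_mul_sq_enorm_sub_average_le _ (hpair a ha u) 0
    simp only [zero_sub, enorm_neg, Measure.restrict_apply_univ] at h1
    have h2 : ∫⁻ x in T.disc κ (f a), ‖pair (grad u x) (a - x)‖ₑ ^ 2 ≤
        ENNReal.ofReal ((2 * T.meshSize) ^ 2 * energy u (hull (f a))) := by
      calc _ ≤ ∫⁻ x in T.disc κ (f a), ENNReal.ofReal ((2 * T.meshSize) ^ 2) * ‖grad u x‖ₑ ^ 2 := by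
            refine setLIntegral_mono_ae' (hmeas a) (ae_of_all _ fun x hx => ?_)
            have h3 := norm_pair_le (grad u x) (a - x)
            have h4 := hdist a ha x hx
            rw [dist_comm, dist_eq_norm] at h4
            have h5 : ‖pair (grad u x) (a - x)‖ ≤ 2 * T.meshSize * ‖grad u x‖ :=
              h3.trans (by gcongr)
            rw [← ofReal_norm, ← ofReal_norm, ← ENNReal.ofReal_pow (norm_nonneg _),
              ← ENNReal.ofReal_pow (norm_nonneg _), ← ENNReal.ofReal_mul (sq_nonneg _), ← mul_pow]
            exact ENNReal.ofReal_le_ofReal (pow_le_pow_left₀ (norm_nonneg _) h5 2)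
        _ = ENNReal.ofReal ((2 * T.meshSize) ^ 2) * ENNReal.ofReal (energy u (T.disc κ (f a))) := by
            rw [lintegral_const_mul' _ _ ENNReal.ofReal_ne_top, lintegral_grad_eq u (hsub a ha)]
        _ ≤ _ := by
            rw [← ENNReal.ofReal_mul (sq_nonneg _)]
            refine ENNReal.ofReal_le_ofReal (mul_le_mul_of_nonneg_left (energy_mono u ?_)
              (sq_nonneg _))
            exact Set.inter_subset_left.trans ((hT.disc_subset (hfc a ha)).trans interior_subset)
    have h3 := h1.trans h2
    rw [← ofReal_norm, ← ENNReal.ofReal_pow (norm_nonneg _),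
      ← ENNReal.ofReal_toReal (volume_disc_ne_top (f a)), ← ENNReal.ofReal_mul (by positivity),
      ENNReal.ofReal_le_ofReal_iff (mul_nonneg (sq_nonneg _) (energy_nonneg _ _))] at h3
    change volume.real (T.disc κ (f a)) * _ ≤ _ at h3
    rw [hT.volume_disc] at h3
    rw [e]
    have hp : 0 < Real.pi * (κ * T.meshSize) ^ 2 := by positivity
    rw [mul_comm, ← le_div_iff₀ hp] at h3
    refine h3.trans (le_of_eq ?_)
    field_simp
    ring

/-- The functions that are continuous up to the boundary are dense in the Sobolev space. -/
theorem dense_continuous (hΩ : IsPolygonalLipschitz Ω) {ι : Type*} {l : Filter ι} [l.NeBot]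
    {T : ι → Triangulation Ω ΓD} (hT : ∀ᶠ i in l, (T i).Regular κ)
    (hh : Tendsto (fun i => (T i).meshSize) l (𝓝 0)) :
    Dense {w : H1 Ω | ∃ v, ContinuousOn v (closure Ω) ∧ Represents w v} := by
  intro u
  -- Regularity holds only eventually; for the other indices a piecewise affine function with zero
  -- nodal values is a harmless default.
  have h : ∀ i, ∃ w : H1 Ω, ∃ v, (T i).IsP1 v ∧ Represents w v ∧
      ((T i).Regular κ → ∃ N, (T i).IsNodal κ (4 / (Real.pi * κ ^ 2)) N ∧
        ∀ a ∈ (T i).vertices, v a = N a u) := fun i => by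
    by_cases hi : (T i).Regular κ
    · obtain ⟨N, hN⟩ := hi.exists_isNodal hΩ
      obtain ⟨v, hv, hvn⟩ := (T i).exists_isP1 fun a => N a u
      obtain ⟨w, hw, -⟩ := hv.exists_H1 hΩ
      exact ⟨w, v, hv, hw, fun _ => ⟨N, hN, hvn⟩⟩
    · obtain ⟨v, hv, hvn⟩ := (T i).exists_isP1 fun _ => 0
      obtain ⟨w, hw, -⟩ := hv.exists_H1 hΩ
      exact ⟨w, v, hv, hw, fun h => absurd h hi⟩
  choose w v hv hw hN using h
  choose! N hN using hN
  have ht : Tendsto w l (𝓝 u) := tendsto_interpolant hΩ (N := N)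
    (hT.mono fun i hi => ⟨hi, (hN i hi).1⟩) hh u
    (hT.mono fun i hi => ⟨v i, hv i, hw i, (hN i hi).2⟩)
  exact mem_closure_of_tendsto ht (Eventually.of_forall fun i => ⟨v i, (hv i).continuousOn, hw i⟩)

end Triangulation

section

/-! ### Traces -/

/-- The curve `S` carries traces of Sobolev functions. -/
structure Traceable (Ω S : Set Plane) : Prop where
  measurableSet : MeasurableSet S
  subset : S ⊆ closure Ω
  dense : Dense {w : H1 Ω | ∃ v, ContinuousOn v (closure Ω) ∧ Represents w v}
  bound : ∃ C : ℝ≥0, ∀ (w : H1 Ω) (v : Plane → ℂ), ContinuousOn v (closure Ω) → Represents w v →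
    eLpNorm v 2 (arcLength S) ≤ C * ‖w‖ₑ

variable {Ω S : Set Plane}

theorem Traceable.mono (h : Traceable Ω S) {S' : Set Plane} (hS' : MeasurableSet S')
    (hs : S' ⊆ S) : Traceable Ω S' where
  measurableSet := hS'
  subset := hs.trans h.subset
  dense := h.dense
  bound := h.bound.imp fun _ hC w v hv hw =>
    (eLpNorm_mono_measure v (Measure.restrict_mono hs le_rfl)).trans (hC w v hv hw)

theorem Traceable.memLp (h : Traceable Ω S) {w : H1 Ω} {v : Plane → ℂ}
    (hv : ContinuousOn v (closure Ω)) (hw : Represents w v) : MemLp v 2 (arcLength S) := by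
  obtain ⟨C, hC⟩ := h.bound
  refine ⟨(hv.mono h.subset).aestronglyMeasurable h.measurableSet, (hC w v hv hw).trans_lt ?_⟩
  exact ENNReal.mul_lt_top ENNReal.coe_lt_top enorm_lt_top

theorem Traceable.isTraceOn_of_continuousOn (h : Traceable Ω S) {w : H1 Ω} {v : Plane → ℂ}
    (hv : ContinuousOn v (closure Ω)) (hw : Represents w v) : IsTraceOn Ω S w v :=
  ⟨h.memLp hv hw, fun _ => w, fun _ => v, fun _ => ⟨hv, hw⟩, tendsto_const_nhds, by simp⟩

/-- The same approximating sequence serves on a smaller curve. This links the trace on `∂Ω` with the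
traces on single edges. -/
theorem IsTraceOn.mono {u : H1 Ω} {t : Plane → ℂ} (h : IsTraceOn Ω S u t) {S' : Set Plane}
    (hs : S' ⊆ S) : IsTraceOn Ω S' u t := by
  have hμ : arcLength S' ≤ arcLength S := Measure.restrict_mono hs le_rfl
  obtain ⟨ht, w, v, h1, h2, h3⟩ := h
  exact ⟨ht.mono_measure hμ, w, v, h1, h2, tendsto_of_tendsto_of_tendsto_of_le_of_le
    tendsto_const_nhds h3 (fun _ => zero_le) fun n => eLpNorm_mono_measure _ hμ⟩

/-- The bound applied to differences makes the restrictions of an approximating sequence a Cauchy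
sequence in `L²(S)`. -/
theorem Traceable.exists_isTraceOn (h : Traceable Ω S) (u : H1 Ω) : ∃ t, IsTraceOn Ω S u t := by
  obtain ⟨C, hC⟩ := h.bound
  obtain ⟨w, hw, hwu⟩ := mem_closure_iff_seq_limit.1 (h.dense u)
  choose v hv hwv using hw
  let f : ℕ → Lp ℂ 2 (arcLength S) := fun n => (h.memLp (hv n) (hwv n)).toLp (v n)
  have hd : ∀ n m, dist (f n) (f m) ≤ C * dist (w n) (w m) := fun n m => by
    rw [dist_eq_norm, dist_eq_norm, ← MemLp.toLp_sub, Lp.norm_toLp]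
    have := hC (w n - w m) (fun x => v n x - v m x) ((hv n).sub (hv m)) ((hwv n).sub (hwv m))
    refine ENNReal.toReal_le_of_le_ofReal (by positivity) (this.trans_eq ?_)
    rw [ENNReal.ofReal_mul NNReal.zero_le_coe, ENNReal.ofReal_coe_nnreal, ofReal_norm]
  have hc : CauchySeq f := by
    refine Metric.cauchySeq_iff'.2 fun ε hε => ?_
    obtain ⟨n, hn⟩ := Metric.cauchySeq_iff'.1 hwu.cauchySeq (ε / (C + 1)) (by positivity)
    refine ⟨n, fun m hm => (hd m n).trans_lt ?_⟩
    have h1 := hn m hm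
    rw [lt_div_iff₀ (by positivity)] at h1
    have h2 : 0 ≤ dist (w m) (w n) := dist_nonneg
    nlinarith
  obtain ⟨t, ht⟩ := cauchySeq_tendsto_of_complete hc
  refine ⟨t, Lp.memLp t, w, v, fun n => ⟨hv n, hwv n⟩, hwu, ?_⟩
  refine ((Lp.tendsto_Lp_iff_tendsto_eLpNorm' _ _).1 ht).congr fun n => ?_
  exact eLpNorm_congr_ae ((h.memLp (hv n) (hwv n)).coeFn_toLp.mono fun x hx => by
    simp only [Pi.sub_apply, f, hx])

theorem IsTraceOn.add {u u' : H1 Ω} {t t' : Plane → ℂ} (h : IsTraceOn Ω S u t)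
    (h' : IsTraceOn Ω S u' t') (hS : Traceable Ω S) :
    IsTraceOn Ω S (u + u') (fun x => t x + t' x) := by
  obtain ⟨ht, w, v, h1, h2, h3⟩ := h
  obtain ⟨ht', w', v', h1', h2', h3'⟩ := h'
  refine ⟨ht.add ht', fun n => w n + w' n, fun n x => v n x + v' n x,
    fun n => ⟨(h1 n).1.add (h1' n).1, (h1 n).2.add (h1' n).2⟩, h2.add h2', ?_⟩
  refine tendsto_of_tendsto_of_tendsto_of_le_of_le tendsto_const_nhds
    (by simpa using h3.add h3') (fun _ => zero_le) fun n => ?_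
  have e : (fun x => v n x + v' n x - (t x + t' x)) =
      (fun x => v n x - t x) + fun x => v' n x - t' x := by
    ext x; simp only [Pi.add_apply]; ring
  simp only
  rw [e]
  exact eLpNorm_add_le ((hS.memLp (h1 n).1 (h1 n).2).sub ht).1
    ((hS.memLp (h1' n).1 (h1' n).2).sub ht').1 (by norm_num)

theorem IsTraceOn.smul {u : H1 Ω} {t : Plane → ℂ} (c : ℂ) (h : IsTraceOn Ω S u t) :
    IsTraceOn Ω S (c • u) (fun x => c * t x) := by
  obtain ⟨ht, w, v, h1, h2, h3⟩ := h
  refine ⟨ht.const_mul c, fun n => c • w n, fun n x => c * v n x,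
    fun n => ⟨continuousOn_const.mul (h1 n).1, (h1 n).2.smul c⟩, h2.const_smul c, ?_⟩
  have e : ∀ n, eLpNorm (fun x => c * v n x - c * t x) 2 (arcLength S) =
      ‖c‖ₑ * eLpNorm (fun x => v n x - t x) 2 (arcLength S) := fun n => by
    rw [← eLpNorm_const_smul]
    congr 1
    ext x
    simp [mul_sub]
  simp_rw [e]
  simpa using ENNReal.Tendsto.const_mul h3 (Or.inr enorm_ne_top)

theorem IsTraceOn.eLpNorm_le {C : ℝ≥0} (hS : Traceable Ω S)
    (hC : ∀ (w : H1 Ω) (v : Plane → ℂ), ContinuousOn v (closure Ω) → Represents w v →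
      eLpNorm v 2 (arcLength S) ≤ C * ‖w‖ₑ)
    {u : H1 Ω} {t : Plane → ℂ} (h : IsTraceOn Ω S u t) : eLpNorm t 2 (arcLength S) ≤ C * ‖u‖ₑ := by
  obtain ⟨ht, w, v, h1, h2, h3⟩ := h
  have hlim : Tendsto (fun n => C * ‖w n‖ₑ + eLpNorm (fun x => v n x - t x) 2 (arcLength S)) atTop
      (𝓝 (C * ‖u‖ₑ + 0)) :=
    (ENNReal.Tendsto.const_mul h2.enorm (Or.inr ENNReal.coe_ne_top)).add h3
  rw [add_zero] at hlim
  refine ge_of_tendsto hlim (Eventually.of_forall fun n => ?_)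
  have hvn := hS.memLp (h1 n).1 (h1 n).2
  have e : t = v n - fun x => v n x - t x := by ext x; simp
  calc eLpNorm t 2 (arcLength S) = eLpNorm (v n - fun x => v n x - t x) 2 (arcLength S) := by
        rw [← e]
    _ ≤ eLpNorm (v n) 2 (arcLength S) + eLpNorm (fun x => v n x - t x) 2 (arcLength S) :=
        eLpNorm_sub_le hvn.1 (hvn.sub ht).1 (by norm_num)
    _ ≤ _ := by gcongr; exact hC _ _ (h1 n).1 (h1 n).2

/-- The difference of two traces of `u` is a trace of zero, and the norm bound makes it vanish. So
the arbitrary choice in `traceOn` is immaterial almost everywhere. -/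
theorem IsTraceOn.ae_eq (hS : Traceable Ω S) {u : H1 Ω} {t t' : Plane → ℂ}
    (h : IsTraceOn Ω S u t) (h' : IsTraceOn Ω S u t') : t =ᵐ[arcLength S] t' := by
  obtain ⟨C, hC⟩ := hS.bound
  have h1 := (h.add (h'.smul (-1)) hS).eLpNorm_le hS hC
  have e : u + (-1 : ℂ) • u = 0 := by rw [neg_one_smul, add_neg_cancel]
  have e0 : ‖(0 : H1 Ω)‖ₑ = 0 := by rw [← ofReal_norm, norm_zero, ENNReal.ofReal_zero]
  rw [e, e0, mul_zero, nonpos_iff_eq_zero] at h1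
  have hm : AEStronglyMeasurable (fun x => t x + -1 * t' x) (arcLength S) :=
    (h.1.add (h'.1.const_mul (-1))).1
  filter_upwards [(eLpNorm_eq_zero_iff hm (by norm_num)).1 h1] with x hx
  simp only [Pi.zero_apply, neg_mul, one_mul] at hx
  exact add_neg_eq_zero.1 hx

theorem Traceable.isTraceOn (hS : Traceable Ω S) (u : H1 Ω) : IsTraceOn Ω S u (traceOn Ω S u) :=
  Classical.epsilon_spec (hS.exists_isTraceOn u)

theorem Traceable.traceOn_ae_eq (hS : Traceable Ω S) {u : H1 Ω} {t : Plane → ℂ}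
    (h : IsTraceOn Ω S u t) : traceOn Ω S u =ᵐ[arcLength S] t :=
  (hS.isTraceOn u).ae_eq hS h

/-- The trace as a bounded operator. -/
def traceL (hS : Traceable Ω S) : H1 Ω →L[ℂ] Lp ℂ 2 (arcLength S) :=
  LinearMap.mkContinuous
    { toFun := fun u => (hS.isTraceOn u).1.toLp (traceOn Ω S u)
      map_add' := fun u u' => by
        rw [← MemLp.toLp_add, MemLp.toLp_eq_toLp_iff]
        exact hS.traceOn_ae_eq ((hS.isTraceOn u).add (hS.isTraceOn u') hS)
      map_smul' := fun c u => by
        rw [RingHom.id_apply, ← MemLp.toLp_const_smul, MemLp.toLp_eq_toLp_iff]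
        exact hS.traceOn_ae_eq ((hS.isTraceOn u).smul c) }
    hS.bound.choose fun u => by
      simp only [LinearMap.coe_mk, AddHom.coe_mk]
      rw [Lp.norm_toLp]
      refine ENNReal.toReal_le_of_le_ofReal (by positivity)
        (((hS.isTraceOn u).eLpNorm_le hS hS.bound.choose_spec).trans_eq ?_)
      rw [ENNReal.ofReal_mul NNReal.zero_le_coe, ENNReal.ofReal_coe_nnreal, ofReal_norm]

theorem coeFn_traceL (hS : Traceable Ω S) (u : H1 Ω) :
    traceL hS u =ᵐ[arcLength S] traceOn Ω S u :=
  (hS.isTraceOn u).1.coeFn_toLp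

theorem eLpNorm_two_sq {μ : Measure Plane} (f : Plane → ℂ) :
    eLpNorm f 2 μ ^ 2 = ∫⁻ x, ‖f x‖ₑ ^ 2 ∂μ := by
  have := eLpNorm_nnreal_pow_eq_lintegral (f := f) (μ := μ) (p := 2) two_ne_zero
  simpa using this

theorem sq_enorm_eq (u : H1 Ω) : ‖u‖ₑ ^ 2 = ENNReal.ofReal (‖u‖ ^ 2) := by
  rw [← ofReal_norm, ENNReal.ofReal_pow (norm_nonneg _)]

namespace Triangulation

variable {ΓD : Set Plane} {T : Triangulation Ω ΓD} {κ : ℝ}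

/-- An edge, with a cell that contains it. -/
theorem exists_cell_edge {e : Finset Plane} (he : e ∈ T.edges) {a : Plane} (ha : a ∈ e) :
    ∃ c ∈ T.cells, e ⊆ c ∧ ∃ b q, a ≠ q ∧ hull e = segment ℝ a q ∧ q ∈ e ∧
      hull c = convexHull ℝ {b, a, q} := by
  classical
  obtain ⟨c, hc, hec, hc3⟩ := T.pure e he.1
  obtain ⟨q, hq⟩ : ∃ q, e.erase a = {q} := Finset.card_eq_one.1 (by
    rw [Finset.card_erase_of_mem ha, he.2])
  obtain ⟨b, hb⟩ : ∃ b, c \ e = {b} := Finset.card_eq_one.1 (by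
    rw [Finset.card_sdiff_of_subset hec, hc3, he.2])
  have hqe : q ∈ e.erase a := by rw [hq]; exact Finset.mem_singleton_self q
  have e1 : e = {a, q} := by rw [← Finset.insert_erase ha, hq]
  have e2 : c = {b, a, q} := by
    rw [← Finset.sdiff_union_of_subset hec, hb, e1]; rfl
  refine ⟨c, ⟨hc, hc3⟩, hec, b, q, (Finset.ne_of_mem_erase hqe).symm, ?_, Finset.mem_of_mem_erase hqe, ?_⟩
  · rw [hull, e1, ← convexHull_pair]; simp
  · rw [hull, e2]; simp

/-- The trace inequality on an edge of a cell. -/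
theorem lintegral_edge_le (hΩ : IsPolygonalLipschitz Ω) {c : Finset Plane} (hc : c ∈ T.cells)
    {b p q : Plane} (hcb : hull c = convexHull ℝ {b, p, q}) {w : H1 Ω} {v : Plane → ℂ}
    (hv : ContinuousOn v (closure Ω)) (hw : Represents w v) :
    ∫⁻ s in Set.Icc (0 : ℝ) 1, ‖v (AffineMap.lineMap p q s)‖ₑ ^ 2 ≤
      (volume (hull c))⁻¹ * (8 * ENNReal.ofReal (mass w (openHull c)) +
        ENNReal.ofReal (2 * T.meshSize ^ 2) * ENNReal.ofReal (energy w (openHull c))) := by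
  have hb : b ∈ hull c := by rw [hcb]; exact subset_convexHull ℝ _ (by simp)
  have hne := T.openHull_nonempty hc
  have hsub := T.openHull_subset hΩ hc
  rw [← lintegral_value_eq w hsub, ← lintegral_grad_eq w hsub]
  unfold openHull at *
  have hvc : ContinuousOn v (hull c) := hv.mono (T.hull_subset_closure hc.1)
  have hd : ∀ x ∈ hull c, dist x b ≤ T.meshSize := fun x hx => T.dist_le hc hx hb
  rw [hcb] at hne hsub hvc hd ⊢
  exact trace_continuous hΩ.isOpen hw hne hsub hvc hd

/-- The constant may depend on the edge and the mesh, as it only serves the existence of traces;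
uniform constants come from `Regular.sq_norm_integral_sub_mean_le`. -/
theorem exists_edge_bound (hΩ : IsPolygonalLipschitz Ω) {e : Finset Plane} (he : e ∈ T.edges) :
    ∃ C : ℝ≥0, ∀ (w : H1 Ω) (v : Plane → ℂ), ContinuousOn v (closure Ω) → Represents w v →
      ∫⁻ x, ‖v x‖ₑ ^ 2 ∂(arcLength (hull e)) ≤ C * ‖w‖ₑ ^ 2 := by
  obtain ⟨a, ha⟩ : e.Nonempty := Finset.card_pos.1 (by rw [he.2]; norm_num)
  obtain ⟨c, hc, -, b, q, hne, hes, -, hcb⟩ := exists_cell_edge he ha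
  have hvol : volume (hull c) ≠ 0 := by
    rw [← measure_congr (volume_openHull_ae c)]
    exact (isOpen_interior.measure_pos volume (T.openHull_nonempty hc)).ne'
  have hC : ENNReal.ofReal (dist a q) * ((volume (hull c))⁻¹ *
      (8 + ENNReal.ofReal (2 * T.meshSize ^ 2))) ≠ ⊤ := by
    finiteness
  refine ⟨(ENNReal.ofReal (dist a q) * ((volume (hull c))⁻¹ *
      (8 + ENNReal.ofReal (2 * T.meshSize ^ 2)))).toNNReal, fun w v hv hw => ?_⟩
  rw [ENNReal.coe_toNNReal hC, hes, lintegral_arcLength_segment hne, mul_assoc, mul_assoc, add_mul]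
  refine mul_le_mul_right ((lintegral_edge_le hΩ hc hcb hv hw).trans ?_) _
  rw [sq_enorm_eq]
  have h1 := ENNReal.ofReal_le_ofReal (mass_le_sq_norm w (openHull c))
  have h2 := ENNReal.ofReal_le_ofReal (energy_le_sq_norm w (openHull c))
  gcongr

-- Open cells lie in `Ω`, so a boundary point has a vanishing barycentric coordinate in its cell and
-- belongs to the opposite edge.
variable (T) in
theorem frontier_subset_edges (hΩ : IsPolygonalLipschitz Ω) :
    frontier Ω ⊆ ⋃ e ∈ T.edges, hull e := by
  classical
  intro x hx
  obtain ⟨c, hc, hxc⟩ := T.exists_cell_mem (frontier_subset_closure hx)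
  have hxo : x ∉ openHull c := fun h => by
    rw [hΩ.isOpen.frontier_eq] at hx
    exact hx.2 (T.openHull_subset hΩ hc h)
  rw [T.mem_openHull_iff hc] at hxo
  push Not at hxo
  obtain ⟨a, ha⟩ := hxo
  have h0 := (T.mem_hull_iff hc).1 hxc
  have ha0 : (T.cellBasis hc).coord a x = 0 := le_antisymm ha (h0 a)
  have hcard : (c.erase a.1).card = 2 := by rw [Finset.card_erase_of_mem a.2, hc.2]
  have hface : c.erase a.1 ∈ T.complex.faces :=
    T.complex.down_closed hc.1 (Finset.erase_subset _ _)
      (Finset.card_pos.1 (by rw [hcard]; norm_num))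
  refine Set.mem_biUnion (x := c.erase a.1) ⟨hface, hcard⟩ ?_
  have hs := (T.cellBasis hc).sum_coord_apply_eq_one x
  have hx2 := (T.cellBasis hc).linear_combination_coord_eq_self x
  rw [← hx2, ← Finset.sum_erase (a := a) _ (by rw [ha0, zero_smul])]
  rw [← Finset.sum_erase (a := a) _ ha0] at hs
  refine (convex_hull _).sum_mem (fun b _ => h0 b) hs fun b hb => subset_hull ?_
  rw [T.cellBasis_apply]
  exact Finset.mem_erase.2 ⟨fun h => Finset.ne_of_mem_erase hb (Subtype.ext h), b.2⟩

variable (T) in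
/-- A closed set that is covered by the edges carries traces. -/
theorem traceable (hΩ : IsPolygonalLipschitz Ω)
    (hd : Dense {w : H1 Ω | ∃ v, ContinuousOn v (closure Ω) ∧ Represents w v}) {S : Set Plane}
    (hS : MeasurableSet S) (hSe : S ⊆ ⋃ e ∈ T.edges, hull e) : Traceable Ω S := by
  have hfin : T.edges.Finite := T.finite.subset fun _ h => h.1
  refine ⟨hS, hSe.trans (Set.iUnion₂_subset fun e he => T.hull_subset_closure he.1), hd, ?_⟩
  choose! C hC using fun e (he : e ∈ T.edges) => exists_edge_bound hΩ he
  have : Finite T.edges := hfin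
  have := Fintype.ofFinite T.edges
  obtain ⟨K, hK⟩ : ∃ K : ℝ≥0, K = ∑ e : T.edges, C e := ⟨_, rfl⟩
  -- The edge bounds control the square of the norm by `K`; since `K ≤ (K + 1)²`, the constant `K +
  -- 1` works without a root.
  refine ⟨K + 1, fun w v hv hw => ?_⟩
  have h1 : eLpNorm v 2 (arcLength S) ^ 2 ≤ K * ‖w‖ₑ ^ 2 := by
    rw [eLpNorm_two_sq]
    rw [Set.biUnion_eq_iUnion] at hSe
    calc ∫⁻ x, ‖v x‖ₑ ^ 2 ∂(arcLength S)
        ≤ ∫⁻ x, ‖v x‖ₑ ^ 2 ∂(arcLength (⋃ e : T.edges, hull e.1)) :=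
          lintegral_mono' (Measure.restrict_mono hSe le_rfl) le_rfl
      _ ≤ ∑' e : T.edges, ∫⁻ x, ‖v x‖ₑ ^ 2 ∂(arcLength (hull e.1)) := lintegral_iUnion_le _ _
      _ ≤ ∑' e : T.edges, (C e : ℝ≥0∞) * ‖w‖ₑ ^ 2 :=
          ENNReal.tsum_le_tsum fun e => hC e.1 e.2 w v hv hw
      _ = K * ‖w‖ₑ ^ 2 := by
          rw [tsum_fintype, ← Finset.sum_mul, hK]
          push_cast
          rfl
  have h2 : eLpNorm v 2 (arcLength S) ^ 2 ≤ (((K + 1 : ℝ≥0) : ℝ≥0∞) * ‖w‖ₑ) ^ 2 := by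
    refine h1.trans ?_
    rw [mul_pow]
    refine mul_le_mul_left ?_ _
    norm_cast
    calc K ≤ K + 1 := le_self_add
      _ ≤ (K + 1) ^ 2 := le_self_pow₀ le_add_self two_ne_zero
  exact (ENNReal.pow_right_strictMono two_ne_zero).le_iff_le.1 h2

end Triangulation

end

section

/-! ### The Scott–Zhang functionals -/

variable {Ω : Set Plane}

/-- The values of a Sobolev function, as a bounded operator. -/
def valueL (Ω : Set Plane) : H1 Ω →L[ℂ] L2 Ω :=
  (ContinuousLinearMap.fst ℂ (L2 Ω) (L2Vec Ω)).comp
    ((WithLp.prodContinuousLinearEquiv 2 ℂ (L2 Ω) (L2Vec Ω)).toContinuousLinearMap.comp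
      (H1 Ω).subtypeL)

/-- The gradient of a Sobolev function, as a bounded operator. -/
def gradL (Ω : Set Plane) : H1 Ω →L[ℂ] L2Vec Ω :=
  (ContinuousLinearMap.snd ℂ (L2 Ω) (L2Vec Ω)).comp
    ((WithLp.prodContinuousLinearEquiv 2 ℂ (L2 Ω) (L2Vec Ω)).toContinuousLinearMap.comp
      (H1 Ω).subtypeL)

theorem coe_valueL (u : H1 Ω) : (valueL Ω u : Plane → ℂ) = value u := rfl

theorem coe_gradL (u : H1 Ω) : (gradL Ω u : Plane → EuclideanSpace ℂ (Fin 2)) = grad u := rfl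

/-- Together with `continuous_mean`, this extends the bound on the Scott–Zhang functionals from a
dense set to all of `H¹`. -/
theorem continuous_energy {A : Set Plane} (hA : MeasurableSet A) :
    Continuous fun u : H1 Ω => energy u A := by
  have h : ∀ u : H1 Ω, energy u A = ‖LpToLpRestrictCLM Plane (EuclideanSpace ℂ (Fin 2)) ℂ
      (volume.restrict Ω) 2 A (gradL Ω u)‖ ^ 2 := fun u => by
    rw [sq_norm_toLp_eq_integral, energy, ← Measure.restrict_restrict hA]
    refine integral_congr_ae ?_
    filter_upwards [LpToLpRestrictCLM_coeFn ℂ A (gradL Ω u)] with x hx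
    rw [hx, coe_gradL]
  simp_rw [h]
  fun_prop

theorem continuous_mean [IsFiniteMeasure (volume.restrict Ω)] {A : Set Plane}
    (hA : MeasurableSet A) (hAΩ : A ⊆ Ω) : Continuous fun u : H1 Ω => mean u A := by
  have h : ∀ u : H1 Ω, mean u A = (volume.real A)⁻¹ • inner ℂ
      (indicatorConstLp 2 hA (measure_ne_top (volume.restrict Ω) A) (1 : ℂ)) (valueL Ω u) :=
    fun u => by
      rw [mean, setAverage_eq, L2.inner_indicatorConstLp_one, Measure.restrict_restrict hA,
        Set.inter_eq_left.2 hAΩ, coe_valueL]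
  simp_rw [h]
  fun_prop

theorem integral_ofReal_mul_eq_inner {μ : Measure Plane} {φ : Plane → ℝ}
    (hφ : MemLp (fun x => (φ x : ℂ)) 2 μ) (f : Lp ℂ 2 μ) :
    ∫ x, (φ x : ℂ) * f x ∂μ = inner ℂ (hφ.toLp _) f := by
  rw [L2.inner_def]
  refine integral_congr_ae ?_
  filter_upwards [hφ.coeFn_toLp] with x h1
  rw [h1]
  simp [mul_comm]

theorem diam_segment (p q : Plane) : Metric.diam (segment ℝ p q) = dist p q := by
  rw [← convexHull_pair, convexHull_diam, Metric.diam_pair]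

theorem continuous_dualNodal (e : Set Plane) (a : Plane) : Continuous (dualNodal e a) := by
  unfold dualNodal
  fun_prop

theorem memLp_dualNodal (a p q : Plane) (b : Plane) :
    MemLp (fun x => (dualNodal (segment ℝ p q) a x : ℂ)) 2 (arcLength (segment ℝ b q)) := by
  have hc := continuous_dualNodal (segment ℝ p q) a
  have hcpt : IsCompact (segment ℝ b q) := by
    rw [← convexHull_pair]
    exact (Set.toFinite {b, q}).isCompact_convexHull ℝ
  obtain ⟨C, hC⟩ := hcpt.exists_bound_of_continuousOn hc.continuousOn
  refine MemLp.of_bound (Complex.continuous_ofReal.comp hc).aestronglyMeasurable C ?_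
  refine (ae_restrict_mem hcpt.isClosed.measurableSet).mono fun x hx => ?_
  rw [Complex.norm_real]
  exact hC x hx

theorem integral_dualNodal {a q : Plane} (h : a ≠ q) (v : Plane → ℂ) :
    ∫ x, (dualNodal (segment ℝ a q) a x : ℂ) * v x ∂(arcLength (segment ℝ a q)) =
      ∫ s in Set.Icc (0 : ℝ) 1, ((4 - 6 * s : ℝ) : ℂ) * v (AffineMap.lineMap a q s) := by
  have hℓ : dist a q ≠ 0 := dist_ne_zero.2 h
  rw [integral_arcLength_segment h, ← integral_const_mul]
  refine setIntegral_congr_fun measurableSet_Icc fun s hs => ?_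
  simp only [dualNodal, diam_segment, dist_lineMap_left, Real.norm_of_nonneg hs.1]
  rw [← mul_assoc]
  congr 1
  rw [← Complex.ofReal_mul]
  congr 1
  field_simp

/-- The weight `4 - 6 s` has mean one and is orthogonal to `s`, so it returns the value at `s = 0`
and ignores the slope. -/
theorem integral_affine (A : Plane →ᵃ[ℝ] ℂ) (a q : Plane) :
    ∫ s in Set.Icc (0 : ℝ) 1, ((4 - 6 * s : ℝ) : ℂ) * A (AffineMap.lineMap a q s) = A a := by
  have e : ∀ s : ℝ, ((4 - 6 * s : ℝ) : ℂ) * A (AffineMap.lineMap a q s) =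
      ((4 - 6 * s : ℝ) : ℂ) * A a + ((4 * s - 6 * s ^ 2 : ℝ) : ℂ) * (A q - A a) := fun s => by
    rw [AffineMap.apply_lineMap, AffineMap.lineMap_apply, vsub_eq_sub, vadd_eq_add,
      Complex.real_smul]
    push_cast
    ring
  simp_rw [e]
  rw [integral_Icc_eq_integral_Ioc, ← intervalIntegral.integral_of_le zero_le_one,
    intervalIntegral.integral_add (Continuous.intervalIntegrable (by fun_prop) _ _)
      (Continuous.intervalIntegrable (by fun_prop) _ _),
    intervalIntegral.integral_mul_const, intervalIntegral.integral_mul_const,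
    intervalIntegral.integral_ofReal, intervalIntegral.integral_ofReal]
  have h1 : ∫ s in (0 : ℝ)..1, (4 - 6 * s) = 1 := by
    rw [intervalIntegral.integral_sub (by simp) (Continuous.intervalIntegrable (by fun_prop) _ _),
      intervalIntegral.integral_const_mul, integral_id]
    norm_num
  have h2 : ∫ s in (0 : ℝ)..1, (4 * s - 6 * s ^ 2) = 0 := by
    rw [intervalIntegral.integral_sub (Continuous.intervalIntegrable (by fun_prop) _ _)
        (Continuous.intervalIntegrable (by fun_prop) _ _),
      intervalIntegral.integral_const_mul, intervalIntegral.integral_const_mul, integral_id,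
      integral_pow]
    norm_num
  rw [h1, h2]
  simp

/-- On the unit interval the weight is at most 4 in modulus. -/
theorem sq_enorm_integral_le {f : ℝ → ℂ} (hf : ContinuousOn f (Set.Icc 0 1)) :
    ‖∫ s in Set.Icc (0 : ℝ) 1, ((4 - 6 * s : ℝ) : ℂ) * f s‖ₑ ^ 2 ≤
      16 * ∫⁻ s in Set.Icc (0 : ℝ) 1, ‖f s‖ₑ ^ 2 := by
  have hc : ContinuousOn (fun s => ((4 - 6 * s : ℝ) : ℂ) * f s) (Set.Icc 0 1) :=
    (Continuous.continuousOn (by fun_prop)).mul hf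
  have h1 := measure_mul_sq_enorm_sub_average_le (volume.restrict (Set.Icc (0 : ℝ) 1))
    (hc.integrableOn_compact isCompact_Icc) 0
  rw [setAverage_eq] at h1
  simp only [zero_sub, enorm_neg, Measure.restrict_apply_univ, Real.volume_Icc, sub_zero,
    ENNReal.ofReal_one, one_mul, Real.volume_real_Icc_of_le zero_le_one, inv_one, one_smul] at h1
  refine h1.trans ?_
  rw [← lintegral_const_mul' _ _ (by norm_num)]
  refine setLIntegral_mono_ae' measurableSet_Icc (ae_of_all _ fun s hs => ?_)
  rw [enorm_mul, mul_pow]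
  refine mul_le_mul_left ?_ _
  rw [← ofReal_norm, ← ENNReal.ofReal_pow (norm_nonneg _), Complex.norm_real, Real.norm_eq_abs,
    sq_abs]
  rw [show (16 : ℝ≥0∞) = ENNReal.ofReal 16 by simp]
  refine ENNReal.ofReal_le_ofReal ?_
  nlinarith [hs.1, hs.2]

namespace Triangulation

variable {ΓD : Set Plane} {T : Triangulation Ω ΓD} {κ : ℝ}

/-- The bound for the Scott–Zhang functionals. -/
def szConst (κ : ℝ) : ℝ := 16 * ((Real.pi * κ ^ 2)⁻¹ * (8 * (4 / κ ^ 2) + 2))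

/-- The scaled trace inequality for the functions that are continuous up to the boundary. -/
theorem Regular.sq_norm_integral_sub_mean_le (hΩ : IsPolygonalLipschitz Ω) (hT : T.Regular κ)
    {c : Finset Plane} (hc : c ∈ T.cells) {b a q : Plane}
    (hcb : hull c = convexHull ℝ {b, a, q}) {w : H1 Ω} {v : Plane → ℂ}
    (hv : ContinuousOn v (closure Ω)) (hw : Represents w v) :
    ‖(∫ s in Set.Icc (0 : ℝ) 1, ((4 - 6 * s : ℝ) : ℂ) * v (AffineMap.lineMap a q s)) -
      mean w (T.disc κ c)‖ ^ 2 ≤ szConst κ * energy w (hull c) := by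
  have := hΩ.isFiniteMeasure
  have hκ := hT.pos
  have hh := hT.mesh_pos
  have hcΩ := T.openHull_subset hΩ hc
  -- The functional reproduces constants, so the mean may be subtracted first. Then the mass of `w -
  -- m` is `O(h²)` times the energy, and in the trace inequality all powers of `h` cancel.
  obtain ⟨m, hm⟩ : ∃ m, m = mean w (T.disc κ c) := ⟨_, rfl⟩
  obtain ⟨p, hp, -⟩ := (isP1_affine (T := T) (AffineMap.const ℝ Plane m)).exists_H1 hΩ
  have hpg := T.grad_ae_eq_of_affine hΩ hp
  have hg0 : gradA (AffineMap.const ℝ Plane m) = 0 := by ext j; simp [gradA]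
  have hwp : Represents (w - p) (fun x => v x - m) := hw.sub hp
  have hvm : ContinuousOn (fun x => v x - m) (closure Ω) := hv.sub continuousOn_const
  have hline : Set.MapsTo (AffineMap.lineMap a q : ℝ → Plane) (Set.Icc 0 1) (closure Ω) := by
    intro s hs
    refine T.hull_subset_closure hc.1 ?_
    rw [hcb]
    refine convexHull_mono (s := {a, q}) (by simp) ?_
    rw [convexHull_pair, segment_eq_image_lineMap]
    exact Set.mem_image_of_mem _ hs
  have hcl : ContinuousOn (fun s : ℝ => v (AffineMap.lineMap a q s)) (Set.Icc 0 1) :=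
    hv.comp (AffineMap.lineMap_continuous).continuousOn hline
  have h1 : (∫ s in Set.Icc (0 : ℝ) 1, ((4 - 6 * s : ℝ) : ℂ) * v (AffineMap.lineMap a q s)) - m =
      ∫ s in Set.Icc (0 : ℝ) 1, ((4 - 6 * s : ℝ) : ℂ) * (v (AffineMap.lineMap a q s) - m) := by
    have e := integral_affine (AffineMap.const ℝ Plane m) a q
    simp only [AffineMap.const_apply] at e
    conv_lhs => rw [← e]
    rw [← integral_sub]
    · simp_rw [mul_sub]
    · exact ((Continuous.continuousOn (by fun_prop)).mul hcl).integrableOn_compact isCompact_Icc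
    · exact (Continuous.continuousOn (by fun_prop)).integrableOn_compact isCompact_Icc
  have h2 := (sq_enorm_integral_le (hcl.sub continuousOn_const)).trans
    (mul_le_mul_right (lintegral_edge_le hΩ hc hcb hvm hwp) 16)
  have hmass : mass (w - p) (openHull c) ≤ 4 / κ ^ 2 * T.meshSize ^ 2 * energy w (openHull c) := by
    refine le_of_eq_of_le ?_ (hT.integral_sq_sub_mean_cell_le hΩ w hc)
    rw [mass, Set.inter_eq_left.2 hcΩ]
    refine integral_congr_ae ?_
    filter_upwards [ae_restrict_of_ae_restrict_of_subset hcΩ (value_sub w p),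
      ae_restrict_of_ae_restrict_of_subset hcΩ hp] with x hx hx'
    rw [hx, hx', ← hm, AffineMap.const_apply]
  have hen : energy (w - p) (openHull c) = energy w (openHull c) := by
    rw [energy, energy, Set.inter_eq_left.2 hcΩ]
    refine integral_congr_ae ?_
    filter_upwards [ae_restrict_of_ae_restrict_of_subset hcΩ (grad_sub w p),
      ae_restrict_of_ae_restrict_of_subset hcΩ hpg] with x hx hx'
    rw [hx, hx', hg0, sub_zero]
  have hen2 : energy w (openHull c) ≤ energy w (hull c) :=
    energy_mono w (Set.inter_subset_left.trans interior_subset)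
  have hE := energy_nonneg w (openHull c)
  have hvol : Real.pi * (κ * T.meshSize) ^ 2 ≤ volume.real (hull c) := by
    rw [← hT.volume_disc c]
    exact measureReal_mono ((hT.disc_subset hc).trans interior_subset)
      (isCompact_hull c).measure_lt_top.ne
  have hpos : 0 < Real.pi * (κ * T.meshSize) ^ 2 := by positivity
  have hvol' : (volume (hull c))⁻¹ ≤ ENNReal.ofReal (Real.pi * (κ * T.meshSize) ^ 2)⁻¹ := by
    rw [← ENNReal.ofReal_toReal (isCompact_hull c).measure_lt_top.ne,
      ENNReal.ofReal_inv_of_pos hpos]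
    exact ENNReal.inv_le_inv.2 (ENNReal.ofReal_le_ofReal hvol)
  rw [← hm, h1]
  have h3 : 16 * ((volume (hull c))⁻¹ * (8 * ENNReal.ofReal (mass (w - p) (openHull c)) +
      ENNReal.ofReal (2 * T.meshSize ^ 2) * ENNReal.ofReal (energy (w - p) (openHull c)))) ≤
      ENNReal.ofReal (szConst κ * energy w (hull c)) := by
    rw [hen]
    calc _ ≤ ENNReal.ofReal 16 * (ENNReal.ofReal (Real.pi * (κ * T.meshSize) ^ 2)⁻¹ *
          (ENNReal.ofReal 8 *
            ENNReal.ofReal (4 / κ ^ 2 * T.meshSize ^ 2 * energy w (openHull c)) +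
          ENNReal.ofReal (2 * T.meshSize ^ 2) * ENNReal.ofReal (energy w (openHull c)))) := by
          rw [show ENNReal.ofReal 16 = 16 by simp, show ENNReal.ofReal 8 = 8 by simp]
          refine mul_le_mul_right (mul_le_mul' hvol' (add_le_add ?_ le_rfl)) _
          exact mul_le_mul_right (ENNReal.ofReal_le_ofReal hmass) _
      _ = ENNReal.ofReal (16 * ((Real.pi * (κ * T.meshSize) ^ 2)⁻¹ *
          (8 * (4 / κ ^ 2 * T.meshSize ^ 2 * energy w (openHull c)) +
            2 * T.meshSize ^ 2 * energy w (openHull c)))) := by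
          rw [← ENNReal.ofReal_mul (by norm_num), ← ENNReal.ofReal_mul (by positivity),
            ← ENNReal.ofReal_add (by positivity) (by positivity),
            ← ENNReal.ofReal_mul (by positivity), ← ENNReal.ofReal_mul (by norm_num)]
      _ ≤ _ := by
          refine ENNReal.ofReal_le_ofReal ?_
          calc _ = szConst κ * energy w (openHull c) := by
                unfold szConst
                field_simp
            _ ≤ _ := mul_le_mul_of_nonneg_left hen2 (by unfold szConst; positivity)
  have h4 := h2.trans h3
  rw [← ofReal_norm, ← ENNReal.ofReal_pow (norm_nonneg _), ENNReal.ofReal_le_ofReal_iff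
    (mul_nonneg (by unfold szConst; positivity) (energy_nonneg _ _))] at h4
  exact h4

theorem traceable_edge (hΩ : IsPolygonalLipschitz Ω)
    (hd : Dense {w : H1 Ω | ∃ v, ContinuousOn v (closure Ω) ∧ Represents w v}) {e : Finset Plane}
    (he : e ∈ T.edges) : Traceable Ω (hull e) :=
  T.traceable hΩ hd (isCompact_hull e).isClosed.measurableSet
    (Set.subset_biUnion_of_mem (u := fun e : Finset Plane => hull e) he)

end Triangulation

namespace ScottZhangChoice

variable {ΓD : Set Plane} {T : Triangulation Ω ΓD} {κ : ℝ}

theorem nodalValue_of_isTraceOn (hΩ : IsPolygonalLipschitz Ω)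
    (hd : Dense {w : H1 Ω | ∃ v, ContinuousOn v (closure Ω) ∧ Represents w v})
    (S : ScottZhangChoice T) {a : Plane} (ha : a ∈ T.vertices) {u : H1 Ω} {t : Plane → ℂ}
    (ht : IsTraceOn Ω (hull (S.edge a)) u t) :
    S.nodalValue u a = ∫ x, (dualNodal (hull (S.edge a)) a x : ℂ) * t x
      ∂(arcLength (hull (S.edge a))) := by
  refine integral_congr_ae ?_
  filter_upwards [(Triangulation.traceable_edge hΩ hd (S.edge_mem a ha)).traceOn_ae_eq ht] with x hx
  rw [hx]

/-- The functional pairs the bounded trace operator with the dual function, so it is linear and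
continuous. -/
theorem exists_nodalL (hΩ : IsPolygonalLipschitz Ω)
    (hd : Dense {w : H1 Ω | ∃ v, ContinuousOn v (closure Ω) ∧ Represents w v})
    (S : ScottZhangChoice T) {a : Plane} (ha : a ∈ T.vertices) :
    ∃ L : H1 Ω →L[ℂ] ℂ, ∀ u, S.nodalValue u a = L u := by
  have hS := Triangulation.traceable_edge hΩ hd (S.edge_mem a ha)
  obtain ⟨c, hc, -, b, q, hne, hes, -⟩ :=
    Triangulation.exists_cell_edge (S.edge_mem a ha) (S.mem_edge a ha)
  have hθ : MemLp (fun x => (dualNodal (hull (S.edge a)) a x : ℂ)) 2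
      (arcLength (hull (S.edge a))) := by
    rw [hes]; exact memLp_dualNodal a a q a
  refine ⟨(innerSL ℂ (hθ.toLp _)).comp (traceL hS), fun u => ?_⟩
  rw [ContinuousLinearMap.comp_apply, innerSL_apply_apply, ← integral_ofReal_mul_eq_inner]
  refine integral_congr_ae ?_
  filter_upwards [coeFn_traceL hS u] with x hx
  rw [hx]

/-- The Scott–Zhang functionals are nodal functionals. -/
theorem isNodal (hΩ : IsPolygonalLipschitz Ω)
    (hd : Dense {w : H1 Ω | ∃ v, ContinuousOn v (closure Ω) ∧ Represents w v})
    (S : ScottZhangChoice T) (hT : T.Regular κ) :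
    T.IsNodal κ (Triangulation.szConst κ) fun a u => S.nodalValue u a := by
  have hfin := hΩ.isFiniteMeasure
  have hκ := hT.pos
  refine ⟨by unfold Triangulation.szConst; positivity, fun a ha u w => ?_, fun a ha A p hp => ?_,
    fun a ha => ?_⟩
  · obtain ⟨L, hL⟩ := S.exists_nodalL hΩ hd ha
    simp only [hL, map_sub]
  · obtain ⟨c, hc, -, b, q, hne, hes, -⟩ :=
      Triangulation.exists_cell_edge (S.edge_mem a ha) (S.mem_edge a ha)
    have hA := Triangulation.isP1_affine (T := T) A
    have ht := (Triangulation.traceable_edge hΩ hd (S.edge_mem a ha)).isTraceOn_of_continuousOn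
      hA.continuousOn hp
    rw [S.nodalValue_of_isTraceOn hΩ hd ha ht, hes, integral_dualNodal hne, integral_affine]
  · obtain ⟨c, hc, hec, b, q, hne, hes, -, hcb⟩ :=
      Triangulation.exists_cell_edge (S.edge_mem a ha) (S.mem_edge a ha)
    refine ⟨c, hc, hec (S.mem_edge a ha), fun u => ?_⟩
    obtain ⟨L, hL⟩ := S.exists_nodalL hΩ hd ha
    -- Both sides depend continuously on `u`, so it suffices to treat the dense set of functions
    -- whose trace is a genuine restriction.
    have hclosed : IsClosed {u : H1 Ω | ‖L u - mean u (T.disc κ c)‖ ^ 2 ≤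
        Triangulation.szConst κ * energy u (hull c)} := by
      have h1 := continuous_mean (Ω := Ω) (A := T.disc κ c) Metric.isOpen_ball.measurableSet
        ((hT.disc_subset hc).trans (T.openHull_subset hΩ hc))
      have h2 := continuous_energy (Ω := Ω) (isCompact_hull c).isClosed.measurableSet
      exact isClosed_le ((L.continuous.sub h1).norm.pow 2) (continuous_const.mul h2)
    simp only [hL]
    refine hclosed.closure_subset_iff.2 ?_ (hd u)
    rintro w ⟨v, hv, hw⟩
    have ht := (Triangulation.traceable_edge hΩ hd (S.edge_mem a ha)).isTraceOn_of_continuousOn hv hw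
    have h3 := hT.sq_norm_integral_sub_mean_le hΩ hc hcb hv hw
    rw [← integral_dualNodal hne, ← hes, ← S.nodalValue_of_isTraceOn hΩ hd ha ht, hL] at h3
    exact h3

end ScottZhangChoice

/-! ### Boundary values of interpolants -/

theorem trace_isTraceOn (h : Traceable Ω (frontier Ω)) (u : H1 Ω) :
    IsTraceOn Ω (frontier Ω) u (trace u) := h.isTraceOn u

/-- The edge chosen at a vertex of `ΓD` stays in `ΓD`, so the nodal value sees nothing but the
Dirichlet data. -/
theorem ScottZhangChoice.nodalValue_congr {ΓD : Set Plane} {T : Triangulation Ω ΓD}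
    (hΩ : IsPolygonalLipschitz Ω) (hΓD : ΓD ⊆ frontier Ω)
    (hd : Dense {w : H1 Ω | ∃ v, ContinuousOn v (closure Ω) ∧ Represents w v})
    (htr : Traceable Ω (frontier Ω)) (S : ScottZhangChoice T) {u u' : H1 Ω}
    (h : ∀ᵐ x ∂(arcLength ΓD), trace u x = trace u' x) {a : Plane} (ha : a ∈ T.vertices)
    (haD : a ∈ ΓD) : S.nodalValue u a = S.nodalValue u' a := by
  have hsub := S.dirichlet a ha haD
  rw [S.nodalValue_of_isTraceOn hΩ hd ha ((trace_isTraceOn htr u).mono (hsub.trans hΓD)),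
    S.nodalValue_of_isTraceOn hΩ hd ha ((trace_isTraceOn htr u').mono (hsub.trans hΓD))]
  refine integral_congr_ae ?_
  have h' : ∀ᵐ x ∂(arcLength (hull (S.edge a))), trace u x = trace u' x :=
    ae_restrict_of_ae_restrict_of_subset hsub h
  filter_upwards [h'] with x hx
  rw [hx]

/-- As `ΓD` is a union of edges, every point of it lies on an edge whose end points are Dirichlet
vertices. -/
theorem Triangulation.IsP1.eq_zero_of_vertices {ΓD : Set Plane} {T : Triangulation Ω ΓD}
    {v : Plane → ℂ} (hv : T.IsP1 v) (h : ∀ a ∈ T.vertices, a ∈ ΓD → v a = 0) {x : Plane}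
    (hx : x ∈ ΓD) : v x = 0 := by
  obtain ⟨e, he, -, hxe, heD⟩ := T.fits_dirichlet x hx
  obtain ⟨c, hc, hec, hc3⟩ := T.pure e he
  obtain ⟨A, hA⟩ := hv c ⟨hc, hc3⟩
  have hsub : hull e ⊆ hull c := convexHull_mono (by exact_mod_cast hec)
  rw [hA x (hsub hxe)]
  refine (AffineMap.eqOn_convexHull (A := A) (B := 0) (s := (e : Set Plane)) (fun a ha => ?_)) hxe
  rw [← hA a (hsub (subset_hull ha)), h a (T.mem_vertices he ha) (heD (subset_hull ha))]
  rfl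

end

section

/-! ### Compactness -/

variable {Ω : Set Plane}

theorem sq_norm_valueL (u : H1 Ω) : ‖valueL Ω u‖ ^ 2 = ∫ x in Ω, ‖value u x‖ ^ 2 :=
  sq_norm_toLp_eq_integral _

theorem sq_norm_gradL (u : H1 Ω) : ‖gradL Ω u‖ ^ 2 = ∫ x in Ω, ‖grad u x‖ ^ 2 :=
  sq_norm_toLp_eq_integral _

theorem norm_gradL_le (u : H1 Ω) : ‖gradL Ω u‖ ≤ ‖u‖ := by
  refine (sq_le_sq₀ (norm_nonneg _) (norm_nonneg _)).1 ?_
  rw [sq_norm_gradL, sq_norm_eq]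
  linarith [sq_norm_valueL u, sq_nonneg ‖valueL Ω u‖]

/-- By closedness of `H1` the limits of the values and of the gradients again form a function with
its weak gradient. -/
theorem exists_tendsto_of_tendsto {ι : Type*} {l : Filter ι} [l.NeBot] {θ : ι → H1 Ω} {f : L2 Ω}
    {G : L2Vec Ω} (hf : Tendsto (fun i => valueL Ω (θ i)) l (𝓝 f))
    (hG : Tendsto (fun i => gradL Ω (θ i)) l (𝓝 G)) :
    ∃ u : H1 Ω, Tendsto θ l (𝓝 u) ∧ gradL Ω u = G := by
  have h : Tendsto (fun i => (θ i : WithLp 2 (L2 Ω × L2Vec Ω))) l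
      (𝓝 (WithLp.toLp 2 (f, G))) :=
    ((WithLp.prod_continuous_toLp 2 (L2 Ω) (L2Vec Ω)).tendsto (f, G)).comp (hf.prodMk_nhds hG)
  have hmem : WithLp.toLp 2 (f, G) ∈ H1 Ω :=
    isClosed_H1.mem_of_tendsto h (Eventually.of_forall fun i => (θ i).2)
  exact ⟨⟨_, hmem⟩, tendsto_subtype_rng.2 h, rfl⟩

namespace Triangulation

variable {ΓD : Set Plane} {κ : ℝ}

/-- The average over a set, as a bounded functional. -/
theorem exists_meanL [IsFiniteMeasure (volume.restrict Ω)] {A : Set Plane}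
    (hA : MeasurableSet A) (hAΩ : A ⊆ Ω) : ∃ L : H1 Ω →L[ℂ] ℂ, ∀ u, L u = mean u A := by
  refine ⟨(volume.real A)⁻¹ • (innerSL ℂ
    (indicatorConstLp 2 hA (measure_ne_top (volume.restrict Ω) A) (1 : ℂ))).comp (valueL Ω),
    fun u => ?_⟩
  rw [_root_.smul_apply, ContinuousLinearMap.comp_apply, innerSL_apply_apply, mean,
    setAverage_eq, L2.inner_indicatorConstLp_one, Measure.restrict_restrict hA,
    Set.inter_eq_left.2 hAΩ, coe_valueL]

/-- Averaging over the cells is an operator of finite rank, close to the identity. -/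
theorem exists_compact_approx (hΩ : IsPolygonalLipschitz Ω) {T : Triangulation Ω ΓD}
    (hT : T.Regular κ) : ∃ F : H1 Ω →L[ℂ] L2 Ω, IsCompactOperator F ∧
      ‖F - valueL Ω‖ ≤ 2 / κ * T.meshSize := by
  have hfin := hΩ.isFiniteMeasure
  have hκ := hT.pos
  have hh := hT.mesh_pos
  have hmo : ∀ c : Finset Plane, MeasurableSet (openHull c) :=
    fun c => isOpen_interior.measurableSet
  have hex : ∀ c : Finset Plane, ∃ L : H1 Ω →L[ℂ] ℂ, c ∈ T.cells → ∀ u, L u = mean u (T.disc κ c) :=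
    fun c => by
      by_cases hc : c ∈ T.cells
      · obtain ⟨L, hL⟩ := exists_meanL (Ω := Ω) (A := T.disc κ c) Metric.isOpen_ball.measurableSet
          ((hT.disc_subset hc).trans (T.openHull_subset hΩ hc))
        exact ⟨L, fun _ => hL⟩
      · exact ⟨0, fun h => absurd h hc⟩
  choose L hL using hex
  let χ : Finset Plane → L2 Ω := fun c =>
    indicatorConstLp 2 (hmo c) (measure_ne_top (volume.restrict Ω) _) (1 : ℂ)
  let F : H1 Ω →L[ℂ] L2 Ω := ∑ c ∈ T.finite_cells.toFinset,
    (ContinuousLinearMap.toSpanSingleton ℂ (χ c)).comp (L c)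
  refine ⟨F, ?_, ContinuousLinearMap.opNorm_le_bound _ (by positivity) fun u => ?_⟩
  · refine (compactOperator (RingHom.id ℂ) (H1 Ω) (L2 Ω)).sum_mem
      (t := T.finite_cells.toFinset)
      (f := fun c => (((ContinuousLinearMap.toSpanSingleton ℂ (χ c)).comp (L c) :
        H1 Ω →L[ℂ] L2 Ω))) fun c _ => ?_
    have hLc : IsCompactOperator (L c) := isCompactOperator_of_locallyCompactSpace_dom (L c)
    exact hLc.clm_comp (ContinuousLinearMap.toSpanSingleton ℂ (χ c))
  · have hae : ∀ᵐ x ∂(volume.restrict Ω), ∀ c ∈ T.cells, x ∈ openHull c →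
        F u x = mean u (T.disc κ c) := by
      have h1 : F u = ∑ c ∈ T.finite_cells.toFinset, L c u • χ c := by
        simp [F]
      have h2 : ∀ᵐ x ∂(volume.restrict Ω), F u x =
          ∑ c ∈ T.finite_cells.toFinset, L c u * (openHull c).indicator (fun _ => (1 : ℂ)) x := by
        rw [h1]
        have h3 := Lp.coeFn_finsetSum T.finite_cells.toFinset fun c => L c u • χ c
        have h4 : ∀ᵐ x ∂(volume.restrict Ω), ∀ c ∈ T.finite_cells.toFinset,
            (L c u • χ c : L2 Ω) x = L c u * (openHull c).indicator (fun _ => (1 : ℂ)) x := by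
          refine (Finset.eventually_all _).2 fun c _ => ?_
          filter_upwards [Lp.coeFn_smul (L c u) (χ c), indicatorConstLp_coeFn (p := 2) (hs := hmo c)
            (hμs := measure_ne_top (volume.restrict Ω) _) (c := (1 : ℂ))] with x h5 h6
          rw [h5, Pi.smul_apply, h6, smul_eq_mul]
        filter_upwards [h3, h4] with x h5 h6
        rw [h5, Finset.sum_apply]
        exact Finset.sum_congr rfl fun c hc => h6 c hc
      filter_upwards [h2] with x hx c hc hxc
      rw [hx, Finset.sum_eq_single c, Set.indicator_of_mem hxc, mul_one, hL c hc]
      · intro c' hc' hne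
        rw [Set.indicator_of_notMem, mul_zero]
        exact fun h => Set.disjoint_left.1 (T.disjoint_openHull (by simpa using hc') hc hne) h hxc
      · intro h
        exact absurd (by simpa using hc) h
    have h1 : ‖(F - valueL Ω) u‖ ^ 2 ≤ (2 / κ * T.meshSize * ‖u‖) ^ 2 := by
      have e : ‖(F - valueL Ω) u‖ ^ 2 = ∫ x in Ω, ‖F u x - value u x‖ ^ 2 := by
        rw [sq_norm_toLp_eq_integral, _root_.sub_apply]
        refine integral_congr_ae ?_
        filter_upwards [Lp.coeFn_sub (F u) (valueL Ω u)] with x hx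
        rw [hx, Pi.sub_apply, coe_valueL]
      rw [e, T.setIntegral_eq_sum hΩ (integrableOn_sq_norm_sub (Lp.memLp (F u)) (memLp_value u))]
      calc _ ≤ ∑ c ∈ T.finite_cells.toFinset, 4 / κ ^ 2 * T.meshSize ^ 2 *
              ∫ x in openHull c, ‖grad u x‖ ^ 2 := by
            refine Finset.sum_le_sum fun c hc => ?_
            have hc : c ∈ T.cells := by simpa using hc
            have h2 := hT.integral_sq_sub_mean_cell_le hΩ u hc
            rw [energy, Set.inter_eq_left.2 (T.openHull_subset hΩ hc)] at h2
            refine le_of_eq_of_le (integral_congr_ae ?_) h2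
            filter_upwards [ae_restrict_of_ae_restrict_of_subset (T.openHull_subset hΩ hc) hae,
              ae_restrict_mem (hmo c)] with x h3 h4
            rw [h3 c hc h4, norm_sub_rev]
        _ = 4 / κ ^ 2 * T.meshSize ^ 2 * ∫ x in Ω, ‖grad u x‖ ^ 2 := by
            rw [← Finset.mul_sum, ← T.setIntegral_eq_sum hΩ (integrableOn_sq_grad u)]
        _ ≤ 4 / κ ^ 2 * T.meshSize ^ 2 * ‖u‖ ^ 2 := by
            rw [← sq_norm_gradL]
            have := norm_gradL_le u
            gcongr
        _ = _ := by ring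
    exact (sq_le_sq₀ (norm_nonneg _) (by positivity)).1 h1

/-- Rellich's theorem. -/
theorem isCompactOperator_valueL (hΩ : IsPolygonalLipschitz Ω) {ι : Type*} {l : Filter ι}
    [l.NeBot] {T : ι → Triangulation Ω ΓD} (hT : ∀ᶠ i in l, (T i).Regular κ)
    (hh : Tendsto (fun i => (T i).meshSize) l (𝓝 0)) : IsCompactOperator (valueL Ω) := by
  have h : ∀ i, ∃ F : H1 Ω →L[ℂ] L2 Ω, (T i).Regular κ → IsCompactOperator F ∧
      ‖F - valueL Ω‖ ≤ 2 / κ * (T i).meshSize := fun i => by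
    by_cases hi : (T i).Regular κ
    · obtain ⟨F, hF⟩ := exists_compact_approx hΩ hi
      exact ⟨F, fun _ => hF⟩
    · exact ⟨0, fun h => absurd h hi⟩
  choose F hF using h
  -- The inclusion into `L²` is a norm limit of operators of finite rank, with error at most `(2 /
  -- κ) h`.
  refine isCompactOperator_of_tendsto (F := F) (l := l) ?_ (hT.mono fun i hi => (hF i hi).1)
  refine (tendsto_iff_norm_sub_tendsto_zero (E := H1 Ω →L[ℂ] L2 Ω)).2 ?_
  refine squeeze_zero' (Eventually.of_forall fun i => (norm_nonneg (F i - valueL Ω) :))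
    (hT.mono fun i hi => (hF i hi).2) ?_
  simpa using hh.const_mul (2 / κ)

end Triangulation

/-- The Poincaré inequality on a closed subspace without functions of vanishing gradient. -/
theorem exists_poincare (hc : IsCompactOperator (valueL Ω)) {V : Submodule ℂ (H1 Ω)}
    (hV : IsClosed (V : Set (H1 Ω))) (hker : ∀ η ∈ V, gradL Ω η = 0 → η = 0) :
    ∃ C > 0, ∀ η ∈ V, ‖η‖ ≤ C * ‖gradL Ω η‖ := by
  -- Otherwise there are unit vectors in `V` whose gradients tend to zero. Compactness makes a
  -- subsequence converge in `H¹`, to a unit vector of `V` with zero gradient.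
  by_contra! hcon
  have h : ∀ n : ℕ, ∃ θ ∈ V, ‖θ‖ = 1 ∧ ‖gradL Ω θ‖ ≤ 1 / ((n : ℝ) + 1) := fun n => by
    obtain ⟨η, hη, hlt⟩ := hcon ((n : ℝ) + 1) (by positivity)
    have hpos : 0 < ‖η‖ := lt_of_le_of_lt (by positivity) hlt
    refine ⟨((‖η‖⁻¹ : ℝ) : ℂ) • η, V.smul_mem _ hη, ?_, ?_⟩
    · rw [norm_smul, Complex.norm_real, norm_inv, norm_norm, inv_mul_cancel₀ hpos.ne']
    · rw [map_smul, norm_smul, Complex.norm_real, norm_inv, norm_norm, le_div_iff₀ (by positivity),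
        mul_assoc, inv_mul_le_iff₀ hpos, mul_one, mul_comm]
      exact hlt.le
  choose θ hθV hθ1 hθg using h
  obtain ⟨f, -, φ, hφ, hf⟩ := (hc.isCompact_closure_image_closedBall 1).tendsto_subseq
    (x := fun n => valueL Ω (θ n)) fun n =>
      subset_closure (Set.mem_image_of_mem _ (by simp [hθ1 n]))
  have hg : Tendsto (fun n => gradL Ω (θ (φ n))) atTop (𝓝 0) := by
    have h1 : Tendsto (fun n => gradL Ω (θ n)) atTop (𝓝 0) :=
      squeeze_zero_norm hθg tendsto_one_div_add_atTop_nhds_zero_nat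
    exact h1.comp hφ.tendsto_atTop
  obtain ⟨u, hu, hug⟩ := exists_tendsto_of_tendsto (θ := fun n => θ (φ n)) hf hg
  have huV : u ∈ V := hV.mem_of_tendsto hu (Eventually.of_forall fun n => hθV _)
  have hu1 : ‖u‖ = 1 := tendsto_nhds_unique hu.norm (by simp [hθ1])
  rw [hker u huV hug, norm_zero] at hu1
  exact zero_ne_one hu1

/-! ### Complex conjugation -/

/-- The conjugate of a complex vector. -/
def conjVec (G : EuclideanSpace ℂ (Fin 2)) : EuclideanSpace ℂ (Fin 2) :=
  WithLp.toLp 2 fun j => starRingEnd ℂ (G j)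

theorem norm_conjVec (G : EuclideanSpace ℂ (Fin 2)) : ‖conjVec G‖ = ‖G‖ := by
  rw [EuclideanSpace.norm_eq, EuclideanSpace.norm_eq]
  simp [conjVec]

theorem conjVec_sub (G H : EuclideanSpace ℂ (Fin 2)) :
    conjVec (G - H) = conjVec G - conjVec H := by
  ext j
  simp [conjVec]

/-- Conjugation is used to split an element of `V_0` into real-valued parts that again belong to
`V_0`. -/
theorem exists_conj (u : H1 Ω) : ∃ w : H1 Ω,
    value w =ᵐ[volume.restrict Ω] (fun x => starRingEnd ℂ (value u x)) ∧
      grad w =ᵐ[volume.restrict Ω] fun x => conjVec (grad u x) := by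
  refine exists_H1 (memLp_value u).star ?_ fun φ hφ j => ?_
  · refine MemLp.of_eval_piLp fun j => ?_
    exact (memLp_component u.1.snd j).star
  · have h1 := congrArg (starRingEnd ℂ) (isWeakGradient u hφ j)
    rw [map_neg, ← integral_conj, ← integral_conj] at h1
    simpa [conjVec] using h1

/-- The conjugate of a Sobolev function. -/
def conjH1 (u : H1 Ω) : H1 Ω := (exists_conj u).choose

theorem value_conjH1 (u : H1 Ω) :
    value (conjH1 u) =ᵐ[volume.restrict Ω] fun x => starRingEnd ℂ (value u x) :=
  (exists_conj u).choose_spec.1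

theorem grad_conjH1 (u : H1 Ω) :
    grad (conjH1 u) =ᵐ[volume.restrict Ω] fun x => conjVec (grad u x) :=
  (exists_conj u).choose_spec.2

theorem norm_conjH1_sub (u w : H1 Ω) : ‖conjH1 u - conjH1 w‖ = ‖u - w‖ := by
  refine (sq_eq_sq₀ (norm_nonneg _) (norm_nonneg _)).1 ?_
  rw [sq_norm_eq, sq_norm_eq]
  congr 1
  · refine integral_congr_ae ?_
    filter_upwards [value_conjH1 u, value_conjH1 w, value_sub u w,
      value_sub (conjH1 u) (conjH1 w)] with x h1 h2 h3 h4
    rw [h4, h3, h1, h2, ← map_sub, RCLike.norm_conj]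
  · refine integral_congr_ae ?_
    filter_upwards [grad_conjH1 u, grad_conjH1 w, grad_sub u w,
      grad_sub (conjH1 u) (conjH1 w)] with x h1 h2 h3 h4
    rw [h4, h3, h1, h2, ← conjVec_sub, norm_conjVec]

theorem IsTraceOn.conj {S : Set Plane} {u : H1 Ω} {t : Plane → ℂ} (h : IsTraceOn Ω S u t) :
    IsTraceOn Ω S (conjH1 u) (fun x => starRingEnd ℂ (t x)) := by
  obtain ⟨ht, w, v, h1, h2, h3⟩ := h
  refine ⟨ht.star, fun n => conjH1 (w n), fun n x => starRingEnd ℂ (v n x),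
    fun n => ⟨Complex.continuous_conj.comp_continuousOn (h1 n).1, ?_⟩, ?_, ?_⟩
  · filter_upwards [value_conjH1 (w n), (h1 n).2] with x hx hx'
    rw [hx, hx']
  · rw [tendsto_iff_norm_sub_tendsto_zero] at h2 ⊢
    simpa only [norm_conjH1_sub] using h2
  · refine h3.congr fun n => eLpNorm_congr_norm_ae (ae_of_all _ fun x => ?_)
    rw [← map_sub, RCLike.norm_conj]

end

section

/-! ### The coefficients -/

/-- Written as a composition with the projection onto `[ξm, ξp]`, the cut-off inherits continuity
from the coefficient on that interval alone. -/
theorem cutOff_eq {ξm ξp : ℝ} (h : ξm ≤ ξp) (Γ : ℝ → ℝ) (ξ : ℝ) :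
    cutOff ξm ξp Γ ξ = Γ (max ξm (min ξ ξp)) := by
  unfold cutOff
  split_ifs with h1 h2
  · rw [min_eq_right h1, max_eq_right h]
  · rw [min_eq_left (h2.trans h), max_eq_left h2]
  · push Not at h1 h2
    rw [min_eq_left h1.le, max_eq_right h2.le]

/-- A bounded quotient has no simple poles. -/
theorem eq_zero_of_bounded_div {N D : ℝ → ℝ} {a b M x₀ D' : ℝ} (hab : a < b)
    (hx : x₀ ∈ Set.Icc a b) (hM : ∀ x ∈ Set.Icc a b, |N x / D x| ≤ M) (hN : Continuous N)
    (hD : HasDerivAt D D' x₀) (hD' : D' ≠ 0) (hD0 : D x₀ = 0) : N x₀ = 0 := by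
  -- The bound at `x₀` itself is void, because a quotient by zero is zero, so one passes to the
  -- limit through the punctured interval. This also covers the end points.
  have hne : (𝓝[Set.Icc a b \ {x₀}] x₀).NeBot := by
    have h1 : Set.Icc a b ⊆ closure (Set.Icc a b \ {x₀}) := by
      have h2 : Set.Icc a b ⊆ closure (Set.Ioo a b \ {x₀}) := by
        rw [← closure_Ioo hab.ne]
        refine closure_minimal (fun x hx => ?_) isClosed_closure
        have : Set.Ioo a b ⊆ closure (Set.Ioo a b ∩ {x₀}ᶜ) := by
          have hd : Dense ({x₀}ᶜ : Set ℝ) := dense_compl_singleton x₀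
          exact hd.open_subset_closure_inter isOpen_Ioo
        exact this hx
      exact h2.trans (closure_mono (Set.sdiff_subset_sdiff_left Set.Ioo_subset_Icc_self))
    exact mem_closure_iff_nhdsWithin_neBot.1 (h1 hx)
  have hev : ∀ᶠ x in 𝓝[Set.Icc a b \ {x₀}] x₀, |N x| ≤ M * |D x| := by
    have h1 : ∀ᶠ x in 𝓝[≠] x₀, D x ≠ 0 := hD.eventually_ne hD'
    have h2 : ∀ᶠ x in 𝓝[Set.Icc a b \ {x₀}] x₀, D x ≠ 0 :=
      h1.filter_mono (nhdsWithin_mono _ fun x hx => hx.2)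
    filter_upwards [h2, self_mem_nhdsWithin] with x hx hxI
    have := hM x hxI.1
    rwa [abs_div, div_le_iff₀ (abs_pos.2 hx)] at this
  have h1 : Tendsto (fun x => |N x|) (𝓝[Set.Icc a b \ {x₀}] x₀) (𝓝 |N x₀|) :=
    (hN.abs.tendsto x₀).mono_left nhdsWithin_le_nhds
  have h2 : Tendsto (fun x => M * |D x|) (𝓝[Set.Icc a b \ {x₀}] x₀) (𝓝 (M * |D x₀|)) :=
    ((hD.continuousAt.abs.tendsto).const_mul M).mono_left nhdsWithin_le_nhds
  have h3 := le_of_tendsto_of_tendsto h1 h2 hev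
  rw [hD0, abs_zero, mul_zero] at h3
  exact abs_nonpos_iff.1 h3

theorem hasDerivAt_mu1 (α ξ : ℝ) : HasDerivAt (mu1 α) (-Real.sin ξ - α * Real.cos ξ) ξ :=
  (Real.hasDerivAt_cos ξ).sub ((Real.hasDerivAt_sin ξ).const_mul α)

theorem hasDerivAt_mu2 (β ξ : ℝ) : HasDerivAt (mu2 β) (-Real.sin ξ + β * Real.cos ξ) ξ :=
  (Real.hasDerivAt_cos ξ).add ((Real.hasDerivAt_sin ξ).const_mul β)

theorem deriv_mu1 (α : ℝ) : deriv (mu1 α) = fun ξ => -Real.sin ξ - α * Real.cos ξ :=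
  funext fun ξ => (hasDerivAt_mu1 α ξ).deriv

theorem deriv_mu2 (β : ℝ) : deriv (mu2 β) = fun ξ => -Real.sin ξ + β * Real.cos ξ :=
  funext fun ξ => (hasDerivAt_mu2 β ξ).deriv

theorem continuous_mu1 (α : ℝ) : Continuous (mu1 α) := by unfold mu1; fun_prop

theorem continuous_mu2 (β : ℝ) : Continuous (mu2 β) := by unfold mu2; fun_prop

namespace Params

theorem ξm_le_ξp (P : Params) : P.ξm ≤ P.ξp := P.ξm_mem.2.trans P.ξp_mem.1

theorem mul_nonpos (P : Params) : P.α * P.β ≤ 0 :=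
  mul_nonpos_of_nonpos_of_nonneg P.α_nonpos P.β_nonneg

theorem clamp_mem (P : Params) (ξ : ℝ) : max P.ξm (min ξ P.ξp) ∈ Set.Icc P.ξm P.ξp :=
  ⟨le_max_left _ _, max_le P.ξm_le_ξp (min_le_right _ _)⟩

theorem exists_bound_Icc (P : Params) : ∃ M : ℝ, ∀ ξ ∈ Set.Icc P.ξm P.ξp,
    |Gamma21 P.α P.β ξ| ≤ M ∧ |Gamma12 P.α P.β ξ| ≤ M := by
  obtain ⟨M, hM⟩ := P.bounded
  refine ⟨M, fun ξ hξ => ?_⟩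
  have h := hM ξ
  rwa [cutOff_eq P.ξm_le_ξp, cutOff_eq P.ξm_le_ξp, min_eq_left hξ.2, max_eq_right hξ.1] at h

/-- At a zero `cos ξ = α sin ξ`, so `μ₁' = -(1 + α²) sin ξ` does not vanish and the zero is simple.
Boundedness of the quotient would force `μ₂' = (αβ - 1) sin ξ` to vanish too, which `αβ ≤ 0`
excludes. If the interval is one point, that point is `0`, where `μ₁ = 1`. -/
theorem mu1_ne_zero (P : Params) {ξ : ℝ} (hξ : ξ ∈ Set.Icc P.ξm P.ξp) : mu1 P.α ξ ≠ 0 := by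
  intro h0
  have h0' : Real.cos ξ = P.α * Real.sin ξ := by unfold mu1 at h0; linarith
  have hsc := Real.sin_sq_add_cos_sq ξ
  have hs : Real.sin ξ ≠ 0 := by
    intro hs
    rw [h0', hs] at hsc
    norm_num at hsc
  rcases P.ξm_le_ξp.lt_or_eq with hlt | heq
  · obtain ⟨M, hM⟩ := P.exists_bound_Icc
    have h1 := eq_zero_of_bounded_div hlt hξ (fun x hx => (hM x hx).1)
      (by rw [deriv_mu2]; fun_prop) (hasDerivAt_mu1 P.α ξ) (by
        rw [h0', show -Real.sin ξ - P.α * (P.α * Real.sin ξ) = -((1 + P.α ^ 2) * Real.sin ξ) by ring]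
        exact neg_ne_zero.2 (mul_ne_zero (by positivity) hs)) h0
    rw [deriv_mu2] at h1
    simp only [h0'] at h1
    have h2 : (P.α * P.β - 1) * Real.sin ξ = 0 := by linarith
    rcases mul_eq_zero.1 h2 with h3 | h3
    · linarith [P.mul_nonpos]
    · exact hs h3
  · have : ξ = 0 := by
      have h1 := hξ.1
      have h2 := hξ.2
      have h3 := P.ξm_mem.2
      have h4 := P.ξp_mem.1
      linarith
    rw [this, Real.sin_zero] at hs
    exact hs rfl

theorem mu2_ne_zero (P : Params) {ξ : ℝ} (hξ : ξ ∈ Set.Icc P.ξm P.ξp) : mu2 P.β ξ ≠ 0 := by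
  intro h0
  have h0' : Real.cos ξ = -(P.β * Real.sin ξ) := by unfold mu2 at h0; linarith
  have hsc := Real.sin_sq_add_cos_sq ξ
  have hs : Real.sin ξ ≠ 0 := by
    intro hs
    rw [h0', hs] at hsc
    norm_num at hsc
  rcases P.ξm_le_ξp.lt_or_eq with hlt | heq
  · obtain ⟨M, hM⟩ := P.exists_bound_Icc
    have h1 := eq_zero_of_bounded_div (N := deriv (mu1 P.α)) hlt hξ
      (fun x hx => by have := (hM x hx).2; rwa [Gamma12, abs_neg] at this)
      (by rw [deriv_mu1]; fun_prop) (hasDerivAt_mu2 P.β ξ) (by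
        rw [h0', show -Real.sin ξ + P.β * -(P.β * Real.sin ξ) = -((1 + P.β ^ 2) * Real.sin ξ) by ring]
        exact neg_ne_zero.2 (mul_ne_zero (by positivity) hs)) h0
    rw [deriv_mu1] at h1
    simp only [h0'] at h1
    have h2 : (P.α * P.β - 1) * Real.sin ξ = 0 := by linarith
    rcases mul_eq_zero.1 h2 with h3 | h3
    · linarith [P.mul_nonpos]
    · exact hs h3
  · have : ξ = 0 := by
      have h1 := hξ.1
      have h2 := hξ.2
      have h3 := P.ξm_mem.2
      have h4 := P.ξp_mem.1
      linarith
    rw [this, Real.sin_zero] at hs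
    exact hs rfl

theorem continuous_cutOff (P : Params) {Γ : ℝ → ℝ} (h : ContinuousOn Γ (Set.Icc P.ξm P.ξp)) :
    Continuous (cutOff P.ξm P.ξp Γ) := by
  have : cutOff P.ξm P.ξp Γ = fun ξ => Γ (max P.ξm (min ξ P.ξp)) :=
    funext fun ξ => cutOff_eq P.ξm_le_ξp Γ ξ
  rw [this]
  exact h.comp_continuous (by fun_prop) P.clamp_mem

theorem continuous_Gamma21 (P : Params) :
    Continuous (cutOff P.ξm P.ξp (Gamma21 P.α P.β)) := by
  refine P.continuous_cutOff (ContinuousOn.div ?_ (continuous_mu1 _).continuousOn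
    fun ξ hξ => P.mu1_ne_zero hξ)
  rw [deriv_mu2]
  fun_prop

theorem continuous_Gamma12 (P : Params) :
    Continuous (cutOff P.ξm P.ξp (Gamma12 P.α P.β)) := by
  refine P.continuous_cutOff (ContinuousOn.neg (ContinuousOn.div ?_
    (continuous_mu2 _).continuousOn fun ξ hξ => P.mu2_ne_zero hξ))
  rw [deriv_mu1]
  fun_prop

/-- The diagonal entries of `B̂(ξ)`. -/
def diag (P : Params) (ξ : ℝ) : Fin 2 → ℝ :=
  ![-cutOff P.ξm P.ξp (Gamma21 P.α P.β) ξ, cutOff P.ξm P.ξp (Gamma12 P.α P.β) ξ]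

/-- The diagonal entries of `B̂(ξ) + i ε I`. -/
def coef (P : Params) (ε ξ : ℝ) (j : Fin 2) : ℂ := (P.diag ξ j : ℂ) + Complex.I * ε

theorem Beps_mulVec (P : Params) (ε ξ : ℝ) (G : Fin 2 → ℂ) :
    (P.Beps ε ξ).mulVec G = fun j => P.coef ε ξ j * G j := by
  ext j
  fin_cases j <;>
    simp [Beps, Bhat, coef, diag, Matrix.mulVec, dotProduct, Fin.sum_univ_two]

theorem continuous_coef (P : Params) (ε : ℝ) (j : Fin 2) : Continuous fun ξ => P.coef ε ξ j := by
  have h : Continuous fun ξ => P.diag ξ j := by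
    fin_cases j
    · exact P.continuous_Gamma21.neg
    · exact P.continuous_Gamma12
  exact (Complex.continuous_ofReal.comp h).add continuous_const

theorem exists_norm_coef_le (P : Params) (ε : ℝ) : ∃ M : ℝ, 0 ≤ M ∧
    ∀ ξ j, ‖P.coef ε ξ j‖ ≤ M := by
  obtain ⟨M, hM⟩ := P.bounded
  have hM0 : 0 ≤ M := (abs_nonneg _).trans (hM 0).1
  refine ⟨M + |ε|, by positivity, fun ξ j => (norm_add_le _ _).trans (add_le_add ?_ ?_)⟩
  · rw [Complex.norm_real, Real.norm_eq_abs]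
    fin_cases j
    · simpa [diag] using (hM ξ).1
    · simpa [diag] using (hM ξ).2
  · rw [norm_mul, Complex.norm_I, one_mul, Complex.norm_real, Real.norm_eq_abs]

/-- A bound for the coefficients. -/
def coefBound (P : Params) (ε : ℝ) : ℝ := (P.exists_norm_coef_le ε).choose

theorem coefBound_nonneg (P : Params) (ε : ℝ) : 0 ≤ P.coefBound ε :=
  (P.exists_norm_coef_le ε).choose_spec.1

theorem norm_coef_le (P : Params) (ε ξ : ℝ) (j : Fin 2) : ‖P.coef ε ξ j‖ ≤ P.coefBound ε :=
  (P.exists_norm_coef_le ε).choose_spec.2 ξ j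

/-- The flux `(B̂(ξ) + i ε I) G`. -/
def flux (P : Params) (ε ξ : ℝ) (G : EuclideanSpace ℂ (Fin 2)) : EuclideanSpace ℂ (Fin 2) :=
  WithLp.toLp 2 ((P.Beps ε ξ).mulVec G.ofLp)

theorem flux_apply (P : Params) (ε ξ : ℝ) (G : EuclideanSpace ℂ (Fin 2)) (j : Fin 2) :
    P.flux ε ξ G j = P.coef ε ξ j * G j := by
  rw [flux, P.Beps_mulVec]

theorem norm_flux_le (P : Params) (ε ξ : ℝ) (G : EuclideanSpace ℂ (Fin 2)) :
    ‖P.flux ε ξ G‖ ≤ P.coefBound ε * ‖G‖ := by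
  refine (sq_le_sq₀ (norm_nonneg _) (mul_nonneg (P.coefBound_nonneg ε) (norm_nonneg _))).1 ?_
  rw [mul_pow, EuclideanSpace.norm_sq_eq, EuclideanSpace.norm_sq_eq, Finset.mul_sum]
  refine Finset.sum_le_sum fun j _ => ?_
  rw [flux_apply, norm_mul, mul_pow]
  exact mul_le_mul_of_nonneg_right (pow_le_pow_left₀ (norm_nonneg _) (P.norm_coef_le ε ξ j) 2)
    (sq_nonneg _)

theorem flux_add (P : Params) (ε ξ : ℝ) (G H : EuclideanSpace ℂ (Fin 2)) :
    P.flux ε ξ (G + H) = P.flux ε ξ G + P.flux ε ξ H := by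
  ext j
  simp only [flux_apply, PiLp.add_apply, mul_add]

theorem flux_smul (P : Params) (ε ξ : ℝ) (c : ℂ) (G : EuclideanSpace ℂ (Fin 2)) :
    P.flux ε ξ (c • G) = c • P.flux ε ξ G := by
  ext j
  simp only [flux_apply, PiLp.smul_apply, smul_eq_mul]
  ring

theorem continuous_flux (P : Params) (ε : ℝ) (G : EuclideanSpace ℂ (Fin 2)) :
    Continuous fun ξ => P.flux ε ξ G := by
  have : (fun ξ => P.flux ε ξ G) = fun ξ => WithLp.toLp 2 fun j => P.coef ε ξ j * G j :=
    funext fun ξ => by ext j; exact P.flux_apply ε ξ G j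
  rw [this]
  exact (PiLp.continuous_toLp 2 _).comp
    (continuous_pi fun j => (P.continuous_coef ε j).mul continuous_const)

/-- The real diagonal matrix contributes only to the real part, so no sign or ellipticity of `B̂` is
needed. -/
theorem inner_flux_im (P : Params) (ε ξ : ℝ) (G : EuclideanSpace ℂ (Fin 2)) :
    (inner ℂ G (P.flux ε ξ G)).im = ε * ‖G‖ ^ 2 := by
  rw [EuclideanSpace.norm_sq_eq, PiLp.inner_apply]
  simp only [Fin.sum_univ_two, flux_apply, RCLike.inner_apply, coef, Complex.sq_norm,
    Complex.normSq_apply]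
  simp
  ring

variable {Ω : Set Plane}

theorem memLp_flux (P : Params) (ε : ℝ) {r : Plane → ℝ} (hr : Measurable r) (G : L2Vec Ω) :
    MemLp (fun x => P.flux ε (r x) (G x)) 2 (volume.restrict Ω) := by
  refine MemLp.of_eval_piLp fun j => ?_
  simp only [flux_apply]
  refine (memLp_component G j).of_le_mul (c := P.coefBound ε) ?_ (ae_of_all _ fun x => ?_)
  · exact ((P.continuous_coef ε j).measurable.comp hr).aestronglyMeasurable.mul
      (memLp_component G j).1
  · rw [norm_mul]
    exact mul_le_mul_of_nonneg_right (P.norm_coef_le ε _ j) (norm_nonneg _)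

/-- Multiplication by `B̂(r) + i ε I`, as a bounded operator. -/
def fluxL (P : Params) (ε : ℝ) {r : Plane → ℝ} (hr : Measurable r) : L2Vec Ω →L[ℂ] L2Vec Ω :=
  LinearMap.mkContinuous
    { toFun := fun G => (P.memLp_flux ε hr G).toLp _
      map_add' := fun G H => by
        rw [← MemLp.toLp_add, MemLp.toLp_eq_toLp_iff]
        filter_upwards [Lp.coeFn_add G H] with x hx
        rw [hx, Pi.add_apply, Pi.add_apply, flux_add]
      map_smul' := fun c G => by
        rw [RingHom.id_apply, ← MemLp.toLp_const_smul, MemLp.toLp_eq_toLp_iff]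
        filter_upwards [Lp.coeFn_smul c G] with x hx
        rw [hx, Pi.smul_apply, Pi.smul_apply, flux_smul] }
    (P.coefBound ε) fun G => by
      refine Lp.norm_le_mul_norm_of_ae_le_mul ?_
      simp only [LinearMap.coe_mk, AddHom.coe_mk]
      filter_upwards [(P.memLp_flux ε hr G).coeFn_toLp] with x hx
      rw [hx]
      exact P.norm_flux_le ε _ _

theorem coeFn_fluxL (P : Params) (ε : ℝ) {r : Plane → ℝ} (hr : Measurable r) (G : L2Vec Ω) :
    P.fluxL ε hr G =ᵐ[volume.restrict Ω] fun x => P.flux ε (r x) (G x) :=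
  (P.memLp_flux ε hr G).coeFn_toLp

theorem norm_fluxL_apply_le (P : Params) (ε : ℝ) {r : Plane → ℝ} (hr : Measurable r)
    (G : L2Vec Ω) : ‖P.fluxL ε hr G‖ ≤ P.coefBound ε * ‖G‖ :=
  (ContinuousLinearMap.le_opNorm _ _).trans (mul_le_mul_of_nonneg_right
    (LinearMap.mkContinuous_norm_le _ (P.coefBound_nonneg ε) _) (norm_nonneg _))

theorem inner_fluxL_im (P : Params) (ε : ℝ) {r : Plane → ℝ} (hr : Measurable r) (G : L2Vec Ω) :
    (inner ℂ G (P.fluxL ε hr G)).im = ε * ‖G‖ ^ 2 := by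
  rw [L2.inner_def, sq_norm_toLp_eq_integral, ← integral_const_mul]
  have := integral_im (L2.integrable_inner (𝕜 := ℂ) G (P.fluxL ε hr G))
  simp only [RCLike.im_to_complex] at this
  rw [← this]
  refine integral_congr_ae ?_
  filter_upwards [P.coeFn_fluxL ε hr G] with x hx
  rw [hx, P.inner_flux_im]

theorem aForm_eq_inner (P : Params) (ε : ℝ) {r : Plane → ℝ} (hr : Measurable r) (ζ η : H1 Ω) :
    aForm P ε r ζ η = inner ℂ (gradL Ω η) (P.fluxL ε hr (gradL Ω ζ)) := by
  rw [L2.inner_def]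
  refine integral_congr_ae ?_
  filter_upwards [P.coeFn_fluxL ε hr (gradL Ω ζ)] with x hx
  rw [hx, EuclideanSpace.inner_eq_star_dotProduct]
  rfl

/-- The flux of a fixed field depends continuously on the coefficient. -/
theorem tendsto_fluxL (P : Params) (ε : ℝ) {r : ℕ → Plane → ℝ} (hr : ∀ n, Measurable (r n))
    {s : Plane → ℝ} (hs : Measurable s)
    (h : ∀ᵐ x ∂(volume.restrict Ω), Tendsto (fun n => r n x) atTop (𝓝 (s x))) (G : L2Vec Ω) :
    Tendsto (fun n => P.fluxL ε (hr n) G) atTop (𝓝 (P.fluxL ε hs G)) := by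
  rw [tendsto_iff_norm_sub_tendsto_zero]
  have hsq : ∀ n, ‖P.fluxL ε (hr n) G - P.fluxL ε hs G‖ ^ 2 =
      ∫ x in Ω, ‖P.flux ε (r n x) (G x) - P.flux ε (s x) (G x)‖ ^ 2 := fun n => by
    rw [sq_norm_toLp_eq_integral]
    refine integral_congr_ae ?_
    filter_upwards [Lp.coeFn_sub (P.fluxL ε (hr n) G) (P.fluxL ε hs G), P.coeFn_fluxL ε (hr n) G,
      P.coeFn_fluxL ε hs G] with x h1 h2 h3
    rw [h1, Pi.sub_apply, h2, h3]
  -- Dominated convergence works because `G` is fixed: the coefficients converge only almost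
  -- everywhere, so no convergence in operator norm is claimed.
  have key : Tendsto (fun n => ‖P.fluxL ε (hr n) G - P.fluxL ε hs G‖ ^ 2) atTop (𝓝 0) := by
    simp_rw [hsq]
    have h0 : (0 : ℝ) = ∫ x in Ω, ‖P.flux ε (s x) (G x) - P.flux ε (s x) (G x)‖ ^ 2 := by simp
    rw [h0]
    refine tendsto_integral_of_dominated_convergence
      (fun x => (2 * P.coefBound ε) ^ 2 * ‖G x‖ ^ 2) (fun n => ?_) ?_ (fun n => ?_) ?_
    · exact (((P.memLp_flux ε (hr n) G).sub (P.memLp_flux ε hs G)).1.norm.pow 2)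
    · exact ((memLp_two_iff_integrable_sq_norm (Lp.memLp G).1).1 (Lp.memLp G)).const_mul _
    · refine ae_of_all _ fun x => ?_
      rw [Real.norm_of_nonneg (sq_nonneg _), ← mul_pow]
      refine pow_le_pow_left₀ (norm_nonneg _) ((norm_sub_le _ _).trans ?_) 2
      linarith [P.norm_flux_le ε (r n x) (G x), P.norm_flux_le ε (s x) (G x)]
    · filter_upwards [h] with x hx
      have h1 : Tendsto (fun n => P.flux ε (r n x) (G x)) atTop (𝓝 (P.flux ε (s x) (G x))) :=
        ((P.continuous_flux ε (G x)).tendsto (s x)).comp hx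
      exact ((h1.sub_const _).norm.pow 2)
  have := (Real.continuous_sqrt.tendsto 0).comp key
  simpa [Function.comp_def, Real.sqrt_sq (norm_nonneg _)] using this

end Params

end

section

/-! ### The linearized problem -/

variable {Ω ΓD : Set Plane}

theorem Traceable.traceL_ae_eq_trace (htr : Traceable Ω (frontier Ω)) {S : Set Plane}
    (hS : Traceable Ω S) (hsub : S ⊆ frontier Ω) (u : H1 Ω) :
    traceL hS u =ᵐ[arcLength S] trace u :=
  (coeFn_traceL hS u).trans (hS.traceOn_ae_eq ((trace_isTraceOn htr u).mono hsub))

/-- Exhibits `V_0` as the kernel of a bounded operator, hence as a closed subspace. -/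
theorem memV0_iff (htr : Traceable Ω (frontier Ω)) (hD : Traceable Ω ΓD) (hsub : ΓD ⊆ frontier Ω)
    (u : H1 Ω) : MemV0 ΓD u ↔ u ∈ LinearMap.ker (traceL hD).toLinearMap := by
  rw [LinearMap.mem_ker, ContinuousLinearMap.coe_coe, Lp.eq_zero_iff_ae_eq_zero]
  have h := htr.traceL_ae_eq_trace hD hsub u
  constructor
  · intro h0
    filter_upwards [h, h0] with x h1 h2
    rw [h1, h2, Pi.zero_apply]
  · intro h0
    filter_upwards [h, h0] with x h1 h2
    rw [← h1, h2, Pi.zero_apply]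

theorem trace_add_ae_eq (htr : Traceable Ω (frontier Ω)) (u w : H1 Ω) :
    trace (u + w) =ᵐ[arcLength (frontier Ω)] fun x => trace u x + trace w x :=
  htr.traceOn_ae_eq ((trace_isTraceOn htr u).add (trace_isTraceOn htr w) htr)

theorem trace_add_ae_eq_of_memV0 (htr : Traceable Ω (frontier Ω)) (hsub : ΓD ⊆ frontier Ω)
    (u : H1 Ω) {η : H1 Ω} (hη : MemV0 ΓD η) :
    ∀ᵐ x ∂(arcLength ΓD), trace (u + η) x = trace u x := by
  have h : ∀ᵐ x ∂(arcLength ΓD), trace (u + η) x = trace u x + trace η x :=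
    ae_restrict_of_ae_restrict_of_subset hsub (trace_add_ae_eq htr u η)
  filter_upwards [h, hη] with x h1 h2
  rw [h1, h2, add_zero]

theorem MemV0.conj (htr : Traceable Ω (frontier Ω)) (hsub : ΓD ⊆ frontier Ω) {η : H1 Ω}
    (hη : MemV0 ΓD η) : MemV0 ΓD (conjH1 η) := by
  have h : ∀ᵐ x ∂(arcLength ΓD), trace (conjH1 η) x = starRingEnd ℂ (trace η x) :=
    ae_restrict_of_ae_restrict_of_subset hsub (htr.traceOn_ae_eq (trace_isTraceOn htr η).conj)
  filter_upwards [h, hη] with x h1 h2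
  rw [h1, h2, map_zero]

theorem memV0_of_memVh0 {T : Triangulation Ω ΓD} (htr : Traceable Ω (frontier Ω))
    (hΓD : MeasurableSet ΓD) (hsub : ΓD ⊆ frontier Ω) {η : H1 Ω} (h : MemVh0 T η) :
    MemV0 ΓD η := by
  obtain ⟨v, hv, hηv, h0⟩ := h
  have h1 : ∀ᵐ x ∂(arcLength ΓD), trace η x = v x := ae_restrict_of_ae_restrict_of_subset hsub
    (htr.traceOn_ae_eq (htr.isTraceOn_of_continuousOn hv.continuousOn hηv))
  filter_upwards [h1, ae_restrict_mem hΓD] with x hx hxD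
  rw [hx, h0 x hxD]

theorem lForm_eq_inner (htr : Traceable Ω (frontier Ω)) {g : Plane → ℝ}
    (hN : Traceable Ω (frontier Ω \ ΓD))
    (hg : MemLp (fun x => (g x : ℂ)) 2 (arcLength (frontier Ω \ ΓD))) (η : H1 Ω) :
    lForm ΓD g η = inner ℂ η ((traceL hN).adjoint (hg.toLp _)) := by
  rw [ContinuousLinearMap.adjoint_inner_right, L2.inner_def]
  refine integral_congr_ae ?_
  filter_upwards [htr.traceL_ae_eq_trace hN Set.sdiff_subset η, hg.coeFn_toLp] with x h1 h2
  rw [h1, h2, RCLike.inner_apply]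
  rfl

/-- A coercive operator is onto. -/
theorem surjective_of_coercive {E : Type*} [NormedAddCommGroup E] [InnerProductSpace ℂ E]
    [CompleteSpace E] (A : E →L[ℂ] E) {c : ℝ} (hc : 0 < c)
    (h : ∀ x, c * ‖x‖ ^ 2 ≤ ‖inner ℂ x (A x)‖) : Function.Surjective A := by
  -- Boundedness below makes the range closed. A vector orthogonal to the range is orthogonal to its
  -- own image, so coercivity makes it zero.
  have hb : ∀ x, ‖x‖ ≤ (c⁻¹ : ℝ) * ‖A x‖ := fun x => by
    have h1 := (h x).trans (norm_inner_le_norm x (A x))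
    rcases (norm_nonneg x).eq_or_lt with h0 | h0
    · rw [← h0]; positivity
    · rw [inv_mul_eq_div, le_div_iff₀ hc]
      nlinarith
  have hanti : AntilipschitzWith (Real.toNNReal c⁻¹) A :=
    AddMonoidHomClass.antilipschitz_of_bound A fun x => by
      rw [Real.coe_toNNReal _ (by positivity)]; exact hb x
  have hcl : IsClosed (Set.range A) := hanti.isClosed_range A.uniformContinuous
  have hcl' : IsClosed ((LinearMap.range A.toLinearMap : Submodule ℂ E) : Set E) := by
    rw [LinearMap.coe_range]
    exact hcl
  have : CompleteSpace (LinearMap.range A.toLinearMap) := hcl'.completeSpace_coe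
  have htop : LinearMap.range A.toLinearMap = ⊤ := by
    rw [← Submodule.orthogonal_eq_bot_iff, Submodule.eq_bot_iff]
    intro x hx
    have h1 : inner ℂ x (A x) = 0 := by
      have := hx (A x) ⟨x, rfl⟩
      rwa [inner_eq_zero_symm] at this
    have h2 := h x
    rw [h1, norm_zero] at h2
    by_contra hne
    have : 0 < ‖x‖ := norm_pos_iff.2 hne
    have : 0 < c * ‖x‖ ^ 2 := by positivity
    linarith
  exact LinearMap.range_eq_top.1 htop

/-- The Lax–Milgram theorem on a subspace, with inhomogeneous essential data. -/
theorem exists_solution_of_coercive {H W : Type*} [NormedAddCommGroup H] [InnerProductSpace ℂ H]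
    [CompleteSpace H] [NormedAddCommGroup W] [InnerProductSpace ℂ W] [CompleteSpace W]
    (V : Submodule ℂ H) [CompleteSpace V] (D : H →L[ℂ] W) (m : W →L[ℂ] W) {c : ℝ} (hc : 0 < c)
    (h : ∀ x ∈ V, c * ‖x‖ ^ 2 ≤ ‖inner ℂ (D x) (m (D x))‖) (ζ F : H) :
    ∃ z ∈ V, ∀ η ∈ V, inner ℂ (D η) (m (D (ζ + z))) = inner ℂ η F := by
  let G : V →L[ℂ] W := D.comp V.subtypeL
  obtain ⟨z, hz⟩ := surjective_of_coercive (G.adjoint.comp (m.comp G)) hc (fun x => by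
    rw [ContinuousLinearMap.comp_apply, ContinuousLinearMap.adjoint_inner_right,
      ContinuousLinearMap.comp_apply]
    exact h x x.2) (V.subtypeL.adjoint F - G.adjoint (m (D ζ)))
  refine ⟨z, z.2, fun η hη => ?_⟩
  have h1 := congrArg (inner ℂ (⟨η, hη⟩ : V)) hz
  rw [ContinuousLinearMap.comp_apply, ContinuousLinearMap.adjoint_inner_right, inner_sub_right,
    ContinuousLinearMap.adjoint_inner_right, ContinuousLinearMap.adjoint_inner_right] at h1
  change inner ℂ (D η) (m (D z)) = inner ℂ η F - inner ℂ (D η) (m (D ζ)) at h1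
  rw [map_add, map_add, inner_add_right, h1]
  ring

/-- The linear problem has a solution. -/
theorem exists_linear_solution (P : Params) {ε : ℝ} (hε : 0 < ε) {r : Plane → ℝ}
    (hr : Measurable r) {V : Submodule ℂ (H1 Ω)} (hV : IsClosed (V : Set (H1 Ω))) {C : ℝ}
    (hC : 0 < C) (hp : ∀ η ∈ V, ‖η‖ ≤ C * ‖gradL Ω η‖) (ζ F : H1 Ω) :
    ∃ z ∈ V, ∀ η ∈ V, inner ℂ (gradL Ω η) (P.fluxL ε hr (gradL Ω (ζ + z))) = inner ℂ η F := by
  have : CompleteSpace V := hV.completeSpace_coe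
  refine exists_solution_of_coercive V (gradL Ω) (P.fluxL ε hr) (c := ε / C ^ 2) (by positivity)
    (fun x hx => ?_) ζ F
  have h2 := (le_abs_self _).trans
    (Complex.abs_im_le_norm (inner ℂ (gradL Ω x) (P.fluxL ε hr (gradL Ω x))))
  rw [P.inner_fluxL_im ε hr (gradL Ω x)] at h2
  refine le_trans ?_ h2
  rw [div_mul_eq_mul_div, div_le_iff₀ (by positivity)]
  calc ε * ‖x‖ ^ 2 ≤ ε * (C * ‖gradL Ω x‖) ^ 2 :=
        mul_le_mul_of_nonneg_left (pow_le_pow_left₀ (norm_nonneg _) (hp x hx) 2) hε.le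
    _ = _ := by ring

/-- The imaginary part bounds `ε ‖∇e‖²`, and one factor `‖∇e‖` cancels. Both the a priori bound and
the error estimate use this. -/
theorem norm_gradL_le_of_inner_le (P : Params) {ε : ℝ} (hε : 0 < ε) {r : Plane → ℝ}
    (hr : Measurable r) {e : H1 Ω} {K : ℝ} (hK : 0 ≤ K)
    (h : ‖inner ℂ (gradL Ω e) (P.fluxL ε hr (gradL Ω e))‖ ≤ ‖gradL Ω e‖ * K) :
    ‖gradL Ω e‖ ≤ K / ε := by
  have h1 := P.inner_fluxL_im ε hr (gradL Ω e)
  have h2 := (le_abs_self _).trans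
    (Complex.abs_im_le_norm (inner ℂ (gradL Ω e) (P.fluxL ε hr (gradL Ω e))))
  rw [h1] at h2
  have h3 := h2.trans h
  rw [le_div_iff₀ hε]
  rcases (norm_nonneg (gradL Ω e)).eq_or_lt with h0 | h0
  · rw [← h0]; simpa using hK
  · nlinarith

/-! ### Functions with vanishing gradient -/

theorem gradL_eq_zero_iff (u : H1 Ω) :
    gradL Ω u = 0 ↔ ∀ᵐ x ∂(volume.restrict Ω), grad u x = 0 := by
  rw [Lp.eq_zero_iff_ae_eq_zero, coe_gradL]
  rfl

/-- Adding `iη` to `ξε` changes neither the real part, on which the coefficient depends, nor the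
gradient, nor the Dirichlet values. The sum is again a solution, so uniqueness excludes `η ≠ 0`. -/
theorem eq_zero_of_real_of_unique (htr : Traceable Ω (frontier Ω)) (hD : Traceable Ω ΓD)
    (hsub : ΓD ⊆ frontier Ω) {P : Params} {ε : ℝ} {ξD g : Plane → ℝ} {ξε : H1 Ω}
    (hξε : IsSolution ΓD P ε ξD g ξε) (hunique : ∀ ξ : H1 Ω, IsSolution ΓD P ε ξD g ξ → ξ = ξε)
    {η : H1 Ω} (hη : MemV0 ΓD η) (hg : gradL Ω η = 0)
    (him : ∀ᵐ x ∂(volume.restrict Ω), (value η x).im = 0) : η = 0 := by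
  have hIη : MemV0 ΓD (Complex.I • η) := by
    rw [memV0_iff htr hD hsub] at hη ⊢
    exact Submodule.smul_mem _ _ hη
  have h : ξε + Complex.I • η = ξε := by
    refine hunique _ ⟨?_, fun θ hθ => ?_⟩
    · filter_upwards [trace_add_ae_eq_of_memV0 htr hsub ξε hIη, hξε.1] with x h1 h2
      rw [h1]
      exact h2
    · rw [← hξε.2 θ hθ]
      refine integral_congr_ae ?_
      filter_upwards [value_add ξε (Complex.I • η), value_smul Complex.I η,
        grad_add ξε (Complex.I • η), grad_smul Complex.I η, (gradL_eq_zero_iff η).1 hg, him]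
        with x h1 h2 h3 h4 h5 h6
      rw [h1, h2, h3, h4, h5, smul_zero, add_zero]
      simp [h6]
  have h2 : Complex.I • η = 0 := by simpa using h
  exact (smul_eq_zero.1 h2).resolve_left Complex.I_ne_zero

/-- The real case applies to `η + η̄` and to `i(η - η̄)`. This replaces any assumption that `ΓD` has
positive length. -/
theorem eq_zero_of_grad_of_unique (htr : Traceable Ω (frontier Ω)) (hD : Traceable Ω ΓD)
    (hsub : ΓD ⊆ frontier Ω) {P : Params} {ε : ℝ} {ξD g : Plane → ℝ} {ξε : H1 Ω}
    (hξε : IsSolution ΓD P ε ξD g ξε) (hunique : ∀ ξ : H1 Ω, IsSolution ΓD P ε ξD g ξ → ξ = ξε)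
    {η : H1 Ω} (hη : MemV0 ΓD η) (hg : gradL Ω η = 0) : η = 0 := by
  have hη' := hη.conj htr hsub
  have hg' : gradL Ω (conjH1 η) = 0 := by
    rw [gradL_eq_zero_iff] at hg ⊢
    filter_upwards [grad_conjH1 η, hg] with x h1 h2
    rw [h1, h2]
    ext j
    simp [conjVec]
  have hV := memV0_iff htr hD hsub
  have h1 : η + conjH1 η = 0 := by
    refine eq_zero_of_real_of_unique htr hD hsub hξε hunique ?_ ?_ ?_
    · rw [hV] at hη hη' ⊢
      exact Submodule.add_mem _ hη hη'
    · rw [map_add, hg, hg', add_zero]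
    · filter_upwards [value_add η (conjH1 η), value_conjH1 η] with x h1 h2
      rw [h1, h2]
      simp
  have h2 : Complex.I • (η - conjH1 η) = 0 := by
    refine eq_zero_of_real_of_unique htr hD hsub hξε hunique ?_ ?_ ?_
    · rw [hV] at hη hη' ⊢
      exact Submodule.smul_mem _ _ (Submodule.sub_mem _ hη hη')
    · rw [map_smul, map_sub, hg, hg', sub_zero, smul_zero]
    · filter_upwards [value_smul Complex.I (η - conjH1 η), value_sub η (conjH1 η),
        value_conjH1 η] with x h1 h2 h3
      rw [h1, h2, h3]
      simp
  have h3 : η - conjH1 η = 0 := (smul_eq_zero.1 h2).resolve_left Complex.I_ne_zero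
  have h4 : (2 : ℂ) • η = 0 := by
    rw [two_smul, ← add_zero (η + η), ← h1]
    rw [← sub_eq_zero] at h1
    have h5 : conjH1 η = η := (sub_eq_zero.1 h3).symm
    rw [h5] at h1 ⊢
    have h6 : η + η = 0 := by simpa using h1
    rw [h6, add_zero]
  exact (smul_eq_zero.1 h4).resolve_left two_ne_zero

/-! ### Convergence -/

/-- The interpolants of `z` and `ζD` agree at the Dirichlet vertices, so the discrete solution minus
the interpolant of `z` is an admissible test function. -/
theorem exists_interpolant (hΩ : IsPolygonalLipschitz Ω) (hsub : ΓD ⊆ frontier Ω)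
    (hd : Dense {w : H1 Ω | ∃ v, ContinuousOn v (closure Ω) ∧ Represents w v})
    (htr : Traceable Ω (frontier Ω)) {T : Triangulation Ω ΓD} (S : ScottZhangChoice T)
    {ζD ξ z : H1 Ω} (hξ : MemVhD S ζD ξ)
    (hz : ∀ᵐ x ∂(arcLength ΓD), trace z x = trace ζD x) :
    ∃ w : H1 Ω, MemVh0 T (ξ - w) ∧ ∃ v, T.IsP1 v ∧ Represents w v ∧
      ∀ a ∈ T.vertices, v a = S.nodalValue z a := by
  obtain ⟨v, hv, hvn⟩ := T.exists_isP1 fun a => S.nodalValue z a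
  obtain ⟨w, hw, -⟩ := hv.exists_H1 hΩ
  obtain ⟨v', hv', hξv', w', hw', hD⟩ := hξ
  refine ⟨w, ⟨fun x => v' x - v x, hv'.sub hv, hξv'.sub hw, fun x hx => ?_⟩, v, hv, hw, hvn⟩
  refine (hv'.sub hv).eq_zero_of_vertices (fun a ha haD => ?_) hx
  have h1 : v' a = w' a := by
    obtain ⟨h2, h3⟩ := hD a haD
    rw [← h2]
    exact Complex.ext (by simp) (by simp [h3])
  rw [hvn a ha, h1, hw'.2 a ha, S.nodalValue_congr hΩ hsub hd htr hz ha haD, sub_self]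

theorem measurable_re_value (u : H1 Ω) : Measurable fun x => (value u x).re :=
  Complex.measurable_re.comp (stronglyMeasurable_value u).measurable

/-- Every sequence of discrete solutions has a subsequence that converges to the solution. -/
theorem exists_subseq_tendsto (hΩ : IsPolygonalLipschitz Ω) (hΓD : IsClosed ΓD)
    (hsub : ΓD ⊆ frontier Ω) {P : Params} {ε : ℝ} (hε : 0 < ε) {ξD g : Plane → ℝ}
    (hg : MemLp g 2 (arcLength (frontier Ω \ ΓD))) {ζD : H1 Ω} (hζD : IsLifting ΓD ξD ζD)
    {ξε : H1 Ω} (hξε : IsSolution ΓD P ε ξD g ξε)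
    (hunique : ∀ ξ : H1 Ω, IsSolution ΓD P ε ξD g ξ → ξ = ξε) {T : ℕ → Triangulation Ω ΓD} {κ : ℝ}
    (hT : ∀ᶠ n in atTop, (T n).Regular κ)
    (hh : Tendsto (fun n => (T n).meshSize) atTop (𝓝 0)) (S : ∀ n, ScottZhangChoice (T n))
    {ξ : ℕ → H1 Ω} (hξ : ∀ n, IsDiscreteSolution (S n) P ε g ζD (ξ n)) :
    ∃ χ : ℕ → ℕ, Tendsto (fun n => ξ (χ n)) atTop (𝓝 ξε) := by
  have hd := Triangulation.dense_continuous hΩ hT hh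
  have htr : Traceable Ω (frontier Ω) := (T 0).traceable hΩ hd isClosed_frontier.measurableSet
    ((T 0).frontier_subset_edges hΩ)
  have hD : Traceable Ω ΓD := htr.mono hΓD.measurableSet hsub
  have hN : Traceable Ω (frontier Ω \ ΓD) :=
    htr.mono (isClosed_frontier.measurableSet.diff hΓD.measurableSet) Set.sdiff_subset
  have hcomp := Triangulation.isCompactOperator_valueL hΩ hT hh
  obtain ⟨V, hVdef⟩ : ∃ V, V = LinearMap.ker (traceL hD).toLinearMap := ⟨_, rfl⟩
  have hV0 : ∀ u, MemV0 ΓD u ↔ u ∈ V := by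
    rw [hVdef]; exact memV0_iff htr hD hsub
  have hVc : IsClosed (V : Set (H1 Ω)) := by
    rw [hVdef]; exact (traceL hD).isClosed_ker
  obtain ⟨C, hC, hp⟩ := exists_poincare hcomp hVc fun η hη hη0 =>
    eq_zero_of_grad_of_unique htr hD hsub hξε hunique ((hV0 η).2 hη) hη0
  have hgC : MemLp (fun x => (g x : ℂ)) 2 (arcLength (frontier Ω \ ΓD)) := hg.ofReal
  obtain ⟨F, hF⟩ : ∃ F : H1 Ω, ∀ η, lForm ΓD g η = inner ℂ η F :=
    ⟨_, fun η => lForm_eq_inner htr hN hgC η⟩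
  have hr := fun n => measurable_re_value (ξ n)
  have hM := P.coefBound_nonneg ε
  have hsol : ∀ n η, MemVh0 (T n) η →
      inner ℂ (gradL Ω η) (P.fluxL ε (hr n) (gradL Ω (ξ n))) = inner ℂ η F := fun n η hη => by
    rw [← hF, ← (hξ n).2 η hη, P.aForm_eq_inner ε (hr n)]
  have hVh : ∀ n η, MemVh0 (T n) η → η ∈ V := fun n η hη =>
    (hV0 η).1 (memV0_of_memVh0 htr hΓD.measurableSet hsub hη)
  have hinterp : ∀ z : H1 Ω, (∀ᵐ x ∂(arcLength ΓD), trace z x = trace ζD x) →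
      ∃ w : ℕ → H1 Ω, (∀ n, MemVh0 (T n) (ξ n - w n)) ∧ Tendsto w atTop (𝓝 z) := fun z hz => by
    choose w hw0 hw using fun n => exists_interpolant hΩ hsub hd htr (S n) (hξ n).1 hz
    exact ⟨w, hw0, Triangulation.tendsto_interpolant hΩ
      (hT.mono fun n hn => ⟨hn, (S n).isNodal hΩ hd hn⟩) hh z (Eventually.of_forall hw)⟩
  -- The test function is `ξ n` minus the interpolant of `ζD`; the interpolants converge and are
  -- therefore bounded.
  obtain ⟨B, hB⟩ : ∃ B, ∀ n, ‖ξ n‖ ≤ B := by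
    obtain ⟨w, hw0, hw⟩ := hinterp ζD (ae_of_all _ fun _ => rfl)
    obtain ⟨R, hR⟩ := hw.norm.bddAbove_range
    have hR' : ∀ n, ‖w n‖ ≤ R := fun n => hR ⟨n, rfl⟩
    refine ⟨C * ((C * ‖F‖ + P.coefBound ε * R) / ε) + R, fun n => ?_⟩
    have hR0 : 0 ≤ R := (norm_nonneg _).trans (hR' n)
    have he := hp _ (hVh n _ (hw0 n))
    have h1 : ‖gradL Ω (ξ n - w n)‖ ≤ (C * ‖F‖ + P.coefBound ε * R) / ε := by
      refine norm_gradL_le_of_inner_le P hε (hr n) (by positivity) ?_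
      have e : P.fluxL ε (hr n) (gradL Ω (ξ n - w n)) =
          P.fluxL ε (hr n) (gradL Ω (ξ n)) - P.fluxL ε (hr n) (gradL Ω (w n)) := by
        rw [map_sub, map_sub]
      rw [e, inner_sub_right, hsol n _ (hw0 n)]
      refine (norm_sub_le _ _).trans ?_
      have h2 : ‖inner ℂ (ξ n - w n) F‖ ≤ (C * ‖gradL Ω (ξ n - w n)‖) * ‖F‖ :=
        (norm_inner_le_norm _ _).trans (mul_le_mul_of_nonneg_right he (norm_nonneg _))
      have h3 : ‖inner ℂ (gradL Ω (ξ n - w n)) (P.fluxL ε (hr n) (gradL Ω (w n)))‖ ≤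
          ‖gradL Ω (ξ n - w n)‖ * (P.coefBound ε * R) := by
        refine (norm_inner_le_norm _ _).trans (mul_le_mul_of_nonneg_left ?_ (norm_nonneg _))
        exact (P.norm_fluxL_apply_le ε (hr n) _).trans
          (mul_le_mul_of_nonneg_left ((norm_gradL_le _).trans (hR' n)) hM)
      linarith
    calc ‖ξ n‖ = ‖(ξ n - w n) + w n‖ := by rw [sub_add_cancel]
      _ ≤ ‖ξ n - w n‖ + ‖w n‖ := norm_add_le _ _
      _ ≤ _ := add_le_add (he.trans (mul_le_mul_of_nonneg_left h1 hC.le)) (hR' n)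
  obtain ⟨f, -, φ, hφ, hf⟩ := (hcomp.isCompact_closure_image_closedBall B).tendsto_subseq
    (x := fun n => valueL Ω (ξ n)) fun n =>
      subset_closure (Set.mem_image_of_mem _ (by simpa using hB n))
  obtain ⟨ψ, hψ, hae⟩ := (tendstoInMeasure_of_tendsto_Lp hf).exists_seq_tendsto_ae
  have hχ : Tendsto (fun n => φ (ψ n)) atTop atTop := hφ.tendsto_atTop.comp hψ.tendsto_atTop
  have hs : Measurable fun x => (f x).re :=
    Complex.measurable_re.comp (Lp.stronglyMeasurable f).measurable
  have hrs : ∀ᵐ x ∂(volume.restrict Ω),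
      Tendsto (fun n => (value (ξ (φ (ψ n))) x).re) atTop (𝓝 (f x).re) := by
    filter_upwards [hae] with x hx
    exact (Complex.continuous_re.tendsto _).comp hx
  -- The candidate limit solves the linear problem with coefficient frozen at the real part of the
  -- `L²` limit `f`. That its values are `f` is known only at the end.
  obtain ⟨z₀, hz₀, hz⟩ := exists_linear_solution P hε hs hVc hC hp ζD F
  obtain ⟨z, hzdef⟩ : ∃ z, z = ζD + z₀ := ⟨_, rfl⟩
  rw [← hzdef] at hz
  have hztr : ∀ᵐ x ∂(arcLength ΓD), trace z x = trace ζD x := by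
    rw [hzdef]
    exact trace_add_ae_eq_of_memV0 htr hsub ζD ((hV0 z₀).2 hz₀)
  obtain ⟨w, hw0, hw⟩ := hinterp z hztr
  have hflux := P.tendsto_fluxL ε (fun n => hr (φ (ψ n))) hs hrs (gradL Ω z)
  have hwχ : Tendsto (fun n => w (φ (ψ n))) atTop (𝓝 z) := hw.comp hχ
  have hbound : ∀ n, ‖ξ (φ (ψ n)) - w (φ (ψ n))‖ ≤
      C * ((‖P.fluxL ε (hr (φ (ψ n))) (gradL Ω z) - P.fluxL ε hs (gradL Ω z)‖ +
        P.coefBound ε * ‖w (φ (ψ n)) - z‖) / ε) := by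
    intro n
    obtain ⟨k, hk⟩ : ∃ k, k = φ (ψ n) := ⟨_, rfl⟩
    simp only [← hk]
    have hmem := hVh k _ (hw0 k)
    refine (hp _ hmem).trans (mul_le_mul_of_nonneg_left ?_ hC.le)
    refine norm_gradL_le_of_inner_le P hε (hr k) (by positivity) ?_
    -- The first difference is annihilated by the discrete test function, as `ξ k` and `z` satisfy
    -- equations with the same right side. A coefficient error and an interpolation error remain.
    have e : P.fluxL ε (hr k) (gradL Ω (ξ k - w k)) =
        P.fluxL ε (hr k) (gradL Ω (ξ k)) - P.fluxL ε hs (gradL Ω z) -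
          ((P.fluxL ε (hr k) (gradL Ω z) - P.fluxL ε hs (gradL Ω z)) +
            P.fluxL ε (hr k) (gradL Ω (w k - z))) := by
      simp only [map_sub]
      abel
    rw [e, inner_sub_right, inner_sub_right, hsol k _ (hw0 k), hz _ hmem, sub_self, zero_sub,
      norm_neg]
    refine (norm_inner_le_norm _ _).trans (mul_le_mul_of_nonneg_left ?_ (norm_nonneg _))
    refine (norm_add_le _ _).trans (add_le_add le_rfl ?_)
    exact (P.norm_fluxL_apply_le ε (hr k) _).trans
      (mul_le_mul_of_nonneg_left (norm_gradL_le _) hM)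
  have hlim : Tendsto (fun n => ξ (φ (ψ n))) atTop (𝓝 z) := by
    have h1 : Tendsto (fun n => C * ((‖P.fluxL ε (hr (φ (ψ n))) (gradL Ω z) -
        P.fluxL ε hs (gradL Ω z)‖ + P.coefBound ε * ‖w (φ (ψ n)) - z‖) / ε)) atTop (𝓝 0) := by
      have h2 := tendsto_iff_norm_sub_tendsto_zero.1 hflux
      have h3 := tendsto_iff_norm_sub_tendsto_zero.1 hwχ
      simpa using ((h2.add (h3.const_mul (P.coefBound ε))).div_const ε).const_mul C
    have h4 : Tendsto (fun n => ξ (φ (ψ n)) - w (φ (ψ n))) atTop (𝓝 0) :=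
      squeeze_zero_norm hbound h1
    simpa using h4.add hwχ
  -- Strong convergence to `z` and `L²` convergence to `f` along the same subsequence identify the
  -- frozen coefficient with that of `z`.
  have hfz : valueL Ω z = f := tendsto_nhds_unique (((valueL Ω).continuous.tendsto z).comp hlim)
    (hf.comp hψ.tendsto_atTop)
  have hzsol : IsSolution ΓD P ε ξD g z := by
    refine ⟨?_, fun η hη => ?_⟩
    · filter_upwards [hztr, hζD.2] with x h1 h2
      rw [h1, h2]
      simp
    · subst hfz
      rw [hF, ← hz η ((hV0 η).1 hη), ← P.aForm_eq_inner ε hs]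
      rfl
  rw [hunique z hzsol] at hlim
  exact ⟨fun n => φ (ψ n), hlim⟩

end

end

end Kirigami

/-! ### The main theorem -/

theorem mainTheorem1
    (Ω ΓD : Set Kirigami.Plane) (hΩ : Kirigami.IsPolygonalLipschitz Ω)
    (hΓD : IsClosed ΓD) (hΓDΩ : ΓD ⊆ frontier Ω)
    (P : Kirigami.Params) (ε : ℝ) (hε : 0 < ε)
    (ξD g : Kirigami.Plane → ℝ)
    (hg : MemLp g 2 (Kirigami.arcLength (frontier Ω \ ΓD)))
    (ζD : Kirigami.H1 Ω) (hζD : Kirigami.IsLifting ΓD ξD ζD)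
    (ξε : Kirigami.H1 Ω) (hξε : Kirigami.IsSolution ΓD P ε ξD g ξε)
    (hunique : ∀ ξ : Kirigami.H1 Ω, Kirigami.IsSolution ΓD P ε ξD g ξ → ξ = ξε)
    {ι : Type*} (T : ι → Kirigami.Triangulation Ω ΓD)
    (hshape : Kirigami.ShapeRegular T) (hquasi : Kirigami.QuasiUniform T)
    (S : ∀ i, Kirigami.ScottZhangChoice (T i))
    (ξ : ι → Kirigami.H1 Ω)
    (hξ : ∀ i, Kirigami.IsDiscreteSolution (S i) P ε g ζD (ξ i)) :
    Tendsto ξ (comap (fun i => (T i).meshSize) (𝓝[>] 0)) (𝓝 ξε) := by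
  obtain ⟨κ, -, hκ⟩ := Kirigami.exists_regular hshape hquasi
  -- The filter of vanishing mesh size is countably generated, so sequences suffice, and each needs
  -- only a subsequence with limit `ξε`. Positivity of the mesh size along this filter is what
  -- regularity of the triangulations requires.
  refine tendsto_of_subseq_tendsto fun ns hns => ?_
  have hmesh : Tendsto (fun n => (T (ns n)).meshSize) atTop (𝓝[>] 0) :=
    (tendsto_comap (f := fun i => (T i).meshSize)).comp hns
  have hpos : ∀ᶠ n in atTop, (T (ns n)).Regular κ := by
    filter_upwards [hmesh.eventually self_mem_nhdsWithin] with n hn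
    exact hκ (ns n) hn
  exact Kirigami.exists_subseq_tendsto hΩ hΓD hΓDΩ hε hg hζD hξε hunique hpos
    (hmesh.mono_right nhdsWithin_le_nhds) (fun n => S (ns n)) fun n => hξ (ns n)
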